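/- A \emph{topological order} of a directed acyclic graph (DAG) with vertex set $V$, $|V|=n$, is a bijection $T$ from $V$ onto $n$ consecutive positions with $T(u)<T(v)$ for every edge $(u,v)$. In the \emph{online topological ordering problem} one is given a starting DAG on $n$ vertices, and then new, pairwise distinct edges $e_1,\dots,e_m$ are inserted one at a time in such a way that the graph stays acyclic; before the first insertion and after each insertion (without knowledge of the later edges) a topological order of the current graph has to be stored explicitly as an array. Running time is measured on a random access machine (with logarithmic cost); the \emph{total running time} is the time for the initialization plus the time for all $m$ insertions. \textbf{Theorem.} (1) There are a program for online topological ordering and constants $C,k$ such that for every $n\ge 2$, every starting DAG on $n$ vertices and every admissible sequence of edge insertions, the program maintains a valid topological order with total running time at most $C\,n^{2.5}(\log n)^k$, that is, $\tilde O(n^{2.5})$, independently of the number $m$ of inserted edges. (2) This bound is attained by the following algorithm. For $n \ge 2$ let $p=\lceil \log_{3/2} n\rceil$, $f(p)=\dfrac{3^{p+1}}{2\cdot 3^{p+1}-2^{p+1}}$, $t_0=n^{f(p)}$ and $t_i=t_0^{\,2-(2/3)^i}$ for $i=0,\dots,p+1$ (so $t_{p+1}=n$). Let $T$ be the current order, initially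 any given topological order of the starting DAG; write $u<v$ for $T(u)<T(v)$, $d(u,v)=|T(v)-T(u)|$, and $u\to v$ if $(u,v)$ is an edge of the current graph. For real $s$ put $$\hat A(s)=\{w: u\to w,\ d(u,w)\le s,\ w<v\},\qquad \hat B(s)=\{w: w\to v,\ d(w,v)\le s,\ w>u\}.$$ $\mathrm{Insert}(u,v)$: if $v\le u$, call $\mathrm{Reorder}(v,u,0,0)$; then add the edge $(u,v)$. $\mathrm{Reorder}(u,v,f_1,f_2)$: if $v\le u$, exit. If $d(u,v)\le t_0$, let $A=\hat A(t_0)$ and $B=\hat B(t_0)$. Otherwise let $0\le i\le p$ be such that $t_i<d(u,v)\le t_{i+1}$; let $A=\hat A(t_i)$ if $\hat A(t_i)\neq\emptyset$ or $f_1=1$, and $A=\hat A(t_{i+1})$ otherwise; let $B=\hat B(t_i)$ if $\hat B(t_i)\ne\emptyset$ or $f_2=1$, and $B=\hat B(t_{i+1})$ otherwise. If $A=B=\emptyset$, exchange the positions of $u$ and $v$ in $T$. Otherwise, with $T_{\mathrm{orig}}$ the order at the start of this call, for each $u'\in\{u\}\cup A$ in decreasing order of $T_{\mathrm{orig}}$,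 and for each $v'\in B\cup\{v\}$ with $T_{\mathrm{orig}}(v')>T_{\mathrm{orig}}(u')$ in increasing order of $T_{\mathrm{orig}}$, call $\mathrm{Reorder}(u',v',f_1',f_2')$, where $f_1'=1$ if $u'=u$ and $A=\emptyset$, and $f_1'=0$ otherwise, and $f_2'=1$ if $v'=v$ and $B=\emptyset$, and $f_2'=0$ otherwise. For every $n\ge2$, every starting DAG with a topological order of it, and every admissible sequence of insertions, all calls halt and $T$ is a topological order of the current graph after every insertion. Moreover, there are a program and constants $C,k$ such that the program, given the initial topological order and the parameters $p,\lfloor t_0\rfloor,\dots,\lfloor t_{p+1}\rfloor$, stores before the first and after every insertion exactly the order $T$ of this algorithm, with total running time at most $C\,n^{2.5}(\log n)^k$. -/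

import Mathlib

namespace OnlineTopo

/-! ### Directed acyclic graphs and topological orders on the vertex set `Fin n` -/

/-- The directed graph with edge set `E` has no directed cycle (in particular no loop). -/
def IsDAG {n : ℕ} (E : Finset (Fin n × Fin n)) : Prop :=
  ∀ v : Fin n, ¬ Relation.TransGen (fun a b => (a, b) ∈ E) v v

/-- `T v` is the position of `v`. Positions are counted from `0`. -/
def IsTopOrder {n : ℕ} (E : Finset (Fin n × Fin n)) (T : Equiv.Perm (Fin n)) : Prop :=
  ∀ e ∈ E, T e.1 < T e.2

/-- The graph after the first `i` edges of `es` have been inserted into `E₀`. -/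
def graphAfter {n : ℕ} (E₀ : Finset (Fin n × Fin n)) (es : List (Fin n × Fin n)) (i : ℕ) :
    Finset (Fin n × Fin n) :=
  E₀ ∪ (es.take i).toFinset

/-- `es` is a sequence of new, pairwise distinct edges whose insertion into `E₀` never creates a
cycle (a subgraph of an acyclic graph is acyclic, so it is enough to look at the final graph). -/
def IsInsertionSequence {n : ℕ} (E₀ : Finset (Fin n × Fin n)) (es : List (Fin n × Fin n)) :
    Prop :=
  es.Nodup ∧ (∀ e ∈ es, e ∉ E₀) ∧ IsDAG (E₀ ∪ es.toFinset)

/-! ### The machine: a random access machine with logarithmic cost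

The memory consists of arrays of natural numbers; a program is a fixed finite text, so it uses
finitely many of them. Every operation is charged the total bit length of the numbers and addresses
it handles. -/

/-- `σ a i` is the content of cell `i` of array `a`. -/
abbrev Store := ℕ → ℕ → ℕ

/-- Basic operations; subtraction is truncated, comparisons return `1` or `0`. -/
inductive Op
  | add | sub | mul | div | lt | eq

def Op.apply : Op → ℕ → ℕ → ℕ
  | .add, x, y => x + y
  | .sub, x, y => x - y
  | .mul, x, y => x * y
  | .div, x, y => x / y
  | .lt, x, y => if x < y then 1 else 0
  | .eq, x, y => if x = y then 1 else 0

/-- Expressions: constants, contents of an array cell with computed index, operations. -/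
inductive Expr
  | lit (k : ℕ)
  | cell (a : ℕ) (i : Expr)
  | bin (o : Op) (e₁ e₂ : Expr)

def Expr.eval (σ : Store) : Expr → ℕ
  | .lit k => k
  | .cell a i => σ a (i.eval σ)
  | .bin o e₁ e₂ => o.apply (e₁.eval σ) (e₂.eval σ)

/-- Cost of handling the number `x`: its number of binary digits plus one. -/
def len (x : ℕ) : ℕ := Nat.size x + 1

def Expr.cost (σ : Store) : Expr → ℕ
  | .lit k => len k
  | .cell a i => i.cost σ + len (i.eval σ) + len (σ a (i.eval σ))
  | .bin _ e₁ e₂ => e₁.cost σ + e₂.cost σ + len (e₁.eval σ) + len (e₂.eval σ)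

inductive Cmd
  | skip
  /-- `assign a i e` is `a[i] := e`. -/
  | assign (a : ℕ) (i e : Expr)
  | seq (c₁ c₂ : Cmd)
  /-- `cond b c₁ c₂` runs `c₁` if `b` is nonzero and `c₂` otherwise. -/
  | cond (b : Expr) (c₁ c₂ : Cmd)
  /-- `loop b c` repeats `c` as long as `b` is nonzero. -/
  | loop (b : Expr) (c : Cmd)

/-- The memory `σ` with the content of cell `i` of array `a` replaced by `x`. -/
def Store.write (σ : Store) (a i x : ℕ) : Store :=
  fun a' i' => if a' = a ∧ i' = i then x else σ a' i'

/-- `Exec c σ τ k`: command `c`, started in memory `σ`, halts in memory `τ`, at total cost `k`. -/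
inductive Exec : Cmd → Store → Store → ℕ → Prop
  | skip (σ : Store) : Exec .skip σ σ 1
  | assign (σ : Store) (a : ℕ) (i e : Expr) :
      Exec (.assign a i e) σ (σ.write a (i.eval σ) (e.eval σ))
        (i.cost σ + e.cost σ + len (i.eval σ) + len (e.eval σ))
  | seq {c₁ c₂ : Cmd} {σ τ υ : Store} {k₁ k₂ : ℕ} :
      Exec c₁ σ τ k₁ → Exec c₂ τ υ k₂ → Exec (.seq c₁ c₂) σ υ (k₁ + k₂)
  | condTrue {b : Expr} {c₁ c₂ : Cmd} {σ τ : Store} {k : ℕ} :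
      b.eval σ ≠ 0 → Exec c₁ σ τ k →
      Exec (.cond b c₁ c₂) σ τ (b.cost σ + len (b.eval σ) + k)
  | condFalse {b : Expr} {c₁ c₂ : Cmd} {σ τ : Store} {k : ℕ} :
      b.eval σ = 0 → Exec c₂ σ τ k →
      Exec (.cond b c₁ c₂) σ τ (b.cost σ + len (b.eval σ) + k)
  | loopDone {b : Expr} {c : Cmd} {σ : Store} :
      b.eval σ = 0 → Exec (.loop b c) σ σ (b.cost σ + len (b.eval σ))
  | loopStep {b : Expr} {c : Cmd} {σ τ υ : Store} {k₁ k₂ : ℕ} :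
      b.eval σ ≠ 0 → Exec c σ τ k₁ → Exec (.loop b c) τ υ k₂ →
      Exec (.loop b c) σ υ (b.cost σ + len (b.eval σ) + k₁ + k₂)

/-! ### Online programs -/

/-- An online program: `setup` is run once on the starting graph; `onInsert` is run once for
every inserted edge, on the memory left by the previous run. -/
structure OnlineProgram where
  setup : Cmd
  onInsert : Cmd

/-- Input for the starting graph `E` on `n` vertices: `n` in cell `0` of array `0`, the adjacency
matrix of `E`, row by row, in array `2`, and zero everywhere else. -/
def inputStore (n : ℕ) (E : Finset (Fin n × Fin n)) : Store := fun a i =>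
  if a = 0 ∧ i = 0 then n
  else if a = 2 ∧ ∃ e ∈ E, i = (e.1 : ℕ) * n + (e.2 : ℕ) then 1
  else 0

/-- Handing the edge `e` to the program: its end points are put into cells `1`, `2` of array `0`. -/
def presentEdge {n : ℕ} (σ : Store) (e : Fin n × Fin n) : Store :=
  (σ.write 0 1 (e.1 : ℕ)).write 0 2 (e.2 : ℕ)

/-- Started in memory `σ₀`, the program `P` handles the edges `es` one after the other, within
total cost `B`. When `i` edges have been inserted, array `1` holds the order `T i`. Since
`onInsert` sees one edge at a time, the order `T i` is produced without knowledge of later edges. -/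
def MaintainsWithin {n : ℕ} (P : OnlineProgram) (σ₀ : Store) (es : List (Fin n × Fin n))
    (T : ℕ → Equiv.Perm (Fin n)) (B : ℝ) : Prop :=
  ∃ (σ : ℕ → Store) (c : ℕ → ℕ),
    Exec P.setup σ₀ (σ 0) (c 0) ∧
    (∀ (i : ℕ) (h : i < es.length),
      Exec P.onInsert (presentEdge (σ i) es[i]) (σ (i + 1)) (c (i + 1))) ∧
    (∀ i ≤ es.length, ∀ v : Fin n, σ i 1 (v : ℕ) = (T i v : ℕ)) ∧
    ((∑ i ∈ Finset.range (es.length + 1), c i : ℕ) : ℝ) ≤ B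

/-! ### The procedures `Insert` and `Reorder` with thresholds `t 0 < t 1 < ⋯ < t (p + 1)` -/

/-- The distance `d(u, v)` in the order `T`. -/
def dist {n : ℕ} (T : Equiv.Perm (Fin n)) (u v : Fin n) : ℕ :=
  Nat.dist (T u : ℕ) (T v : ℕ)

/-- `{w : u → w, d(u, w) ≤ s, w < v}`. -/
noncomputable def hatA {n : ℕ} (E : Finset (Fin n × Fin n)) (T : Equiv.Perm (Fin n)) (s : ℝ)
    (u v : Fin n) : Finset (Fin n) := by
  classical
  exact Finset.univ.filter fun w => (u, w) ∈ E ∧ (dist T u w : ℝ) ≤ s ∧ T w < T v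

/-- `{w : w → v, d(w, v) ≤ s, w > u}`. -/
noncomputable def hatB {n : ℕ} (E : Finset (Fin n × Fin n)) (T : Equiv.Perm (Fin n)) (s : ℝ)
    (u v : Fin n) : Finset (Fin n) := by
  classical
  exact Finset.univ.filter fun w => (w, v) ∈ E ∧ (dist T w v : ℝ) ≤ s ∧ T u < T w

/-- The arguments of a call `Reorder (u, v, f₁, f₂)`. -/
structure Call (n : ℕ) where
  u : Fin n
  v : Fin n
  f₁ : Bool
  f₂ : Bool

/-- The call `c`, made in the graph `E` with current order `T`, computes the sets `A` and `B`. -/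
def Selects {n : ℕ} (p : ℕ) (t : ℕ → ℝ) (E : Finset (Fin n × Fin n)) (T : Equiv.Perm (Fin n))
    (c : Call n) (A B : Finset (Fin n)) : Prop :=
  ((dist T c.u c.v : ℝ) ≤ t 0 ∧ A = hatA E T (t 0) c.u c.v ∧ B = hatB E T (t 0) c.u c.v) ∨
  ∃ i ≤ p, t i < (dist T c.u c.v : ℝ) ∧ (dist T c.u c.v : ℝ) ≤ t (i + 1) ∧
    A = (if hatA E T (t i) c.u c.v ≠ ∅ ∨ c.f₁ = true then hatA E T (t i) c.u c.v
      else hatA E T (t (i + 1)) c.u c.v) ∧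
    B = (if hatB E T (t i) c.u c.v ≠ ∅ ∨ c.f₂ = true then hatB E T (t i) c.u c.v
      else hatB E T (t (i + 1)) c.u c.v)

/-- The elements of `S` in increasing order of their position in `T`. -/
def inOrder {n : ℕ} (T : Equiv.Perm (Fin n)) (S : Finset (Fin n)) : List (Fin n) :=
  ((List.finRange n).map T.symm).filter fun w => w ∈ S

/-- The recursive calls made by the call `c` with sets `A`, `B`, in the order in which they are
made; `T` is the order at the start of `c`. -/
def subcalls {n : ℕ} (T : Equiv.Perm (Fin n)) (c : Call n) (A B : Finset (Fin n)) :
    List (Call n) :=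
  (inOrder T (insert c.u A)).reverse.flatMap fun u' =>
    ((inOrder T (insert c.v B)).filter fun v' => T u' < T v').map fun v' =>
      { u := u', v := v'
        f₁ := decide (u' = c.u ∧ A = ∅)
        f₂ := decide (v' = c.v ∧ B = ∅) }

/-- `Calls p t E T cs T'`: in the graph `E`, executing the list `cs` of calls of `Reorder` one
after the other (each with all its recursive calls) halts and turns the order `T` into `T'`. -/
inductive Calls {n : ℕ} (p : ℕ) (t : ℕ → ℝ) (E : Finset (Fin n × Fin n)) :
    Equiv.Perm (Fin n) → List (Call n) → Equiv.Perm (Fin n) → Prop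
  | nil (T : Equiv.Perm (Fin n)) : Calls p t E T [] T
  | exit {T T' : Equiv.Perm (Fin n)} {c : Call n} {cs : List (Call n)} :
      T c.v ≤ T c.u → Calls p t E T cs T' → Calls p t E T (c :: cs) T'
  | swap {T T' : Equiv.Perm (Fin n)} {c : Call n} {cs : List (Call n)} :
      T c.u < T c.v → Selects p t E T c ∅ ∅ →
      Calls p t E (T * Equiv.swap c.u c.v) cs T' → Calls p t E T (c :: cs) T'
  | recurse {T T' T'' : Equiv.Perm (Fin n)} {c : Call n} {cs : List (Call n)}
      {A B : Finset (Fin n)} :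
      T c.u < T c.v → Selects p t E T c A B → ¬ (A = ∅ ∧ B = ∅) →
      Calls p t E T (subcalls T c A B) T' → Calls p t E T' cs T'' →
      Calls p t E T (c :: cs) T''

/-- The call `Insert (e.1, e.2)` in the graph `E` (before insertion) turns the order `T` into
`T'`. -/
def InsertStep {n : ℕ} (p : ℕ) (t : ℕ → ℝ) (E : Finset (Fin n × Fin n))
    (T : Equiv.Perm (Fin n)) (e : Fin n × Fin n) (T' : Equiv.Perm (Fin n)) : Prop :=
  (T e.2 ≤ T e.1 ∧ Calls p t E T [⟨e.2, e.1, false, false⟩] T') ∨ (T e.1 < T e.2 ∧ T' = T)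

/-! ### The choice of the parameters -/

/-- `p = ⌈log_{3/2} n⌉`. -/
noncomputable def levels (n : ℕ) : ℕ := ⌈Real.logb (3 / 2) (n : ℝ)⌉₊

/-- `f(p) = 3^(p+1) / (2 * 3^(p+1) - 2^(p+1))`. -/
noncomputable def expo (p : ℕ) : ℝ := 3 ^ (p + 1) / (2 * 3 ^ (p + 1) - 2 ^ (p + 1))

/-- `t_i = t_0 ^ (2 - (2/3)^i)` with `t_0 = n ^ f(p)`. -/
noncomputable def threshold (n i : ℕ) : ℝ :=
  ((n : ℝ) ^ expo (levels n)) ^ (2 - (2 / 3 : ℝ) ^ i)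

/-- Input for a program that is given the parameters: in addition to the starting graph `E`, an
order `T` of `E` in array `1`, the number `p` in cell `3` of array `0`, and the integer parts of
`t_0, …, t_{p+1}` in array `3` (a distance, being an integer, is at most `t_i` if and only if it is
at most the integer part of `t_i`). -/
noncomputable def inputStoreWithParameters (n : ℕ) (E : Finset (Fin n × Fin n))
    (T : Equiv.Perm (Fin n)) : Store := fun a i =>
  if a = 0 ∧ i = 3 then levels n
  else if a = 1 then (if h : i < n then (T ⟨i, h⟩ : ℕ) else 0)
  else if a = 3 then (if i ≤ levels n + 1 then ⌊threshold n i⌋₊ else 0)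
  else inputStore n E a i

end OnlineTopo

/-! Fix a topological order `F` of the final graph; it serves the analysis only. Suppose an edge (x,
y) arrives while y stands before x. Let `D` be the set of vertices reachable from y and `Z` the set
of those that reach x. `F` puts `Z` below `D`, so every pair (a, b) of `D × Z` with a before b (a
`bad` pair) has to be inverted. An exchange takes place only when its first vertex has no successor
and its second no predecessor in between, so it keeps the order valid (`moves_swap`). It moves an
element of `D` to the right and one of `Z` to the left. Hence inverted pairs stay inverted, every
call inverts its own pair, and a call that is not an exchange has at least two subcalls. This bounds
the number of calls by a constant times the number of bad pairs. After the insertion these pairs are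
forced by the graph for ever (they leave `unsettled`), so there are O(n²) calls in all, however many
edges arrive.

Two other costs have to be controlled: the sum of the distances of the exchanges, and the searches
that go beyond the near range of their level (`wide` searches). The tool is the correlation ∑ T(w)
F(w). An exchange of u and v at distance d raises it by d (F u - F v) (`corr_swap`), it never
decreases, and it is at most n³. A wide search on level l costs at most θ (l+1), and its pair is at
distance more than θ l. If the `F`-gap of the pair is less than k_l, the cost is charged to the
pair; at most n k_l pairs are that close. If the gap is at least k_l, passing each other forces u
and v through a displacement θ l by exchanges of gap at least k_l, which raises the correlation by
an amount of order k_l θ l. The choice k_l = n / √(θ l) balances both charges at θ (l+1) n² / √(θ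
l), which is O(n^2.5) as soon as θ (l+1)² = O(n θ l) (`Balanced.exists_weights`).

The delicate point is that nested calls share displacements and must not spend them twice.
`exists_run_call` proves three bounds at once for the wide searches on one side: twice the growth of
the potential `phi` in general; once the growth if the end point has no neighbour in between; and
nothing at all if the flag is set. The subcalls of a call that has just made a wide search either
leave its end point in place or are of the cheaper second kind, and the saved half pays for the
search. The flag keeps the cheap kind from repeating a search known to be in vain. `exists_insert`
turns this into a decrease of `energy`, which depends only on the graph and the order and therefore
telescopes over all insertions.

On the machine, each level, side and vertex has a bucket list that contains all neighbours within
the threshold and possibly outdated entries. An exchange at distance d adds at most 4 d entries per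
level. A search empties the bucket and refills it with what is still near, so scanning old entries
is paid by the total list length. The neighbours found are sorted by marking distances in blocks of
length θ 0, at a cost of n / θ 0 for the blocks and θ 0 per vertex found; with θ 0 of order √n this
is O(√n) for each of the O(n²) calls and subcalls. Recursion is replaced by an explicit stack
(`Run.simulate`). Each assignment raises the largest number in memory by at most one, so the
logarithmic cost is the number of steps times O(log n) (`Ex.exec`).

The prescribed thresholds satisfy the growth condition by `threshold_facts`. If no order and no
parameters are given, the program uses thresholds S, 2S, 4S, … with S = ⌈√n⌉, starts from the empty
graph with the identical order, and inserts the starting edges one by one; the same potential pays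
for that. -/

namespace OnlineTopo

section Reordering

variable {n : ℕ}

/-! ### Reordering with integral thresholds -/

/-- `{w : u → w, d(u, w) ≤ s, w < v}` for an integer `s`. -/
def outNear (E : Finset (Fin n × Fin n)) (T : Equiv.Perm (Fin n)) (s : ℕ) (u v : Fin n) :
    Finset (Fin n) :=
  Finset.univ.filter fun w => (u, w) ∈ E ∧ dist T u w ≤ s ∧ T w < T v

/-- `{w : w → v, d(w, v) ≤ s, w > u}` for an integer `s`. -/
def inNear (E : Finset (Fin n × Fin n)) (T : Equiv.Perm (Fin n)) (s : ℕ) (u v : Fin n) :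
    Finset (Fin n) :=
  Finset.univ.filter fun w => (w, v) ∈ E ∧ dist T w v ≤ s ∧ T u < T w

/-- The choice between the near set and the wide set on one side of a call with flag `f`, at
distance `d`; `s` is the price of the search for the wide set. -/
def PicksSide (near wide : Finset (Fin n)) (f : Bool) (d : ℕ) (A : Finset (Fin n)) (s : ℕ) :
    Prop :=
  ((near ≠ ∅ ∨ f = true) ∧ A = near ∧ s = 0) ∨ (near = ∅ ∧ f = false ∧ A = wide ∧ s = d)

/-- The sets `A`, `B` computed by a call, together with the prices `sa`, `sb` of wide searches. -/
def Picks (p : ℕ) (θ : ℕ → ℕ) (E : Finset (Fin n × Fin n)) (T : Equiv.Perm (Fin n)) (c : Call n)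
    (A B : Finset (Fin n)) (sa sb : ℕ) : Prop :=
  (dist T c.u c.v ≤ θ 0 ∧ A = outNear E T (θ 0) c.u c.v ∧ B = inNear E T (θ 0) c.u c.v ∧
    sa = 0 ∧ sb = 0) ∨
  ∃ i ≤ p, (∀ j ≤ i, θ j < dist T c.u c.v) ∧ dist T c.u c.v ≤ θ (i + 1) ∧
    PicksSide (outNear E T (θ i) c.u c.v) (outNear E T (θ (i + 1)) c.u c.v) c.f₁
      (dist T c.u c.v) A sa ∧
    PicksSide (inNear E T (θ i) c.u c.v) (inNear E T (θ (i + 1)) c.u c.v) c.f₂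
      (dist T c.u c.v) B sb

/-- An execution of a list of calls in which no call exits at once. `N` counts calls, each with the
number of its subcalls; `wA`, `wB` are the total prices of wide searches; `sw` is the sum of the
distances of the swaps. -/
inductive Run (p : ℕ) (θ : ℕ → ℕ) (E : Finset (Fin n × Fin n)) :
    Equiv.Perm (Fin n) → List (Call n) → Equiv.Perm (Fin n) → ℕ → ℕ → ℕ → ℕ → Prop
  | nil (T : Equiv.Perm (Fin n)) : Run p θ E T [] T 0 0 0 0
  | swap {T T' : Equiv.Perm (Fin n)} {c : Call n} {cs : List (Call n)} {sa sb N wA wB sw : ℕ} :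
      IsTopOrder E T → T c.u < T c.v → Picks p θ E T c ∅ ∅ sa sb →
      Run p θ E (T * Equiv.swap c.u c.v) cs T' N wA wB sw →
      Run p θ E T (c :: cs) T' (1 + N) (sa + wA) (sb + wB) (dist T c.u c.v + sw)
  | recurse {T T' T'' : Equiv.Perm (Fin n)} {c : Call n} {cs : List (Call n)}
      {A B : Finset (Fin n)} {sa sb N₁ wA₁ wB₁ sw₁ N₂ wA₂ wB₂ sw₂ : ℕ} :
      IsTopOrder E T → T c.u < T c.v → Picks p θ E T c A B sa sb → ¬ (A = ∅ ∧ B = ∅) →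
      Run p θ E T (subcalls T c A B) T' N₁ wA₁ wB₁ sw₁ →
      Run p θ E T' cs T'' N₂ wA₂ wB₂ sw₂ →
      Run p θ E T (c :: cs) T'' (1 + (subcalls T c A B).length + N₁ + N₂) (sa + wA₁ + wA₂)
        (sb + wB₁ + wB₂) (sw₁ + sw₂)

theorem Run.append {p : ℕ} {θ : ℕ → ℕ} {E : Finset (Fin n × Fin n)}
    {T T' T'' : Equiv.Perm (Fin n)} {cs cs' : List (Call n)}
    {N₁ wA₁ wB₁ sw₁ N₂ wA₂ wB₂ sw₂ : ℕ}
    (h₁ : Run p θ E T cs T' N₁ wA₁ wB₁ sw₁) (h₂ : Run p θ E T' cs' T'' N₂ wA₂ wB₂ sw₂) :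
    Run p θ E T (cs ++ cs') T'' (N₁ + N₂) (wA₁ + wA₂) (wB₁ + wB₂) (sw₁ + sw₂) := by
  induction h₁ with
  | nil T => simpa using h₂
  | swap h1 h2 h3 _ ih =>
    have := Run.swap h1 h2 h3 (ih h₂)
    simpa only [List.cons_append, add_assoc] using this
  | recurse h1 h2 h3 h4 h5 _ _ ih =>
    have := Run.recurse h1 h2 h3 h4 h5 (ih h₂)
    simpa only [List.cons_append, add_assoc] using this

/-! ### Potentials -/

/-- `F a - F b` as a real number. -/
def gap (F : Equiv.Perm (Fin n)) (a b : Fin n) : ℝ := ((F a : ℕ) : ℝ) - ((F b : ℕ) : ℝ)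

/-- The correlation of the order `T` with the order `F`. -/
def corr (F T : Equiv.Perm (Fin n)) : ℝ := ∑ w, ((T w : ℕ) : ℝ) * ((F w : ℕ) : ℝ)

/-- The pairs in `D × Z` which are still to be inverted. -/
def bad (D Z : Finset (Fin n)) (T : Equiv.Perm (Fin n)) : Finset (Fin n × Fin n) :=
  (D ×ˢ Z).filter fun q => T q.1 < T q.2

theorem mem_bad {D Z : Finset (Fin n)} {T : Equiv.Perm (Fin n)} {a b : Fin n} :
    (a, b) ∈ bad D Z T ↔ (a ∈ D ∧ b ∈ Z) ∧ T a < T b := by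
  simp [bad]

/-- `D` is closed under successors, `Z` under predecessors, and the order `F` of the graph puts
`Z` below `D`. -/
structure Separated (E : Finset (Fin n × Fin n)) (F : Equiv.Perm (Fin n))
    (D Z : Finset (Fin n)) : Prop where
  top : IsTopOrder E F
  closedD : ∀ a w, a ∈ D → (a, w) ∈ E → w ∈ D
  closedZ : ∀ b w, b ∈ Z → (w, b) ∈ E → w ∈ Z
  sep : ∀ a ∈ D, ∀ b ∈ Z, F b < F a

/-- Weights of pairs of vertices and of the correlation which pay for wide searches. -/
structure Weights (p : ℕ) (θ : ℕ → ℕ) (F : Equiv.Perm (Fin n)) (α : Fin n × Fin n → ℝ) (β : ℝ) :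
    Prop where
  beta_nonneg : 0 ≤ β
  base : ∀ q, (θ 0 : ℝ) ≤ α q
  level : ∀ l ≤ p, ∀ a b, F b < F a → (θ (l + 1) : ℝ) ≤ α (a, b) + β / 2 * (gap F a b * θ l)

theorem Weights.nonneg {p : ℕ} {θ : ℕ → ℕ} {F : Equiv.Perm (Fin n)} {α : Fin n × Fin n → ℝ} {β : ℝ}
    (h : Weights p θ F α β) (q : Fin n × Fin n) : 0 ≤ α q :=
  le_trans (Nat.cast_nonneg _) (h.base q)

/-- The potential that pays for a run. -/
noncomputable def phi (F : Equiv.Perm (Fin n)) (D Z : Finset (Fin n)) (α : Fin n × Fin n → ℝ)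
    (β : ℝ) (T : Equiv.Perm (Fin n)) : ℝ :=
  β * corr F T - ∑ q ∈ bad D Z T, α q

/-- `T'` arises from `T` by moving `D` to the right and `Z` to the left, by swaps of pairs with
`F`-gap at least `g`. -/
structure Moves (E : Finset (Fin n × Fin n)) (F : Equiv.Perm (Fin n)) (D Z : Finset (Fin n))
    (g : ℝ) (T T' : Equiv.Perm (Fin n)) : Prop where
  top : IsTopOrder E T'
  right : ∀ a ∈ D, (T a : ℕ) ≤ (T' a : ℕ)
  left : ∀ b ∈ Z, (T' b : ℕ) ≤ (T b : ℕ)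
  adv : ∀ w, g * |((T' w : ℕ) : ℝ) - ((T w : ℕ) : ℝ)| ≤ corr F T' - corr F T

theorem Moves.refl {E : Finset (Fin n × Fin n)} {F : Equiv.Perm (Fin n)} {D Z : Finset (Fin n)}
    {g : ℝ} {T : Equiv.Perm (Fin n)} (h : IsTopOrder E T) : Moves E F D Z g T T :=
  ⟨h, fun _ _ => le_rfl, fun _ _ => le_rfl, fun w => by simp⟩

theorem Moves.trans {E : Finset (Fin n × Fin n)} {F : Equiv.Perm (Fin n)} {D Z : Finset (Fin n)}
    {g : ℝ} {T T' T'' : Equiv.Perm (Fin n)} (hg : 0 ≤ g) (h₁ : Moves E F D Z g T T')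
    (h₂ : Moves E F D Z g T' T'') : Moves E F D Z g T T'' :=
  ⟨h₂.top, fun a ha => (h₁.right a ha).trans (h₂.right a ha),
    fun b hb => (h₂.left b hb).trans (h₁.left b hb), fun w => by
      have h1 := h₁.adv w
      have h2 := h₂.adv w
      have h3 : |((T'' w : ℕ) : ℝ) - ((T w : ℕ) : ℝ)| ≤
          |((T'' w : ℕ) : ℝ) - ((T' w : ℕ) : ℝ)| + |((T' w : ℕ) : ℝ) - ((T w : ℕ) : ℝ)| :=
        abs_sub_le _ _ _
      have h4 := mul_le_mul_of_nonneg_left h3 hg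
      linarith⟩

theorem Moves.mono {E : Finset (Fin n × Fin n)} {F : Equiv.Perm (Fin n)} {D Z : Finset (Fin n)}
    {g g' : ℝ} {T T' : Equiv.Perm (Fin n)} (hg : g' ≤ g) (h : Moves E F D Z g T T') :
    Moves E F D Z g' T T' :=
  ⟨h.top, h.right, h.left, fun w =>
    (mul_le_mul_of_nonneg_right hg (abs_nonneg _)).trans (h.adv w)⟩

/-- Elements of `D` move only right and those of `Z` only left, so an inverted pair cannot become
bad again. -/
theorem Moves.bad_subset {E : Finset (Fin n × Fin n)} {F : Equiv.Perm (Fin n)}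
    {D Z : Finset (Fin n)} {g : ℝ} {T T' : Equiv.Perm (Fin n)} (h : Moves E F D Z g T T') :
    bad D Z T' ⊆ bad D Z T := by
  rintro ⟨a, b⟩ hq
  rw [mem_bad] at hq ⊢
  have h1 := h.right a hq.1.1
  have h2 := h.left b hq.1.2
  refine ⟨hq.1, ?_⟩
  have h3 := hq.2
  rw [Fin.lt_def] at h3 ⊢
  omega

/-- The displacement of a single vertex is already paid for by the correlation, since every exchange
has gap at least `g`; the bad pairs can only help. -/
theorem Moves.phi_le {E : Finset (Fin n × Fin n)} {F : Equiv.Perm (Fin n)} {D Z : Finset (Fin n)}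
    {g : ℝ} {T T' : Equiv.Perm (Fin n)} {p : ℕ} {θ : ℕ → ℕ} {α : Fin n × Fin n → ℝ} {β : ℝ}
    (hW : Weights p θ F α β) (w : Fin n) (h : Moves E F D Z g T T') :
    β * (g * |((T' w : ℕ) : ℝ) - ((T w : ℕ) : ℝ)|) ≤ phi F D Z α β T' - phi F D Z α β T := by
  have h1 := mul_le_mul_of_nonneg_left (h.adv w) hW.beta_nonneg
  have h2 : ∑ q ∈ bad D Z T', α q ≤ ∑ q ∈ bad D Z T, α q :=
    Finset.sum_le_sum_of_subset_of_nonneg h.bad_subset fun q _ _ => hW.nonneg q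
  unfold phi
  linarith

/-- Inverting the pair `(u, v)` earns its weight. -/
theorem Moves.phi_le_of_inverted {E : Finset (Fin n × Fin n)} {F : Equiv.Perm (Fin n)}
    {D Z : Finset (Fin n)} {g : ℝ} {T T' : Equiv.Perm (Fin n)} {p : ℕ} {θ : ℕ → ℕ}
    {α : Fin n × Fin n → ℝ} {β : ℝ}
    (hW : Weights p θ F α β) (h : Moves E F D Z g T T') {u v : Fin n}
    (hu : u ∈ D) (hv : v ∈ Z) (h1 : T u < T v) (h2 : T' v < T' u) :
    α (u, v) + β / 2 * (g * |((T' u : ℕ) : ℝ) - ((T u : ℕ) : ℝ)|) +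
      β / 2 * (g * |((T' v : ℕ) : ℝ) - ((T v : ℕ) : ℝ)|) ≤
      phi F D Z α β T' - phi F D Z α β T := by
  -- The same gain of correlation bounds the displacement of `u` and that of `v`, so each of the two
  -- may use only half of `β`.
  have ha := mul_le_mul_of_nonneg_left (h.adv u) (div_nonneg hW.beta_nonneg (zero_le_two))
  have hb := mul_le_mul_of_nonneg_left (h.adv v) (div_nonneg hW.beta_nonneg (zero_le_two))
  have h3 : (u, v) ∈ bad D Z T := mem_bad.2 ⟨⟨hu, hv⟩, h1⟩
  have h4 : (u, v) ∉ bad D Z T' := fun hc => absurd (mem_bad.1 hc).2 (not_lt.2 h2.le)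
  have h5 : ∑ q ∈ insert (u, v) (bad D Z T'), α q ≤ ∑ q ∈ bad D Z T, α q :=
    Finset.sum_le_sum_of_subset_of_nonneg
      (Finset.insert_subset h3 h.bad_subset) fun q _ _ => hW.nonneg q
  rw [Finset.sum_insert h4] at h5
  unfold phi
  linarith

/-- No out-neighbour of `u` lies below `v`. -/
def NoOut (E : Finset (Fin n × Fin n)) (T : Equiv.Perm (Fin n)) (u v : Fin n) : Prop :=
  ∀ w, (u, w) ∈ E → (T v : ℕ) < (T w : ℕ)

/-- No in-neighbour of `v` lies above `u`. -/
def NoIn (E : Finset (Fin n × Fin n)) (T : Equiv.Perm (Fin n)) (u v : Fin n) : Prop :=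
  ∀ w, (w, v) ∈ E → (T w : ℕ) < (T u : ℕ)

/-- Successors of `u` are in `D` and move right, `v'` is in `Z` and moves left: an interval once
free of out-neighbours of `u` stays free. This is what makes the flags of subcalls correct although
they are executed later. -/
theorem NoOut.mono {E : Finset (Fin n × Fin n)} {F : Equiv.Perm (Fin n)} {D Z : Finset (Fin n)}
    {g : ℝ} {T T' : Equiv.Perm (Fin n)} {u v v' : Fin n} (hS : Separated E F D Z) (hu : u ∈ D)
    (hv' : v' ∈ Z) (hle : (T v' : ℕ) ≤ (T v : ℕ)) (h : NoOut E T u v)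
    (hM : Moves E F D Z g T T') : NoOut E T' u v' := fun w hw => by
  have h1 := h w hw
  have h2 := hM.right w (hS.closedD u w hu hw)
  have h3 := hM.left v' hv'
  omega

theorem NoIn.mono {E : Finset (Fin n × Fin n)} {F : Equiv.Perm (Fin n)} {D Z : Finset (Fin n)}
    {g : ℝ} {T T' : Equiv.Perm (Fin n)} {u u' v : Fin n} (hS : Separated E F D Z) (hv : v ∈ Z)
    (hu' : u' ∈ D) (hle : (T u : ℕ) ≤ (T u' : ℕ)) (h : NoIn E T u v)
    (hM : Moves E F D Z g T T') : NoIn E T' u' v := fun w hw => by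
  have h1 := h w hw
  have h2 := hM.left w (hS.closedZ v w hv hw)
  have h3 := hM.right u' hu'
  omega

/-- The preconditions of a call. -/
structure Valid (E : Finset (Fin n × Fin n)) (D Z : Finset (Fin n)) (T : Equiv.Perm (Fin n))
    (c : Call n) : Prop where
  top : IsTopOrder E T
  memD : c.u ∈ D
  memZ : c.v ∈ Z
  lt : (T c.u : ℕ) < (T c.v : ℕ)
  flag₁ : c.f₁ = true → NoOut E T c.u c.v
  flag₂ : c.f₂ = true → NoIn E T c.u c.v

/-- What a call achieves, and how its costs are bounded by the potential. -/
structure Outcome (E : Finset (Fin n × Fin n)) (F : Equiv.Perm (Fin n)) (D Z : Finset (Fin n))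
    (α : Fin n × Fin n → ℝ) (β : ℝ) (T : Equiv.Perm (Fin n)) (c : Call n)
    (T' : Equiv.Perm (Fin n)) (N wA wB sw : ℕ) : Prop where
  moves : Moves E F D Z (gap F c.u c.v) T T'
  inverted : (T' c.v : ℕ) < (T' c.u : ℕ)
  confined : ∀ w, (T w : ℕ) < (T c.u : ℕ) ∨ (T c.v : ℕ) < (T w : ℕ) → T' w = T w
  count : N + 3 + 4 * (bad D Z T').card ≤ 4 * (bad D Z T).card
  wideA : (wA : ℝ) ≤ 2 * (phi F D Z α β T' - phi F D Z α β T)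
  wideA_of_noOut : NoOut E T c.u c.v → (wA : ℝ) ≤ phi F D Z α β T' - phi F D Z α β T
  wideA_of_flag : c.f₁ = true → wA = 0
  wideB : (wB : ℝ) ≤ 2 * (phi F D Z α β T' - phi F D Z α β T)
  wideB_of_noIn : NoIn E T c.u c.v → (wB : ℝ) ≤ phi F D Z α β T' - phi F D Z α β T
  wideB_of_flag : c.f₂ = true → wB = 0
  swaps : (sw : ℝ) ≤ phi F D Z α β T' - phi F D Z α β T

/-- The positions below `q` are occupied by the same vertices as before, so no other vertex can have
got there. -/
theorem le_of_fixes_below {T T' : Equiv.Perm (Fin n)} {q : ℕ}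
    (h : ∀ w, (T w : ℕ) < q → T' w = T w) {b : Fin n} (hb : q ≤ (T b : ℕ)) : q ≤ (T' b : ℕ) := by
  by_contra hlt
  push Not at hlt
  have h1 := h (T.symm (T' b)) (by simpa using hlt)
  have h2 : T.symm (T' b) = b := T'.injective (by simpa using h1)
  rw [← h2] at hb
  simp at hb
  omega

theorem le_of_fixes_above {T T' : Equiv.Perm (Fin n)} {q : ℕ}
    (h : ∀ w, q < (T w : ℕ) → T' w = T w) {b : Fin n} (hb : (T b : ℕ) ≤ q) : (T' b : ℕ) ≤ q := by
  by_contra hlt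
  push Not at hlt
  have h1 := h (T.symm (T' b)) (by simpa using hlt)
  have h2 : T.symm (T' b) = b := T'.injective (by simpa using h1)
  rw [← h2] at hb
  simp at hb
  omega

end Reordering

/-! ### Adding up the subcalls that share their first end point -/

section Reordering

variable {n : ℕ}

/-- What a list of `k` subcalls of a call with end points `u`, `v` achieves. Here `eA` says that
the set `A` of the call is empty, and `wideA` that it has all out-neighbours of `u` below `v`. -/
structure ListOutcome (E : Finset (Fin n × Fin n)) (F : Equiv.Perm (Fin n)) (D Z : Finset (Fin n))
    (α : Fin n × Fin n → ℝ) (β : ℝ) (u v : Fin n) (eA fA eB fB : Prop)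
    (T : Equiv.Perm (Fin n)) (k : ℕ) (T' : Equiv.Perm (Fin n)) (N wA wB sw : ℕ) : Prop where
  moves : Moves E F D Z (gap F u v) T T'
  count : N + 3 * k + 4 * (bad D Z T').card ≤ 4 * (bad D Z T).card
  wideA : (wA : ℝ) ≤ 2 * (phi F D Z α β T' - phi F D Z α β T)
  wideA_zero : eA → wA = 0
  wideA_move : fA → (wA : ℝ) + β * (gap F u v * |((T' u : ℕ) : ℝ) - ((T u : ℕ) : ℝ)|) ≤
    2 * (phi F D Z α β T' - phi F D Z α β T)
  wideB : (wB : ℝ) ≤ 2 * (phi F D Z α β T' - phi F D Z α β T)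
  wideB_zero : eB → wB = 0
  wideB_move : fB → (wB : ℝ) + β * (gap F u v * |((T' v : ℕ) : ℝ) - ((T v : ℕ) : ℝ)|) ≤
    2 * (phi F D Z α β T' - phi F D Z α β T)
  swaps : (sw : ℝ) ≤ phi F D Z α β T' - phi F D Z α β T

theorem ListOutcome.refl {E : Finset (Fin n × Fin n)} {F : Equiv.Perm (Fin n)}
    {D Z : Finset (Fin n)} {α : Fin n × Fin n → ℝ} {β : ℝ} {u v : Fin n} {eA fA eB fB : Prop}
    {T : Equiv.Perm (Fin n)} (h : IsTopOrder E T) :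
    ListOutcome E F D Z α β u v eA fA eB fB T 0 T 0 0 0 0 :=
  ⟨Moves.refl h, by simp, by simp, by simp, by simp, by simp, by simp, by simp, by simp⟩

theorem ListOutcome.trans {E : Finset (Fin n × Fin n)} {F : Equiv.Perm (Fin n)}
    {D Z : Finset (Fin n)} {α : Fin n × Fin n → ℝ} {β : ℝ} {u v : Fin n} {eA fA eB fB : Prop}
    {T T' T'' : Equiv.Perm (Fin n)} {k k' N wA wB sw N' wA' wB' sw' : ℕ}
    (hβ : 0 ≤ β) (hg : 0 ≤ gap F u v)
    (h : ListOutcome E F D Z α β u v eA fA eB fB T k T' N wA wB sw)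
    (h' : ListOutcome E F D Z α β u v eA fA eB fB T' k' T'' N' wA' wB' sw') :
    ListOutcome E F D Z α β u v eA fA eB fB T (k + k') T'' (N + N') (wA + wA') (wB + wB')
      (sw + sw') := by
  have key : ∀ w, β * (gap F u v * |((T'' w : ℕ) : ℝ) - ((T w : ℕ) : ℝ)|) ≤
      β * (gap F u v * |((T' w : ℕ) : ℝ) - ((T w : ℕ) : ℝ)|) +
      β * (gap F u v * |((T'' w : ℕ) : ℝ) - ((T' w : ℕ) : ℝ)|) := fun w => by
    have h3 : |((T'' w : ℕ) : ℝ) - ((T w : ℕ) : ℝ)| ≤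
        |((T'' w : ℕ) : ℝ) - ((T' w : ℕ) : ℝ)| + |((T' w : ℕ) : ℝ) - ((T w : ℕ) : ℝ)| :=
      abs_sub_le _ _ _
    have h4 := mul_le_mul_of_nonneg_left (mul_le_mul_of_nonneg_left h3 hg) hβ
    linarith
  refine ⟨h.moves.trans hg h'.moves, ?_, ?_, ?_, ?_, ?_, ?_, ?_, ?_⟩
  · have := h.count; have := h'.count; omega
  · have := h.wideA; have := h'.wideA; push_cast; linarith
  · intro e; rw [h.wideA_zero e, h'.wideA_zero e]
  · intro e
    have := h.wideA_move e; have := h'.wideA_move e; have := key u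
    push_cast; linarith
  · have := h.wideB; have := h'.wideB; push_cast; linarith
  · intro e; rw [h.wideB_zero e, h'.wideB_zero e]
  · intro e
    have := h.wideB_move e; have := h'.wideB_move e; have := key v
    push_cast; linarith
  · have := h.swaps; have := h'.swaps; push_cast; linarith

/-- For `wideA_move` there are two cases. If the subcall starts at `u` itself and `u` has no
out-neighbour in its range, its wide searches use the growth of the potential only once, and the
second copy covers the displacement of `u`. If it starts above `u`, then `u` is outside its range
and does not move. The side of `v` is symmetric. -/
theorem Outcome.toList {E : Finset (Fin n × Fin n)} {F : Equiv.Perm (Fin n)}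
    {D Z : Finset (Fin n)} {α : Fin n × Fin n → ℝ} {β : ℝ} {u v : Fin n} {eA fA eB fB : Prop}
    {p : ℕ} {θ : ℕ → ℕ} (hW : Weights p θ F α β)
    {T T' : Equiv.Perm (Fin n)} {c : Call n} {N wA wB sw : ℕ}
    (h : Outcome E F D Z α β T c T' N wA wB sw)
    (hu : F u ≤ F c.u) (hv : F c.v ≤ F v) (heA : eA → c.f₁ = true) (heB : eB → c.f₂ = true)
    (hA : fA → (c.u = u ∧ NoOut E T u c.v) ∨ (T u : ℕ) < (T c.u : ℕ))
    (hB : fB → (c.v = v ∧ NoIn E T c.u v) ∨ (T c.v : ℕ) < (T v : ℕ)) :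
    ListOutcome E F D Z α β u v eA fA eB fB T 1 T' N wA wB sw := by
  -- The end points of a subcall are successors of `u` and predecessors of `v`, or `u` and `v`
  -- themselves, so gaps only grow down the recursion.
  have hgap : gap F u v ≤ gap F c.u c.v := by
    unfold gap
    have h1 : ((F u : ℕ) : ℝ) ≤ ((F c.u : ℕ) : ℝ) := by exact_mod_cast hu
    have h2 : ((F c.v : ℕ) : ℝ) ≤ ((F v : ℕ) : ℝ) := by exact_mod_cast hv
    linarith
  have hM := h.moves.mono hgap
  refine ⟨hM, by have := h.count; omega, h.wideA, fun e => h.wideA_of_flag (heA e), fun e => ?_,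
    h.wideB, fun e => h.wideB_of_flag (heB e), fun e => ?_, h.swaps⟩
  · rcases hA e with ⟨h1, h2⟩ | h1
    · have h3 := h.wideA_of_noOut (by rw [h1]; exact h2)
      have h4 := hM.phi_le hW u
      linarith
    · rw [h.confined u (Or.inl h1)]
      simpa using h.wideA
  · rcases hB e with ⟨h1, h2⟩ | h1
    · have h3 := h.wideB_of_noIn (by rw [h1]; exact h2)
      have h4 := hM.phi_le hW v
      linarith
    · rw [h.confined v (Or.inr h1)]
      simpa using h.wideB

/-- The subcalls with a fixed first end point `u'`. -/
theorem exists_run_group {E : Finset (Fin n × Fin n)} {F : Equiv.Perm (Fin n)}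
    {D Z : Finset (Fin n)} {α : Fin n × Fin n → ℝ} {β : ℝ} {u v : Fin n} {eA fA eB fB : Prop}
    {p : ℕ} {θ : ℕ → ℕ} (hS : Separated E F D Z) (hW : Weights p θ F α β) (hg : 0 ≤ gap F u v)
    {m : ℕ}
    (IH : ∀ T c, Valid E D Z T c → (T c.v : ℕ) - (T c.u : ℕ) + (bad D Z T).card < m →
      ∃ T' N wA wB sw, Run p θ E T [c] T' N wA wB sw ∧ Outcome E F D Z α β T c T' N wA wB sw)
    {u' : Fin n} {mk : Fin n → Call n} (hmk : ∀ v', (mk v').u = u' ∧ (mk v').v = v')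
    (hu' : u' ∈ D) (huu' : F u ≤ F u') :
    ∀ (vs : List (Fin n)) (T : Equiv.Perm (Fin n)), IsTopOrder E T →
      (∀ v' ∈ vs, v' ∈ Z ∧ F v' ≤ F v) → vs.Pairwise (fun b b' => (T b : ℕ) < (T b' : ℕ)) →
      (∀ v' ∈ vs, (T u' : ℕ) < (T v' : ℕ)) →
      (∀ v' ∈ vs, (T v' : ℕ) - (T u' : ℕ) + (bad D Z T).card < m) →
      (∀ v' ∈ vs, (mk v').f₁ = true → NoOut E T u' v') →
      (∀ v' ∈ vs, (mk v').f₂ = true → NoIn E T u' v') →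
      (∀ v' ∈ vs, eA → (mk v').f₁ = true) → (∀ v' ∈ vs, eB → (mk v').f₂ = true) →
      (fA → (u' = u ∧ ∀ v' ∈ vs, NoOut E T u v') ∨ (T u : ℕ) < (T u' : ℕ)) →
      (∀ v' ∈ vs, v' = v ∨ (T v' : ℕ) < (T v : ℕ)) →
      (fB → ∀ w, (w, v) ∈ E → (T w : ℕ) < (T u' : ℕ) ∨ w ∈ vs) →
      ∃ T' N wA wB sw, Run p θ E T (vs.map mk) T' N wA wB sw ∧
        ListOutcome E F D Z α β u v eA fA eB fB T vs.length T' N wA wB sw ∧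
        (∀ b ∈ vs, (T' b : ℕ) < (T' u' : ℕ)) ∧
        (∀ b ∈ vs, ∀ b' ∈ vs, (T b : ℕ) < (T b' : ℕ) → (T' b : ℕ) < (T' b' : ℕ)) ∧
        (∀ w, (T w : ℕ) < (T u' : ℕ) → T' w = T w) ∧
        (∀ q, (T u' : ℕ) ≤ q → (∀ v' ∈ vs, (T v' : ℕ) ≤ q) → ∀ w, q < (T w : ℕ) → T' w = T w) := by
  intro vs
  induction vs with
  | nil =>
    intro T hT _ _ _ _ _ _ _ _ _ _ _
    exact ⟨T, 0, 0, 0, 0, Run.nil T, ListOutcome.refl hT, by simp, by simp, by simp, by simp⟩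
  | cons v₁ vs ih =>
    intro T hT hZ hP hlt hμ hf₁ hf₂ heA heB hA hB hB2
    obtain ⟨hmu, hmv⟩ := hmk v₁
    simp only [List.forall_mem_cons] at hZ hlt hμ hf₁ hf₂ heA heB hB
    rw [List.pairwise_cons] at hP
    have hval : Valid E D Z T (mk v₁) :=
      ⟨hT, hmu ▸ hu', by rw [hmv]; exact hZ.1.1, by rw [hmu, hmv]; exact hlt.1,
        by rw [hmu, hmv]; exact hf₁.1, by rw [hmu, hmv]; exact hf₂.1⟩
    obtain ⟨T₁, N₁, wA₁, wB₁, sw₁, hrun, hout⟩ := IH T (mk v₁) hval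
      (by rw [hmu, hmv]; exact hμ.1)
    have hL : ListOutcome E F D Z α β u v eA fA eB fB T 1 T₁ N₁ wA₁ wB₁ sw₁ := by
      refine hout.toList hW (by rw [hmu]; exact huu') (by rw [hmv]; exact hZ.1.2)
        heA.1 heB.1 ?_ ?_
      · intro e
        rw [hmu, hmv]
        rcases hA e with ⟨h1, h2⟩ | h1
        · exact Or.inl ⟨h1, h2 v₁ (by simp)⟩
        · exact Or.inr h1
      · intro e
        rw [hmu, hmv]
        -- If `v₁ = v`, a predecessor of `v` that is still in the list would stand at or above `v`;
        -- so all predecessors of `v` are below `u'` by now.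
        rcases hB.1 with h1 | h1
        · refine Or.inl ⟨h1, fun w hw => ?_⟩
          have h3 : (T w : ℕ) < (T v : ℕ) := hT _ hw
          rcases hB2 e w hw with h2 | h2
          · exact h2
          · rcases List.mem_cons.1 h2 with h4 | h4
            · rw [h4, h1] at h3; omega
            · have := hP.1 w h4
              rw [h1] at this; omega
        · exact Or.inr h1
    have hM := hL.moves
    have hconf := hout.confined
    have hinv := hout.inverted
    rw [hmu, hmv] at hinv
    simp only [hmu, hmv] at hconf
    -- The call on (`u'`, `v₁`) acts only up to the position of `v₁`; the later end points stand
    -- above it.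
    have hfix : ∀ b ∈ vs, T₁ b = T b := fun b hb => hconf b (Or.inr (hP.1 b hb))
    have hu1 : (T u' : ℕ) ≤ (T₁ u' : ℕ) := hM.right u' hu'
    have hu2 : (T₁ u' : ℕ) ≤ (T v₁ : ℕ) :=
      le_of_fixes_above (fun w hw => hconf w (Or.inr hw)) hlt.1.le
    have hbad := Finset.card_le_card hM.bad_subset
    obtain ⟨T', N₂, wA₂, wB₂, sw₂, hrun₂, hL₂, hc1, hc2, hc3, hc4⟩ := ih T₁ hM.top hZ.2
      (hP.2.imp_of_mem (fun ha hb h => by rw [hfix _ ha, hfix _ hb]; exact h))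
      (fun b hb => by rw [hfix b hb]; have := hP.1 b hb; omega)
      (fun b hb => by rw [hfix b hb]; have := hμ.2 b hb; omega)
      (fun b hb e => (hf₁.2 b hb e).mono hS hu' (hZ.2 b hb).1 le_rfl hM)
      (fun b hb e => (hf₂.2 b hb e).mono hS (hZ.2 b hb).1 hu' le_rfl hM)
      heA.2 heB.2
      (fun e => by
        rcases hA e with ⟨h1, h2⟩ | h1
        · exact Or.inl ⟨h1, fun b hb =>
            (h2 b (by simp [hb])).mono hS (h1 ▸ hu') (hZ.2 b hb).1 le_rfl hM⟩
        · right
          rw [hconf u (Or.inl h1)]; omega)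
      (fun b hb => by
        rcases hB.2 b hb with h1 | h1
        · exact Or.inl h1
        · right
          have := hP.1 b hb
          rw [hfix b hb, hconf v (Or.inr (by omega))]; exact h1)
      (fun e w hw => by
        rcases hB2 e w hw with h1 | h1
        · left
          rw [hconf w (Or.inl h1)]; omega
        · rcases List.mem_cons.1 h1 with h2 | h2
          · left; rw [h2]; exact hinv
          · exact Or.inr h2)
    -- The remaining calls act from the position of `u'` upwards, and `v₁` is below that now.
    have hv1 : T' v₁ = T₁ v₁ := hc3 v₁ hinv
    have hlow : ∀ b, (T₁ u' : ℕ) ≤ (T₁ b : ℕ) → (T₁ u' : ℕ) ≤ (T' b : ℕ) :=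
      fun b hb => le_of_fixes_below hc3 hb
    have hvs : ∀ b ∈ vs, (T₁ v₁ : ℕ) < (T' b : ℕ) := fun b hb => by
      have := hlow b (by rw [hfix b hb]; have := hP.1 b hb; omega)
      omega
    refine ⟨T', N₁ + N₂, wA₁ + wA₂, wB₁ + wB₂, sw₁ + sw₂, ?_, ?_, ?_, ?_, ?_, ?_⟩
    · have := hrun.append hrun₂
      simpa using this
    · have := hL.trans hW.beta_nonneg hg hL₂
      rw [List.length_cons, add_comm]; exact this
    · rintro b hb
      rcases List.mem_cons.1 hb with rfl | hb
      · rw [hv1]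
        have := hlow u' le_rfl
        omega
      · exact hc1 b hb
    · intro b hb b' hb' h
      rcases List.mem_cons.1 hb with h1 | h1 <;> rcases List.mem_cons.1 hb' with h2 | h2
      · rw [h1, h2] at h; omega
      · rw [h1, hv1]; exact hvs b' h2
      · rw [h2] at h; have := hP.1 b h1; omega
      · exact hc2 b h1 b' h2 (by rw [hfix b h1, hfix b' h2]; exact h)
    · intro w hw
      rw [hc3 w (by rw [hconf w (Or.inl hw)]; omega), hconf w (Or.inl hw)]
    · intro q hq hvq w hw
      simp only [List.forall_mem_cons] at hvq
      have h1 : T₁ w = T w := hconf w (Or.inr (by omega))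
      rw [hc4 q (by omega) (fun b hb => by rw [hfix b hb]; exact hvq.2 b hb) w
        (by rw [h1]; exact hw), h1]

end Reordering

/-! ### The sequence of subcalls, and those that start in `A` -/

section Reordering

variable {n : ℕ}

theorem mem_inOrder {T : Equiv.Perm (Fin n)} {S : Finset (Fin n)} {w : Fin n} :
    w ∈ inOrder T S ↔ w ∈ S := by
  simp only [inOrder, List.mem_filter, List.mem_map, List.mem_finRange, true_and,
    decide_eq_true_eq, and_iff_right_iff_imp]
  exact fun _ => ⟨T w, by simp⟩

theorem pairwise_inOrder (T : Equiv.Perm (Fin n)) (S : Finset (Fin n)) :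
    (inOrder T S).Pairwise fun a b => (T a : ℕ) < (T b : ℕ) := by
  refine List.Pairwise.filter _ ?_
  rw [List.pairwise_map]
  refine (List.pairwise_lt_finRange n).imp fun {a b} h => ?_
  simpa using h

theorem eq_of_pairwise_of_mem_iff {T : Equiv.Perm (Fin n)} {l l' : List (Fin n)}
    (hl : l.Pairwise (fun a b => (T a : ℕ) < (T b : ℕ)))
    (hl' : l'.Pairwise (fun a b => (T a : ℕ) < (T b : ℕ))) (h : ∀ w, w ∈ l ↔ w ∈ l') : l = l' := by
  let r : Fin n → Fin n → Prop := fun a b => (T a : ℕ) < (T b : ℕ)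
  have : Std.Irrefl r := ⟨fun a h => lt_irrefl _ h⟩
  have : Std.Antisymm r := ⟨fun a b h h' => absurd h (lt_asymm h')⟩
  exact List.Pairwise.eq_of_mem_iff (r := r) hl hl' (fun {w} => h w)

theorem inOrder_insert_first {T : Equiv.Perm (Fin n)} {A : Finset (Fin n)} {u : Fin n}
    (h : ∀ a ∈ A, (T u : ℕ) < (T a : ℕ)) : inOrder T (insert u A) = u :: inOrder T A := by
  refine eq_of_pairwise_of_mem_iff (T := T) (pairwise_inOrder _ _) ?_ fun w => by
    simp [mem_inOrder]
  rw [List.pairwise_cons]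
  exact ⟨fun a ha => h a (mem_inOrder.1 ha), pairwise_inOrder _ _⟩

theorem inOrder_insert_last {T : Equiv.Perm (Fin n)} {B : Finset (Fin n)} {v : Fin n}
    (h : ∀ b ∈ B, (T b : ℕ) < (T v : ℕ)) : inOrder T (insert v B) = inOrder T B ++ [v] := by
  refine eq_of_pairwise_of_mem_iff (T := T) (pairwise_inOrder _ _) ?_ fun w => by
    simp [mem_inOrder, or_comm]
  rw [List.pairwise_append]
  refine ⟨pairwise_inOrder _ _, by simp, fun a ha b hb => ?_⟩
  rw [List.mem_singleton.1 hb]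
  exact h a (mem_inOrder.1 ha)

/-- The subcall of `c` with end points `u'`, `v'`. -/
def subcall (c : Call n) (A B : Finset (Fin n)) (u' v' : Fin n) : Call n where
  u := u'
  v := v'
  f₁ := decide (u' = c.u ∧ A = ∅)
  f₂ := decide (v' = c.v ∧ B = ∅)

/-- The subcalls of `c` with first end point `u'`. -/
def group (T : Equiv.Perm (Fin n)) (c : Call n) (A B : Finset (Fin n)) (u' : Fin n) :
    List (Call n) :=
  ((inOrder T (insert c.v B)).filter fun v' => T u' < T v').map (subcall c A B u')

/-- The three blocks are paid for differently. The calls starting in `A` do not move `u`; the calls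
(u, b) with b in `B` move `u` but not `v`; the last call repeats (u, v) itself, and it is the one
that inverts this pair. -/
theorem subcalls_eq {T : Equiv.Perm (Fin n)} {c : Call n} {A B : Finset (Fin n)}
    (hA : ∀ a ∈ A, (T c.u : ℕ) < (T a : ℕ)) (hB : ∀ b ∈ B, (T b : ℕ) < (T c.v : ℕ))
    (hB' : ∀ b ∈ B, (T c.u : ℕ) < (T b : ℕ)) (huv : (T c.u : ℕ) < (T c.v : ℕ)) :
    subcalls T c A B = ((inOrder T A).reverse.flatMap (group T c A B) ++
      (inOrder T B).map (subcall c A B c.u)) ++ [subcall c A B c.u c.v] := by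
  have h : subcalls T c A B = (inOrder T (insert c.u A)).reverse.flatMap (group T c A B) := rfl
  rw [h, inOrder_insert_first hA, List.reverse_cons, List.flatMap_append, List.append_assoc]
  congr 1
  simp only [group, List.flatMap_cons, List.flatMap_nil, List.append_nil]
  rw [List.filter_eq_self.2, inOrder_insert_last hB, List.map_append, List.map_singleton]
  intro b hb
  have : (T c.u : ℕ) < (T b : ℕ) := by
    rcases Finset.mem_insert.1 (mem_inOrder.1 hb) with h1 | h1
    · rw [h1]; exact huv
    · exact hB' b h1
  exact decide_eq_true this

/-- The subcalls whose first end point lies in `A`. -/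
theorem exists_run_groups {E : Finset (Fin n × Fin n)} {F : Equiv.Perm (Fin n)}
    {D Z : Finset (Fin n)} {α : Fin n × Fin n → ℝ} {β : ℝ} {fA fB : Prop}
    {p : ℕ} {θ : ℕ → ℕ} (hS : Separated E F D Z) (hW : Weights p θ F α β)
    {T₀ : Equiv.Perm (Fin n)} {c : Call n} {A B : Finset (Fin n)} (hc : Valid E D Z T₀ c)
    (IH : ∀ T c', Valid E D Z T c' → (T c'.v : ℕ) - (T c'.u : ℕ) + (bad D Z T).card <
      (T₀ c.v : ℕ) - (T₀ c.u : ℕ) + (bad D Z T₀).card →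
      ∃ T' N wA wB sw, Run p θ E T [c'] T' N wA wB sw ∧ Outcome E F D Z α β T c' T' N wA wB sw)
    (hA : ∀ a ∈ A, (c.u, a) ∈ E ∧ (T₀ c.u : ℕ) < (T₀ a : ℕ) ∧ (T₀ a : ℕ) < (T₀ c.v : ℕ))
    (hB : ∀ b ∈ B, (b, c.v) ∈ E ∧ (T₀ c.u : ℕ) < (T₀ b : ℕ) ∧ (T₀ b : ℕ) < (T₀ c.v : ℕ))
    (heB : B = ∅ → NoIn E T₀ c.u c.v)
    (hfB : fB → ∀ w, (w, c.v) ∈ E → (T₀ c.u : ℕ) < (T₀ w : ℕ) → w ∈ B) :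
    ∀ (us : List (Fin n)) (T : Equiv.Perm (Fin n)), (∀ a ∈ us, a ∈ A) →
      us.Pairwise (fun a a' => (T₀ a' : ℕ) < (T₀ a : ℕ)) →
      Moves E F D Z (gap F c.u c.v) T₀ T →
      (∀ b ∈ insert c.v B, ∀ b' ∈ insert c.v B, (T₀ b : ℕ) < (T₀ b' : ℕ) →
        (T b : ℕ) < (T b' : ℕ)) →
      (∀ a ∈ us, ∀ w, (T₀ w : ℕ) ≤ (T₀ a : ℕ) → T w = T₀ w) →
      (∀ q, (∀ a ∈ A, q ≤ (T₀ a : ℕ)) → ∀ w, (T₀ w : ℕ) < q → T w = T₀ w) →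
      (∀ w, (T₀ c.v : ℕ) < (T₀ w : ℕ) → T w = T₀ w) →
      (∀ a ∈ A, a ∈ us ∨ ∀ b ∈ insert c.v B, (T b : ℕ) < (T a : ℕ)) →
      ∃ T' N wA wB sw, Run p θ E T (us.flatMap (group T₀ c A B)) T' N wA wB sw ∧
        ListOutcome E F D Z α β c.u c.v (A = ∅) fA (B = ∅) fB T
          (us.flatMap (group T₀ c A B)).length T' N wA wB sw ∧
        (∀ b ∈ insert c.v B, ∀ b' ∈ insert c.v B, (T₀ b : ℕ) < (T₀ b' : ℕ) →
          (T' b : ℕ) < (T' b' : ℕ)) ∧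
        (∀ q, (∀ a ∈ A, q ≤ (T₀ a : ℕ)) → ∀ w, (T₀ w : ℕ) < q → T' w = T₀ w) ∧
        (∀ w, (T₀ c.v : ℕ) < (T₀ w : ℕ) → T' w = T₀ w) ∧
        (∀ a ∈ A, ∀ b ∈ insert c.v B, (T' b : ℕ) < (T' a : ℕ)) := by
  have hg : 0 ≤ gap F c.u c.v := by
    have h1 := hS.sep _ hc.memD _ hc.memZ
    have h2 : ((F c.v : ℕ) : ℝ) ≤ ((F c.u : ℕ) : ℝ) := by exact_mod_cast h1.le
    unfold gap; linarith
  have hVZ : ∀ b ∈ insert c.v B, b ∈ Z := by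
    intro b hb
    rcases Finset.mem_insert.1 hb with h1 | h1
    · rw [h1]; exact hc.memZ
    · exact hS.closedZ _ _ hc.memZ (hB b h1).1
  intro us
  induction us with
  | nil =>
    intro T _ _ hM hord _ hlowq hhigh hdone
    exact ⟨T, 0, 0, 0, 0, Run.nil T, ListOutcome.refl hM.top, hord, hlowq, hhigh,
      fun a ha => (hdone a ha).resolve_left (by simp)⟩
  | cons u' us ih =>
    intro T husA husP hM hord hlow hlowq hhigh hdone
    rw [List.pairwise_cons] at husP
    simp only [List.forall_mem_cons] at husA hlow
    have hu'A := hA u' husA.1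
    have hu'D : u' ∈ D := hS.closedD _ _ hc.memD hu'A.1
    have hTu' : T u' = T₀ u' := hlow.1 u' le_rfl
    have hTu : T c.u = T₀ c.u := hlow.1 c.u hu'A.2.1.le
    have hne : u' ≠ c.u := fun e => by rw [e] at hu'A; omega
    have hAne : A ≠ ∅ := fun e => by rw [e] at husA; simp at husA
    have hbad := Finset.card_le_card hM.bad_subset
    set vs := (inOrder T₀ (insert c.v B)).filter fun v' => T₀ u' < T₀ v' with hvs
    have hmem : ∀ b, b ∈ vs ↔ b ∈ insert c.v B ∧ (T₀ u' : ℕ) < (T₀ b : ℕ) := fun b => by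
      rw [hvs, List.mem_filter, mem_inOrder, decide_eq_true_eq, Fin.lt_def]
    have hup : ∀ b, (T₀ u' : ℕ) < (T₀ b : ℕ) → (T u' : ℕ) < (T b : ℕ) := fun b hb => by
      have := le_of_fixes_below (T := T₀) (T' := T) (q := (T₀ u' : ℕ) + 1)
        (fun w hw => hlow.1 w (by omega)) (b := b) (by omega)
      rw [hTu']; omega
    have hle : ∀ b ∈ insert c.v B, (T₀ b : ℕ) ≤ (T₀ c.v : ℕ) := fun b hb => by
      rcases Finset.mem_insert.1 hb with h1 | h1
      · rw [h1]
      · exact (hB b h1).2.2.le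
    obtain ⟨T₁, N₁, wA₁, wB₁, sw₁, hrun, hL, hc1, hc2, hc3, hc4⟩ :=
      exists_run_group (u := c.u) (v := c.v) (eA := A = ∅) (fA := fA) (eB := B = ∅) (fB := fB)
        hS hW hg IH (u' := u') (mk := subcall c A B u') (fun v' => ⟨rfl, rfl⟩) hu'D
        (hS.top _ hu'A.1).le vs T hM.top
        (fun b hb => by
          have h1 := ((hmem b).1 hb).1
          refine ⟨hVZ b h1, ?_⟩
          rcases Finset.mem_insert.1 h1 with h2 | h2
          · rw [h2]
          · exact (hS.top _ (hB b h2).1).le)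
        (((pairwise_inOrder T₀ _).filter _).imp_of_mem (fun ha hb h =>
          hord _ ((hmem _).1 ha).1 _ ((hmem _).1 hb).1 h))
        (fun b hb => hup b ((hmem b).1 hb).2)
        (fun b hb => by
          have h1 := hM.left b (hVZ b ((hmem b).1 hb).1)
          have h2 := hle b ((hmem b).1 hb).1
          have h3 := ((hmem b).1 hb).2
          rw [hTu']; omega)
        (fun b hb e => by simp [subcall, hne] at e)
        (fun b hb e => by
          simp only [subcall, decide_eq_true_eq] at e
          rw [e.1]
          exact (heB e.2).mono hS hc.memZ hu'D hu'A.2.1.le hM)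
        (fun b hb e => absurd e hAne)
        (fun b hb e => by
          have h1 := ((hmem b).1 hb).1
          rw [e, Finset.insert_empty, Finset.mem_singleton] at h1
          simp [subcall, h1, e])
        -- In this block `u` lies below the range of every call, hence is not moved.
        (fun e => Or.inr (by rw [hTu, hTu']; exact hu'A.2.1))
        (fun b hb => by
          rcases Finset.mem_insert.1 ((hmem b).1 hb).1 with h2 | h2
          · exact Or.inl h2
          · exact Or.inr (hord b ((hmem b).1 hb).1 c.v (by simp) (hB b h2).2.2))
        -- A predecessor of `v` outside the list was not above `u'` at the start, and as an element
        -- of `Z` it has only moved to the left since.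
        (fun e w hw => by
          have hwZ := hS.closedZ _ _ hc.memZ hw
          have h1 := hM.left w hwZ
          by_cases h2 : (T₀ c.u : ℕ) < (T₀ w : ℕ)
          · by_cases h3 : (T₀ u' : ℕ) < (T₀ w : ℕ)
            · exact Or.inr ((hmem w).2 ⟨by simp [hfB e w hw h2], h3⟩)
            · left
              have h4 : w ≠ u' := fun h => absurd (hS.sep u' hu'D w hwZ) (by rw [h]; simp)
              have h5 : (T₀ w : ℕ) ≠ (T₀ u' : ℕ) := fun h =>
                h4 (T₀.injective (Fin.ext h))
              rw [hTu']; omega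
          · left
            rw [hTu']; have := hu'A.2.1; omega)
    have hM₁ := hM.trans hg hL.moves
    have hfixlow : ∀ w, (T₀ w : ℕ) < (T₀ u' : ℕ) → T₁ w = T₀ w := fun w hw => by
      have h1 := hlow.1 w hw.le
      rw [hc3 w (by rw [h1, hTu']; exact hw), h1]
    have hu'r := hM₁.right u' hu'D
    have hne' : ∀ b ∈ insert c.v B, (T₀ b : ℕ) ≠ (T₀ u' : ℕ) := fun b hb h => by
      have h4 : b = u' := T₀.injective (Fin.ext h)
      exact absurd (hS.sep u' hu'D b (hVZ b hb)) (by rw [h4]; simp)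
    have hinv : ∀ b ∈ insert c.v B, (T₁ b : ℕ) < (T₁ u' : ℕ) := fun b hb => by
      by_cases h1 : (T₀ u' : ℕ) < (T₀ b : ℕ)
      · exact hc1 b ((hmem b).2 ⟨hb, h1⟩)
      · have := hne' b hb
        have h2 := hfixlow b (by omega)
        rw [h2]; omega
    obtain ⟨T', N₂, wA₂, wB₂, sw₂, hrun₂, hL₂, hd1, hd2, hd3, hd4⟩ := ih T₁ husA.2 husP.2 hM₁
      (fun b hb b' hb' h => by
        -- Vertices that started above `u'` keep their relative order and stay at or above the old
        -- position of `u'`; those that started below it have not moved at all.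
        by_cases h1 : (T₀ u' : ℕ) < (T₀ b : ℕ)
        · exact hc2 b ((hmem b).2 ⟨hb, h1⟩) b' ((hmem b').2 ⟨hb', by omega⟩) (hord b hb b' hb' h)
        · have h2 := hne' b hb
          by_cases h3 : (T₀ u' : ℕ) < (T₀ b' : ℕ)
          · have h4 := le_of_fixes_below (T := T) (T' := T₁) hc3 (hup b' h3).le
            rw [hfixlow b (by omega)]
            rw [hTu'] at h4; omega
          · have := hne' b' hb'
            rw [hfixlow b (by omega), hfixlow b' (by omega)]; exact h)
      (fun a ha w hw => hfixlow w (by have := husP.1 a ha; omega))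
      (fun q hq w hw => hfixlow w (by have := hq u' husA.1; omega))
      (fun w hw => by
        rw [hc4 (T₀ c.v) (by rw [hTu']; exact hu'A.2.2.le) (fun b hb =>
          (hM.left b (hVZ b ((hmem b).1 hb).1)).trans (hle b ((hmem b).1 hb).1)) w
          (by rw [hhigh w hw]; exact hw), hhigh w hw])
      (fun a ha => by
        rcases hdone a ha with h1 | h1
        · rcases List.mem_cons.1 h1 with h2 | h2
          · right; rw [h2]; exact hinv
          · exact Or.inl h2
        · right
          intro b hb
          have h2 := h1 b hb
          have h3 := hL.moves.left b (hVZ b hb)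
          have h4 := hL.moves.right a (hS.closedD _ _ hc.memD (hA a ha).1)
          omega)
    refine ⟨T', N₁ + N₂, wA₁ + wA₂, wB₁ + wB₂, sw₁ + sw₂, ?_, ?_, hd1, hd2, hd3, hd4⟩
    · rw [List.flatMap_cons]
      exact hrun.append hrun₂
    · have := hL.trans hW.beta_nonneg hg hL₂
      rw [List.flatMap_cons, List.length_append]
      convert this using 2
      simp [group, hvs]

end Reordering

/-! ### The sets chosen by a call, and a single exchange -/

section Reordering

variable {n : ℕ}

theorem dist_of_le {T : Equiv.Perm (Fin n)} {u v : Fin n} (h : (T u : ℕ) ≤ (T v : ℕ)) :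
    dist T u v = (T v : ℕ) - (T u : ℕ) := by
  unfold dist Nat.dist; omega

/-- Properties of the set `A` of a call and of the price of finding it. -/
structure SideA (p : ℕ) (θ : ℕ → ℕ) (E : Finset (Fin n × Fin n)) (T : Equiv.Perm (Fin n))
    (c : Call n) (A : Finset (Fin n)) (s : ℕ) : Prop where
  mem : ∀ a ∈ A, (c.u, a) ∈ E ∧ (T c.u : ℕ) < (T a : ℕ) ∧ (T a : ℕ) < (T c.v : ℕ)
  noOut_iff : A = ∅ ↔ NoOut E T c.u c.v
  price : s = 0 ∨ (c.f₁ = false ∧ s ≤ (T c.v : ℕ) - (T c.u : ℕ) ∧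
    (∀ w, (c.u, w) ∈ E → (T w : ℕ) < (T c.v : ℕ) → w ∈ A) ∧
    ∃ l ≤ p, θ l < (T c.v : ℕ) - (T c.u : ℕ) ∧ (T c.v : ℕ) - (T c.u : ℕ) ≤ θ (l + 1) ∧
      ∀ a ∈ A, (T c.u : ℕ) + θ l < (T a : ℕ))

structure SideB (p : ℕ) (θ : ℕ → ℕ) (E : Finset (Fin n × Fin n)) (T : Equiv.Perm (Fin n))
    (c : Call n) (B : Finset (Fin n)) (s : ℕ) : Prop where
  mem : ∀ b ∈ B, (b, c.v) ∈ E ∧ (T c.u : ℕ) < (T b : ℕ) ∧ (T b : ℕ) < (T c.v : ℕ)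
  noIn_iff : B = ∅ ↔ NoIn E T c.u c.v
  price : s = 0 ∨ (c.f₂ = false ∧ s ≤ (T c.v : ℕ) - (T c.u : ℕ) ∧
    (∀ w, (w, c.v) ∈ E → (T c.u : ℕ) < (T w : ℕ) → w ∈ B) ∧
    ∃ l ≤ p, θ l < (T c.v : ℕ) - (T c.u : ℕ) ∧ (T c.v : ℕ) - (T c.u : ℕ) ≤ θ (l + 1) ∧
      ∀ b ∈ B, (T b : ℕ) + θ l < (T c.v : ℕ))

theorem mem_outNear {E : Finset (Fin n × Fin n)} {T : Equiv.Perm (Fin n)} {s : ℕ} {u v w : Fin n}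
    (hT : IsTopOrder E T) : w ∈ outNear E T s u v ↔
      (u, w) ∈ E ∧ (T w : ℕ) - (T u : ℕ) ≤ s ∧ (T w : ℕ) < (T v : ℕ) := by
  simp only [outNear, Finset.mem_filter, Finset.mem_univ, true_and, Fin.lt_def]
  refine and_congr_right fun h => ?_
  rw [dist_of_le (Fin.le_def.1 (hT _ h).le)]

theorem mem_inNear {E : Finset (Fin n × Fin n)} {T : Equiv.Perm (Fin n)} {s : ℕ} {u v w : Fin n}
    (hT : IsTopOrder E T) : w ∈ inNear E T s u v ↔
      (w, v) ∈ E ∧ (T v : ℕ) - (T w : ℕ) ≤ s ∧ (T u : ℕ) < (T w : ℕ) := by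
  simp only [inNear, Finset.mem_filter, Finset.mem_univ, true_and, Fin.lt_def]
  refine and_congr_right fun h => ?_
  rw [dist_of_le (Fin.le_def.1 (hT _ h).le)]

/-- The edge (u, v) has to be excluded: the set looks only strictly below `v`, whereas `NoOut` also
forbids `v` itself. -/
theorem outNear_eq_empty_iff {E : Finset (Fin n × Fin n)} {T : Equiv.Perm (Fin n)} {s : ℕ}
    {u v : Fin n} (hT : IsTopOrder E T) (huv : (u, v) ∉ E)
    (hs : (T v : ℕ) - (T u : ℕ) ≤ s) : outNear E T s u v = ∅ ↔ NoOut E T u v := by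
  constructor
  · intro h w hw
    by_contra hlt
    have h1 : (T w : ℕ) ≠ (T v : ℕ) := fun e => huv (by rwa [← T.injective (Fin.ext e)])
    have : w ∈ outNear E T s u v := (mem_outNear hT).2 ⟨hw, by omega, by omega⟩
    rw [h] at this; simp at this
  · intro h
    refine Finset.eq_empty_of_forall_notMem fun w hw => ?_
    rw [mem_outNear hT] at hw
    have := h w hw.1; omega

theorem inNear_eq_empty_iff {E : Finset (Fin n × Fin n)} {T : Equiv.Perm (Fin n)} {s : ℕ}
    {u v : Fin n} (hT : IsTopOrder E T) (huv : (u, v) ∉ E)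
    (hs : (T v : ℕ) - (T u : ℕ) ≤ s) : inNear E T s u v = ∅ ↔ NoIn E T u v := by
  constructor
  · intro h w hw
    by_contra hlt
    have h1 : (T w : ℕ) ≠ (T u : ℕ) := fun e => huv (by rwa [← T.injective (Fin.ext e)])
    have : w ∈ inNear E T s u v := (mem_inNear hT).2 ⟨hw, by omega, by omega⟩
    rw [h] at this; simp at this
  · intro h
    refine Finset.eq_empty_of_forall_notMem fun w hw => ?_
    rw [mem_inNear hT] at hw
    have := h w hw.1; omega

theorem outNear_mem {E : Finset (Fin n × Fin n)} {T : Equiv.Perm (Fin n)} {s : ℕ} {u v : Fin n}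
    (hT : IsTopOrder E T) : ∀ a ∈ outNear E T s u v,
      (u, a) ∈ E ∧ (T u : ℕ) < (T a : ℕ) ∧ (T a : ℕ) < (T v : ℕ) := fun a ha => by
  rw [mem_outNear hT] at ha
  exact ⟨ha.1, hT _ ha.1, ha.2.2⟩

theorem inNear_mem {E : Finset (Fin n × Fin n)} {T : Equiv.Perm (Fin n)} {s : ℕ} {u v : Fin n}
    (hT : IsTopOrder E T) : ∀ b ∈ inNear E T s u v,
      (b, v) ∈ E ∧ (T u : ℕ) < (T b : ℕ) ∧ (T b : ℕ) < (T v : ℕ) := fun b hb => by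
  rw [mem_inNear hT] at hb
  exact ⟨hb.1, hb.2.2, hT _ hb.1⟩

/-- The level is one less than the first index whose threshold reaches the distance; it exists
because distances are smaller than `n`, and monotonicity of the thresholds plays no role. With a set
flag the wide search is skipped, and the empty near set is still the right answer, since `Valid`
guarantees that there is no neighbour in between. -/
theorem exists_picks {E : Finset (Fin n × Fin n)} {D Z : Finset (Fin n)} {p : ℕ} {θ : ℕ → ℕ}
    (hθ : n ≤ θ (p + 1)) {T : Equiv.Perm (Fin n)} {c : Call n} (hc : Valid E D Z T c)
    (huv : (c.u, c.v) ∉ E) :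
    ∃ A B sa sb, Picks p θ E T c A B sa sb ∧ SideA p θ E T c A sa ∧ SideB p θ E T c B sb := by
  have hT := hc.top
  have hd : dist T c.u c.v = (T c.v : ℕ) - (T c.u : ℕ) := dist_of_le hc.lt.le
  by_cases h0 : dist T c.u c.v ≤ θ 0
  · refine ⟨_, _, 0, 0, Or.inl ⟨h0, rfl, rfl, rfl, rfl⟩, ⟨outNear_mem hT, ?_, Or.inl rfl⟩,
      ⟨inNear_mem hT, ?_, Or.inl rfl⟩⟩
    · exact outNear_eq_empty_iff hT huv (by omega)
    · exact inNear_eq_empty_iff hT huv (by omega)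
  · have hex : ∃ j, dist T c.u c.v ≤ θ j := ⟨p + 1, by have := (T c.v).2; omega⟩
    obtain ⟨i, hi⟩ : ∃ i, Nat.find hex = i + 1 := by
      refine Nat.exists_eq_succ_of_ne_zero fun h => h0 ?_
      have := Nat.find_spec hex
      rwa [h] at this
    have hip : i ≤ p := by
      have := Nat.find_min' hex (m := p + 1) (by have := (T c.v).2; omega)
      omega
    have hlow : ∀ j ≤ i, θ j < dist T c.u c.v := fun j hj => by
      have := Nat.find_min hex (m := j) (by omega)
      omega
    have hup : dist T c.u c.v ≤ θ (i + 1) := hi ▸ Nat.find_spec hex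
    have hl := hlow i le_rfl
    have HA : ∃ A sa, PicksSide (outNear E T (θ i) c.u c.v) (outNear E T (θ (i + 1)) c.u c.v) c.f₁
      (dist T c.u c.v) A sa ∧ SideA p θ E T c A sa := by
      by_cases h : outNear E T (θ i) c.u c.v ≠ ∅ ∨ c.f₁ = true
      · refine ⟨_, 0, Or.inl ⟨h, rfl, rfl⟩, outNear_mem hT, ⟨fun e => ?_, fun e => ?_⟩, Or.inl rfl⟩
        · exact hc.flag₁ (h.resolve_left fun h' => h' e)
        · exact Finset.eq_empty_of_forall_notMem fun w hw => by
            rw [mem_outNear hT] at hw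
            have := e w hw.1; omega
      · push Not at h
        have hf : c.f₁ = false := by simpa using h.2
        refine ⟨_, _, Or.inr ⟨h.1, hf, rfl, rfl⟩, outNear_mem hT,
          outNear_eq_empty_iff hT huv (by omega), Or.inr ⟨hf, hd.le, fun w hw hlt => ?_,
          i, hip, by omega, by omega, fun a ha => ?_⟩⟩
        · exact (mem_outNear hT).2 ⟨hw, by omega, hlt⟩
        · by_contra hlt
          have h1 := (mem_outNear hT).1 ha
          have : a ∈ outNear E T (θ i) c.u c.v := (mem_outNear hT).2 ⟨h1.1, by omega, h1.2.2⟩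
          rw [h.1] at this; simp at this
    have HB : ∃ B sb, PicksSide (inNear E T (θ i) c.u c.v) (inNear E T (θ (i + 1)) c.u c.v) c.f₂
      (dist T c.u c.v) B sb ∧ SideB p θ E T c B sb := by
      by_cases h : inNear E T (θ i) c.u c.v ≠ ∅ ∨ c.f₂ = true
      · refine ⟨_, 0, Or.inl ⟨h, rfl, rfl⟩, inNear_mem hT, ⟨fun e => ?_, fun e => ?_⟩, Or.inl rfl⟩
        · exact hc.flag₂ (h.resolve_left fun h' => h' e)
        · exact Finset.eq_empty_of_forall_notMem fun w hw => by
            rw [mem_inNear hT] at hw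
            have := e w hw.1; omega
      · push Not at h
        have hf : c.f₂ = false := by simpa using h.2
        refine ⟨_, _, Or.inr ⟨h.1, hf, rfl, rfl⟩, inNear_mem hT,
          inNear_eq_empty_iff hT huv (by omega), Or.inr ⟨hf, hd.le, fun w hw hlt => ?_,
          i, hip, by omega, by omega, fun a ha => ?_⟩⟩
        · exact (mem_inNear hT).2 ⟨hw, by omega, hlt⟩
        · by_contra hlt
          have h1 := (mem_inNear hT).1 ha
          have : a ∈ inNear E T (θ i) c.u c.v := (mem_inNear hT).2 ⟨h1.1, by omega, h1.2.2⟩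
          rw [h.1] at this; simp at this
    obtain ⟨A, sa, hA, hA'⟩ := HA
    obtain ⟨B, sb, hB, hB'⟩ := HB
    exact ⟨A, B, sa, sb, Or.inr ⟨i, hip, hlow, hup, hA, hB⟩, hA', hB'⟩

/-- Only the terms of `u` and `v` change. The product form, distance times gap, is why the
correlation can pay for displacements: far moves of pairs that are far apart in `F` are rare. -/
theorem corr_swap (F T : Equiv.Perm (Fin n)) {u v : Fin n} (huv : u ≠ v) :
    corr F (T * Equiv.swap u v) - corr F T =
      (((T v : ℕ) : ℝ) - ((T u : ℕ) : ℝ)) * gap F u v := by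
  have hv : v ∈ Finset.univ.erase u := by simp [huv.symm]
  unfold corr
  rw [← Finset.sum_sub_distrib, ← Finset.add_sum_erase _ _ (Finset.mem_univ u),
    ← Finset.add_sum_erase _ _ hv, Finset.sum_eq_zero]
  · simp [gap]; ring
  · intro w hw
    simp only [Finset.mem_erase, Finset.mem_univ, and_true] at hw
    simp [Equiv.swap_apply_of_ne_of_ne hw.2 hw.1]

/-- Exchanging two vertices with nothing to be moved between them. -/
theorem moves_swap {E : Finset (Fin n × Fin n)} {F : Equiv.Perm (Fin n)} {D Z : Finset (Fin n)}
    (hS : Separated E F D Z) {T : Equiv.Perm (Fin n)} {c : Call n} (hc : Valid E D Z T c)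
    (hA : NoOut E T c.u c.v) (hB : NoIn E T c.u c.v) :
    Moves E F D Z (gap F c.u c.v) T (T * Equiv.swap c.u c.v) := by
  have hsep := hS.sep _ hc.memD _ hc.memZ
  have hne : c.u ≠ c.v := fun e => by rw [e] at hsep; simp at hsep
  have hlt := hc.lt
  have hval : ∀ w, (w = c.u ∧ (T * Equiv.swap c.u c.v) w = T c.v) ∨
      (w = c.v ∧ (T * Equiv.swap c.u c.v) w = T c.u) ∨
      (w ≠ c.u ∧ w ≠ c.v ∧ (T * Equiv.swap c.u c.v) w = T w) := fun w => by
    by_cases h1 : w = c.u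
    · left; simp [h1]
    · by_cases h2 : w = c.v
      · right; left; simp [h2]
      · right; right
        exact ⟨h1, h2, by simp [Equiv.swap_apply_of_ne_of_ne h1 h2]⟩
  have hZu : c.u ∉ Z := fun h => by have := hS.sep _ hc.memD _ h; simp at this
  have hDv : c.v ∉ D := fun h => by have := hS.sep _ h _ hc.memZ; simp at this
  refine ⟨?_, ?_, ?_, ?_⟩
  · rintro ⟨x, y⟩ hxy
    have hT : (T x : ℕ) < (T y : ℕ) := hc.top _ hxy
    show ((T * Equiv.swap c.u c.v) x : ℕ) < ((T * Equiv.swap c.u c.v) y : ℕ)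
    rcases hval x with ⟨h1, h2⟩ | ⟨h1, h2⟩ | ⟨h1, h1', h2⟩ <;>
      rcases hval y with ⟨h3, h4⟩ | ⟨h3, h4⟩ | ⟨h3, h3', h4⟩ <;> rw [h2, h4]
    · rw [h1, h3] at hT; omega
    · rw [h1, h3] at hxy
      have := hA _ hxy; omega
    · rw [h1] at hxy
      exact hA _ hxy
    · rw [h1, h3] at hT; omega
    · rw [h1, h3] at hT; omega
    · rw [h1] at hT; omega
    · rw [h3] at hT; omega
    · rw [h3] at hxy
      exact hB _ hxy
    · exact hT
  · intro a ha
    rcases hval a with ⟨h1, h2⟩ | ⟨h1, h2⟩ | ⟨h1, h1', h2⟩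
    · rw [h2, h1]; omega
    · exact absurd (h1 ▸ ha) hDv
    · rw [h2]
  · intro b hb
    rcases hval b with ⟨h1, h2⟩ | ⟨h1, h2⟩ | ⟨h1, h1', h2⟩
    · exact absurd (h1 ▸ hb) hZu
    · rw [h2, h1]; omega
    · rw [h2]
  · intro w
    rw [corr_swap F T hne]
    have hlt' : ((T c.u : ℕ) : ℝ) < ((T c.v : ℕ) : ℝ) := by exact_mod_cast hlt
    have hg : 0 ≤ gap F c.u c.v := by
      have h2 : ((F c.v : ℕ) : ℝ) ≤ ((F c.u : ℕ) : ℝ) := by exact_mod_cast hsep.le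
      unfold gap; linarith
    rw [mul_comm]
    refine mul_le_mul_of_nonneg_right ?_ hg
    rcases hval w with ⟨h1, h2⟩ | ⟨h1, h2⟩ | ⟨h1, h1', h2⟩
    · rw [h2, h1, abs_of_nonneg (by linarith)]
    · rw [h2, h1, abs_of_nonpos (by linarith)]; linarith
    · rw [h2, sub_self, abs_zero]; linarith

end Reordering

/-! ### The recursion: termination, correctness and amortized cost of a call -/

section Reordering

variable {n : ℕ}

/-- Two vertices that pass each other are displaced by at least their distance in total. -/
theorem Moves.phi_le_dist {E : Finset (Fin n × Fin n)} {F : Equiv.Perm (Fin n)}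
    {D Z : Finset (Fin n)} {g : ℝ} {T T' : Equiv.Perm (Fin n)} {p : ℕ} {θ : ℕ → ℕ}
    {α : Fin n × Fin n → ℝ} {β : ℝ} (hW : Weights p θ F α β) (hg : 0 ≤ g)
    (h : Moves E F D Z g T T') {u v : Fin n} (hu : u ∈ D) (hv : v ∈ Z) (h1 : T u < T v)
    (h2 : T' v < T' u) :
    α (u, v) + β / 2 * (g * (((T v : ℕ) : ℝ) - ((T u : ℕ) : ℝ))) ≤
      phi F D Z α β T' - phi F D Z α β T := by
  have h3 := h.phi_le_of_inverted hW hu hv h1 h2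
  have h4 : ((T' v : ℕ) : ℝ) ≤ ((T' u : ℕ) : ℝ) := by exact_mod_cast h2.le
  have h5 := le_abs_self (((T' u : ℕ) : ℝ) - ((T u : ℕ) : ℝ))
  have h6 := neg_abs_le (((T' v : ℕ) : ℝ) - ((T v : ℕ) : ℝ))
  have h7 : (((T v : ℕ) : ℝ) - ((T u : ℕ) : ℝ)) ≤ |((T' u : ℕ) : ℝ) - ((T u : ℕ) : ℝ)| +
    |((T' v : ℕ) : ℝ) - ((T v : ℕ) : ℝ)| := by linarith
  have h8 := mul_le_mul_of_nonneg_left (mul_le_mul_of_nonneg_left h7 hg)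
    (div_nonneg hW.beta_nonneg (zero_le_two))
  linarith

/-- The price of a wide search on level `l` is paid by the inversion of a pair at distance more
than `θ l`. -/
theorem Weights.price_le {p : ℕ} {θ : ℕ → ℕ} {F : Equiv.Perm (Fin n)} {α : Fin n × Fin n → ℝ}
    {β : ℝ} (hW : Weights p θ F α β) {u v : Fin n} (hF : F v < F u) {l s d : ℕ} {x : ℝ}
    (hl : l ≤ p) (hs : s ≤ d) (hd : d ≤ θ (l + 1)) (hx : (θ l : ℝ) ≤ x) :
    (s : ℝ) ≤ α (u, v) + β / 2 * (gap F u v * x) := by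
  have h1 := hW.level l hl u v hF
  have h2 : (s : ℝ) ≤ (θ (l + 1) : ℝ) := by exact_mod_cast hs.trans hd
  have hg : 0 ≤ gap F u v := by
    have h2 : ((F v : ℕ) : ℝ) ≤ ((F u : ℕ) : ℝ) := by exact_mod_cast hF.le
    unfold gap; linarith
  have h3 := mul_le_mul_of_nonneg_left (mul_le_mul_of_nonneg_left hx hg)
    (div_nonneg hW.beta_nonneg (zero_le_two))
  linarith

/-- Induction on the distance of the end points plus the number of bad pairs. Subcalls before the
last act on a shorter interval; the last has the same end points but fewer bad pairs.

The count allows 4 per bad pair with a reserve of 3 per call. An exchange uses 1 + 3. A call with r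
≥ 2 subcalls adds 1 + r and needs its own reserve of 3, while its subcalls leave 3 r, and 1 + r + 3
≤ 3 r.

For wide searches on the side of `u`, let Δ be the growth of `phi`. Without out-neighbours of `u` in
between, all subcalls start at `u` with the flag set, so only the search of the call itself counts,
and the inversion of (u, v) pays for it. Otherwise the subcalls are within 2 Δ, and a wide search of
the call is paid from what the second and third block of subcalls, which meet no out-neighbours of
`u`, leave unused. -/
theorem exists_run_call {E : Finset (Fin n × Fin n)} {F : Equiv.Perm (Fin n)}
    {D Z : Finset (Fin n)} {α : Fin n × Fin n → ℝ} {β : ℝ} {p : ℕ} {θ : ℕ → ℕ}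
    (hS : Separated E F D Z) (hW : Weights p θ F α β) (hθ : n ≤ θ (p + 1)) :
    ∀ T c, Valid E D Z T c → ∃ T' N wA wB sw, Run p θ E T [c] T' N wA wB sw ∧
      Outcome E F D Z α β T c T' N wA wB sw := by
  intro T c hc
  induction hm : (T c.v : ℕ) - (T c.u : ℕ) + (bad D Z T).card using Nat.strong_induction_on
    generalizing T c with
  | _ m IH₀ =>
  have IH : ∀ T' c', Valid E D Z T' c' → (T' c'.v : ℕ) - (T' c'.u : ℕ) + (bad D Z T').card <
      (T c.v : ℕ) - (T c.u : ℕ) + (bad D Z T).card → ∃ T'' N wA wB sw,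
      Run p θ E T' [c'] T'' N wA wB sw ∧ Outcome E F D Z α β T' c' T'' N wA wB sw :=
    fun T' c' h1 h2 => IH₀ _ (by omega) T' c' h1 rfl
  clear IH₀ hm
  have hsep := hS.sep _ hc.memD _ hc.memZ
  have hne : c.u ≠ c.v := fun e => by rw [e] at hsep; simp at hsep
  have huv : (c.u, c.v) ∉ E := fun h => absurd (hS.top _ h) (not_lt.2 hsep.le)
  have hlt := hc.lt
  have hlt' : T c.u < T c.v := hc.lt
  have hltR : ((T c.u : ℕ) : ℝ) < ((T c.v : ℕ) : ℝ) := by exact_mod_cast hlt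
  have hg : 0 ≤ gap F c.u c.v := by
    have h2 : ((F c.v : ℕ) : ℝ) ≤ ((F c.u : ℕ) : ℝ) := by exact_mod_cast hsep.le
    unfold gap; linarith
  have hβ := hW.beta_nonneg
  have hd : dist T c.u c.v = (T c.v : ℕ) - (T c.u : ℕ) := dist_of_le hlt.le
  have hdR : ((((T c.v : ℕ) - (T c.u : ℕ) : ℕ) : ℕ) : ℝ) =
    ((T c.v : ℕ) : ℝ) - ((T c.u : ℕ) : ℝ) := Nat.cast_sub hlt.le
  obtain ⟨A, B, sa, sb, hP, hA, hB⟩ := exists_picks hθ hc huv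
  by_cases hempty : A = ∅ ∧ B = ∅
  · obtain ⟨rfl, rfl⟩ := hempty
    have hM := moves_swap hS hc (hA.noOut_iff.1 rfl) (hB.noIn_iff.1 rfl)
    have hu : (T * Equiv.swap c.u c.v) c.u = T c.v := by simp
    have hv : (T * Equiv.swap c.u c.v) c.v = T c.u := by simp
    have hinv : (T * Equiv.swap c.u c.v) c.v < (T * Equiv.swap c.u c.v) c.u := by
      rw [hu, hv]; exact hc.lt
    have hphi := hM.phi_le_dist hW hg hc.memD hc.memZ hc.lt hinv
    have hsa : (sa : ℝ) ≤ phi F D Z α β (T * Equiv.swap c.u c.v) - phi F D Z α β T := by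
      rcases hA.price with h1 | ⟨_, h2, _, l, hl, h3, h4, _⟩
      · rw [h1]
        have := hW.nonneg (c.u, c.v)
        have : 0 ≤ β / 2 * (gap F c.u c.v * (((T c.v : ℕ) : ℝ) - ((T c.u : ℕ) : ℝ))) := by
          have : 0 ≤ ((T c.v : ℕ) : ℝ) - ((T c.u : ℕ) : ℝ) := by linarith
          positivity
        push_cast; linarith
      · refine (hW.price_le hsep hl h2 h4 ?_).trans hphi
        rw [← hdR]; exact_mod_cast h3.le
    have hsb : (sb : ℝ) ≤ phi F D Z α β (T * Equiv.swap c.u c.v) - phi F D Z α β T := by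
      rcases hB.price with h1 | ⟨_, h2, _, l, hl, h3, h4, _⟩
      · rw [h1]
        have := hW.nonneg (c.u, c.v)
        have : 0 ≤ β / 2 * (gap F c.u c.v * (((T c.v : ℕ) : ℝ) - ((T c.u : ℕ) : ℝ))) := by
          have : 0 ≤ ((T c.v : ℕ) : ℝ) - ((T c.u : ℕ) : ℝ) := by linarith
          positivity
        push_cast; linarith
      · refine (hW.price_le hsep hl h2 h4 ?_).trans hphi
        rw [← hdR]; exact_mod_cast h3.le
    have hpos : 0 ≤ phi F D Z α β (T * Equiv.swap c.u c.v) - phi F D Z α β T :=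
      le_trans (Nat.cast_nonneg _) hsa
    have hrun := Run.swap hc.top hlt' hP (Run.nil _)
    rw [add_zero, add_zero, add_zero, add_zero] at hrun
    refine ⟨_, _, _, _, _, hrun, hM, hinv, ?_, ?_, by linarith, fun _ => hsa, ?_, by linarith,
      fun _ => hsb, ?_, ?_⟩
    · intro w hw
      have h1 : w ≠ c.u := by rintro rfl; omega
      have h2 : w ≠ c.v := by rintro rfl; omega
      simp [Equiv.swap_apply_of_ne_of_ne h1 h2]
    · have : (bad D Z (T * Equiv.swap c.u c.v)).card < (bad D Z T).card := by
        refine Finset.card_lt_card (Finset.ssubset_iff_subset_ne.2 ⟨hM.bad_subset, fun e => ?_⟩)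
        have h1 : (c.u, c.v) ∈ bad D Z T := mem_bad.2 ⟨⟨hc.memD, hc.memZ⟩, hlt'⟩
        rw [← e] at h1
        exact absurd (mem_bad.1 h1).2 (not_lt.2 hinv.le)
      omega
    · intro h
      rcases hA.price with h1 | ⟨h1, _⟩
      · exact h1
      · rw [h1] at h; simp at h
    · intro h
      rcases hB.price with h1 | ⟨h1, _⟩
      · exact h1
      · rw [h1] at h; simp at h
    -- An exchange within `θ 0` is paid by the base weight of its pair, a longer one in the same way
    -- as a wide search on its level.
    · rw [hd]
      rcases hP with ⟨h1, _⟩ | ⟨i, hi, h1, h2, _⟩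
      · have h3 := hW.base (c.u, c.v)
        have h4 : ((((T c.v : ℕ) - (T c.u : ℕ) : ℕ) : ℕ) : ℝ) ≤ (θ 0 : ℝ) := by
          rw [hd] at h1; exact_mod_cast h1
        have : 0 ≤ β / 2 * (gap F c.u c.v * (((T c.v : ℕ) : ℝ) - ((T c.u : ℕ) : ℝ))) := by
          have : 0 ≤ ((T c.v : ℕ) : ℝ) - ((T c.u : ℕ) : ℝ) := by linarith
          positivity
        linarith
      · refine (hW.price_le hsep hi (hd ▸ le_rfl) h2 ?_).trans hphi
        have := h1 i le_rfl
        rw [← hdR]; rw [hd] at this; exact_mod_cast this.le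
  -- `fA` and `fB` hold after a wide search on the respective side. Only then does the call need the
  -- displacement of its end point as payment, and only then is it known that later subcalls meet no
  -- neighbour.
  · set fA : Prop := ∀ w, (c.u, w) ∈ E → (T w : ℕ) < (T c.v : ℕ) → w ∈ A with hfA
    set fB : Prop := ∀ w, (w, c.v) ∈ E → (T c.u : ℕ) < (T w : ℕ) → w ∈ B with hfB
    have hMT : Moves E F D Z (gap F c.u c.v) T T := Moves.refl hc.top
    obtain ⟨T₁, N₁, wA₁, wB₁, sw₁, hrun₁, hL₁, hord, hlowq, hhigh, hdone⟩ :=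
      exists_run_groups (fA := fA) (fB := fB) hS hW hc IH hA.mem hB.mem hB.noIn_iff.1 (fun e => e)
        (inOrder T A).reverse T (fun a ha => by simpa [mem_inOrder] using ha)
        (by rw [List.pairwise_reverse]; exact pairwise_inOrder T A) hMT
        (fun _ _ _ _ h => h) (fun _ _ _ _ => rfl) (fun _ _ _ _ => rfl) (fun _ _ => rfl)
        (fun a ha => Or.inl (by simpa [mem_inOrder] using ha))
    have hM₁ := hL₁.moves
    have hVZ : ∀ b ∈ insert c.v B, b ∈ Z := by
      intro b hb
      rcases Finset.mem_insert.1 hb with h1 | h1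
      · rw [h1]; exact hc.memZ
      · exact hS.closedZ _ _ hc.memZ (hB.mem b h1).1
    have hle : ∀ b ∈ insert c.v B, (T b : ℕ) ≤ (T c.v : ℕ) := fun b hb => by
      rcases Finset.mem_insert.1 hb with h1 | h1
      · rw [h1]
      · exact (hB.mem b h1).2.2.le
    have hgt : ∀ b ∈ insert c.v B, (T c.u : ℕ) < (T b : ℕ) := fun b hb => by
      rcases Finset.mem_insert.1 hb with h1 | h1
      · rw [h1]; exact hlt
      · exact (hB.mem b h1).2.1
    have hfix₁ : ∀ w, (T w : ℕ) ≤ (T c.u : ℕ) → T₁ w = T w := fun w hw =>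
      hlowq ((T c.u : ℕ) + 1) (fun a ha => (hA.mem a ha).2.1) w (by omega)
    have hu₁ : T₁ c.u = T c.u := hfix₁ _ le_rfl
    have hgt₁ : ∀ b ∈ insert c.v B, (T₁ c.u : ℕ) < (T₁ b : ℕ) := fun b hb => by
      have := le_of_fixes_below (T := T) (T' := T₁) (q := (T c.u : ℕ) + 1)
        (fun w hw => hfix₁ w (by omega)) (b := b) (hgt b hb)
      rw [hu₁]; omega
    have hno₁ : fA → ∀ b ∈ insert c.v B, NoOut E T₁ c.u b := fun hf b hb w hw => by
      by_cases h1 : (T w : ℕ) < (T c.v : ℕ)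
      · exact hdone w (hf w hw h1) b hb
      · have h2 : (T w : ℕ) ≠ (T c.v : ℕ) := fun e => huv (by rwa [← T.injective (Fin.ext e)])
        have h3 := hM₁.left b (hVZ b hb)
        have h4 := hM₁.right w (hS.closedD _ _ hc.memD hw)
        have h5 := hle b hb
        omega
    have hbad₁ := Finset.card_le_card hM₁.bad_subset
    obtain ⟨T₂, N₂, wA₂, wB₂, sw₂, hrun₂, hL₂, hc1, hc2, hc3, hc4⟩ :=
      exists_run_group (u := c.u) (v := c.v) (eA := A = ∅) (fA := fA) (eB := B = ∅) (fB := fB)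
        hS hW hg IH (u' := c.u) (mk := subcall c A B c.u) (fun v' => ⟨rfl, rfl⟩) hc.memD
        le_rfl (inOrder T B) T₁ hM₁.top
        (fun b hb => ⟨hVZ b (by simp [mem_inOrder.1 hb]),
          (hS.top _ (hB.mem b (mem_inOrder.1 hb)).1).le⟩)
        ((pairwise_inOrder T B).imp_of_mem (fun ha hb h =>
          hord _ (by simp [mem_inOrder.1 ha]) _ (by simp [mem_inOrder.1 hb]) h))
        (fun b hb => hgt₁ b (by simp [mem_inOrder.1 hb]))
        (fun b hb => by
          have h0 : b ∈ insert c.v B := by simp [mem_inOrder.1 hb]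
          have h1 := hM₁.left b (hVZ b h0)
          have h3 := (hB.mem b (mem_inOrder.1 hb)).2
          rw [hu₁]; omega)
        (fun b hb e => by
          simp only [subcall, decide_eq_true_eq, true_and] at e
          have h0 : b ∈ insert c.v B := by simp [mem_inOrder.1 hb]
          exact (hA.noOut_iff.1 e).mono hS hc.memD (hVZ b h0) (hle b h0) hM₁)
        (fun b hb e => by
          simp only [subcall, decide_eq_true_eq] at e
          have := mem_inOrder.1 hb
          rw [e.2] at this; simp at this)
        (fun b hb e => by simp [subcall, e])
        (fun b hb e => by
          have := mem_inOrder.1 hb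
          rw [e] at this; simp at this)
        (fun e => Or.inl ⟨rfl, fun b hb => hno₁ e b (by simp [mem_inOrder.1 hb])⟩)
        (fun b hb => Or.inr (hord b (by simp [mem_inOrder.1 hb]) c.v (by simp)
          (hB.mem b (mem_inOrder.1 hb)).2.2))
        (fun e w hw => by
          by_cases h2 : (T c.u : ℕ) < (T w : ℕ)
          · exact Or.inr (mem_inOrder.2 (e w hw h2))
          · left
            have h1 := hM₁.left w (hS.closedZ _ _ hc.memZ hw)
            have h5 : (T w : ℕ) ≠ (T c.u : ℕ) := fun h =>
              huv (by rwa [← T.injective (Fin.ext h)])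
            rw [hu₁]; omega)
    have hL := hL₁.trans hβ hg hL₂
    set k := ((inOrder T A).reverse.flatMap (group T c A B)).length + (inOrder T B).length with hk
    have hlen : (subcalls T c A B).length = k + 1 := by
      rw [subcalls_eq (fun a ha => (hA.mem a ha).2.1) (fun b hb => (hB.mem b hb).2.2)
        (fun b hb => (hB.mem b hb).2.1) hlt]
      rw [hk, List.length_append, List.length_append, List.length_map, List.length_singleton]
    -- An element a of `A` gives an earlier subcall (a, v), an element b of `B` a subcall (u, b). It
    -- inverts a bad pair, which makes the final call on (u, v) smaller than the present one and
    -- closes the count.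
    have hk1 : 1 ≤ k := by
      by_contra hk0
      have h1 : inOrder T B = [] := List.length_eq_zero_iff.1 (by omega)
      have h2 : (inOrder T A).reverse.flatMap (group T c A B) = [] :=
        List.length_eq_zero_iff.1 (by omega)
      refine hempty ⟨Finset.eq_empty_of_forall_notMem fun a ha => ?_,
        Finset.eq_empty_of_forall_notMem fun b hb => ?_⟩
      · rw [List.flatMap_eq_nil_iff] at h2
        have h3 := h2 a (by simpa [mem_inOrder] using ha)
        have h4 : c.v ∈ (inOrder T (insert c.v B)).filter fun v' => T a < T v' := by
          simp only [List.mem_filter, mem_inOrder, Finset.mem_insert, true_or, true_and]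
          exact decide_eq_true (hA.mem a ha).2.2
        rw [group, List.map_eq_nil_iff] at h3
        rw [h3] at h4; simp at h4
      · have := mem_inOrder (T := T).2 hb
        rw [h1] at this; simp at this
    have hM₂ := hL.moves
    have hv₂ : T₂ c.v = T₁ c.v := by
      refine hc4 ((T₁ c.v : ℕ) - 1) ?_ (fun b hb => ?_) c.v ?_
      · have := hgt₁ c.v (by simp); omega
      · have := hord b (by simp [mem_inOrder.1 hb]) c.v (by simp)
          (hB.mem b (mem_inOrder.1 hb)).2.2
        omega
      · have := hgt₁ c.v (by simp); omega
    have hq : ∀ q, (T c.u : ℕ) ≤ q → (∀ b ∈ B, (T₁ b : ℕ) ≤ q) → (T₂ c.u : ℕ) ≤ q :=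
      fun q h1 h2 => le_of_fixes_above (T := T₁) (T' := T₂)
        (hc4 q (by rw [hu₁]; exact h1) fun b hb => h2 b (mem_inOrder.1 hb)) (by rw [hu₁]; exact h1)
    have hlt₂ : (T₂ c.u : ℕ) < (T₂ c.v : ℕ) := by
      have h0 := hgt₁ c.v (by simp)
      have := hq ((T₁ c.v : ℕ) - 1) (by rw [hu₁] at h0; omega) (fun b hb => by
        have := hord b (by simp [hb]) c.v (by simp) (hB.mem b hb).2.2
        omega)
      rw [hv₂]; omega
    have hbad₂ : (bad D Z T₂).card < (bad D Z T).card := by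
      have := hL.count
      omega
    have hur := hM₂.right _ hc.memD
    have hvl := hM₂.left _ hc.memZ
    have hval : Valid E D Z T₂ (subcall c A B c.u c.v) := by
      refine ⟨hM₂.top, hc.memD, hc.memZ, hlt₂, fun e => ?_, fun e => ?_⟩
      · simp only [subcall, decide_eq_true_eq, true_and] at e
        exact (hA.noOut_iff.1 e).mono hS hc.memD hc.memZ le_rfl hM₂
      · simp only [subcall, decide_eq_true_eq, true_and] at e
        exact (hB.noIn_iff.1 e).mono hS hc.memZ hc.memD le_rfl hM₂
    obtain ⟨T', N₃, wA₃, wB₃, sw₃, hrun₃, hO⟩ := IH T₂ _ hval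
      (by show (T₂ c.v : ℕ) - (T₂ c.u : ℕ) + _ < _; omega)
    have hrun := Run.recurse hc.top hlt' hP hempty
      (by
        rw [subcalls_eq (fun a ha => (hA.mem a ha).2.1) (fun b hb => (hB.mem b hb).2.2)
          (fun b hb => (hB.mem b hb).2.1) hlt]
        exact (hrun₁.append hrun₂).append hrun₃)
      (Run.nil T')
    have hM₃ : Moves E F D Z (gap F c.u c.v) T₂ T' := hO.moves
    have hM := hM₂.trans hg hM₃
    have hinv : (T' c.v : ℕ) < (T' c.u : ℕ) := hO.inverted
    have hphi := hM.phi_le_dist hW hg hc.memD hc.memZ hlt' hinv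
    have hphi₃ := hM₃.phi_le_of_inverted hW hc.memD hc.memZ (Fin.lt_def.2 hlt₂) (Fin.lt_def.2 hinv)
    have hno₂ : fA → NoOut E T₂ c.u c.v := fun hf =>
      (hno₁ hf c.v (by simp)).mono hS hc.memD hc.memZ le_rfl hL₂.moves
    have hni₂ : fB → NoIn E T₂ c.u c.v := fun hf w hw => by
      by_cases h2 : (T c.u : ℕ) < (T w : ℕ)
      · exact hc1 w (mem_inOrder.2 (hf w hw h2))
      · have h1 := hM₂.left w (hS.closedZ _ _ hc.memZ hw)
        have h5 : (T w : ℕ) ≠ (T c.u : ℕ) := fun h =>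
          huv (by rwa [← T.injective (Fin.ext h)])
        omega
    have hpos : 0 ≤ phi F D Z α β T' - phi F D Z α β T := by
      have := hM.phi_le hW c.u
      have : 0 ≤ β * (gap F c.u c.v * |((T' c.u : ℕ) : ℝ) - ((T c.u : ℕ) : ℝ)|) := by positivity
      linarith
    have hvu' : ((T' c.v : ℕ) : ℝ) ≤ ((T' c.u : ℕ) : ℝ) := by exact_mod_cast hinv.le
    have habs : ∀ x : ℝ, x ≤ |x| := le_abs_self
    have habs' : ∀ x : ℝ, -x ≤ |x| := neg_le_abs
    -- the case without wide search out-neighbours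
    have hA1 : NoOut E T c.u c.v →
        ((sa + (wA₁ + wA₂ + wA₃) : ℕ) : ℝ) ≤ phi F D Z α β T' - phi F D Z α β T := by
      intro hno
      have hAe := hA.noOut_iff.2 hno
      have h1 : wA₁ + wA₂ = 0 := hL.wideA_zero hAe
      have h2 : wA₃ = 0 := hO.wideA_of_flag (by simp [subcall, hAe])
      rw [h1, h2]
      rcases hA.price with h1 | ⟨_, h2, _, l, hl, h3, h4, _⟩
      · rw [h1]; simpa using hpos
      · refine le_trans ?_ ((hW.price_le hsep hl h2 h4 ?_).trans hphi)
        · simp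
        · rw [← hdR]; exact_mod_cast h3.le
    have hB1 : NoIn E T c.u c.v →
        ((sb + (wB₁ + wB₂ + wB₃) : ℕ) : ℝ) ≤ phi F D Z α β T' - phi F D Z α β T := by
      intro hno
      have hBe := hB.noIn_iff.2 hno
      have h1 : wB₁ + wB₂ = 0 := hL.wideB_zero hBe
      have h2 : wB₃ = 0 := hO.wideB_of_flag (by simp [subcall, hBe])
      rw [h1, h2]
      rcases hB.price with h1 | ⟨_, h2, _, l, hl, h3, h4, _⟩
      · rw [h1]; simpa using hpos
      · refine le_trans ?_ ((hW.price_le hsep hl h2 h4 ?_).trans hphi)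
        · simp
        · rw [← hdR]; exact_mod_cast h3.le
    have hA2 : ((sa + (wA₁ + wA₂ + wA₃) : ℕ) : ℝ) ≤
        2 * (phi F D Z α β T' - phi F D Z α β T) := by
      rcases hA.price with h1 | ⟨_, h2, hfull, l, hl, h3, h4, h5⟩
      · have := hL.wideA; have := hO.wideA
        rw [h1]; push_cast at *; linarith
      · by_cases hAe : A = ∅
        · have := hA1 (hA.noOut_iff.1 hAe); linarith
        have ha := hL.wideA_move hfull
        have hb := hO.wideA_of_noOut (hno₂ hfull)
        -- All vertices of `A` lie beyond `θ l`, since the near set was empty. So the first block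
        -- left everything up to that position in place, and `v` is still above it.
        have hq1 : (T c.u : ℕ) + θ l + 1 ≤ (T₁ c.v : ℕ) :=
          le_of_fixes_below (hlowq _ fun a ha => h5 a ha) (by omega)
        have hq2 : ((T c.u : ℕ) : ℝ) + θ l ≤ ((T₂ c.v : ℕ) : ℝ) := by
          rw [hv₂]; exact_mod_cast (by omega : (T c.u : ℕ) + θ l ≤ (T₁ c.v : ℕ))
        -- `u` starts at least `θ l` below the place of `v` at time `T₂` and ends above `v`, so
        -- these three displacements add up to at least `θ l`. The first is paid by `wideA_move` of
        -- the earlier subcalls, the other two by the final call.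
        have hx := hW.price_le hsep hl h2 h4 (x := |((T₂ c.u : ℕ) : ℝ) - ((T c.u : ℕ) : ℝ)| +
          |((T' c.u : ℕ) : ℝ) - ((T₂ c.u : ℕ) : ℝ)| + |((T' c.v : ℕ) : ℝ) - ((T₂ c.v : ℕ) : ℝ)|)
          (by
            have h6 := habs (((T₂ c.u : ℕ) : ℝ) - ((T c.u : ℕ) : ℝ))
            have h7 := habs (((T' c.u : ℕ) : ℝ) - ((T₂ c.u : ℕ) : ℝ))
            have h8 := habs' (((T' c.v : ℕ) : ℝ) - ((T₂ c.v : ℕ) : ℝ))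
            linarith)
        have hy : 0 ≤ β / 2 * (gap F c.u c.v * |((T₂ c.u : ℕ) : ℝ) - ((T c.u : ℕ) : ℝ)|) := by
          positivity
        push_cast at *
        linarith
    have hB2 : ((sb + (wB₁ + wB₂ + wB₃) : ℕ) : ℝ) ≤
        2 * (phi F D Z α β T' - phi F D Z α β T) := by
      rcases hB.price with h1 | ⟨_, h2, hfull, l, hl, h3, h4, h5⟩
      · have := hL.wideB; have := hO.wideB
        rw [h1]; push_cast at *; linarith
      · by_cases hBe : B = ∅
        · have := hB1 (hB.noIn_iff.1 hBe); linarith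
        have ha := hL.wideB_move hfull
        have hb := hO.wideB_of_noIn (hni₂ hfull)
        -- Here it is `v` that moves in the first block, while `u` moves in the second, but not
        -- beyond the places of the vertices of `B`, which lie more than `θ l` below the original
        -- place of `v`.
        have hq1 : (T₂ c.u : ℕ) ≤ (T c.v : ℕ) - θ l :=
          hq _ (by omega) fun b hb => by
            have := h5 b hb
            have := hM₁.left b (hVZ b (by simp [hb]))
            omega
        have hq2 : ((T₂ c.u : ℕ) : ℝ) + θ l ≤ ((T c.v : ℕ) : ℝ) := by
          exact_mod_cast (by omega : (T₂ c.u : ℕ) + θ l ≤ (T c.v : ℕ))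
        have hx := hW.price_le hsep hl h2 h4 (x := |((T₂ c.v : ℕ) : ℝ) - ((T c.v : ℕ) : ℝ)| +
          |((T' c.u : ℕ) : ℝ) - ((T₂ c.u : ℕ) : ℝ)| + |((T' c.v : ℕ) : ℝ) - ((T₂ c.v : ℕ) : ℝ)|)
          (by
            have h6 := habs' (((T₂ c.v : ℕ) : ℝ) - ((T c.v : ℕ) : ℝ))
            have h7 := habs (((T' c.u : ℕ) : ℝ) - ((T₂ c.u : ℕ) : ℝ))
            have h8 := habs' (((T' c.v : ℕ) : ℝ) - ((T₂ c.v : ℕ) : ℝ))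
            linarith)
        have hy : 0 ≤ β / 2 * (gap F c.u c.v * |((T₂ c.v : ℕ) : ℝ) - ((T c.v : ℕ) : ℝ)|) := by
          positivity
        push_cast at *
        linarith
    refine ⟨T', _, _, _, _, hrun, hM, hinv, ?_, ?_, hA2, hA1, ?_, hB2, hB1, ?_, ?_⟩
    · have hfixL : ∀ w, (T w : ℕ) < (T c.u : ℕ) → T₂ w = T w := fun w hw => by
        have h1 := hfix₁ w hw.le
        rw [hc3 w (by rw [h1, hu₁]; exact hw), h1]
      have hfixR : ∀ w, (T c.v : ℕ) < (T w : ℕ) → T₂ w = T w := fun w hw => by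
        have h1 := hhigh w hw
        rw [hc4 (T c.v : ℕ) (by rw [hu₁]; omega) (fun b hb => by
          have h0 : b ∈ insert c.v B := by simp [mem_inOrder.1 hb]
          exact (hM₁.left b (hVZ b h0)).trans (hle b h0)) w (by rw [h1]; exact hw), h1]
      rintro w (hw | hw)
      · have h1 := hfixL w hw
        rw [hO.confined w (Or.inl (by rw [h1]; show _ < (T₂ c.u : ℕ); omega)), h1]
      · have h1 := hfixR w hw
        rw [hO.confined w (Or.inr (by rw [h1]; show (T₂ c.v : ℕ) < _; omega)), h1]
    · have h1 := hL.count
      have h2 := hO.count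
      rw [hlen]
      omega
    · intro h
      have hno := hc.flag₁ h
      have hAe := hA.noOut_iff.2 hno
      have h1 : wA₁ + wA₂ = 0 := hL.wideA_zero hAe
      have h2 : wA₃ = 0 := hO.wideA_of_flag (by simp [subcall, hAe])
      have h3 : sa = 0 := by
        rcases hA.price with h1 | ⟨h1, _⟩
        · exact h1
        · rw [h1] at h; simp at h
      omega
    · intro h
      have hno := hc.flag₂ h
      have hBe := hB.noIn_iff.2 hno
      have h1 : wB₁ + wB₂ = 0 := hL.wideB_zero hBe
      have h2 : wB₃ = 0 := hO.wideB_of_flag (by simp [subcall, hBe])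
      have h3 : sb = 0 := by
        rcases hB.price with h1 | ⟨h1, _⟩
        · exact h1
        · rw [h1] at h; simp at h
      omega
    · have h1 := hL.swaps
      have h2 := hO.swaps
      push_cast at *
      linarith

end Reordering

/-! ### The insertion of an edge, and a potential for the whole sequence -/

section Insertion

variable {n : ℕ}

/-- Distances are integers, so only the integer part of a threshold matters. -/
theorem hatA_eq {E : Finset (Fin n × Fin n)} {T : Equiv.Perm (Fin n)} {t : ℝ} (ht : 0 ≤ t)
    (u v : Fin n) : hatA E T t u v = outNear E T ⌊t⌋₊ u v := by
  ext w; simp [hatA, outNear, Nat.le_floor_iff ht]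

theorem hatB_eq {E : Finset (Fin n × Fin n)} {T : Equiv.Perm (Fin n)} {t : ℝ} (ht : 0 ≤ t)
    (u v : Fin n) : hatB E T t u v = inNear E T ⌊t⌋₊ u v := by
  ext w; simp [hatB, inNear, Nat.le_floor_iff ht]

theorem PicksSide.eq_ite {near wide A : Finset (Fin n)} {f : Bool} {d s : ℕ}
    (h : PicksSide near wide f d A s) : A = if near ≠ ∅ ∨ f = true then near else wide := by
  rcases h with ⟨h1, h2, _⟩ | ⟨h1, h2, h3, _⟩
  · rw [if_pos h1, h2]
  · rw [if_neg (by simp [h1, h2]), h3]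

theorem Picks.selects {p : ℕ} {t : ℕ → ℝ} (ht : ∀ i, 0 ≤ t i) {E : Finset (Fin n × Fin n)}
    {T : Equiv.Perm (Fin n)} {c : Call n} {A B : Finset (Fin n)} {sa sb : ℕ}
    (h : Picks p (fun i => ⌊t i⌋₊) E T c A B sa sb) : Selects p t E T c A B := by
  rcases h with ⟨h1, h2, h3, _, _⟩ | ⟨i, hi, h1, h2, h3, h4⟩
  · refine Or.inl ⟨(Nat.le_floor_iff (ht 0)).1 h1, ?_, ?_⟩
    · rw [hatA_eq (ht 0), h2]
    · rw [hatB_eq (ht 0), h3]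
  · refine Or.inr ⟨i, hi, (Nat.floor_lt (ht i)).1 (h1 i le_rfl), (Nat.le_floor_iff (ht _)).1 h2, ?_, ?_⟩
    · rw [hatA_eq (ht i), hatA_eq (ht _)]
      exact h3.eq_ite
    · rw [hatB_eq (ht i), hatB_eq (ht _)]
      exact h4.eq_ite

theorem Run.calls {p : ℕ} {t : ℕ → ℝ} (ht : ∀ i, 0 ≤ t i) {E : Finset (Fin n × Fin n)}
    {T T' : Equiv.Perm (Fin n)} {cs : List (Call n)} {N wA wB sw : ℕ}
    (h : Run p (fun i => ⌊t i⌋₊) E T cs T' N wA wB sw) : Calls p t E T cs T' := by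
  induction h with
  | nil T => exact Calls.nil T
  | swap _ h2 h3 _ ih => exact Calls.swap h2 (h3.selects ht) ih
  | recurse _ h2 h3 h4 _ _ ih ih₂ => exact Calls.recurse h2 (h3.selects ht) h4 ih ih₂

/-- Reachability by a directed path, possibly trivial. -/
def Reaches (E : Finset (Fin n × Fin n)) (a b : Fin n) : Prop :=
  Relation.ReflTransGen (fun x y => (x, y) ∈ E) a b

theorem Reaches.le {E : Finset (Fin n × Fin n)} {T : Equiv.Perm (Fin n)} (hT : IsTopOrder E T)
    {a b : Fin n} (h : Reaches E a b) : T a ≤ T b := by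
  induction h with
  | refl => exact le_rfl
  | tail _ h ih => exact ih.trans (hT _ h).le

theorem Reaches.mono {E E' : Finset (Fin n × Fin n)} (hE : E ⊆ E') {a b : Fin n}
    (h : Reaches E a b) : Reaches E' a b :=
  Relation.ReflTransGen.mono (fun _ _ h => hE h) _ _ h

open Classical in
/-- The pairs `(a, b)` with `b` before `a` in the final order `F`, which the graph `E` does not
force to be in this order. -/
noncomputable def unsettled (F : Equiv.Perm (Fin n)) (E : Finset (Fin n × Fin n)) :
    Finset (Fin n × Fin n) :=
  Finset.univ.filter fun q => F q.2 < F q.1 ∧ ¬ Reaches E q.2 q.1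

/-- The potential of the graph `E` with order `T`. -/
noncomputable def energy (F : Equiv.Perm (Fin n)) (α : Fin n × Fin n → ℝ) (β : ℝ)
    (E : Finset (Fin n × Fin n)) (T : Equiv.Perm (Fin n)) : ℝ :=
  ∑ q ∈ unsettled F E, α q - β * corr F T

theorem unsettled_subset {F : Equiv.Perm (Fin n)} {E E' : Finset (Fin n × Fin n)} (h : E ⊆ E') :
    unsettled F E' ⊆ unsettled F E := by
  intro q hq
  simp only [unsettled, Finset.mem_filter, Finset.mem_univ, true_and] at hq ⊢
  exact ⟨hq.1, fun h' => hq.2 (h'.mono h)⟩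

/-- Take for `D` the vertices reachable from the head and for `Z` those that reach the tail. Bad
pairs are unsettled before the insertion, as a path from b to a would contradict the current order,
and settled afterwards, because b reaches a through the new edge. So the insertion removes them all
from `unsettled`, and the growth of `phi`, which depends on `D` and `Z`, is dominated by the
decrease of `energy`, which does not. If the new edge respects the order, nothing moves and `energy`
can only drop. -/
theorem exists_insert {E : Finset (Fin n × Fin n)} {F : Equiv.Perm (Fin n)}
    {α : Fin n × Fin n → ℝ} {β : ℝ} {p : ℕ} {θ : ℕ → ℕ} (hW : Weights p θ F α β)
    (hθ : n ≤ θ (p + 1)) {e : Fin n × Fin n} (hF : IsTopOrder (insert e E) F)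
    {T : Equiv.Perm (Fin n)} (hT : IsTopOrder E T) :
    ∃ T' N wA wB sw, IsTopOrder (insert e E) T' ∧
      ((T e.2 < T e.1 ∧ Run p θ E T [⟨e.2, e.1, false, false⟩] T' N wA wB sw) ∨
        (T e.1 < T e.2 ∧ T' = T ∧ N = 0 ∧ wA = 0 ∧ wB = 0 ∧ sw = 0)) ∧
      N + 4 * (unsettled F (insert e E)).card ≤ 4 * (unsettled F E).card ∧
      (wA : ℝ) ≤ 2 * (energy F α β E T - energy F α β (insert e E) T') ∧
      (wB : ℝ) ≤ 2 * (energy F α β E T - energy F α β (insert e E) T') ∧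
      (sw : ℝ) ≤ energy F α β E T - energy F α β (insert e E) T' := by
  classical
  obtain ⟨x, y⟩ := e
  have hsub : E ⊆ insert (x, y) E := Finset.subset_insert _ _
  have hU := unsettled_subset (F := F) hsub
  have hFxy : F x < F y := hF (x, y) (by simp)
  have hne : x ≠ y := fun h => by rw [h] at hFxy; simp at hFxy
  rcases lt_or_gt_of_ne (fun h : T x = T y => hne (T.injective h)) with hlt | hlt
  · have hen : energy F α β (insert (x, y) E) T ≤ energy F α β E T := by
      have := Finset.sum_le_sum_of_subset_of_nonneg hU (f := α) fun q _ _ => hW.nonneg q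
      unfold energy; linarith
    refine ⟨T, 0, 0, 0, 0, ?_, Or.inr ⟨hlt, rfl, rfl, rfl, rfl, rfl⟩, ?_, ?_, ?_, ?_⟩
    · intro e he
      rcases Finset.mem_insert.1 he with h | h
      · rw [h]; exact hlt
      · exact hT e h
    · have := Finset.card_le_card hU; omega
    all_goals push_cast; linarith
  · set D : Finset (Fin n) := Finset.univ.filter fun a => Reaches E y a with hD
    set Z : Finset (Fin n) := Finset.univ.filter fun b => Reaches E b x with hZ
    have hFE : IsTopOrder E F := fun e he => hF e (hsub he)
    have hS : Separated E F D Z := by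
      refine ⟨hFE, fun a w ha hw => ?_, fun b w hb hw => ?_, fun a ha b hb => ?_⟩
      · simp only [hD, Finset.mem_filter, Finset.mem_univ, true_and] at ha ⊢
        exact Relation.ReflTransGen.tail ha hw
      · simp only [hZ, Finset.mem_filter, Finset.mem_univ, true_and] at hb ⊢
        exact Relation.ReflTransGen.head hw hb
      · simp only [hD, hZ, Finset.mem_filter, Finset.mem_univ, true_and] at ha hb
        exact ((hb.le hFE).trans_lt hFxy).trans_le (ha.le hFE)
    have hval : Valid E D Z T ⟨y, x, false, false⟩ :=
      ⟨hT, by rw [hD, Finset.mem_filter]; exact ⟨Finset.mem_univ _, Relation.ReflTransGen.refl⟩,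
        by rw [hZ, Finset.mem_filter]; exact ⟨Finset.mem_univ _, Relation.ReflTransGen.refl⟩, hlt, by simp, by simp⟩
    obtain ⟨T', N, wA, wB, sw, hrun, hO⟩ := exists_run_call hS hW hθ T _ hval
    have hbad : Disjoint (unsettled F (insert (x, y) E)) (bad D Z T) := by
      rw [Finset.disjoint_left]
      rintro ⟨a, b⟩ h1 h2
      simp only [unsettled, Finset.mem_filter, Finset.mem_univ, true_and] at h1
      simp only [mem_bad, hD, hZ, Finset.mem_filter, Finset.mem_univ, true_and] at h2
      refine h1.2 ?_
      exact ((h2.1.2.mono hsub).tail (by simp)).trans (h2.1.1.mono hsub)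
    have hbad' : unsettled F (insert (x, y) E) ∪ bad D Z T ⊆ unsettled F E := by
      refine Finset.union_subset hU ?_
      rintro ⟨a, b⟩ h2
      have h3 := mem_bad.1 h2
      simp only [unsettled, Finset.mem_filter, Finset.mem_univ, true_and]
      exact ⟨hS.sep a h3.1.1 b h3.1.2, fun h => absurd (h.le hT) (not_le.2 h3.2)⟩
    have hcard := Finset.card_le_card hbad'
    rw [Finset.card_union_of_disjoint hbad] at hcard
    have hsum := Finset.sum_le_sum_of_subset_of_nonneg hbad' (f := α) fun q _ _ => hW.nonneg q
    rw [Finset.sum_union hbad] at hsum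
    have hpos : 0 ≤ ∑ q ∈ bad D Z T', α q := Finset.sum_nonneg fun q _ => hW.nonneg q
    have hphi : phi F D Z α β T' - phi F D Z α β T ≤
        energy F α β E T - energy F α β (insert (x, y) E) T' := by
      unfold phi energy; linarith
    have h1 := hO.count
    have h2 := hO.wideA
    have h3 := hO.wideB
    have h4 := hO.swaps
    refine ⟨T', N, wA, wB, sw, ?_, Or.inl ⟨hlt, hrun⟩, by omega, by linarith, by linarith,
      by linarith⟩
    intro e he
    rcases Finset.mem_insert.1 he with h | h
    · rw [h]; exact hO.inverted
    · exact hO.moves.top e h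

end Insertion

/-! ### Step counts

For programs in which every assigned value exceeds the stored ones by at most one, the cost of an
execution is bounded by the number of its steps times the length of the occurring numbers. -/

/-- Executions with the number of steps in place of the cost. -/
inductive Ex : Cmd → Store → Store → ℕ → Prop
  | skip (σ : Store) : Ex .skip σ σ 1
  | assign (σ : Store) (a : ℕ) (i e : Expr) :
      Ex (.assign a i e) σ (σ.write a (i.eval σ) (e.eval σ)) 1
  | seq {c₁ c₂ : Cmd} {σ τ υ : Store} {k₁ k₂ : ℕ} :
      Ex c₁ σ τ k₁ → Ex c₂ τ υ k₂ → Ex (.seq c₁ c₂) σ υ (k₁ + k₂)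
  | condTrue {b : Expr} {c₁ c₂ : Cmd} {σ τ : Store} {k : ℕ} :
      b.eval σ ≠ 0 → Ex c₁ σ τ k → Ex (.cond b c₁ c₂) σ τ (1 + k)
  | condFalse {b : Expr} {c₁ c₂ : Cmd} {σ τ : Store} {k : ℕ} :
      b.eval σ = 0 → Ex c₂ σ τ k → Ex (.cond b c₁ c₂) σ τ (1 + k)
  | loopDone {b : Expr} {c : Cmd} {σ : Store} :
      b.eval σ = 0 → Ex (.loop b c) σ σ 1
  | loopStep {b : Expr} {c : Cmd} {σ τ υ : Store} {k₁ k₂ : ℕ} :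
      b.eval σ ≠ 0 → Ex c σ τ k₁ → Ex (.loop b c) τ υ k₂ → Ex (.loop b c) σ υ (1 + k₁ + k₂)

/-- An exponent `d` with `e ≤ X ^ d` when all cells are smaller than `X ≥ 2`. -/
def Expr.deg : Expr → ℕ
  | .lit k => k + 1
  | .cell _ _ => 1
  | .bin _ e₁ e₂ => e₁.deg + e₂.deg

theorem Expr.one_le_deg : ∀ e : Expr, 1 ≤ e.deg
  | .lit _ => by simp [Expr.deg]
  | .cell _ _ => le_rfl
  | .bin _ e₁ _ => by have := e₁.one_le_deg; simp only [Expr.deg]; omega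

theorem Expr.eval_le {σ : Store} {X : ℕ} (hX : 2 ≤ X) (h : ∀ a i, σ a i ≤ X) :
    ∀ e : Expr, e.eval σ ≤ X ^ e.deg
  | .lit k => by
    have h1 : k + 1 < 2 ^ (k + 1) := Nat.lt_two_pow_self
    have h2 : 2 ^ (k + 1) ≤ X ^ (k + 1) := Nat.pow_le_pow_left hX _
    simp only [Expr.eval, Expr.deg]
    omega
  | .cell a i => by simpa [Expr.eval, Expr.deg] using h a _
  | .bin o e₁ e₂ => by
    have h1 := e₁.eval_le hX h
    have h2 := e₂.eval_le hX h
    have h3 : 2 ≤ X ^ e₁.deg := hX.trans (Nat.le_self_pow (by have := e₁.one_le_deg; omega) X)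
    have h4 : 2 ≤ X ^ e₂.deg := hX.trans (Nat.le_self_pow (by have := e₂.one_le_deg; omega) X)
    simp only [Expr.eval, Expr.deg, pow_add]
    -- Both factors are at least 2, so sums are covered by products; constants have degree `k + 1`
    -- for the same reason.
    have h5 : X ^ e₁.deg + X ^ e₂.deg ≤ X ^ e₁.deg * X ^ e₂.deg := by nlinarith
    cases o with
    | add => simp only [Op.apply]; omega
    | sub => simp only [Op.apply]; omega
    | mul => exact Nat.mul_le_mul h1 h2
    | div => have := Nat.div_le_self (e₁.eval σ) (e₂.eval σ); simp only [Op.apply]; omega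
    | lt => simp only [Op.apply]; split_ifs <;> omega
    | eq => simp only [Op.apply]; split_ifs <;> omega

theorem len_mono {x y : ℕ} (h : x ≤ y) : len x ≤ len y :=
  Nat.add_le_add_right (Nat.size_le_size h) 1

theorem len_pow_le (X d : ℕ) (hd : 1 ≤ d) : len (X ^ d) ≤ d * len X := by
  have h1 : Nat.size (X ^ d) ≤ Nat.size X * d := by
    rw [Nat.size_le, pow_mul]
    exact Nat.pow_lt_pow_left (Nat.lt_size_self X) (by omega)
  unfold len
  nlinarith

theorem Expr.len_eval_le {σ : Store} {X : ℕ} (hX : 2 ≤ X) (h : ∀ a i, σ a i ≤ X) (e : Expr) :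
    len (e.eval σ) ≤ e.deg * len X :=
  (len_mono (e.eval_le hX h)).trans (len_pow_le X _ e.one_le_deg)

/-- The cost of an expression relative to the length of the occurring numbers. -/
def Expr.weight : Expr → ℕ
  | .lit k => k + 1
  | .cell _ i => i.weight + i.deg + 1
  | .bin _ e₁ e₂ => e₁.weight + e₂.weight + e₁.deg + e₂.deg

theorem Expr.cost_le {σ : Store} {X : ℕ} (hX : 2 ≤ X) (h : ∀ a i, σ a i ≤ X) :
    ∀ e : Expr, e.cost σ ≤ e.weight * len X
  | .lit k => by
    have := (Expr.lit k).len_eval_le hX h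
    simpa [Expr.eval, Expr.deg, Expr.cost, Expr.weight] using this
  | .cell a i => by
    have h1 := i.cost_le hX h
    have h2 := i.len_eval_le hX h
    have h3 := len_mono (h a (i.eval σ))
    simp only [Expr.cost, Expr.weight]
    nlinarith
  | .bin o e₁ e₂ => by
    have h1 := e₁.cost_le hX h
    have h2 := e₂.cost_le hX h
    have h3 := e₁.len_eval_le hX h
    have h4 := e₂.len_eval_le hX h
    simp only [Expr.cost, Expr.weight]
    nlinarith

/-- The cost of a step of a program relative to the length of the occurring numbers. -/
def Cmd.weight : Cmd → ℕ
  | .skip => 1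
  | .assign _ i e => i.weight + e.weight + i.deg + e.deg
  | .seq c₁ c₂ => c₁.weight + c₂.weight
  | .cond b c₁ c₂ => b.weight + b.deg + c₁.weight + c₂.weight
  | .loop b c => b.weight + b.deg + c.weight

/-- Expressions whose value does not exceed the largest cell. -/
def Expr.tame : Expr → Bool
  | .lit k => k ≤ 1
  | .cell _ _ => true
  | .bin .add _ _ => false
  | .bin .sub e _ => e.tame
  | .bin .mul _ _ => false
  | .bin .div e _ => e.tame
  | .bin .lt _ _ => true
  | .bin .eq _ _ => true

theorem Expr.eval_le_of_tame {σ : Store} {M : ℕ} (hM : 1 ≤ M) (h : ∀ a i, σ a i ≤ M) :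
    ∀ e : Expr, e.tame = true → e.eval σ ≤ M
  | .lit k, he => by
    simp only [Expr.tame, decide_eq_true_eq] at he
    exact he.trans hM
  | .cell a i, _ => h a _
  | .bin .add _ _, he => by simp [Expr.tame] at he
  | .bin .sub e _, he => by
    have := e.eval_le_of_tame hM h he
    simp only [Expr.eval, Op.apply]; omega
  | .bin .mul _ _, he => by simp [Expr.tame] at he
  | .bin .div e e', he => by
    have := e.eval_le_of_tame hM h he
    have := Nat.div_le_self (e.eval σ) (e'.eval σ)
    simp only [Expr.eval, Op.apply]; omega
  | .bin .lt _ _, _ => by simp only [Expr.eval, Op.apply]; split_ifs <;> omega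
  | .bin .eq _ _, _ => by simp only [Expr.eval, Op.apply]; split_ifs <;> omega

/-- Expressions whose value exceeds the largest cell by at most one. -/
def Expr.slow : Expr → Bool
  | .bin .add e (.lit 1) => e.tame
  | e => e.tame

theorem Expr.eval_le_of_slow {σ : Store} {M : ℕ} (hM : 1 ≤ M) (h : ∀ a i, σ a i ≤ M) (e : Expr)
    (he : e.slow = true) : e.eval σ ≤ M + 1 := by
  unfold Expr.slow at he
  split at he
  · rename_i e'
    have := e'.eval_le_of_tame hM h he
    simp only [Expr.eval, Op.apply]; omega
  · have := e.eval_le_of_tame hM h he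
    omega

/-- Programs that assign slowly growing values only. -/
def Cmd.slow : Cmd → Bool
  | .skip => true
  | .assign _ _ e => e.slow
  | .seq c₁ c₂ => c₁.slow && c₂.slow
  | .cond _ c₁ c₂ => c₁.slow && c₂.slow
  | .loop _ c => c.slow

/-- Each step of a slow program raises the largest stored number by at most one, so after `s` steps
all cells are at most `M + s`. Intermediate values and addresses are bounded by fixed powers of
that, hence every step costs at most a constant depending on the program times `len X`. -/
theorem Ex.exec {c : Cmd} {σ τ : Store} {s : ℕ} (h : Ex c σ τ s) (hc : c.slow = true) :
    ∀ {M : ℕ}, 1 ≤ M → (∀ a i, σ a i ≤ M) → (∀ a i, τ a i ≤ M + s) ∧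
      ∀ X, M + s + 2 ≤ X → ∃ k, Exec c σ τ k ∧ k ≤ s * (c.weight * len X) := by
  have hlen : ∀ X, 1 ≤ len X := fun X => by simp [len]
  induction h with
  | skip σ =>
    intro M _ hσ
    refine ⟨fun a i => (hσ a i).trans (by omega), fun X _ => ⟨1, Exec.skip σ, ?_⟩⟩
    have := hlen X
    simp [Cmd.weight]; omega
  | assign σ a i e =>
    intro M hM hσ
    constructor
    · intro b j
      unfold Store.write
      split_ifs
      · exact Expr.eval_le_of_slow hM hσ e hc
      · exact (hσ b j).trans (by omega)
    · intro X hX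
      refine ⟨_, Exec.assign σ a i e, ?_⟩
      have hσ' : ∀ a i, σ a i ≤ X := fun a i => (hσ a i).trans (by omega)
      have h1 := i.cost_le (by omega) hσ'
      have h2 := e.cost_le (by omega) hσ'
      have h3 := i.len_eval_le (by omega) hσ'
      have h4 := e.len_eval_le (by omega) hσ'
      simp only [Cmd.weight]
      nlinarith
  | @seq c₁ c₂ σ τ υ k₁ k₂ _ _ ih₁ ih₂ =>
    intro M hM hσ
    simp only [Cmd.slow, Bool.and_eq_true] at hc
    obtain ⟨h1, h2⟩ := ih₁ hc.1 hM hσ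
    obtain ⟨h3, h4⟩ := ih₂ hc.2 (by omega) h1
    refine ⟨fun a i => (h3 a i).trans (by omega), fun X hX => ?_⟩
    obtain ⟨a, ha, ha'⟩ := h2 X (by omega)
    obtain ⟨b, hb, hb'⟩ := h4 X (by omega)
    refine ⟨_, ha.seq hb, ?_⟩
    simp only [Cmd.weight, add_mul, mul_add]
    have : 0 ≤ k₁ * (c₂.weight * len X) := Nat.zero_le _
    have : 0 ≤ k₂ * (c₁.weight * len X) := Nat.zero_le _
    omega
  | @condTrue b c₁ c₂ σ τ k hb _ ih =>
    intro M hM hσ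
    simp only [Cmd.slow, Bool.and_eq_true] at hc
    obtain ⟨h1, h2⟩ := ih hc.1 hM hσ
    refine ⟨fun a i => (h1 a i).trans (by omega), fun X hX => ?_⟩
    obtain ⟨a, ha, ha'⟩ := h2 X (by omega)
    refine ⟨_, Exec.condTrue hb ha, ?_⟩
    have hσ' : ∀ a i, σ a i ≤ X := fun a i => (hσ a i).trans (by omega)
    have h3 := b.cost_le (by omega) hσ'
    have h4 := b.len_eval_le (by omega) hσ'
    have h5 := Nat.zero_le (k * (b.weight * len X))
    have h6 := Nat.zero_le (k * (b.deg * len X))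
    have h7 := Nat.zero_le (k * (c₂.weight * len X))
    have h8 := Nat.zero_le (c₁.weight * len X)
    have h9 := Nat.zero_le (c₂.weight * len X)
    simp only [Cmd.weight, add_mul, mul_add, one_mul]
    omega
  | @condFalse b c₁ c₂ σ τ k hb _ ih =>
    intro M hM hσ
    simp only [Cmd.slow, Bool.and_eq_true] at hc
    obtain ⟨h1, h2⟩ := ih hc.2 hM hσ
    refine ⟨fun a i => (h1 a i).trans (by omega), fun X hX => ?_⟩
    obtain ⟨a, ha, ha'⟩ := h2 X (by omega)
    refine ⟨_, Exec.condFalse hb ha, ?_⟩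
    have hσ' : ∀ a i, σ a i ≤ X := fun a i => (hσ a i).trans (by omega)
    have h3 := b.cost_le (by omega) hσ'
    have h4 := b.len_eval_le (by omega) hσ'
    have h5 := Nat.zero_le (k * (b.weight * len X))
    have h6 := Nat.zero_le (k * (b.deg * len X))
    have h7 := Nat.zero_le (k * (c₁.weight * len X))
    have h8 := Nat.zero_le (c₁.weight * len X)
    have h9 := Nat.zero_le (c₂.weight * len X)
    simp only [Cmd.weight, add_mul, mul_add, one_mul]
    omega
  | @loopDone b c σ hb =>
    intro M hM hσ
    refine ⟨fun a i => (hσ a i).trans (by omega), fun X hX => ⟨_, Exec.loopDone hb, ?_⟩⟩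
    have hσ' : ∀ a i, σ a i ≤ X := fun a i => (hσ a i).trans (by omega)
    have h3 := b.cost_le (by omega) hσ'
    have h4 := b.len_eval_le (by omega) hσ'
    have h5 := Nat.zero_le (c.weight * len X)
    simp only [Cmd.weight, add_mul, one_mul]
    omega
  | @loopStep b c σ τ υ k₁ k₂ hb _ _ ih₁ ih₂ =>
    intro M hM hσ
    obtain ⟨h1, h2⟩ := ih₁ hc hM hσ
    obtain ⟨h3, h4⟩ := ih₂ hc (by omega) h1
    refine ⟨fun a i => (h3 a i).trans (by omega), fun X hX => ?_⟩
    obtain ⟨p, hp, hp'⟩ := h2 X (by omega)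
    obtain ⟨q, hq, hq'⟩ := h4 X (by omega)
    refine ⟨_, Exec.loopStep hb hp hq, ?_⟩
    have hσ' : ∀ a i, σ a i ≤ X := fun a i => (hσ a i).trans (by omega)
    have h5 := b.cost_le (by omega) hσ'
    have h6 := b.len_eval_le (by omega) hσ'
    have h7 := Nat.zero_le (k₁ * (b.weight * len X))
    have h8 := Nat.zero_le (k₁ * (b.deg * len X))
    have h9 := Nat.zero_le (c.weight * len X)
    simp only [Cmd.weight, add_mul, mul_add, one_mul] at hq' ⊢
    omega

/-- Whether a program writes into the array `a`. -/
def Cmd.touches (a : ℕ) : Cmd → Bool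
  | .skip => false
  | .assign b _ _ => a == b
  | .seq c₁ c₂ => c₁.touches a || c₂.touches a
  | .cond _ c₁ c₂ => c₁.touches a || c₂.touches a
  | .loop _ c => c.touches a

theorem Store.write_of_ne {σ : Store} {a b i x : ℕ} (h : b ≠ a) : (σ.write a i x) b = σ b := by
  funext j; simp [Store.write, h]

theorem Store.write_same (σ : Store) (a i x : ℕ) : (σ.write a i x) a i = x := by
  simp [Store.write]

theorem Store.write_apply (σ : Store) (a i x j : ℕ) :
    (σ.write a i x) a j = if j = i then x else σ a j := by
  simp [Store.write]

theorem Ex.frame {c : Cmd} {σ τ : Store} {s : ℕ} (h : Ex c σ τ s) {a : ℕ}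
    (ha : c.touches a = false) : τ a = σ a := by
  induction h with
  | skip => rfl
  | assign σ b i e =>
    simp only [Cmd.touches, beq_eq_false_iff_ne] at ha
    exact Store.write_of_ne ha
  | seq _ _ ih₁ ih₂ =>
    simp only [Cmd.touches, Bool.or_eq_false_iff] at ha
    rw [ih₂ ha.2, ih₁ ha.1]
  | condTrue _ _ ih =>
    simp only [Cmd.touches, Bool.or_eq_false_iff] at ha
    exact ih ha.1
  | condFalse _ _ ih =>
    simp only [Cmd.touches, Bool.or_eq_false_iff] at ha
    exact ih ha.2
  | loopDone => rfl
  | loopStep _ _ _ ih₁ ih₂ => rw [ih₂ ha, ih₁ ha]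

/-! ### Total correctness -/

/-- Started in `σ`, the program `c` halts in a memory and after a number of steps with `Q`. -/
def Tri (c : Cmd) (σ : Store) (Q : Store → ℕ → Prop) : Prop := ∃ τ s, Ex c σ τ s ∧ Q τ s

theorem Tri.mono {c : Cmd} {σ : Store} {Q Q' : Store → ℕ → Prop} (h : Tri c σ Q)
    (hQ : ∀ τ s, Q τ s → Q' τ s) : Tri c σ Q' := by
  obtain ⟨τ, s, h1, h2⟩ := h
  exact ⟨τ, s, h1, hQ _ _ h2⟩

theorem Tri.frame {c : Cmd} {σ : Store} {Q : Store → ℕ → Prop} (h : Tri c σ Q) :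
    Tri c σ fun τ s => Q τ s ∧ ∀ a, c.touches a = false → τ a = σ a := by
  obtain ⟨τ, s, h1, h2⟩ := h
  exact ⟨τ, s, h1, h2, fun a ha => h1.frame ha⟩

theorem Tri.skip {σ : Store} {Q : Store → ℕ → Prop} (h : Q σ 1) : Tri .skip σ Q :=
  ⟨_, _, Ex.skip σ, h⟩

theorem Tri.assign {σ : Store} {a : ℕ} {i e : Expr} {Q : Store → ℕ → Prop}
    (h : Q (σ.write a (i.eval σ) (e.eval σ)) 1) : Tri (.assign a i e) σ Q :=
  ⟨_, _, Ex.assign σ a i e, h⟩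

theorem Tri.seq {c₁ c₂ : Cmd} {σ : Store} {Q : Store → ℕ → Prop}
    (h : Tri c₁ σ fun τ s => Tri c₂ τ fun υ s' => Q υ (s + s')) : Tri (.seq c₁ c₂) σ Q := by
  obtain ⟨τ, s, h1, υ, s', h2, h3⟩ := h
  exact ⟨υ, _, h1.seq h2, h3⟩

theorem Tri.cond {b : Expr} {c₁ c₂ : Cmd} {σ : Store} {Q : Store → ℕ → Prop}
    (h₁ : b.eval σ ≠ 0 → Tri c₁ σ fun τ s => Q τ (1 + s))
    (h₂ : b.eval σ = 0 → Tri c₂ σ fun τ s => Q τ (1 + s)) : Tri (.cond b c₁ c₂) σ Q := by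
  by_cases hb : b.eval σ = 0
  · obtain ⟨τ, s, h1, h2⟩ := h₂ hb
    exact ⟨τ, _, Ex.condFalse hb h1, h2⟩
  · obtain ⟨τ, s, h1, h2⟩ := h₁ hb
    exact ⟨τ, _, Ex.condTrue hb h1, h2⟩

/-- The invariant `I` carries the number of steps made so far, including one for each test; the
final failed test is the additional step in the conclusion. -/
theorem Tri.loop {b : Expr} {c : Cmd} (I : Store → ℕ → Prop) (m : Store → ℕ)
    (hI : ∀ σ s, I σ s → b.eval σ ≠ 0 →
      Tri c σ fun τ s' => I τ (s + 1 + s') ∧ m τ < m σ) {σ : Store} (h₀ : I σ 0) :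
    Tri (.loop b c) σ fun τ s => b.eval τ = 0 ∧ ∃ s₀, I τ s₀ ∧ s = s₀ + 1 := by
  suffices H : ∀ k σ s, m σ = k → I σ s → ∃ τ s', Ex (.loop b c) σ τ s' ∧ b.eval τ = 0 ∧
      ∃ s₀, I τ s₀ ∧ s + s' = s₀ + 1 by
    obtain ⟨τ, s', h1, h2, s₀, h3, h4⟩ := H _ σ 0 rfl h₀
    exact ⟨τ, s', h1, h2, s₀, h3, by omega⟩
  intro k
  induction k using Nat.strong_induction_on with
  | _ k ih =>
    intro σ s hk hs
    by_cases hb : b.eval σ = 0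
    · exact ⟨σ, 1, Ex.loopDone hb, hb, s, hs, rfl⟩
    · obtain ⟨τ, s', h1, h2, h3⟩ := hI σ s hs hb
      obtain ⟨υ, s'', h4, h5, s₀, h6, h7⟩ := ih _ (by omega) τ _ rfl h2
      exact ⟨υ, _, Ex.loopStep hb h1 h4, h5, s₀, h6, by omega⟩

instance : Add Expr := ⟨.bin .add⟩
instance : Sub Expr := ⟨.bin .sub⟩
instance : Mul Expr := ⟨.bin .mul⟩
instance : Div Expr := ⟨.bin .div⟩

/-- The scalar variable kept in cell `0` of array `k`. -/
def var (k : ℕ) : Expr := .cell k (.lit 0)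

/-- Assignment to a scalar variable. -/
def setVar (k : ℕ) (e : Expr) : Cmd := .assign k (.lit 0) e

infixr:65 ";;" => Cmd.seq

/-- `for k < hi do c`, from the current value of the variable `k` on. -/
def forLoop (k : ℕ) (hi : Expr) (c : Cmd) : Cmd :=
  .loop (.bin .lt (var k) hi) (c ;; setVar k (var k + .lit 1))

@[simp] theorem eval_lit (σ : Store) (k : ℕ) : (Expr.lit k).eval σ = k := rfl
@[simp] theorem eval_var (σ : Store) (k : ℕ) : (var k).eval σ = σ k 0 := rfl
@[simp] theorem eval_cell (σ : Store) (a : ℕ) (i : Expr) :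
    (Expr.cell a i).eval σ = σ a (i.eval σ) := rfl
@[simp] theorem eval_add (σ : Store) (e e' : Expr) : (e + e').eval σ = e.eval σ + e'.eval σ := rfl
@[simp] theorem eval_sub (σ : Store) (e e' : Expr) : (e - e').eval σ = e.eval σ - e'.eval σ := rfl
@[simp] theorem eval_mul (σ : Store) (e e' : Expr) : (e * e').eval σ = e.eval σ * e'.eval σ := rfl
@[simp] theorem eval_div (σ : Store) (e e' : Expr) : (e / e').eval σ = e.eval σ / e'.eval σ := rfl
@[simp] theorem eval_lt (σ : Store) (e e' : Expr) : (Expr.bin .lt e e').eval σ =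
    if e.eval σ < e'.eval σ then 1 else 0 := rfl
@[simp] theorem eval_eq (σ : Store) (e e' : Expr) : (Expr.bin .eq e e').eval σ =
    if e.eval σ = e'.eval σ then 1 else 0 := rfl

theorem Tri.setVar {σ : Store} {k : ℕ} {e : Expr} {Q : Store → ℕ → Prop}
    (h : Q (σ.write k 0 (e.eval σ)) 1) : Tri (setVar k e) σ Q :=
  Tri.assign h

/-- Each round adds 2 to the steps of its body: the test and the increment of the loop variable. -/
theorem Tri.forLoop {k : ℕ} {hi : Expr} {c : Cmd} {N : ℕ} (I : ℕ → Store → ℕ → Prop)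
    (hk : ∀ i σ s, I i σ s → σ k 0 = i ∧ hi.eval σ = N)
    (hI : ∀ i σ s, i < N → I i σ s →
      Tri c σ fun τ s' => τ k 0 = i ∧ I (i + 1) (τ.write k 0 (i + 1)) (s + s' + 2))
    {σ : Store} {i₀ : ℕ} (hi₀ : i₀ ≤ N) (h₀ : I i₀ σ 0) :
    Tri (forLoop k hi c) σ fun τ s => ∃ s₀, I N τ s₀ ∧ s = s₀ + 1 := by
  refine (Tri.loop (fun σ s => ∃ i ≤ N, I i σ s) (fun σ => N - σ k 0) ?_ ⟨i₀, hi₀, h₀⟩).mono ?_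
  · rintro σ s ⟨i, hiN, h⟩ hb
    obtain ⟨h1, h2⟩ := hk i σ s h
    simp only [eval_lt, eval_var, h1, h2, ne_eq, ite_eq_right_iff, one_ne_zero, imp_false,
      not_not] at hb
    refine Tri.seq ((hI i σ s hb h).mono fun τ s' h' => Tri.setVar ?_)
    have h3 : (var k + Expr.lit 1).eval τ = i + 1 := by simp [h'.1]
    rw [h3]
    refine ⟨⟨i + 1, hb, ?_⟩, ?_⟩
    · have := h'.2
      rwa [show s + 1 + (s' + 1) = s + s' + 2 by ring]
    · rw [Store.write_same, h1]; omega
  · rintro τ s ⟨hb, s₀, ⟨i, hiN, h⟩, rfl⟩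
    obtain ⟨h1, h2⟩ := hk i τ s₀ h
    simp only [eval_lt, eval_var, h1, h2, ite_eq_right_iff, one_ne_zero, imp_false,
      not_lt] at hb
    obtain rfl : i = N := le_antisymm hiN hb
    exact ⟨s₀, h, rfl⟩

/-! ### The program

Arrays: `1` the order, `2` the adjacency matrix, `3` the thresholds, `4` the inverse of the order,
`6` and `7` lengths and entries of the bucket lists, `9` and `10` marks of distances and of blocks
of distances, `11`-`14` the stack of calls, `15` and `16` the sets `A` and `B` of the current call
with its end points in front. Scalar variables: `20` height of the stack, `21`-`24` the current
call, `25` its distance, `26` its level, `27` and `28` lengths of `15` and `16`, `36` and `37` the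
positions of its end points, `38` whether its distance is at most the first threshold, and loop
variables. -/

/-- The number of vertices. -/
def nE : Expr := .cell 0 (.lit 0)

/-- The number of levels. -/
def pE : Expr := .cell 0 (.lit 3)

/-- The index of the bucket of the vertex `x` on level `l`, for out-neighbours (`s = 0`) or
in-neighbours (`s = 1`). -/
def keyE (s l x : Expr) : Expr := (.lit 2 * l + s) * nE + x

/-- The number of buckets. -/
def bucketsE : Expr := .lit 2 * (pE + .lit 1) * nE

/-- Append the value of `w` to a bucket list. -/
def appendCmd (s l x w : ℕ) : Cmd :=
  -- Entry j of bucket κ is kept in cell j K + κ, K being the number of buckets; in this way lists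
  -- of unlimited length share one array.
  .assign 7 (.cell 6 (keyE (.lit s) (var l) (var x)) * bucketsE + keyE (.lit s) (var l) (var x))
    (var w) ;;
  .assign 6 (keyE (.lit s) (var l) (var x)) (.cell 6 (keyE (.lit s) (var l) (var x)) + .lit 1)

/-- Enter the edge from `a` to `b`, if there is one, into the bucket lists of level `l`. -/
def linkCmd (l a b : ℕ) : Cmd :=
  .cond (.cell 2 (var a * nE + var b)) (appendCmd 0 l a b ;; appendCmd 1 l b a) .skip

/-- Exchange the end points of the current call and update the bucket lists. -/
def swapCmd : Cmd :=
  .assign 1 (var 21) (var 37) ;; .assign 1 (var 22) (var 36) ;;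
  .assign 4 (var 36) (var 22) ;; .assign 4 (var 37) (var 21) ;;
  setVar 29 (.lit 0) ;;
  forLoop 29 (pE + .lit 1) (
    setVar 30 (.lit 0) ;;
    -- When `u` moves right by d, the horizon of level l for its out-neighbours advances from T u +
    -- θ l by d places, and only these places have to be inspected; likewise to the left of `v`.
    -- Places outside the array yield some vertex too, but only actual edges are entered, and
    -- searches check the distance again.
    forLoop 30 (var 25) (
      setVar 34 (.cell 4 (var 36 + .cell 3 (var 29) + var 30 + .lit 1)) ;; linkCmd 29 21 34 ;;
      setVar 34 (.cell 4 (var 37 - (.cell 3 (var 29) + var 30 + .lit 1))) ;; linkCmd 29 34 22))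

/-- The position at distance `d` from the end point of side `s` of the current call. -/
def posE (s : ℕ) (d : Expr) : Expr :=
  if s = 0 then .cell 1 (var 21) + d else .cell 1 (var 22) - d

/-- Adjacency of the vertex `w` to the end point of side `s` of the current call. -/
def edgeE (s : ℕ) (w : Expr) : Expr :=
  if s = 0 then .cell 2 (var 21 * nE + w) else .cell 2 (w * nE + var 22)

/-- The distance of the vertex in variable `34` from the end point of side `s`. -/
def distE (s : ℕ) : Expr :=
  -- One of the two truncated differences vanishes, so the sum is the absolute difference.
  (.cell 1 (var 34) - .cell 1 (var (21 + s))) + (.cell 1 (var (21 + s)) - .cell 1 (var 34))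

/-- Append the vertex in variable `34` to the set of side `s`. -/
def takeCmd (s : ℕ) : Cmd :=
  .assign (15 + s) (var (27 + s)) (var 34) ;; setVar (27 + s) (var (27 + s) + .lit 1)

/-- Mark the distances of the valid entries of the bucket of side `s`. -/
def markCmd (s : ℕ) : Cmd :=
  setVar 31 (.lit 0) ;;
  forLoop 31 (.cell 6 (keyE (.lit s) (var 26) (var (21 + s)))) (
    setVar 34 (.cell 7 (var 31 * bucketsE + keyE (.lit s) (var 26) (var (21 + s)))) ;;
    .cond (edgeE s (var 34)) (
      .cond (.bin .lt (distE s) (.cell 3 (var 26) + .lit 1)) (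
        .assign 9 (distE s) (.lit 1) ;; .assign 10 (distE s / .cell 3 (.lit 0)) (.lit 1))
      .skip) .skip)

/-- Collect the marked vertices in the order of their distances, blockwise, and refill the
bucket. -/
def sweepCmd (s : ℕ) : Cmd :=
  .assign 6 (keyE (.lit s) (var 26) (var (21 + s))) (.lit 0) ;;
  setVar 32 (.lit 0) ;;
  -- A block without a mark costs a constant. A marked block costs `θ 0` looks but contains a
  -- vertex, to which they are charged.
  forLoop 32 (.cell 3 (var 26) / .cell 3 (.lit 0) + .lit 1) (
    .cond (.cell 10 (var 32)) (
      .assign 10 (var 32) (.lit 0) ;;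
      setVar 33 (.lit 0) ;;
      forLoop 33 (.cell 3 (.lit 0)) (
        .cond (.cell 9 (var 32 * .cell 3 (.lit 0) + var 33)) (
          .assign 9 (var 32 * .cell 3 (.lit 0) + var 33) (.lit 0) ;;
          setVar 34 (.cell 4 (posE s (var 32 * .cell 3 (.lit 0) + var 33))) ;;
          takeCmd s ;; appendCmd s 26 (21 + s) 34) .skip)) .skip)

/-- Collect all neighbours at distance less than that of the current call. -/
def wideCmd (s : ℕ) : Cmd :=
  setVar 30 (.lit 1) ;;
  forLoop 30 (var 25) (
    setVar 34 (.cell 4 (posE s (var 30))) ;;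
    .cond (edgeE s (var 34)) (takeCmd s) .skip)

/-- Compute the set of side `s` of the current call. -/
def sideCmd (s : ℕ) : Cmd :=
  .assign (15 + s) (.lit 0) (var (21 + s)) ;; setVar (27 + s) (.lit 1) ;;
  -- Within the first threshold all places in between are inspected directly, which costs O(`θ 0`)
  -- and needs no bucket.
  .cond (var 38) (wideCmd s) (
    markCmd s ;; sweepCmd s ;;
    -- The list starts with the end point itself, so length 1 means that the near set is empty.
    .cond (.bin .eq (var (27 + s)) (.lit 1)) (.cond (var (23 + s)) .skip (wideCmd s)) .skip)

/-- Find the level of the current call. -/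
def levelCmd : Cmd :=
  setVar 26 (.lit 0) ;;
  .loop (.bin .lt (.cell 3 (var 26 + .lit 1)) (var 25)) (setVar 26 (var 26 + .lit 1))

/-- Push a subcall. -/
def pushCmd : Cmd :=
  .assign 11 (var 20) (.cell 15 (var 31)) ;; .assign 12 (var 20) (.cell 16 (var 32)) ;;
  -- Index plus length equals 1 exactly if the index is 0 and the list consists of the end point
  -- alone, which is the condition for the flag of the subcall.
  .assign 13 (var 20) (.bin .eq (var 31 + var 27) (.lit 1)) ;;
  .assign 14 (var 20) (.bin .eq (var 32 + var 28) (.lit 1)) ;;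
  setVar 20 (var 20 + .lit 1)

/-- Push all subcalls. -/
def spawnCmd : Cmd :=
  setVar 31 (.lit 0) ;;
  forLoop 31 (var 27) (
    setVar 32 (.lit 0) ;;
    -- The list of side 1 is decreasing in position, so the loop may stop at the first vertex not
    -- above the current one. Calls are pushed in the reverse of the order in which they are to be
    -- executed.
    .loop (.bin .lt (var 32) (var 28) *
        .bin .lt (.cell 1 (.cell 15 (var 31))) (.cell 1 (.cell 16 (var 32)))) (
      pushCmd ;; setVar 32 (var 32 + .lit 1)))

/-- Pop a call and compute its parameters. -/
def popCmd : Cmd :=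
  setVar 20 (var 20 - .lit 1) ;;
  setVar 21 (.cell 11 (var 20)) ;; setVar 22 (.cell 12 (var 20)) ;;
  setVar 23 (.cell 13 (var 20)) ;; setVar 24 (.cell 14 (var 20)) ;;
  setVar 36 (.cell 1 (var 21)) ;; setVar 37 (.cell 1 (var 22)) ;;
  setVar 25 (var 37 - var 36) ;; setVar 38 (.bin .lt (var 25) (.cell 3 (.lit 0) + .lit 1))

/-- Execute the call on top of the stack, up to its subcalls. -/
def callCmd : Cmd :=
  popCmd ;; .cond (var 38) .skip levelCmd ;; sideCmd 0 ;; sideCmd 1 ;;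
  -- The product of the lengths is 1 exactly if both sets are empty. There is no test for an
  -- immediate exit, because in a `Run` every call starts with its first vertex below its second.
  .cond (.bin .eq (var 27 * var 28) (.lit 1)) swapCmd spawnCmd

/-- Enter the edge from `21` to `22`, if there is one, into all bucket lists. -/
def enterCmd : Cmd :=
  setVar 29 (.lit 0) ;; forLoop 29 (pE + .lit 1) (linkCmd 29 21 22)

/-- The insertion of an edge. -/
def insertCmd : Cmd :=
  .cond (.bin .lt (.cell 1 (.cell 0 (.lit 2))) (.cell 1 (.cell 0 (.lit 1)))) (
    .assign 11 (.lit 0) (.cell 0 (.lit 2)) ;; .assign 12 (.lit 0) (.cell 0 (.lit 1)) ;;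
    .assign 13 (.lit 0) (.lit 0) ;; .assign 14 (.lit 0) (.lit 0) ;;
    setVar 20 (.lit 1) ;; .loop (var 20) callCmd) .skip ;;
  setVar 21 (.cell 0 (.lit 1)) ;; setVar 22 (.cell 0 (.lit 2)) ;;
  .assign 2 (var 21 * nE + var 22) (.lit 1) ;; enterCmd

/-- Initialization for a given starting order and given thresholds. -/
def setupCmd : Cmd :=
  setVar 31 (.lit 0) ;; forLoop 31 nE (.assign 4 (.cell 1 (var 31)) (var 31)) ;;
  setVar 21 (.lit 0) ;;
  forLoop 21 nE (setVar 22 (.lit 0) ;; forLoop 22 nE enterCmd)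

theorem insertCmd_slow : insertCmd.slow = true := by decide

theorem setupCmd_slow : setupCmd.slow = true := by decide

/-! ### Representation of the data structure -/

/-- The memory represents the graph `E`, the order `T` and the thresholds `θ`. -/
structure Base (n p : ℕ) (θ : ℕ → ℕ) (E : Finset (Fin n × Fin n)) (T : Equiv.Perm (Fin n))
    (σ : Store) : Prop where
  size : σ 0 0 = n
  lev : σ 0 3 = p
  ord : ∀ v : Fin n, σ 1 v = (T v : ℕ)
  graph : ∀ u w : Fin n, σ 2 ((u : ℕ) * n + w) = if (u, w) ∈ E then 1 else 0
  thr : ∀ i ≤ p + 1, σ 3 i = θ i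
  inv : ∀ q : Fin n, σ 4 q = (T.symm q : ℕ)
  inv_lt : ∀ q, σ 4 q < n

theorem Base.congr {n p : ℕ} {θ : ℕ → ℕ} {E : Finset (Fin n × Fin n)} {T : Equiv.Perm (Fin n)}
    {σ τ : Store} (h : Base n p θ E T σ) (h0 : τ 0 = σ 0) (h1 : τ 1 = σ 1) (h2 : τ 2 = σ 2)
    (h3 : τ 3 = σ 3) (h4 : τ 4 = σ 4) : Base n p θ E T τ := by
  constructor
  · rw [h0]; exact h.size
  · rw [h0]; exact h.lev
  · rw [h1]; exact h.ord
  · rw [h2]; exact h.graph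
  · rw [h3]; exact h.thr
  · rw [h4]; exact h.inv
  · rw [h4]; exact h.inv_lt

/-- The index of a bucket. -/
def key (n s l x : ℕ) : ℕ := (2 * l + s) * n + x

theorem key_lt {n p s l x : ℕ} (hs : s < 2) (hl : l ≤ p) (hx : x < n) :
    key n s l x < 2 * (p + 1) * n := by
  unfold key
  have : (2 * l + s + 1) * n ≤ 2 * (p + 1) * n := Nat.mul_le_mul_right n (by omega)
  nlinarith

/-- `w` occurs in the bucket list `κ`. -/
def InList (K : ℕ) (σ : Store) (κ w : ℕ) : Prop := ∃ j < σ 6 κ, σ 7 (j * K + κ) = w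

/-- All entries of the bucket lists are vertices. -/
def ListsOK (n K : ℕ) (σ : Store) : Prop := ∀ κ < K, ∀ j < σ 6 κ, σ 7 (j * K + κ) < n

/-- The total length of the bucket lists. -/
def listTotal (K : ℕ) (σ : Store) : ℕ := ∑ κ ∈ Finset.range K, σ 6 κ

/-- The edge `(a, b)` is in the bucket lists of level `l`. -/
def Linked (n K : ℕ) (σ : Store) (l a b : ℕ) : Prop :=
  InList K σ (key n 0 l a) b ∧ InList K σ (key n 1 l b) a

/-- Every edge is in the bucket lists of all levels whose threshold is at least its length. -/
def Complete (n p : ℕ) (θ : ℕ → ℕ) (E : Finset (Fin n × Fin n)) (T : Equiv.Perm (Fin n))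
    (σ : Store) : Prop :=
  ∀ l ≤ p, ∀ a b : Fin n, (a, b) ∈ E → dist T a b ≤ θ l →
    Linked n (2 * (p + 1) * n) σ l a b

/-- The bucket lists of `τ` extend those of `σ` by at most `m` entries. -/
structure Grows (n K m : ℕ) (σ τ : Store) : Prop where
  ok : ListsOK n K τ
  mono : ∀ κ < K, ∀ w, InList K σ κ w → InList K τ κ w
  total : listTotal K τ ≤ listTotal K σ + m

theorem Grows.refl {n K : ℕ} {σ : Store} (h : ListsOK n K σ) : Grows n K 0 σ σ :=
  ⟨h, fun _ _ _ h => h, by simp⟩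

theorem Grows.trans {n K m m' : ℕ} {σ τ υ : Store} (h : Grows n K m σ τ)
    (h' : Grows n K m' τ υ) : Grows n K (m + m') σ υ :=
  ⟨h'.ok, fun κ hκ w hw => h'.mono κ hκ w (h.mono κ hκ w hw), by
    have := h.total; have := h'.total; omega⟩

theorem Grows.le {n K m m' : ℕ} {σ τ : Store} (h : Grows n K m σ τ) (hm : m ≤ m') :
    Grows n K m' σ τ :=
  ⟨h.ok, h.mono, h.total.trans (by omega)⟩

theorem Grows.linked {n p m : ℕ} {σ τ : Store} (h : Grows n (2 * (p + 1) * n) m σ τ) {l a b : ℕ}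
    (hl : l ≤ p) (ha : a < n) (hb : b < n) (hL : Linked n (2 * (p + 1) * n) σ l a b) :
    Linked n (2 * (p + 1) * n) τ l a b :=
  ⟨h.mono _ (key_lt (by omega) hl ha) _ hL.1, h.mono _ (key_lt (by omega) hl hb) _ hL.2⟩

theorem InList.congr {K : ℕ} {σ τ : Store} (h6 : τ 6 = σ 6) (h7 : τ 7 = σ 7) {κ w : ℕ} :
    InList K τ κ w ↔ InList K σ κ w := by
  unfold InList; rw [h6, h7]

theorem ListsOK.congr {n K : ℕ} {σ τ : Store} (h6 : τ 6 = σ 6) (h7 : τ 7 = σ 7)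
    (h : ListsOK n K σ) : ListsOK n K τ := by
  unfold ListsOK; rw [h6, h7]; exact h

theorem listTotal_congr {K : ℕ} {σ τ : Store} (h6 : τ 6 = σ 6) :
    listTotal K τ = listTotal K σ := by
  unfold listTotal; rw [h6]

theorem Grows.congr {n K : ℕ} {σ τ : Store} (h6 : τ 6 = σ 6) (h7 : τ 7 = σ 7)
    (h : ListsOK n K σ) : Grows n K 0 σ τ :=
  ⟨h.congr h6 h7, fun _ _ _ hw => (InList.congr h6 h7).2 hw, (listTotal_congr h6).le⟩

theorem eval_keyE {σ : Store} {n s l x : ℕ} (hn : σ 0 0 = n) :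
    (keyE (.lit s) (var l) (var x)).eval σ = key n s (σ l 0) (σ x 0) := by
  simp [keyE, nE, key, hn]

theorem eval_bucketsE {σ : Store} {n p : ℕ} (hn : σ 0 0 = n) (hp : σ 0 3 = p) :
    bucketsE.eval σ = 2 * (p + 1) * n := by
  simp [bucketsE, nE, pE, hn, hp]

theorem append_spec {n p s l x w : ℕ} {σ : Store} (hn : σ 0 0 = n) (hp : σ 0 3 = p)
    (hs : s < 2) (hl : l ≠ 7) (hx : x ≠ 7) (hlp : σ l 0 ≤ p)
    (hxn : σ x 0 < n) (hwn : σ w 0 < n) (hok : ListsOK n (2 * (p + 1) * n) σ) :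
    Tri (appendCmd s l x w) σ fun τ k => k = 2 ∧ Grows n (2 * (p + 1) * n) 1 σ τ ∧
      InList (2 * (p + 1) * n) τ (key n s (σ l 0) (σ x 0)) (σ w 0) := by
  set K := 2 * (p + 1) * n with hK
  set κ := key n s (σ l 0) (σ x 0) with hκ
  have hκK : κ < K := key_lt hs hlp hxn
  refine Tri.seq (Tri.assign (Tri.assign ?_))
  simp only [eval_add, eval_mul, eval_cell, eval_var, eval_lit, eval_keyE hn, eval_bucketsE hn hp]
  have h1 : (keyE (.lit s) (var l) (var x)).eval (σ.write 7 (σ 6 κ * K + κ) (σ w 0)) = κ := by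
    rw [eval_keyE (n := n) (by rw [Store.write_of_ne (by decide)]; exact hn),
      Store.write_of_ne hl, Store.write_of_ne hx]
  rw [h1, Store.write_of_ne (show (6 : ℕ) ≠ 7 by decide)]
  set τ := (σ.write 7 (σ 6 κ * K + κ) (σ w 0)).write 6 κ (σ 6 κ + 1) with hτ
  have h6 : ∀ i, τ 6 i = if i = κ then σ 6 κ + 1 else σ 6 i := fun i => by
    rw [hτ, Store.write_apply, Store.write_of_ne (by decide)]
  have h7 : ∀ i, τ 7 i = if i = σ 6 κ * K + κ then σ w 0 else σ 7 i := fun i => by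
    rw [hτ, Store.write_of_ne (by decide), Store.write_apply]
  -- The residue modulo `K` determines the bucket and the quotient the entry, so the write affects
  -- no other entry.
  have hinj : ∀ κ' < K, ∀ j, j * K + κ' = σ 6 κ * K + κ → κ' = κ ∧ j = σ 6 κ := by
    intro κ' hκ' j h
    have h2 : (j * K + κ') % K = (σ 6 κ * K + κ) % K := by rw [h]
    rw [Nat.mul_add_mod', Nat.mul_add_mod', Nat.mod_eq_of_lt hκ', Nat.mod_eq_of_lt hκK] at h2
    exact ⟨h2, Nat.eq_of_mul_eq_mul_right (by omega) (by omega : j * K = σ 6 κ * K)⟩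
  refine ⟨trivial, ⟨?_, ?_, ?_⟩, ?_⟩
  · intro κ' hκ' j hj
    rw [h7]
    split_ifs with h
    · exact hwn
    · refine hok κ' hκ' j ?_
      rw [h6] at hj
      split_ifs at hj with h3
      · rw [h3] at h ⊢
        have : j ≠ σ 6 κ := fun e => h (by rw [e])
        omega
      · exact hj
  · rintro κ' hκ' v ⟨j, hj, hv⟩
    refine ⟨j, ?_, ?_⟩
    · rw [h6]; split_ifs with h
      · rw [h] at hj; omega
      · exact hj
    · rw [h7, if_neg, hv]
      intro e
      obtain ⟨h3, h4⟩ := hinj κ' hκ' j e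
      rw [h3] at hj
      omega
  · have : listTotal K τ = ∑ i ∈ Finset.range K, (σ 6 i + if i = κ then 1 else 0) := by
      refine Finset.sum_congr rfl fun i _ => ?_
      rw [h6]; split_ifs with h
      · rw [h]
      · rfl
    rw [this, Finset.sum_add_distrib, Finset.sum_ite_eq' (Finset.range K) κ]
    simp [listTotal, hκK]
  · refine ⟨σ 6 κ, ?_, ?_⟩
    · rw [h6, if_pos rfl]; omega
    · rw [h7, if_pos rfl]

theorem link_spec {n p l a b : ℕ} {σ : Store} (hn : σ 0 0 = n) (hp : σ 0 3 = p)
    (hl : l ≠ 6 ∧ l ≠ 7) (ha : a ≠ 6 ∧ a ≠ 7) (hb : b ≠ 6 ∧ b ≠ 7) (hlp : σ l 0 ≤ p)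
    (han : σ a 0 < n) (hbn : σ b 0 < n) (hok : ListsOK n (2 * (p + 1) * n) σ) :
    Tri (linkCmd l a b) σ fun τ k => k ≤ 5 ∧ Grows n (2 * (p + 1) * n) 2 σ τ ∧
      (σ 2 (σ a 0 * n + σ b 0) ≠ 0 →
        Linked n (2 * (p + 1) * n) τ (σ l 0) (σ a 0) (σ b 0)) := by
  refine Tri.cond (fun h => Tri.seq ?_) (fun h => Tri.skip ?_)
  · refine (append_spec hn hp (s := 0) (by decide) hl.2 ha.2 hlp han hbn hok).frame.mono ?_
    rintro τ k ⟨⟨rfl, hg, hin⟩, hfr⟩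
    have hfr' : ∀ c, c ≠ 6 → c ≠ 7 → τ c = σ c := fun c h6 h7 =>
      hfr c (by simp [appendCmd, Cmd.touches, h6, h7])
    have e0 := hfr' 0 (by decide) (by decide)
    have el := hfr' l hl.1 hl.2
    have ea := hfr' a ha.1 ha.2
    have eb := hfr' b hb.1 hb.2
    refine (append_spec (s := 1) (l := l) (x := b) (w := a) (n := n) (p := p)
      (by rw [e0]; exact hn) (by rw [e0]; exact hp) (by decide)
      hl.2 hb.2 (by rw [el]; exact hlp) (by rw [eb]; exact hbn) (by rw [ea]; exact han)
      hg.ok).mono ?_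
    rintro υ k ⟨rfl, hg', hin'⟩
    rw [el, eb, ea] at hin'
    refine ⟨by omega, hg.trans hg', fun _ => ⟨hg'.mono _ (key_lt (by decide) hlp han) _ hin, hin'⟩⟩
  · refine ⟨by omega, (Grows.refl hok).le (by omega), fun h' => absurd ?_ h'⟩
    simpa [nE, hn] using h

theorem enter_spec {n p : ℕ} {σ : Store} (hn : σ 0 0 = n) (hp : σ 0 3 = p)
    (han : σ 21 0 < n) (hbn : σ 22 0 < n) (hok : ListsOK n (2 * (p + 1) * n) σ) :
    Tri enterCmd σ fun τ k => k ≤ 9 * (p + 1) ∧ Grows n (2 * (p + 1) * n) (2 * (p + 1)) σ τ ∧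
      (σ 2 (σ 21 0 * n + σ 22 0) ≠ 0 → ∀ l ≤ p,
        Linked n (2 * (p + 1) * n) τ l (σ 21 0) (σ 22 0)) := by
  refine Tri.seq (Tri.setVar ?_)
  refine (Tri.forLoop (N := p + 1) (i₀ := 0) (fun i τ s => s ≤ 7 * i ∧ τ 29 0 = i ∧
    (∀ c, c ≠ 6 → c ≠ 7 → c ≠ 29 → τ c = σ c) ∧ Grows n (2 * (p + 1) * n) (2 * i) σ τ ∧
      (σ 2 (σ 21 0 * n + σ 22 0) ≠ 0 → ∀ l < i,
        Linked n (2 * (p + 1) * n) τ l (σ 21 0) (σ 22 0))) ?_ ?_ (by omega) ?_).mono ?_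
  · rintro i τ s ⟨_, h1, h2, _⟩
    refine ⟨h1, ?_⟩
    simp [pE, h2 0, hp]
  · rintro i τ s hi ⟨hs, h1, h2, hg, hL⟩
    have e0 := h2 0 (by decide) (by decide) (by decide)
    have e2 := h2 2 (by decide) (by decide) (by decide)
    have e21 := h2 21 (by decide) (by decide) (by decide)
    have e22 := h2 22 (by decide) (by decide) (by decide)
    refine (link_spec (l := 29) (a := 21) (b := 22) (n := n) (p := p) (by rw [e0]; exact hn)
      (by rw [e0]; exact hp) (by decide) (by decide) (by decide) (by omega)
      (by rw [e21]; exact han) (by rw [e22]; exact hbn) hg.ok).frame.mono ?_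
    rintro υ k ⟨⟨hk, hg', hL'⟩, hfr⟩
    have e29 : υ 29 = τ 29 := hfr 29 (by decide)
    have hc : Grows n (2 * (p + 1) * n) 0 υ (υ.write 29 0 (i + 1)) :=
      Grows.congr (Store.write_of_ne (by decide)) (Store.write_of_ne (by decide)) hg'.ok
    refine ⟨by rw [e29, h1], by omega, Store.write_same _ _ _ _, fun c h6 h7 h29 => ?_,
      ((hg.trans hg').trans hc).le (by omega), fun h l hl => ?_⟩
    · rw [Store.write_of_ne h29, hfr c (by simp [linkCmd, appendCmd, Cmd.touches, h6, h7]),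
        h2 c h6 h7 h29]
    · refine hc.linked (by omega) han hbn ?_
      rcases Nat.lt_succ_iff_lt_or_eq.1 hl with h3 | h3
      · exact hg'.linked (by omega) han hbn (hL h l h3)
      · rw [e2, e21, e22, h1] at hL'
        rw [h3]
        exact hL' h
  · have hc : Grows n (2 * (p + 1) * n) 0 σ (σ.write 29 0 0) :=
      Grows.congr (Store.write_of_ne (by decide)) (Store.write_of_ne (by decide)) hok
    refine ⟨by omega, Store.write_same _ _ _ _, fun c _ _ h => Store.write_of_ne h, hc,
      fun _ l hl => by omega⟩
  · rintro τ s ⟨s₀, ⟨hs, _, _, hg, hL⟩, rfl⟩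
    exact ⟨by omega, hg, fun h l hl => hL h l (by omega)⟩

/-- The order that results from the exchange of two vertices, stored in memory. -/
theorem Base.swap {n p : ℕ} {θ : ℕ → ℕ} {E : Finset (Fin n × Fin n)} {T : Equiv.Perm (Fin n)}
    {σ : Store} (h : Base n p θ E T σ) (u v : Fin n) :
    Base n p θ E (T * Equiv.swap u v) ((((σ.write 1 u (T v : ℕ)).write 1 v (T u : ℕ)).write 4
      (T u : ℕ) (v : ℕ)).write 4 (T v : ℕ) (u : ℕ)) := by
  set τ := (((σ.write 1 u (T v : ℕ)).write 1 v (T u : ℕ)).write 4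
      (T u : ℕ) (v : ℕ)).write 4 (T v : ℕ) (u : ℕ) with hτ
  have e : ∀ a, a ≠ 1 → a ≠ 4 → τ a = σ a := fun a h1 h4 => by
    rw [hτ, Store.write_of_ne h4, Store.write_of_ne h4, Store.write_of_ne h1,
      Store.write_of_ne h1]
  have e1 : ∀ i, τ 1 i = if i = (v : ℕ) then (T u : ℕ) else if i = (u : ℕ) then (T v : ℕ)
      else σ 1 i := fun i => by
    rw [hτ, Store.write_of_ne (by decide), Store.write_of_ne (by decide), Store.write_apply,
      Store.write_apply]
  have e4 : ∀ i, τ 4 i = if i = (T v : ℕ) then (u : ℕ) else if i = (T u : ℕ) then (v : ℕ)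
      else σ 4 i := fun i => by
    rw [hτ, Store.write_apply, Store.write_apply, Store.write_of_ne (by decide),
      Store.write_of_ne (by decide)]
  constructor
  · rw [e 0 (by decide) (by decide)]; exact h.size
  · rw [e 0 (by decide) (by decide)]; exact h.lev
  · intro w
    rw [e1]
    by_cases h1 : w = v
    · simp [h1]
    · by_cases h2 : w = u
      · subst h2
        simp [Fin.val_inj, h1]
      · simp [Fin.val_inj, h1, h2, h.ord, Equiv.swap_apply_of_ne_of_ne h2 h1]
  · rw [e 2 (by decide) (by decide)]; exact h.graph
  · rw [e 3 (by decide) (by decide)]; exact h.thr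
  · intro q
    have hs : (T * Equiv.swap u v).symm q = Equiv.swap u v (T.symm q) := by
      rw [Equiv.symm_apply_eq]; simp
    rw [e4, hs]
    by_cases h1 : q = T v
    · simp [h1]
    · have h1' : T.symm q ≠ v := fun e => h1 (by rw [← e]; simp)
      by_cases h2 : q = T u
      · have h3 : (T u : ℕ) ≠ (T v : ℕ) := fun e => h1 (by rw [h2]; exact Fin.ext e)
        simp [h2, h3]
      · have h2' : T.symm q ≠ u := fun e => h2 (by rw [← e]; simp)
        have h3 : (q : ℕ) ≠ (T v : ℕ) := fun e => h1 (Fin.ext e)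
        have h4 : (q : ℕ) ≠ (T u : ℕ) := fun e => h2 (Fin.ext e)
        rw [if_neg h3, if_neg h4, h.inv, Equiv.swap_apply_of_ne_of_ne h2' h1']
  · intro q
    rw [e4]
    split_ifs
    · exact u.2
    · exact v.2
    · exact h.inv_lt q

theorem Base.inv_apply {n p : ℕ} {θ : ℕ → ℕ} {E : Finset (Fin n × Fin n)}
    {T : Equiv.Perm (Fin n)} {σ : Store} (h : Base n p θ E T σ) (w : Fin n) :
    σ 4 (T w : ℕ) = w := by
  rw [h.inv]; simp

theorem Base.edge_ne_zero {n p : ℕ} {θ : ℕ → ℕ} {E : Finset (Fin n × Fin n)}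
    {T : Equiv.Perm (Fin n)} {σ : Store} (h : Base n p θ E T σ) {a b : Fin n} :
    σ 2 ((a : ℕ) * n + b) ≠ 0 ↔ (a, b) ∈ E := by
  rw [h.graph]; split_ifs <;> simp_all

/-- One level of the update of the bucket lists in an exchange. -/
theorem swap_level_spec {n p : ℕ} {θ : ℕ → ℕ} {E : Finset (Fin n × Fin n)}
    {T : Equiv.Perm (Fin n)} {σ : Store} (hB : Base n p θ E T σ) {u v : Fin n} {du dv d l : ℕ}
    (hl : l ≤ p) (h21 : σ 21 0 = u) (h22 : σ 22 0 = v) (h25 : σ 25 0 = d) (h36 : σ 36 0 = du)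
    (h37 : σ 37 0 = dv) (h29 : σ 29 0 = l) (hok : ListsOK n (2 * (p + 1) * n) σ) :
    Tri (setVar 30 (.lit 0) ;;
      forLoop 30 (var 25) (
      setVar 34 (.cell 4 (var 36 + .cell 3 (var 29) + var 30 + .lit 1)) ;; linkCmd 29 21 34 ;;
      setVar 34 (.cell 4 (var 37 - (.cell 3 (var 29) + var 30 + .lit 1))) ;; linkCmd 29 34 22))
      σ fun τ k => k ≤ 14 * d + 2 ∧ Grows n (2 * (p + 1) * n) (4 * d) σ τ ∧
        (∀ c, c ≠ 6 → c ≠ 7 → c ≠ 30 → c ≠ 34 → τ c = σ c) ∧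
        ∀ i < d, (∀ b, (T b : ℕ) = du + θ l + i + 1 → (u, b) ∈ E →
          Linked n (2 * (p + 1) * n) τ l u b) ∧
          (∀ a, (T a : ℕ) + (θ l + i + 1) = dv → (a, v) ∈ E →
          Linked n (2 * (p + 1) * n) τ l a v) := by
  refine Tri.seq (Tri.setVar ?_)
  refine (Tri.forLoop (N := d) (i₀ := 0) (fun i τ s => s ≤ 14 * i ∧ τ 30 0 = i ∧
    (∀ c, c ≠ 6 → c ≠ 7 → c ≠ 30 → c ≠ 34 → τ c = σ c) ∧
    Grows n (2 * (p + 1) * n) (4 * i) σ τ ∧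
    ∀ i' < i, (∀ b, (T b : ℕ) = du + θ l + i' + 1 → (u, b) ∈ E →
          Linked n (2 * (p + 1) * n) τ l u b) ∧
          (∀ a, (T a : ℕ) + (θ l + i' + 1) = dv → (a, v) ∈ E →
          Linked n (2 * (p + 1) * n) τ l a v)) ?_ ?_ (by omega) ?_).mono ?_
  · rintro i τ s ⟨_, h1, h2, _⟩
    exact ⟨h1, by simp [h2 25, h25]⟩
  · rintro i τ s hi ⟨hs, h1, h2, hg, hL⟩
    have g0 := h2 0 (by decide) (by decide) (by decide) (by decide)
    have g2 := h2 2 (by decide) (by decide) (by decide) (by decide)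
    have g3 := h2 3 (by decide) (by decide) (by decide) (by decide)
    have g4 := h2 4 (by decide) (by decide) (by decide) (by decide)
    have g21 := h2 21 (by decide) (by decide) (by decide) (by decide)
    have g22 := h2 22 (by decide) (by decide) (by decide) (by decide)
    have g29 := h2 29 (by decide) (by decide) (by decide) (by decide)
    have g36 := h2 36 (by decide) (by decide) (by decide) (by decide)
    have g37 := h2 37 (by decide) (by decide) (by decide) (by decide)
    have hθ : σ 3 l = θ l := hB.thr l (by omega)
    refine Tri.seq (Tri.setVar ?_)
    have ev : (Expr.cell 4 (var 36 + .cell 3 (var 29) + var 30 + .lit 1)).eval τ =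
        σ 4 (du + θ l + i + 1) := by
      simp [g4, g3, g36, g29, h1, h36, h29, hθ]
    rw [ev]
    set τ₁ := τ.write 34 0 (σ 4 (du + θ l + i + 1)) with hτ₁
    have w1 : ∀ c, c ≠ 34 → τ₁ c = τ c := fun c hc => Store.write_of_ne hc
    have w34 : τ₁ 34 0 = σ 4 (du + θ l + i + 1) := Store.write_same _ _ _ _
    have hg₁ : Grows n (2 * (p + 1) * n) 0 τ τ₁ :=
      Grows.congr (w1 6 (by decide)) (w1 7 (by decide)) hg.ok
    refine Tri.seq ((link_spec (l := 29) (a := 21) (b := 34) (n := n) (p := p)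
      (by rw [w1 0 (by decide), g0]; exact hB.size) (by rw [w1 0 (by decide), g0]; exact hB.lev)
      (by decide) (by decide) (by decide) (by rw [w1 29 (by decide), g29, h29]; exact hl)
      (by rw [w1 21 (by decide), g21, h21]; exact u.2) (by rw [w34]; exact hB.inv_lt _)
      hg₁.ok).frame.mono ?_)
    rintro τ₂ k₂ ⟨⟨hk₂, hg₂, hL₂⟩, fr₂⟩
    have f2 : ∀ c, c ≠ 6 → c ≠ 7 → τ₂ c = τ₁ c := fun c h6 h7 =>
      fr₂ c (by simp [linkCmd, appendCmd, Cmd.touches, h6, h7])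
    have f2' : ∀ c, c ≠ 6 → c ≠ 7 → c ≠ 34 → τ₂ c = τ c := fun c h6 h7 h34 => by
      rw [f2 c h6 h7, w1 c h34]
    have f30 := f2' 30 (by decide) (by decide) (by decide)
    have q0 := f2' 0 (by decide) (by decide) (by decide)
    have q2 := f2' 2 (by decide) (by decide) (by decide)
    have q3 := f2' 3 (by decide) (by decide) (by decide)
    have q4 := f2' 4 (by decide) (by decide) (by decide)
    have q29 := f2' 29 (by decide) (by decide) (by decide)
    have q37 := f2' 37 (by decide) (by decide) (by decide)
    have q22 := f2' 22 (by decide) (by decide) (by decide)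
    refine Tri.seq (Tri.setVar ?_)
    have ev₂ : (Expr.cell 4 (var 37 - (.cell 3 (var 29) + var 30 + .lit 1))).eval τ₂ =
        σ 4 (dv - (θ l + i + 1)) := by
      simp [q4, g4, q3, g3, q37, g37, q29, g29, f30, h1, h37, h29, hθ]
    rw [ev₂]
    set τ₃ := τ₂.write 34 0 (σ 4 (dv - (θ l + i + 1))) with hτ₃
    have w3 : ∀ c, c ≠ 34 → τ₃ c = τ₂ c := fun c hc => Store.write_of_ne hc
    have w334 : τ₃ 34 0 = σ 4 (dv - (θ l + i + 1)) := Store.write_same _ _ _ _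
    have hg₃ : Grows n (2 * (p + 1) * n) 0 τ₂ τ₃ :=
      Grows.congr (w3 6 (by decide)) (w3 7 (by decide)) hg₂.ok
    refine (link_spec (l := 29) (a := 34) (b := 22) (n := n) (p := p)
      (by rw [w3 0 (by decide), q0, g0]; exact hB.size)
      (by rw [w3 0 (by decide), q0, g0]; exact hB.lev)
      (by decide) (by decide) (by decide) (by rw [w3 29 (by decide), q29, g29, h29]; exact hl)
      (by rw [w334]; exact hB.inv_lt _) (by rw [w3 22 (by decide), q22, g22, h22]; exact v.2)
      hg₃.ok).frame.mono ?_
    rintro τ₄ k₄ ⟨⟨hk₄, hg₄, hL₄⟩, fr₄⟩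
    have f4 : ∀ c, c ≠ 6 → c ≠ 7 → c ≠ 34 → τ₄ c = τ c := fun c h6 h7 h34 => by
      rw [fr₄ c (by simp [linkCmd, appendCmd, Cmd.touches, h6, h7]), w3 c h34, f2' c h6 h7 h34]
    set τ₅ := τ₄.write 30 0 (i + 1) with hτ₅
    have w5 : ∀ c, c ≠ 30 → τ₅ c = τ₄ c := fun c hc => Store.write_of_ne hc
    have hg₅ : Grows n (2 * (p + 1) * n) 0 τ₄ τ₅ :=
      Grows.congr (w5 6 (by decide)) (w5 7 (by decide)) hg₄.ok
    refine ⟨by rw [f4 30 (by decide) (by decide) (by decide), h1], by omega,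
      Store.write_same _ _ _ _, fun c h6 h7 h30 h34 => ?_,
      ((((((hg.trans hg₁).trans hg₂).trans hg₃).trans hg₄).trans hg₅)).le (by omega), ?_⟩
    · rw [w5 c h30, f4 c h6 h7 h34, h2 c h6 h7 h30 h34]
    · intro i' hi'
      have hgg := (((hg₁.trans hg₂).trans hg₃).trans hg₄).trans hg₅
      rcases Nat.lt_succ_iff_lt_or_eq.1 hi' with h3 | h3
      · exact ⟨fun b hb he => hgg.linked hl u.2 b.2 ((hL i' h3).1 b hb he),
          fun a ha he => hgg.linked hl a.2 v.2 ((hL i' h3).2 a ha he)⟩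
      · subst h3
        constructor
        · intro b hb he
          rw [w34, ← hb, hB.inv_apply, w1 21 (by decide), g21, h21, w1 2 (by decide), g2,
            w1 29 (by decide), g29, h29] at hL₂
          exact ((hg₃.trans hg₄).trans hg₅).linked hl u.2 b.2 (hL₂ (hB.edge_ne_zero.2 he))
        · intro a ha he
          rw [w334, show dv - (θ l + i' + 1) = (T a : ℕ) by omega, hB.inv_apply,
            w3 22 (by decide), q22, g22, h22, w3 2 (by decide), q2, g2,
            w3 29 (by decide), q29, g29, h29] at hL₄
          exact hg₅.linked hl a.2 v.2 (hL₄ (hB.edge_ne_zero.2 he))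
  · refine ⟨by omega, Store.write_same _ _ _ _, fun c _ _ h _ => Store.write_of_ne h, ?_,
      fun i' hi' => by omega⟩
    exact Grows.congr (Store.write_of_ne (by decide)) (Store.write_of_ne (by decide)) hok
  · rintro τ s ⟨s₀, ⟨hs, _, h2, hg, hL⟩, rfl⟩
    exact ⟨by omega, hg, h2, hL⟩

/-- The edges that become shorter by an exchange are at the two exchanged vertices. -/
theorem near_after_swap {n : ℕ} {E : Finset (Fin n × Fin n)} {T : Equiv.Perm (Fin n)}
    {u v a b : Fin n} (hT : IsTopOrder E T) (hT' : IsTopOrder E (T * Equiv.swap u v))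
    (huv : (T u : ℕ) < (T v : ℕ)) (hab : (a, b) ∈ E) {s : ℕ}
    (h : dist (T * Equiv.swap u v) a b ≤ s) :
    dist T a b ≤ s ∨
      (a = u ∧ ∃ i < (T v : ℕ) - (T u : ℕ),
        ((T * Equiv.swap u v) b : ℕ) = (T u : ℕ) + s + i + 1) ∨
      (b = v ∧ ∃ i < (T v : ℕ) - (T u : ℕ),
        ((T * Equiv.swap u v) a : ℕ) + (s + i + 1) = (T v : ℕ)) := by
  have h1 : (T a : ℕ) < (T b : ℕ) := hT _ hab
  have h2 : ((T * Equiv.swap u v) a : ℕ) < ((T * Equiv.swap u v) b : ℕ) := hT' _ hab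
  rw [dist_of_le h2.le] at h
  rw [dist_of_le h1.le]
  simp only [Equiv.Perm.coe_mul, Function.comp_apply] at h h2 ⊢
  by_cases hau : a = u
  · subst hau
    by_cases hbv : b = v
    · subst hbv; simp at h2; omega
    · have hba : b ≠ a := fun e => by subst e; omega
      rw [Equiv.swap_apply_left, Equiv.swap_apply_of_ne_of_ne hba hbv] at h
      rw [Equiv.swap_apply_left, Equiv.swap_apply_of_ne_of_ne hba hbv] at h2
      rw [Equiv.swap_apply_of_ne_of_ne hba hbv]
      by_cases h3 : (T b : ℕ) - (T a : ℕ) ≤ s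
      · exact Or.inl h3
      · exact Or.inr (Or.inl ⟨rfl, (T b : ℕ) - (T a : ℕ) - s - 1, by omega, by omega⟩)
  · by_cases hbv : b = v
    · subst hbv
      have hab' : a ≠ b := fun e => by subst e; omega
      rw [Equiv.swap_apply_right, Equiv.swap_apply_of_ne_of_ne hau hab'] at h
      rw [Equiv.swap_apply_right, Equiv.swap_apply_of_ne_of_ne hau hab'] at h2
      rw [Equiv.swap_apply_of_ne_of_ne hau hab']
      by_cases h3 : (T b : ℕ) - (T a : ℕ) ≤ s
      · exact Or.inl h3
      · exact Or.inr (Or.inr ⟨rfl, (T b : ℕ) - (T a : ℕ) - s - 1, by omega, by omega⟩)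
    -- Edges that neither leave `u` nor enter `v` do not get shorter: `u` moves right and `v` moves
    -- left.
    · left
      by_cases hav : a = v
      · subst hav
        by_cases hbu : b = u
        · subst hbu; omega
        · rw [Equiv.swap_apply_right, Equiv.swap_apply_of_ne_of_ne hbu hbv] at h
          omega
      · rw [Equiv.swap_apply_of_ne_of_ne hau hav] at h
        by_cases hbu : b = u
        · subst hbu
          rw [Equiv.swap_apply_left] at h
          omega
        · rw [Equiv.swap_apply_of_ne_of_ne hbu hbv] at h
          omega

/-- By `near_after_swap` an edge that comes within a threshold through the exchange leaves `u` or
enters `v`, and its other end lies in the stretch scanned on that level. Nothing is removed from the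
lists: entries that are too far now are left for later searches to discard. -/
theorem swap_spec {n p : ℕ} {θ : ℕ → ℕ} {E : Finset (Fin n × Fin n)} {T : Equiv.Perm (Fin n)}
    {σ : Store} (hB : Base n p θ E T σ) {u v : Fin n} (hT : IsTopOrder E T)
    (hT' : IsTopOrder E (T * Equiv.swap u v)) (huv : (T u : ℕ) < (T v : ℕ))
    (h21 : σ 21 0 = u) (h22 : σ 22 0 = v) (h36 : σ 36 0 = (T u : ℕ)) (h37 : σ 37 0 = (T v : ℕ))
    (h25 : σ 25 0 = (T v : ℕ) - (T u : ℕ)) (hC : Complete n p θ E T σ)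
    (hok : ListsOK n (2 * (p + 1) * n) σ) :
    Tri swapCmd σ fun τ k => k ≤ 24 * ((p + 1) * ((T v : ℕ) - (T u : ℕ))) ∧
      Base n p θ E (T * Equiv.swap u v) τ ∧ Complete n p θ E (T * Equiv.swap u v) τ ∧
      ListsOK n (2 * (p + 1) * n) τ ∧ listTotal (2 * (p + 1) * n) τ ≤
        listTotal (2 * (p + 1) * n) σ + 4 * ((p + 1) * ((T v : ℕ) - (T u : ℕ))) := by
  set d := (T v : ℕ) - (T u : ℕ) with hd
  set K := 2 * (p + 1) * n with hK
  refine Tri.seq (Tri.assign (Tri.seq (Tri.assign (Tri.seq (Tri.assign (Tri.seq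
    (Tri.assign ?_)))))))
  have hτ : (((σ.write 1 (Expr.eval σ (var 21)) (Expr.eval σ (var 37))).write 1
      (Expr.eval (σ.write 1 (Expr.eval σ (var 21)) (Expr.eval σ (var 37))) (var 22))
      (Expr.eval (σ.write 1 (Expr.eval σ (var 21)) (Expr.eval σ (var 37))) (var 36)))) =
      (σ.write 1 u (T v : ℕ)).write 1 v (T u : ℕ) := by
    simp [Store.write_of_ne, h21, h22, h36, h37]
  rw [hτ]
  have hτ' : ∀ υ : Store, υ = (σ.write 1 u (T v : ℕ)).write 1 v (T u : ℕ) →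
      (υ.write 4 ((var 36).eval υ) ((var 22).eval υ)).write 4
        ((var 37).eval (υ.write 4 ((var 36).eval υ) ((var 22).eval υ)))
        ((var 21).eval (υ.write 4 ((var 36).eval υ) ((var 22).eval υ))) =
      (υ.write 4 (T u : ℕ) (v : ℕ)).write 4 (T v : ℕ) (u : ℕ) := by
    rintro υ rfl
    simp [Store.write_of_ne, h21, h22, h36, h37]
  rw [hτ' _ rfl]
  have hB' := hB.swap u v
  set τ := (((σ.write 1 u (T v : ℕ)).write 1 v (T u : ℕ)).write 4
      (T u : ℕ) (v : ℕ)).write 4 (T v : ℕ) (u : ℕ) with hτd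
  have e : ∀ a, a ≠ 1 → a ≠ 4 → τ a = σ a := fun a h1 h4 => by
    rw [hτd, Store.write_of_ne h4, Store.write_of_ne h4, Store.write_of_ne h1,
      Store.write_of_ne h1]
  set T' := T * Equiv.swap u v with hT'd
  refine Tri.seq (Tri.setVar ?_)
  have hg₀ : Grows n K 0 σ (τ.write 29 0 ((Expr.lit 0).eval τ)) :=
    Grows.congr (by rw [Store.write_of_ne (by decide), e 6 (by decide) (by decide)])
      (by rw [Store.write_of_ne (by decide), e 7 (by decide) (by decide)]) hok
  refine (Tri.forLoop (N := p + 1) (i₀ := 0) (fun i υ s => s ≤ (14 * d + 4) * i ∧ υ 29 0 = i ∧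
    (∀ c, c ≠ 6 → c ≠ 7 → c ≠ 29 → c ≠ 30 → c ≠ 34 → υ c = τ c) ∧
    Grows n K (4 * d * i) σ υ ∧
    ∀ l < i, ∀ i' < d, (∀ b, (T' b : ℕ) = (T u : ℕ) + θ l + i' + 1 → (u, b) ∈ E →
          Linked n K υ l u b) ∧
          (∀ a, (T' a : ℕ) + (θ l + i' + 1) = (T v : ℕ) → (a, v) ∈ E →
          Linked n K υ l a v)) ?_ ?_ (by omega) ?_).mono ?_
  · rintro i υ s ⟨_, h1, h2, _⟩
    refine ⟨h1, ?_⟩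
    have := hB'.lev
    simp [pE, h2 0, this]
  · rintro i υ s hi ⟨hs, h1, h2, hg, hL⟩
    have hBυ : Base n p θ E T' υ := hB'.congr (h2 0 (by decide) (by decide) (by decide) (by decide)
      (by decide)) (h2 1 (by decide) (by decide) (by decide) (by decide) (by decide))
      (h2 2 (by decide) (by decide) (by decide) (by decide) (by decide))
      (h2 3 (by decide) (by decide) (by decide) (by decide) (by decide))
      (h2 4 (by decide) (by decide) (by decide) (by decide) (by decide))
    have hv : ∀ c, c ≠ 6 → c ≠ 7 → c ≠ 29 → c ≠ 30 → c ≠ 34 → c ≠ 1 → c ≠ 4 → υ c = σ c :=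
      fun c a1 a2 a3 a4 a5 a6 a7 => by rw [h2 c a1 a2 a3 a4 a5, e c a6 a7]
    refine (swap_level_spec hBυ (u := u) (v := v) (du := T u) (dv := T v) (d := d) (l := i)
      (by omega) ?_ ?_ ?_ ?_ ?_ h1 hg.ok).mono ?_
    · rw [hv 21 (by decide) (by decide) (by decide) (by decide) (by decide) (by decide) (by decide)]
      exact h21
    · rw [hv 22 (by decide) (by decide) (by decide) (by decide) (by decide) (by decide) (by decide)]
      exact h22
    · rw [hv 25 (by decide) (by decide) (by decide) (by decide) (by decide) (by decide) (by decide)]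
      exact h25
    · rw [hv 36 (by decide) (by decide) (by decide) (by decide) (by decide) (by decide) (by decide)]
      exact h36
    · rw [hv 37 (by decide) (by decide) (by decide) (by decide) (by decide) (by decide) (by decide)]
      exact h37
    rintro ρ k ⟨hk, hg', hfr, hL'⟩
    have hc : Grows n K 0 ρ (ρ.write 29 0 (i + 1)) :=
      Grows.congr (Store.write_of_ne (by decide)) (Store.write_of_ne (by decide)) hg'.ok
    refine ⟨by rw [hfr 29 (by decide) (by decide) (by decide) (by decide), h1], ?_,
      Store.write_same _ _ _ _, fun c h6 h7 h29 h30 h34 => ?_,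
      ((hg.trans hg').trans hc).le ?_, fun l hl i' hi' => ?_⟩
    · rw [Nat.mul_succ]; omega
    · rw [Store.write_of_ne h29, hfr c h6 h7 h30 h34, h2 c h6 h7 h29 h30 h34]
    · rw [Nat.mul_succ]; omega
    · rcases Nat.lt_succ_iff_lt_or_eq.1 hl with h3 | h3
      · have := hL l h3 i' hi'
        exact ⟨fun b hb he => (hg'.trans hc).linked (by omega) u.2 b.2 (this.1 b hb he),
          fun a ha he => (hg'.trans hc).linked (by omega) a.2 v.2 (this.2 a ha he)⟩
      · subst h3
        have := hL' i' hi'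
        exact ⟨fun b hb he => hc.linked (by omega) u.2 b.2 (this.1 b hb he),
          fun a ha he => hc.linked (by omega) a.2 v.2 (this.2 a ha he)⟩
  · exact ⟨by omega, Store.write_same _ _ _ _, fun c _ _ h _ _ => Store.write_of_ne h, hg₀,
      fun l hl => by omega⟩
  · rintro υ s ⟨s₀, ⟨hs, _, h2, hg, hL⟩, rfl⟩
    refine ⟨?_, hB'.congr (h2 0 (by decide) (by decide) (by decide) (by decide)
      (by decide)) (h2 1 (by decide) (by decide) (by decide) (by decide) (by decide))
      (h2 2 (by decide) (by decide) (by decide) (by decide) (by decide))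
      (h2 3 (by decide) (by decide) (by decide) (by decide) (by decide))
      (h2 4 (by decide) (by decide) (by decide) (by decide) (by decide)), ?_, hg.ok, ?_⟩
    · have h3 : (14 * d + 4) * (p + 1) = 14 * ((p + 1) * d) + 4 * (p + 1) := by ring
      -- As the distance is at least 1, the overhead per level is absorbed by the term for the
      -- scanned places.
      have h4 : p + 1 ≤ (p + 1) * d := Nat.le_mul_of_pos_right _ (by omega)
      omega
    · intro l hl a b hab hdist
      rcases near_after_swap hT hT' huv hab hdist with h3 | ⟨rfl, i, hi, h3⟩ | ⟨rfl, i, hi, h3⟩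
      · exact hg.linked hl a.2 b.2 (hC l hl a b hab h3)
      · exact (hL l (by omega) i hi).1 b h3 hab
      · exact (hL l (by omega) i hi).2 a h3 hab
    · refine hg.total.trans (le_of_eq ?_)
      ring

/-! ### Collecting the neighbours of an end point -/

/-- `w` is a neighbour of the end point `x` of side `s`: an out-neighbour for `s = 0` and an
in-neighbour otherwise. -/
def Nbr {n : ℕ} (E : Finset (Fin n × Fin n)) (s : ℕ) (x w : Fin n) : Prop :=
  if s = 0 then (x, w) ∈ E else (w, x) ∈ E

/-- The position at distance `e` from the position `q` of the end point of side `s`. -/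
def posn (s q e : ℕ) : ℕ := if s = 0 then q + e else q - e

theorem Nbr.pos {n : ℕ} {E : Finset (Fin n × Fin n)} {T : Equiv.Perm (Fin n)}
    (hT : IsTopOrder E T) {s : ℕ} {x w : Fin n} (h : Nbr E s x w) :
    (T w : ℕ) = posn s (T x) (dist T x w) ∧ 0 < dist T x w := by
  unfold Nbr at h
  unfold posn dist Nat.dist
  split_ifs at h ⊢ with hs
  · have : (T x : ℕ) < (T w : ℕ) := hT _ h
    omega
  · have : (T w : ℕ) < (T x : ℕ) := hT _ h
    omega

theorem dist_posn {n : ℕ} {T : Equiv.Perm (Fin n)} {s e : ℕ} {x w : Fin n}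
    (h : (T w : ℕ) = posn s (T x) e) (he : s ≠ 0 → e ≤ (T x : ℕ)) : dist T x w = e := by
  unfold posn at h
  unfold dist Nat.dist
  split_ifs at h with hs
  · omega
  · have := he hs
    omega

theorem Base.inv_posn {n p : ℕ} {θ : ℕ → ℕ} {E : Finset (Fin n × Fin n)}
    {T : Equiv.Perm (Fin n)} {σ : Store} (h : Base n p θ E T σ) (hT : IsTopOrder E T) {s : ℕ}
    {x w : Fin n} (hw : Nbr E s x w) : σ 4 (posn s (T x) (dist T x w)) = w := by
  rw [← (hw.pos hT).1, h.inv_apply]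

theorem eval_posE {n p : ℕ} {θ : ℕ → ℕ} {E : Finset (Fin n × Fin n)}
    {T : Equiv.Perm (Fin n)} {σ : Store} (h : Base n p θ E T σ) {s : ℕ} (hs : s < 2) {x : Fin n}
    (hx : σ (21 + s) 0 = x) (e : Expr) : (posE s e).eval σ = posn s (T x) (e.eval σ) := by
  interval_cases s <;> simp_all [posE, posn, h.ord]

theorem eval_edgeE {n p : ℕ} {θ : ℕ → ℕ} {E : Finset (Fin n × Fin n)}
    {T : Equiv.Perm (Fin n)} {σ : Store} (h : Base n p θ E T σ) {s : ℕ} (hs : s < 2) {x w : Fin n}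
    (hx : σ (21 + s) 0 = x) (hw : σ 34 0 = w) : (edgeE s (var 34)).eval σ ≠ 0 ↔ Nbr E s x w := by
  interval_cases s
  · have h1 := h.edge_ne_zero (a := x) (b := w)
    simp_all [edgeE, Nbr, nE, h.size]
  · have h1 := h.edge_ne_zero (a := w) (b := x)
    simp_all [edgeE, Nbr, nE, h.size]

theorem eval_distE {n p : ℕ} {θ : ℕ → ℕ} {E : Finset (Fin n × Fin n)}
    {T : Equiv.Perm (Fin n)} {σ : Store} (h : Base n p θ E T σ) {s : ℕ} {x w : Fin n}
    (hx : σ (21 + s) 0 = x) (hw : σ 34 0 = w) : (distE s).eval σ = dist T x w := by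
  simp only [distE, eval_add, eval_sub, eval_cell, eval_var, hx, hw, h.ord, dist, Nat.dist]
  omega

/-- The array of side `s` contains the list `L`. -/
def Holds {n : ℕ} (σ : Store) (s : ℕ) (L : List (Fin n)) : Prop :=
  σ (27 + s) 0 = L.length ∧ ∀ j (h : j < L.length), σ (15 + s) j = L[j]

theorem Holds.congr {n : ℕ} {σ τ : Store} {s : ℕ} {L : List (Fin n)} (h : Holds σ s L)
    (h15 : τ (15 + s) = σ (15 + s)) (h27 : τ (27 + s) = σ (27 + s)) : Holds τ s L := by
  unfold Holds; rw [h15, h27]; exact h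

theorem take_spec {n s : ℕ} {σ : Store} {L : List (Fin n)} {w : Fin n}
    (hL : Holds σ s L) (hw : σ 34 0 = w) :
    Tri (takeCmd s) σ fun τ k => k = 2 ∧ Holds τ s (L ++ [w]) := by
  refine Tri.seq (Tri.assign (Tri.setVar ⟨rfl, ?_, ?_⟩))
  · rw [Store.write_same]
    simp [Store.write_of_ne (show 27 + s ≠ 15 + s by omega), hL.1]
  · intro j hj
    rw [Store.write_of_ne (show 15 + s ≠ 27 + s by omega), Store.write_apply]
    simp only [eval_var, hL.1, hw]
    split_ifs with h
    · subst h; simp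
    · have hlt : j < L.length := by simp at hj; omega
      rw [hL.2 j hlt, List.getElem_append_left hlt]

/-- `L` lists `x` and all `w` with `P w` and distance less than `i` from `x` in the order of their
distances from `x`. -/
structure Gathered {n : ℕ} (T : Equiv.Perm (Fin n)) (x : Fin n) (P : Fin n → Prop)
    (L : List (Fin n)) (i : ℕ) : Prop where
  sorted : L.Pairwise fun a b => dist T x a < dist T x b
  mem : ∀ w, w ∈ L ↔ w = x ∨ (P w ∧ dist T x w < i)

theorem Gathered.take {n : ℕ} {T : Equiv.Perm (Fin n)} {x : Fin n} {P : Fin n → Prop}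
    {L : List (Fin n)} {i : ℕ} (h : Gathered T x P L i) {z : Fin n} (hz : P z)
    (hi : dist T x z = i) (hi0 : 0 < i) (huniq : ∀ w, P w → dist T x w = i → w = z) :
    Gathered T x P (L ++ [z]) (i + 1) := by
  constructor
  · rw [List.pairwise_append]
    refine ⟨h.sorted, by simp, fun a ha b hb => ?_⟩
    rw [List.mem_singleton.1 hb, hi]
    rcases (h.mem a).1 ha with rfl | h1
    · simpa [dist, Nat.dist] using hi0
    · exact h1.2
  · intro w
    rw [List.mem_append, h.mem, List.mem_singleton]
    constructor
    · rintro ((h1 | h1) | rfl)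
      · exact Or.inl h1
      · exact Or.inr ⟨h1.1, by omega⟩
      · exact Or.inr ⟨hz, by omega⟩
    · rintro (h1 | ⟨h1, h2⟩)
      · exact Or.inl (Or.inl h1)
      · rcases Nat.lt_succ_iff_lt_or_eq.1 h2 with h3 | h3
        · exact Or.inl (Or.inr ⟨h1, h3⟩)
        · exact Or.inr (huniq w h1 h3)

theorem Gathered.pass {n : ℕ} {T : Equiv.Perm (Fin n)} {x : Fin n} {P : Fin n → Prop}
    {L : List (Fin n)} {i j : ℕ} (h : Gathered T x P L i) (hij : i ≤ j)
    (hno : ∀ w, P w → dist T x w < j → dist T x w < i) : Gathered T x P L j :=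
  ⟨h.sorted, fun w => by
    rw [h.mem]
    exact or_congr_right ⟨fun h1 => ⟨h1.1, by omega⟩, fun h1 => ⟨h1.1, hno w h1.1 h1.2⟩⟩⟩

theorem Nbr.eq_of_dist {n : ℕ} {E : Finset (Fin n × Fin n)} {T : Equiv.Perm (Fin n)}
    (hT : IsTopOrder E T) {s : ℕ} {x w w' : Fin n} (h : Nbr E s x w) (h' : Nbr E s x w')
    (hd : dist T x w = dist T x w') : w = w' := by
  have h1 := (h.pos hT).1
  have h2 := (h'.pos hT).1
  rw [hd, ← h2] at h1
  exact T.injective (Fin.ext h1)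

theorem wide_spec {n p s d : ℕ} {θ : ℕ → ℕ} {E : Finset (Fin n × Fin n)} {T : Equiv.Perm (Fin n)}
    {σ : Store} (hB : Base n p θ E T σ) (hT : IsTopOrder E T) (hs : s < 2) {x : Fin n}
    (hx : σ (21 + s) 0 = x) (hd : σ 25 0 = d) (hd0 : 1 ≤ d)
    (hd1 : s = 0 → (T x : ℕ) + d ≤ n) (hd2 : s ≠ 0 → d ≤ (T x : ℕ)) (hL : Holds σ s [x]) :
    Tri (wideCmd s) σ fun τ k => k ≤ 8 * d ∧
      ∃ L, Holds τ s L ∧ Gathered T x (Nbr E s x) L d := by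
  refine Tri.seq (Tri.setVar ?_)
  -- Distance 0 belongs to the end point itself, which is already in the list; the loop starts at 1,
  -- and the step bound is shifted by 8 accordingly.
  refine (Tri.forLoop (N := d) (i₀ := 1) (fun i τ k => k + 8 ≤ 8 * i ∧ τ 30 0 = i ∧ 1 ≤ i ∧
    (∀ c, c ≠ 15 + s → c ≠ 27 + s → c ≠ 30 → c ≠ 34 → τ c = σ c) ∧
    ∃ L, Holds τ s L ∧ Gathered T x (Nbr E s x) L i) ?_ ?_ hd0 ?_).mono ?_
  · rintro i τ k ⟨_, h1, _, h2, _⟩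
    refine ⟨h1, ?_⟩
    rw [eval_var, h2 25 (by omega) (by omega) (by decide) (by decide), hd]
  · rintro i τ k hi ⟨hk, h1, hi1, h2, L, hL, hG⟩
    have hBτ : Base n p θ E T τ := hB.congr
      (h2 0 (by omega) (by omega) (by decide) (by decide))
      (h2 1 (by omega) (by omega) (by decide) (by decide))
      (h2 2 (by omega) (by omega) (by decide) (by decide))
      (h2 3 (by omega) (by omega) (by decide) (by decide))
      (h2 4 (by omega) (by omega) (by decide) (by decide))
    have hxτ : τ (21 + s) 0 = x := by
      rw [h2 (21 + s) (by omega) (by omega) (by omega) (by omega), hx]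
    refine Tri.seq (Tri.setVar ?_)
    have hpos : posn s (T x) i < n := by
      unfold posn
      have := (T x).2
      split_ifs with h0
      · have := hd1 h0; omega
      · omega
    set z : Fin n := T.symm ⟨posn s (T x) i, hpos⟩ with hz
    have hTz : (T z : ℕ) = posn s (T x) i := by simp [hz]
    have hdz : dist T x z = i := dist_posn hTz fun h0 => by have := hd2 h0; omega
    have ev : (Expr.cell 4 (posE s (var 30))).eval τ = z := by
      rw [eval_cell, eval_posE hBτ hs hxτ, eval_var, h1, ← hTz, hBτ.inv_apply]
    rw [ev]
    set τ₁ := τ.write 34 0 (z : ℕ) with hτ₁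
    have w1 : ∀ c, c ≠ 34 → τ₁ c = τ c := fun c hc => Store.write_of_ne hc
    have w34 : τ₁ 34 0 = z := Store.write_same _ _ _ _
    have hB₁ : Base n p θ E T τ₁ := hBτ.congr (w1 0 (by decide)) (w1 1 (by decide))
      (w1 2 (by decide)) (w1 3 (by decide)) (w1 4 (by decide))
    have hL₁ : Holds τ₁ s L := hL.congr (w1 _ (by omega)) (w1 _ (by omega))
    have hx₁ : τ₁ (21 + s) 0 = x := by rw [w1 _ (by omega), hxτ]
    have hev := eval_edgeE hB₁ hs hx₁ w34
    refine Tri.cond (fun hb => ?_) (fun hb => Tri.skip ?_)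
    · refine (take_spec hL₁ w34).frame.mono ?_
      rintro τ₂ k₂ ⟨⟨rfl, hL₂⟩, hfr⟩
      have f2 : ∀ c, c ≠ 15 + s → c ≠ 27 + s → τ₂ c = τ₁ c := fun c h3 h4 =>
        hfr c (by simp [takeCmd, setVar, Cmd.touches, h3, h4])
      refine ⟨by rw [f2 30 (by omega) (by omega), w1 30 (by decide), h1], by omega,
        Store.write_same _ _ _ _, by omega, fun c c1 c2 c3 c4 => ?_, L ++ [z], ?_, ?_⟩
      · rw [Store.write_of_ne c3, f2 c c1 c2, w1 c c4, h2 c c1 c2 c3 c4]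
      · exact hL₂.congr (Store.write_of_ne (by omega)) (Store.write_of_ne (by omega))
      · have hN := hev.1 hb
        exact hG.take hN hdz hi1 fun w hw hdw => hw.eq_of_dist hT hN (by rw [hdw, hdz])
    · refine ⟨by rw [w1 30 (by decide), h1], by omega,
        Store.write_same _ _ _ _, by omega, fun c c1 c2 c3 c4 => ?_, L, ?_, ?_⟩
      · rw [Store.write_of_ne c3, w1 c c4, h2 c c1 c2 c3 c4]
      · exact hL₁.congr (Store.write_of_ne (by omega)) (Store.write_of_ne (by omega))
      · refine hG.pass (by omega) fun w hw hlt => ?_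
        rcases Nat.lt_succ_iff_lt_or_eq.1 hlt with h3 | h3
        · exact h3
        · exfalso
          have h4 := (hw.pos hT).1
          rw [h3, ← hTz] at h4
          obtain rfl : w = z := T.injective (Fin.ext h4)
          exact hev.2 hw hb
  · refine ⟨by omega, Store.write_same _ _ _ _, le_rfl, fun c _ _ h _ => Store.write_of_ne h, [x],
      hL.congr (Store.write_of_ne (by omega)) (Store.write_of_ne (by omega)), by simp, fun w => ?_⟩
    rw [List.mem_singleton, iff_self_or]
    intro h
    have := (h.1.pos hT).2
    omega
  · rintro τ k ⟨k₀, ⟨hk, _, _, _, hL⟩, rfl⟩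
    exact ⟨by omega, hL⟩

/-- Array `9` marks the distances from `i` on of the vertices with `P`. -/
def Marked {n : ℕ} (T : Equiv.Perm (Fin n)) (x : Fin n) (P : Fin n → Prop) (σ : Store) (i : ℕ) :
    Prop :=
  ∀ e, σ 9 e ≠ 0 ↔ i ≤ e ∧ ∃ w, P w ∧ dist T x w = e

/-- Array `10` marks the blocks, from the block `b` on, of the distances of the vertices with
`P`. -/
def MarkedBlocks {n : ℕ} (S : ℕ) (T : Equiv.Perm (Fin n)) (x : Fin n) (P : Fin n → Prop)
    (σ : Store) (b : ℕ) : Prop :=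
  ∀ e, σ 10 e ≠ 0 ↔ b ≤ e ∧ ∃ w, P w ∧ dist T x w / S = e

/-- The neighbours on level `l`. -/
def NearNbr {n : ℕ} (θ : ℕ → ℕ) (E : Finset (Fin n × Fin n)) (T : Equiv.Perm (Fin n))
    (s l : ℕ) (x w : Fin n) : Prop :=
  Nbr E s x w ∧ dist T x w ≤ θ l

/-- The tests discard outdated entries, and marking a distance twice has no effect, so duplicates
disappear as well. A near neighbour is determined by its distance, hence the marks describe exactly
the near set, already sorted. -/
theorem mark_spec {n p s l : ℕ} {θ : ℕ → ℕ} {E : Finset (Fin n × Fin n)}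
    {T : Equiv.Perm (Fin n)} {σ : Store} (hB : Base n p θ E T σ) (hs : s < 2)
    {x : Fin n} (hx : σ (21 + s) 0 = x) (hl : l ≤ p) (h26 : σ 26 0 = l)
    (hok : ListsOK n (2 * (p + 1) * n) σ)
    (hC : ∀ w, NearNbr θ E T s l x w → InList (2 * (p + 1) * n) σ (key n s l x) w)
    (h9 : ∀ e, σ 9 e = 0) (h10 : ∀ e, σ 10 e = 0) :
    Tri (markCmd s) σ fun τ k => k ≤ 7 * σ 6 (key n s l x) + 2 ∧
      (∀ c, c ≠ 9 → c ≠ 10 → c ≠ 31 → c ≠ 34 → τ c = σ c) ∧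
      Marked T x (NearNbr θ E T s l x) τ 0 ∧
      MarkedBlocks (θ 0) T x (NearNbr θ E T s l x) τ 0 := by
  set K := 2 * (p + 1) * n with hK
  set κ := key n s l x with hκ
  have hκK : κ < K := key_lt hs hl x.2
  refine Tri.seq (Tri.setVar ?_)
  refine (Tri.forLoop (N := σ 6 κ) (i₀ := 0) (fun i τ k => k ≤ 7 * i ∧ τ 31 0 = i ∧
    (∀ c, c ≠ 9 → c ≠ 10 → c ≠ 31 → c ≠ 34 → τ c = σ c) ∧
    (∀ e, τ 9 e ≠ 0 → ∃ w, NearNbr θ E T s l x w ∧ dist T x w = e) ∧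
    (∀ e, τ 10 e ≠ 0 → ∃ w, NearNbr θ E T s l x w ∧ dist T x w / θ 0 = e) ∧
    (∀ j < i, ∀ w : Fin n, σ 7 (j * K + κ) = w → NearNbr θ E T s l x w →
      τ 9 (dist T x w) ≠ 0 ∧ τ 10 (dist T x w / θ 0) ≠ 0)) ?_ ?_ (by omega) ?_).mono ?_
  · rintro i τ k ⟨_, h1, h2, _⟩
    refine ⟨h1, ?_⟩
    have e0 := h2 0 (by decide) (by decide) (by decide) (by decide)
    rw [eval_cell, eval_keyE (n := n) (by rw [e0]; exact hB.size),
      h2 6 (by decide) (by decide) (by decide) (by decide),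
      h2 26 (by decide) (by decide) (by decide) (by decide),
      h2 (21 + s) (by omega) (by omega) (by omega) (by omega), hx, h26]
  · rintro i τ k hi ⟨hk, h1, h2, m9, m10, hm⟩
    have e0 := h2 0 (by decide) (by decide) (by decide) (by decide)
    have e26 := h2 26 (by decide) (by decide) (by decide) (by decide)
    have ex := h2 (21 + s) (by omega) (by omega) (by omega) (by omega)
    have hBτ : Base n p θ E T τ := hB.congr e0
      (h2 1 (by decide) (by decide) (by decide) (by decide))
      (h2 2 (by decide) (by decide) (by decide) (by decide))
      (h2 3 (by decide) (by decide) (by decide) (by decide))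
      (h2 4 (by decide) (by decide) (by decide) (by decide))
    set z : Fin n := ⟨σ 7 (i * K + κ), hok κ hκK i hi⟩ with hz
    have ev : (Expr.cell 7 (var 31 * bucketsE + keyE (.lit s) (var 26) (var (21 + s)))).eval τ =
        z := by
      rw [eval_cell, eval_add, eval_mul, eval_var, eval_keyE hBτ.size,
        eval_bucketsE hBτ.size hBτ.lev, h1, ex, e26, hx, h26,
        h2 7 (by decide) (by decide) (by decide) (by decide)]
    refine Tri.seq (Tri.setVar ?_)
    rw [ev]
    set τ₁ := τ.write 34 0 (z : ℕ) with hτ₁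
    have w1 : ∀ c, c ≠ 34 → τ₁ c = τ c := fun c hc => Store.write_of_ne hc
    have w34 : τ₁ 34 0 = z := Store.write_same _ _ _ _
    have hB₁ : Base n p θ E T τ₁ := hBτ.congr (w1 0 (by decide)) (w1 1 (by decide))
      (w1 2 (by decide)) (w1 3 (by decide)) (w1 4 (by decide))
    have hx₁ : τ₁ (21 + s) 0 = x := by rw [w1 _ (by omega), ex, hx]
    have h26₁ : τ₁ 26 0 = l := by rw [w1 _ (by decide), e26, h26]
    have hev := eval_edgeE hB₁ hs hx₁ w34
    have hdv := eval_distE hB₁ hx₁ w34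
    have hskip : ¬ NearNbr θ E T s l x z → ∀ k', k' ≤ 5 → τ₁ 31 0 = i ∧
        k + k' + 2 ≤ 7 * (i + 1) ∧ (τ₁.write 31 0 (i + 1)) 31 0 = i + 1 ∧
        (∀ c, c ≠ 9 → c ≠ 10 → c ≠ 31 → c ≠ 34 → (τ₁.write 31 0 (i + 1)) c = σ c) ∧
        (∀ e, (τ₁.write 31 0 (i + 1)) 9 e ≠ 0 → ∃ w, NearNbr θ E T s l x w ∧ dist T x w = e) ∧
        (∀ e, (τ₁.write 31 0 (i + 1)) 10 e ≠ 0 →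
          ∃ w, NearNbr θ E T s l x w ∧ dist T x w / θ 0 = e) ∧
        (∀ j < i + 1, ∀ w : Fin n, σ 7 (j * K + κ) = w → NearNbr θ E T s l x w →
          (τ₁.write 31 0 (i + 1)) 9 (dist T x w) ≠ 0 ∧
          (τ₁.write 31 0 (i + 1)) 10 (dist T x w / θ 0) ≠ 0) := by
      intro hN k' hk'
      rw [Store.write_of_ne (show 9 ≠ 31 by decide), Store.write_of_ne (show 10 ≠ 31 by decide),
        w1 9 (by decide), w1 10 (by decide)]
      refine ⟨by rw [w1 31 (by decide), h1], by omega, Store.write_same _ _ _ _,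
        fun c c1 c2 c3 c4 => ?_, m9, m10, fun j hj w hw hNw => ?_⟩
      · rw [Store.write_of_ne c3, w1 c c4, h2 c c1 c2 c3 c4]
      · rcases Nat.lt_succ_iff_lt_or_eq.1 hj with h3 | h3
        · exact hm j h3 w hw hNw
        · subst h3
          exact absurd (by rwa [show z = w from Fin.ext hw]) hN
    refine Tri.cond (fun hb => Tri.cond (fun hb' => ?_) (fun hb' => Tri.skip ?_))
      (fun hb => Tri.skip ?_)
    · rw [eval_lt, hdv, eval_add, eval_cell, eval_var, h26₁, hB₁.thr l (by omega), eval_lit] at hb'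
      have hN : NearNbr θ E T s l x z := ⟨hev.1 hb, by
        by_contra hc
        exact hb' (if_neg (by omega))⟩
      refine Tri.seq (Tri.assign (Tri.assign ?_))
      rw [hdv, eval_lit]
      set τ₂ := τ₁.write 9 (dist T x z) 1 with hτ₂
      have w2 : ∀ c, c ≠ 9 → τ₂ c = τ₁ c := fun c hc => Store.write_of_ne hc
      have hB₂ : Base n p θ E T τ₂ := hB₁.congr (w2 0 (by decide)) (w2 1 (by decide))
        (w2 2 (by decide)) (w2 3 (by decide)) (w2 4 (by decide))
      have hdv₂ := eval_distE hB₂ (s := s) (x := x) (w := z) (by rw [w2 _ (by omega), hx₁])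
        (by rw [w2 _ (by decide), w34])
      rw [eval_div, hdv₂, eval_cell, eval_lit, hB₂.thr 0 (by omega), eval_lit]
      set τ₃ := τ₂.write 10 (dist T x z / θ 0) 1 with hτ₃
      have w3 : ∀ c, c ≠ 9 → c ≠ 10 → c ≠ 34 → τ₃ c = τ c := fun c c1 c2 c3 => by
        rw [hτ₃, Store.write_of_ne c2, w2 c c1, w1 c c3]
      have n9 : ∀ e, (τ₃.write 31 0 (i + 1)) 9 e = if e = dist T x z then 1 else τ 9 e :=
        fun e => by
          rw [Store.write_of_ne (by decide), hτ₃, Store.write_of_ne (by decide), hτ₂,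
            Store.write_apply, w1 9 (by decide)]
      have n10 : ∀ e, (τ₃.write 31 0 (i + 1)) 10 e = if e = dist T x z / θ 0 then 1 else τ 10 e :=
        fun e => by
          rw [Store.write_of_ne (by decide), hτ₃, Store.write_apply, w2 10 (by decide),
            w1 10 (by decide)]
      refine ⟨by rw [w3 31 (by decide) (by decide) (by decide), h1], by omega,
        Store.write_same _ _ _ _, fun c c1 c2 c3 c4 => ?_, fun e he => ?_, fun e he => ?_,
        fun j hj w hw hNw => ?_⟩
      · rw [Store.write_of_ne c3, w3 c c1 c2 c4, h2 c c1 c2 c3 c4]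
      · rw [n9] at he
        split_ifs at he with h3
        · exact ⟨z, hN, h3.symm⟩
        · exact m9 e he
      · rw [n10] at he
        split_ifs at he with h3
        · exact ⟨z, hN, h3.symm⟩
        · exact m10 e he
      · rw [n9, n10]
        rcases Nat.lt_succ_iff_lt_or_eq.1 hj with h3 | h3
        · have := hm j h3 w hw hNw
          constructor
          · split_ifs
            · exact one_ne_zero
            · exact this.1
          · split_ifs
            · exact one_ne_zero
            · exact this.2
        · subst h3
          rw [show w = z from (Fin.ext hw).symm]
          simp
    · rw [eval_lt, hdv, eval_add, eval_cell, eval_var, h26₁, hB₁.thr l (by omega), eval_lit] at hb'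
      refine hskip (fun hN => ?_) _ (by omega)
      have := hN.2
      rw [if_pos (by omega)] at hb'
      exact one_ne_zero hb'
    · exact hskip (fun hN => hev.2 hN.1 hb) _ (by omega)
  · rw [Store.write_of_ne (show 9 ≠ 31 by decide), Store.write_of_ne (show 10 ≠ 31 by decide)]
    exact ⟨by omega, Store.write_same _ _ _ _, fun c _ _ h _ => Store.write_of_ne h,
      fun e he => absurd (h9 e) he, fun e he => absurd (h10 e) he, fun j hj => by omega⟩
  · rintro τ k ⟨k₀, ⟨hk, _, h2, m9, m10, hm⟩, rfl⟩
    refine ⟨by omega, h2, fun e => ⟨fun h => ⟨by omega, m9 e h⟩, ?_⟩,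
      fun e => ⟨fun h => ⟨by omega, m10 e h⟩, ?_⟩⟩
    · rintro ⟨_, w, hw, rfl⟩
      obtain ⟨j, hj, hjw⟩ := hC w hw
      exact (hm j hj w hjw hw).1
    · rintro ⟨_, w, hw, rfl⟩
      obtain ⟨j, hj, hjw⟩ := hC w hw
      exact (hm j hj w hjw hw).2

theorem sweep_block_spec {n p s l b : ℕ} {θ : ℕ → ℕ} {E : Finset (Fin n × Fin n)}
    {T : Equiv.Perm (Fin n)} {σ : Store} (hB : Base n p θ E T σ) (hT : IsTopOrder E T)
    (hs : s < 2) {x : Fin n} (hx : σ (21 + s) 0 = x) (hl : l ≤ p) (h26 : σ 26 0 = l)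
    (hok : ListsOK n (2 * (p + 1) * n) σ) (h32 : σ 32 0 = b)
    (h9 : Marked T x (NearNbr θ E T s l x) σ (b * θ 0)) {L : List (Fin n)} (hL : Holds σ s L)
    (hG : Gathered T x (NearNbr θ E T s l x) L (b * θ 0)) :
    Tri (setVar 33 (.lit 0) ;;
      forLoop 33 (.cell 3 (.lit 0)) (
        .cond (.cell 9 (var 32 * .cell 3 (.lit 0) + var 33)) (
          .assign 9 (var 32 * .cell 3 (.lit 0) + var 33) (.lit 0) ;;
          setVar 34 (.cell 4 (posE s (var 32 * .cell 3 (.lit 0) + var 33))) ;;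
          takeCmd s ;; appendCmd s 26 (21 + s) 34) .skip)) σ fun τ k => k ≤ 9 * θ 0 + 2 ∧
      (∀ c, c ≠ 6 → c ≠ 7 → c ≠ 9 → c ≠ 15 + s → c ≠ 27 + s → c ≠ 33 → c ≠ 34 → τ c = σ c) ∧
      Marked T x (NearNbr θ E T s l x) τ (b * θ 0 + θ 0) ∧
      ∃ M, Holds τ s (L ++ M) ∧
        Gathered T x (NearNbr θ E T s l x) (L ++ M) (b * θ 0 + θ 0) ∧
        Grows n (2 * (p + 1) * n) M.length σ τ ∧
        ∀ w ∈ M, InList (2 * (p + 1) * n) τ (key n s l x) w := by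
  set K := 2 * (p + 1) * n with hK
  set κ := key n s l x with hκ
  have hκK : κ < K := key_lt hs hl x.2
  refine Tri.seq (Tri.setVar ?_)
  refine (Tri.forLoop (N := θ 0) (i₀ := 0) (fun i τ k => k ≤ 9 * i ∧ τ 33 0 = i ∧
    (∀ c, c ≠ 6 → c ≠ 7 → c ≠ 9 → c ≠ 15 + s → c ≠ 27 + s → c ≠ 33 → c ≠ 34 → τ c = σ c) ∧
    Marked T x (NearNbr θ E T s l x) τ (b * θ 0 + i) ∧
      ∃ M, Holds τ s (L ++ M) ∧ Gathered T x (NearNbr θ E T s l x) (L ++ M) (b * θ 0 + i) ∧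
        Grows n K M.length σ τ ∧ ∀ w ∈ M, InList K τ κ w) ?_ ?_ (by omega) ?_).mono ?_
  · rintro i τ k ⟨_, h1, h2, _⟩
    refine ⟨h1, ?_⟩
    rw [eval_cell, eval_lit, h2 3 (by decide) (by decide) (by decide) (by omega) (by omega)
      (by decide) (by decide), hB.thr 0 (by omega)]
  · rintro i τ k hi ⟨hk, h1, h2, m9, M, hH, hGM, hg, hin⟩
    have e0 := h2 0 (by decide) (by decide) (by decide) (by omega) (by omega) (by decide) (by decide)
    have e1 := h2 1 (by decide) (by decide) (by decide) (by omega) (by omega) (by decide) (by decide)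
    have e2 := h2 2 (by decide) (by decide) (by decide) (by omega) (by omega) (by decide) (by decide)
    have e3 := h2 3 (by decide) (by decide) (by decide) (by omega) (by omega) (by decide) (by decide)
    have e4 := h2 4 (by decide) (by decide) (by decide) (by omega) (by omega) (by decide) (by decide)
    have e26 := h2 26 (by decide) (by decide) (by decide) (by omega) (by omega) (by decide)
      (by decide)
    have e32 := h2 32 (by decide) (by decide) (by decide) (by omega) (by omega) (by decide)
      (by decide)
    have ex := h2 (21 + s) (by omega) (by omega) (by omega) (by omega) (by omega) (by omega)
      (by omega)
    have hBτ : Base n p θ E T τ := hB.congr e0 e1 e2 e3 e4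
    have hee : ∀ υ : Store, υ 32 = τ 32 → υ 3 = τ 3 → υ 33 = τ 33 →
        (var 32 * Expr.cell 3 (.lit 0) + var 33).eval υ = b * θ 0 + i := by
      intro υ a1 a2 a3
      simp only [eval_add, eval_mul, eval_var, eval_cell, eval_lit, a1, a2, a3, h1, e32, h32]
      rw [hBτ.thr 0 (by omega)]
    refine Tri.cond (fun hb => ?_) (fun hb => Tri.skip ?_)
    · rw [eval_cell, hee τ rfl rfl rfl] at hb
      obtain ⟨_, z, hz, hdz⟩ := (m9 _).1 hb
      have hpos := (hz.1.pos hT).2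
      refine Tri.seq (Tri.assign (Tri.seq (Tri.setVar ?_)))
      rw [hee τ rfl rfl rfl, eval_lit]
      set τ₁ := τ.write 9 (b * θ 0 + i) 0 with hτ₁
      have w1 : ∀ c, c ≠ 9 → τ₁ c = τ c := fun c hc => Store.write_of_ne hc
      have hB₁ : Base n p θ E T τ₁ := hBτ.congr (w1 0 (by decide)) (w1 1 (by decide))
        (w1 2 (by decide)) (w1 3 (by decide)) (w1 4 (by decide))
      rw [eval_cell, eval_posE hB₁ hs (x := x) (by rw [w1 _ (by omega), ex, hx]),
        hee τ₁ (w1 _ (by decide)) (w1 _ (by decide)) (w1 _ (by decide)), ← hdz,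
        hB₁.inv_posn hT hz.1]
      set τ₂ := τ₁.write 34 0 (z : ℕ) with hτ₂
      have w2 : ∀ c, c ≠ 9 → c ≠ 34 → τ₂ c = τ c := fun c hc hc' => by
        rw [hτ₂, Store.write_of_ne hc', w1 c hc]
      have hH₂ : Holds τ₂ s (L ++ M) := hH.congr (w2 _ (by omega) (by omega))
        (w2 _ (by omega) (by omega))
      have w34 : τ₂ 34 0 = z := Store.write_same _ _ _ _
      refine Tri.seq ((take_spec hH₂ w34).frame.mono ?_)
      rintro τ₃ k₃ ⟨⟨rfl, hH₃⟩, fr₃⟩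
      have w3 : ∀ c, c ≠ 15 + s → c ≠ 27 + s → τ₃ c = τ₂ c := fun c c1 c2 =>
        fr₃ c (by simp [takeCmd, setVar, Cmd.touches, c1, c2])
      have w3' : ∀ c, c ≠ 9 → c ≠ 34 → c ≠ 15 + s → c ≠ 27 + s → τ₃ c = τ c :=
        fun c c1 c2 c3 c4 => by rw [w3 c c3 c4, w2 c c1 c2]
      have hg₃ : Grows n K 0 τ τ₃ := Grows.congr (w3' 6 (by decide) (by decide) (by omega)
        (by omega)) (w3' 7 (by decide) (by decide) (by omega) (by omega)) hg.ok
      have v26 : τ₃ 26 0 = l := by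
        rw [w3' 26 (by decide) (by decide) (by omega) (by omega), e26, h26]
      have vx : τ₃ (21 + s) 0 = x := by
        rw [w3' (21 + s) (by omega) (by omega) (by omega) (by omega), ex, hx]
      have v34 : τ₃ 34 0 = z := by rw [w3 34 (by omega) (by omega), w34]
      have v0 := w3' 0 (by decide) (by decide) (by omega) (by omega)
      refine (append_spec (l := 26) (x := 21 + s) (w := 34) (n := n) (p := p)
        (by rw [v0]; exact hBτ.size) (by rw [v0]; exact hBτ.lev) hs (by decide) (by omega)
        (by rw [v26]; exact hl) (by rw [vx]; exact x.2) (by rw [v34]; exact z.2)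
        hg₃.ok).frame.mono ?_
      rintro τ₄ k₄ ⟨⟨rfl, hg₄, hin₄⟩, fr₄⟩
      rw [v26, vx, v34] at hin₄
      have w4 : ∀ c, c ≠ 6 → c ≠ 7 → τ₄ c = τ₃ c := fun c c1 c2 =>
        fr₄ c (by simp [appendCmd, Cmd.touches, c1, c2])
      have w4' : ∀ c, c ≠ 6 → c ≠ 7 → c ≠ 9 → c ≠ 34 → c ≠ 15 + s → c ≠ 27 + s → τ₄ c = τ c :=
        fun c c1 c2 c3 c4 c5 c6 => by rw [w4 c c1 c2, w3' c c3 c4 c5 c6]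
      have hg₅ : Grows n K 0 τ₄ (τ₄.write 33 0 (i + 1)) :=
        Grows.congr (Store.write_of_ne (by decide)) (Store.write_of_ne (by decide)) hg₄.ok
      refine ⟨?_, by omega, Store.write_same _ _ _ _, fun c c1 c2 c3 c4 c5 c6 c7 => ?_, ?_,
        M ++ [z], ?_, ?_, ?_, ?_⟩
      · rw [w4' 33 (by decide) (by decide) (by decide) (by decide) (by omega) (by omega), h1]
      · rw [Store.write_of_ne c6, w4' c c1 c2 c3 c7 c4 c5, h2 c c1 c2 c3 c4 c5 c6 c7]
      · intro e
        rw [Store.write_of_ne (by decide), w4 9 (by decide) (by decide),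
          w3 9 (by omega) (by omega), hτ₂, Store.write_of_ne (by decide), hτ₁, Store.write_apply]
        split_ifs with h3
        · subst h3
          simp
        · rw [m9]
          exact and_congr_left fun _ => by omega
      · rw [← List.append_assoc]
        exact hH₃.congr (by rw [Store.write_of_ne (by omega), w4 _ (by omega) (by omega)])
          (by rw [Store.write_of_ne (by omega), w4 _ (by omega) (by omega)])
      · rw [← List.append_assoc]
        exact hGM.take hz hdz (by omega) fun w hw hdw =>
          hw.1.eq_of_dist hT hz.1 (by rw [hdw, hdz])
      · rw [List.length_append]
        exact (((hg.trans hg₃).trans hg₄).trans hg₅).le (by simp)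
      · intro w hw
        rw [List.mem_append, List.mem_singleton] at hw
        refine hg₅.mono κ hκK _ ?_
        rcases hw with h3 | rfl
        · exact hg₄.mono κ hκK _ (hg₃.mono κ hκK _ (hin w h3))
        · exact hin₄
    · rw [eval_cell, hee τ rfl rfl rfl] at hb
      have hno : ∀ w, NearNbr θ E T s l x w → dist T x w ≠ b * θ 0 + i := fun w hw hdw =>
        (m9 _).2 ⟨le_rfl, w, hw, hdw⟩ hb
      have hg₅ : Grows n K 0 τ (τ.write 33 0 (i + 1)) :=
        Grows.congr (Store.write_of_ne (by decide)) (Store.write_of_ne (by decide)) hg.ok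
      refine ⟨h1, by omega, Store.write_same _ _ _ _, fun c c1 c2 c3 c4 c5 c6 c7 => ?_, ?_,
        M, ?_, ?_, (hg.trans hg₅).le (by omega), fun w hw => hg₅.mono κ hκK _ (hin w hw)⟩
      · rw [Store.write_of_ne c6, h2 c c1 c2 c3 c4 c5 c6 c7]
      · intro e
        rw [Store.write_of_ne (by decide), m9]
        refine and_congr_left ?_
        rintro ⟨w, hw, rfl⟩
        have := hno w hw
        omega
      · exact hH.congr (Store.write_of_ne (by omega)) (Store.write_of_ne (by omega))
      · refine hGM.pass (by omega) fun w hw hlt => ?_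
        have := hno w hw
        omega
  · refine ⟨by omega, Store.write_same _ _ _ _, fun c _ _ _ _ _ h _ => Store.write_of_ne h, ?_, [],
      ?_, ?_, ?_, by simp⟩
    · intro e
      rw [Store.write_of_ne (by decide), h9]; simp
    · rw [List.append_nil]
      exact hL.congr (Store.write_of_ne (by omega)) (Store.write_of_ne (by omega))
    · simpa using hG
    · exact Grows.congr (Store.write_of_ne (by decide)) (Store.write_of_ne (by decide)) hok
  · rintro τ k ⟨k₀, ⟨hk, _, h2, m9, hM⟩, rfl⟩
    exact ⟨by omega, h2, m9, hM⟩

theorem key_inj {n s s' l l' x x' : ℕ} (hs : s < 2) (hs' : s' < 2) (hx : x < n) (hx' : x' < n)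
    (h : key n s l x = key n s' l' x') : s = s' ∧ l = l' ∧ x = x' := by
  unfold key at h
  have h1 : ((2 * l + s) * n + x) % n = ((2 * l' + s') * n + x') % n := by rw [h]
  rw [Nat.mul_add_mod', Nat.mul_add_mod', Nat.mod_eq_of_lt hx, Nat.mod_eq_of_lt hx'] at h1
  have h2 : 2 * l + s = 2 * l' + s' :=
    Nat.eq_of_mul_eq_mul_right (by omega : 0 < n) (by omega : (2 * l + s) * n = (2 * l' + s') * n)
  omega

/-- The bucket is emptied and refilled with exactly the neighbours found. The list total therefore
loses the old length and regains only the number of vertices found, which pays for the preceding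
scan. The sweep also clears all marks, ready for the next search. -/
theorem sweep_spec {n p s l : ℕ} {θ : ℕ → ℕ} {E : Finset (Fin n × Fin n)}
    {T : Equiv.Perm (Fin n)} {σ : Store} (hB : Base n p θ E T σ) (hT : IsTopOrder E T)
    (hθ : 1 ≤ θ 0) (hs : s < 2) {x : Fin n} (hx : σ (21 + s) 0 = x) (hl : l ≤ p)
    (h26 : σ 26 0 = l) (hok : ListsOK n (2 * (p + 1) * n) σ)
    (h9 : Marked T x (NearNbr θ E T s l x) σ 0)
    (h10 : MarkedBlocks (θ 0) T x (NearNbr θ E T s l x) σ 0) (hL : Holds σ s [x]) :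
    Tri (sweepCmd s) σ fun τ k =>
      (∀ c, c ≠ 6 → c ≠ 7 → c ≠ 9 → c ≠ 10 → c ≠ 15 + s → c ≠ 27 + s → c ≠ 32 → c ≠ 33 →
        c ≠ 34 → τ c = σ c) ∧
      (∀ e, τ 9 e = 0) ∧ (∀ e, τ 10 e = 0) ∧ ListsOK n (2 * (p + 1) * n) τ ∧
      (∀ κ < 2 * (p + 1) * n, κ ≠ key n s l x → ∀ w, InList (2 * (p + 1) * n) σ κ w →
        InList (2 * (p + 1) * n) τ κ w) ∧
      ∃ M, Holds τ s ([x] ++ M) ∧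
        Gathered T x (NearNbr θ E T s l x) ([x] ++ M) (θ l + 1) ∧
        (∀ w ∈ M, InList (2 * (p + 1) * n) τ (key n s l x) w) ∧
        listTotal (2 * (p + 1) * n) τ + σ 6 (key n s l x) ≤
          listTotal (2 * (p + 1) * n) σ + M.length ∧
        k ≤ 4 * (θ l / θ 0 + 1) + 15 * (θ 0 * M.length) + 3 := by
  set K := 2 * (p + 1) * n with hK
  set κ := key n s l x with hκ
  have hκK : κ < K := key_lt hs hl x.2
  set N := θ l / θ 0 + 1 with hN
  have hNl : θ l < N * θ 0 := by
    have := Nat.div_add_mod (θ l) (θ 0)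
    have := Nat.mod_lt (θ l) (show 0 < θ 0 by omega)
    rw [hN, Nat.add_mul, mul_comm (θ l / θ 0)]
    omega
  refine Tri.seq (Tri.assign (Tri.seq (Tri.setVar ?_)))
  rw [eval_keyE hB.size, h26, hx]
  set σ₁ := σ.write 6 κ ((Expr.lit 0).eval σ) with hσ₁
  have w1 : ∀ c, c ≠ 6 → σ₁ c = σ c := fun c hc => Store.write_of_ne hc
  have w6 : ∀ i, σ₁ 6 i = if i = κ then 0 else σ 6 i := fun i => by
    rw [hσ₁, Store.write_apply, eval_lit]
  set σ₂ := σ₁.write 32 0 ((Expr.lit 0).eval σ₁) with hσ₂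
  have w2 : ∀ c, c ≠ 6 → c ≠ 32 → σ₂ c = σ c := fun c h h' => by
    rw [hσ₂, Store.write_of_ne h', w1 c h]
  have w26 : ∀ i, σ₂ 6 i = if i = κ then 0 else σ 6 i := fun i => by
    rw [hσ₂, Store.write_of_ne (by decide), w6]
  have w27 : σ₂ 7 = σ 7 := w2 7 (by decide) (by decide)
  have hok₂ : ListsOK n K σ₂ := by
    intro κ' hκ' j hj
    rw [w27]
    refine hok κ' hκ' j ?_
    rw [w26] at hj
    split_ifs at hj with h
    · omega
    · exact hj
  have htot : listTotal K σ₂ + σ 6 κ = listTotal K σ := by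
    have h3 := Finset.add_sum_erase (Finset.range K) (σ 6) (Finset.mem_range.2 hκK)
    have h4 := Finset.add_sum_erase (Finset.range K) (σ₂ 6) (Finset.mem_range.2 hκK)
    have h5 : ∑ i ∈ (Finset.range K).erase κ, σ₂ 6 i = ∑ i ∈ (Finset.range K).erase κ, σ 6 i :=
      Finset.sum_congr rfl fun i hi => by rw [w26, if_neg (Finset.ne_of_mem_erase hi)]
    rw [w26, if_pos rfl] at h4
    unfold listTotal
    omega
  refine (Tri.forLoop (N := N) (i₀ := 0) (fun b τ k => τ 32 0 = b ∧
    (∀ c, c ≠ 6 → c ≠ 7 → c ≠ 9 → c ≠ 10 → c ≠ 15 + s → c ≠ 27 + s → c ≠ 32 → c ≠ 33 →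
        c ≠ 34 → τ c = σ c) ∧ Marked T x (NearNbr θ E T s l x) τ (b * θ 0) ∧
    MarkedBlocks (θ 0) T x (NearNbr θ E T s l x) τ b ∧
    ∃ M, Holds τ s ([x] ++ M) ∧ Gathered T x (NearNbr θ E T s l x) ([x] ++ M) (b * θ 0) ∧
      (∀ w ∈ M, InList K τ κ w) ∧ Grows n K M.length σ₂ τ ∧
      k ≤ 4 * b + 15 * (θ 0 * M.length)) ?_ ?_ (Nat.zero_le _) ?_).mono ?_
  · rintro b τ k ⟨h1, h2, _⟩
    refine ⟨h1, ?_⟩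
    have e3 := h2 3 (by decide) (by decide) (by decide) (by decide) (by omega) (by omega)
      (by decide) (by decide) (by decide)
    have e26 := h2 26 (by decide) (by decide) (by decide) (by decide) (by omega) (by omega)
      (by decide) (by decide) (by decide)
    simp only [eval_add, eval_div, eval_cell, eval_lit, eval_var, e3, e26, h26]
    rw [hB.thr l (by omega), hB.thr 0 (by omega)]
  · rintro b τ k hb ⟨h1, h2, m9, m10, M, hH, hG, hin, hg, hk⟩
    have e0 := h2 0 (by decide) (by decide) (by decide) (by decide) (by omega) (by omega)
      (by decide) (by decide) (by decide)
    have e1 := h2 1 (by decide) (by decide) (by decide) (by decide) (by omega) (by omega)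
      (by decide) (by decide) (by decide)
    have e2 := h2 2 (by decide) (by decide) (by decide) (by decide) (by omega) (by omega)
      (by decide) (by decide) (by decide)
    have e3 := h2 3 (by decide) (by decide) (by decide) (by decide) (by omega) (by omega)
      (by decide) (by decide) (by decide)
    have e4 := h2 4 (by decide) (by decide) (by decide) (by decide) (by omega) (by omega)
      (by decide) (by decide) (by decide)
    have e26 := h2 26 (by decide) (by decide) (by decide) (by decide) (by omega) (by omega)
      (by decide) (by decide) (by decide)
    have ex := h2 (21 + s) (by omega) (by omega) (by omega) (by omega) (by omega) (by omega)
      (by omega) (by omega) (by omega)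
    have hBτ : Base n p θ E T τ := hB.congr e0 e1 e2 e3 e4
    refine Tri.cond (fun hc => Tri.seq (Tri.assign ?_)) (fun hc => Tri.skip ?_)
    · rw [eval_cell, eval_var, h1] at hc
      obtain ⟨_, z, hz, hdz⟩ := (m10 b).1 hc
      rw [eval_var, h1, eval_lit]
      set τ₁ := τ.write 10 b 0 with hτ₁
      have v1 : ∀ c, c ≠ 10 → τ₁ c = τ c := fun c hc => Store.write_of_ne hc
      have hg₁ : Grows n K 0 τ τ₁ :=
        Grows.congr (v1 6 (by decide)) (v1 7 (by decide)) hg.ok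
      refine (sweep_block_spec (hBτ.congr (v1 0 (by decide)) (v1 1 (by decide)) (v1 2 (by decide))
        (v1 3 (by decide)) (v1 4 (by decide))) hT hs (x := x) (l := l) (b := b)
        (by rw [v1 _ (by omega), ex, hx]) hl (by rw [v1 _ (by decide), e26, h26]) hg₁.ok
        (by rw [v1 _ (by decide), h1]) (by unfold Marked; rw [v1 9 (by decide)]; exact m9)
        (hH.congr (v1 _ (by omega)) (v1 _ (by omega))) hG).mono ?_
      rintro τ₂ k₂ ⟨hk₂, fr₂, m9₂, M', hH₂, hG₂, hg₂, hin₂⟩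
      -- A marked block contributes at least one new vertex, so its `θ 0` steps are charged to that
      -- vertex.
      have hM' : 1 ≤ M'.length := by
        rw [Nat.one_le_iff_ne_zero, ne_eq, List.length_eq_zero_iff]
        rintro rfl
        rw [List.append_nil] at hG₂
        have hzlt : dist T x z < b * θ 0 + θ 0 := by
          have := Nat.lt_div_mul_add (a := dist T x z) (show 0 < θ 0 by omega)
          rwa [hdz] at this
        have h3 := (hG.mem z).1 ((hG₂.mem z).2 (Or.inr ⟨hz, hzlt⟩))
        rcases h3 with rfl | ⟨_, h3⟩
        · have := (hz.1.pos hT).2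
          simp [dist, Nat.dist] at this
        · have := Nat.div_mul_le_self (dist T x z) (θ 0)
          rw [hdz] at this
          omega
      have hg₃ : Grows n K 0 τ₂ (τ₂.write 32 0 (b + 1)) :=
        Grows.congr (Store.write_of_ne (by decide)) (Store.write_of_ne (by decide)) hg₂.ok
      refine ⟨?_, Store.write_same _ _ _ _, fun c c1 c2 c3 c4 c5 c6 c7 c8 c9 => ?_, ?_, ?_,
        M ++ M', ?_, ?_, ?_, ?_, ?_⟩
      · rw [fr₂ 32 (by decide) (by decide) (by decide) (by omega) (by omega) (by decide)
          (by decide), v1 32 (by decide), h1]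
      · rw [Store.write_of_ne c7, fr₂ c c1 c2 c3 c5 c6 c8 c9, v1 c c4,
          h2 c c1 c2 c3 c4 c5 c6 c7 c8 c9]
      · unfold Marked
        rw [Store.write_of_ne (by decide), Nat.succ_mul]
        exact m9₂
      · intro e
        rw [Store.write_of_ne (by decide), fr₂ 10 (by decide) (by decide) (by decide) (by omega)
          (by omega) (by decide) (by decide), hτ₁, Store.write_apply]
        split_ifs with h3
        · subst h3; simp
        · rw [m10]
          exact and_congr_left fun _ => by omega
      · rw [← List.append_assoc]
        exact hH₂.congr (Store.write_of_ne (by omega)) (Store.write_of_ne (by omega))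
      · rw [← List.append_assoc, Nat.succ_mul]
        exact hG₂
      · intro w hw
        refine hg₃.mono κ hκK w ?_
        rcases List.mem_append.1 hw with h3 | h3
        · exact hg₂.mono κ hκK w (hg₁.mono κ hκK w (hin w h3))
        · exact hin₂ w h3
      · rw [List.length_append]
        exact (((hg.trans hg₁).trans hg₂).trans hg₃).le (by omega)
      · rw [List.length_append, Nat.mul_add (θ 0)]
        have : θ 0 ≤ θ 0 * M'.length := Nat.le_mul_of_pos_right _ (by omega)
        omega
    · rw [eval_cell, eval_var, h1] at hc
      have hno : ∀ w, NearNbr θ E T s l x w → dist T x w / θ 0 ≠ b := fun w hw hdw =>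
        (m10 b).2 ⟨le_rfl, w, hw, hdw⟩ hc
      have hno' : ∀ w, NearNbr θ E T s l x w → b * θ 0 ≤ dist T x w →
          (b + 1) * θ 0 ≤ dist T x w := fun w hw hle => by
        have h3 := (Nat.le_div_iff_mul_le (show 0 < θ 0 by omega)).2 hle
        have h4 := hno w hw
        exact (Nat.le_div_iff_mul_le (show 0 < θ 0 by omega)).1 (by omega)
      have hg₃ : Grows n K 0 τ (τ.write 32 0 (b + 1)) :=
        Grows.congr (Store.write_of_ne (by decide)) (Store.write_of_ne (by decide)) hg.ok
      refine ⟨h1, Store.write_same _ _ _ _, fun c c1 c2 c3 c4 c5 c6 c7 c8 c9 => ?_, ?_, ?_,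
        M, ?_, ?_, fun w hw => hg₃.mono κ hκK w (hin w hw), (hg.trans hg₃).le (by omega),
        by omega⟩
      · rw [Store.write_of_ne c7, h2 c c1 c2 c3 c4 c5 c6 c7 c8 c9]
      · intro e
        rw [Store.write_of_ne (by decide), m9]
        refine and_congr_left ?_
        rintro ⟨w, hw, rfl⟩
        refine ⟨fun h => hno' w hw h, fun h => le_trans (Nat.mul_le_mul_right _ (by omega)) h⟩
      · intro e
        rw [Store.write_of_ne (by decide), m10]
        refine and_congr_left ?_
        rintro ⟨w, hw, rfl⟩
        have := hno w hw
        omega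
      · exact hH.congr (Store.write_of_ne (by omega)) (Store.write_of_ne (by omega))
      · refine hG.pass (Nat.mul_le_mul_right _ (by omega)) fun w hw hlt => ?_
        by_contra hc'
        have := hno' w hw (by omega)
        omega
  · refine ⟨Store.write_same _ _ _ _, fun c c1 c2 c3 c4 c5 c6 c7 c8 c9 => w2 c c1 c7, ?_, ?_, [],
      ?_, ?_, by simp, Grows.refl hok₂, by simp⟩
    · unfold Marked
      rw [w2 9 (by decide) (by decide), zero_mul]; exact h9
    · unfold MarkedBlocks
      rw [w2 10 (by decide) (by decide)]; exact h10
    · exact hL.congr (w2 _ (by omega) (by omega)) (w2 _ (by omega) (by omega))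
    · exact ⟨by simp, fun w => by simp⟩
  · rintro τ k ⟨k₀, ⟨_, h2, m9, m10, M, hH, hG, hin, hg, hk⟩, rfl⟩
    refine ⟨h2, fun e => ?_, fun e => ?_, hg.ok, fun κ' hκ' hne w hw => ?_, M, hH,
      ⟨hG.sorted, fun w => ?_⟩, hin, ?_, by omega⟩
    · by_contra h
      obtain ⟨h3, w, hw, rfl⟩ := (m9 e).1 h
      have := hw.2
      omega
    · by_contra h
      obtain ⟨h3, w, hw, rfl⟩ := (m10 e).1 h
      have := Nat.div_le_div_right (c := θ 0) hw.2
      omega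
    · refine hg.mono κ' hκ' w ?_
      obtain ⟨j, hj, hjw⟩ := hw
      exact ⟨j, by rw [w26, if_neg hne]; exact hj, by rw [w27]; exact hjw⟩
    · rw [hG.mem]
      refine or_congr_right (and_congr_right fun hw => ?_)
      have := hw.2
      omega
    · have := hg.total
      omega

/-- `L` lists `x` and the elements of `A` in the order of their distances from `x`. -/
structure Listed {n : ℕ} (T : Equiv.Perm (Fin n)) (x : Fin n) (A : Finset (Fin n))
    (L : List (Fin n)) : Prop where
  sorted : L.Pairwise fun a b => dist T x a < dist T x b
  mem : ∀ w, w ∈ L ↔ w = x ∨ w ∈ A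

/-- The data structure between the operations. -/
structure Struct (n p : ℕ) (θ : ℕ → ℕ) (E : Finset (Fin n × Fin n)) (T : Equiv.Perm (Fin n))
    (σ : Store) : Prop where
  base : Base n p θ E T σ
  ok : ListsOK n (2 * (p + 1) * n) σ
  complete : Complete n p θ E T σ
  marks : ∀ e, σ 9 e = 0
  blocks : ∀ e, σ 10 e = 0

theorem Struct.congr {n p : ℕ} {θ : ℕ → ℕ} {E : Finset (Fin n × Fin n)}
    {T : Equiv.Perm (Fin n)} {σ τ : Store} (h : Struct n p θ E T σ)
    (hc : ∀ c ≤ 10, τ c = σ c) : Struct n p θ E T τ := by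
  refine ⟨h.base.congr (hc 0 (by decide)) (hc 1 (by decide)) (hc 2 (by decide)) (hc 3 (by decide))
    (hc 4 (by decide)), h.ok.congr (hc 6 (by decide)) (hc 7 (by decide)), ?_,
    by rw [hc 9 (by decide)]; exact h.marks, by rw [hc 10 (by decide)]; exact h.blocks⟩
  intro l hl a b hab hd
  have := h.complete l hl a b hab hd
  exact ⟨(InList.congr (hc 6 (by decide)) (hc 7 (by decide))).2 this.1,
    (InList.congr (hc 6 (by decide)) (hc 7 (by decide))).2 this.2⟩

theorem Struct.inList {n p : ℕ} {θ : ℕ → ℕ} {E : Finset (Fin n × Fin n)}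
    {T : Equiv.Perm (Fin n)} {σ : Store} (h : Struct n p θ E T σ) {s l : ℕ} (hs : s < 2)
    (hl : l ≤ p) {x w : Fin n} (hw : NearNbr θ E T s l x w) :
    InList (2 * (p + 1) * n) σ (key n s l x) w := by
  obtain ⟨h1, h2⟩ := hw
  unfold Nbr at h1
  interval_cases s
  · exact (h.complete l hl x w h1 h2).1
  · exact (h.complete l hl w x h1 (by rwa [dist, Nat.dist_comm])).2

theorem near_side_spec {n p s d : ℕ} {θ : ℕ → ℕ} {E : Finset (Fin n × Fin n)}
    {T : Equiv.Perm (Fin n)} {σ : Store} (hS : Struct n p θ E T σ) (hT : IsTopOrder E T)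
    (hs : s < 2) {x : Fin n} (hx : σ (21 + s) 0 = x) (hd : σ 25 0 = d) (hd0 : 1 ≤ d)
    (hd1 : s = 0 → (T x : ℕ) + d ≤ n) (hd2 : s ≠ 0 → d ≤ (T x : ℕ)) (h38 : σ 38 0 ≠ 0)
    {A : Finset (Fin n)} (hA : ∀ w, w ∈ A ↔ Nbr E s x w ∧ dist T x w < d) :
    Tri (sideCmd s) σ fun τ k => k ≤ 8 * d + 3 ∧ Struct n p θ E T τ ∧
      listTotal (2 * (p + 1) * n) τ = listTotal (2 * (p + 1) * n) σ ∧
      ∃ L, Holds τ s L ∧ Listed T x A L := by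
  refine Tri.seq (Tri.assign (Tri.seq (Tri.setVar (Tri.cond (fun _ => ?_) (fun h => ?_)))))
  · rw [eval_lit, eval_var, hx, eval_lit]
    set τ := (σ.write (15 + s) 0 (x : ℕ)).write (27 + s) 0 1 with hτ
    have w1 : ∀ c, c ≠ 15 + s → c ≠ 27 + s → τ c = σ c := fun c h h' => by
      rw [hτ, Store.write_of_ne h', Store.write_of_ne h]
    have hS₁ : Struct n p θ E T τ := hS.congr fun c hc => w1 c (by omega) (by omega)
    refine (wide_spec hS₁.base hT hs (x := x) (d := d)
      (by rw [w1 _ (by omega) (by omega), hx]) (by rw [w1 _ (by omega) (by omega), hd]) hd0 hd1 hd2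
      ⟨Store.write_same _ _ _ _, fun j hj => ?_⟩).frame.mono ?_
    · obtain rfl : j = 0 := by simpa using hj
      rw [hτ, Store.write_of_ne (by omega), Store.write_same]; rfl
    · rintro υ k ⟨⟨hk, L, hL, hG⟩, hfr⟩
      have f : ∀ c ≤ 10, υ c = τ c := fun c hc => hfr c (by
        have : c ≠ 30 ∧ c ≠ 34 ∧ c ≠ 15 + s ∧ c ≠ 27 + s := by omega
        simp [wideCmd, forLoop, takeCmd, setVar, Cmd.touches, this])
      refine ⟨by omega, hS₁.congr f, ?_, L, hL, hG.sorted, fun w => by rw [hG.mem, hA]⟩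
      exact listTotal_congr (by rw [f 6 (by decide), w1 6 (by omega) (by omega)])
  · exfalso
    rw [eval_var, Store.write_of_ne (by omega), Store.write_of_ne (by omega)] at h
    exact h38 h

/-- Scanning the old bucket takes at most 7 steps per entry, and these entries are dropped; hence
the weight 7 of the list total. Refilling costs that weight again, so the coefficient per vertex
found is 15 + 7 = 22. The term `8 * c` is the wide search, which takes place only if the near set is
empty and the flag is not set. -/
theorem far_side_spec {n p s l d : ℕ} {θ : ℕ → ℕ} {E : Finset (Fin n × Fin n)}
    {T : Equiv.Perm (Fin n)} {σ : Store} (hS : Struct n p θ E T σ) (hT : IsTopOrder E T)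
    (hθ : 1 ≤ θ 0) (hs : s < 2) {x : Fin n} (hx : σ (21 + s) 0 = x) (hd : σ 25 0 = d) (hd0 : 1 ≤ d)
    (hd1 : s = 0 → (T x : ℕ) + d ≤ n) (hd2 : s ≠ 0 → d ≤ (T x : ℕ)) (h38 : σ 38 0 = 0)
    (hl : l ≤ p) (h26 : σ 26 0 = l) {f : Bool} (hf : σ (23 + s) 0 = if f then 1 else 0)
    {near wide A : Finset (Fin n)} {c : ℕ}
    (hnear : ∀ w, w ∈ near ↔ Nbr E s x w ∧ dist T x w ≤ θ l)
    (hwide : ∀ w, w ∈ wide ↔ Nbr E s x w ∧ dist T x w < d)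
    (hA : PicksSide near wide f d A c) :
    Tri (sideCmd s) σ fun τ k => Struct n p θ E T τ ∧
      ∃ L, Holds τ s L ∧ Listed T x A L ∧
      k + 7 * listTotal (2 * (p + 1) * n) τ ≤ 7 * listTotal (2 * (p + 1) * n) σ +
        4 * (θ l / θ 0 + 1) + 22 * (θ 0 * (L.length - 1)) + 8 * c + 12 := by
  set K := 2 * (p + 1) * n with hK
  refine Tri.seq (Tri.assign (Tri.seq (Tri.setVar (Tri.cond (fun h => ?_) (fun _ => ?_)))))
  · exfalso
    rw [eval_var, Store.write_of_ne (by omega), Store.write_of_ne (by omega)] at h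
    exact h h38
  rw [eval_lit, eval_var, hx, eval_lit]
  set τ := (σ.write (15 + s) 0 (x : ℕ)).write (27 + s) 0 1 with hτ
  have w1 : ∀ c, c ≠ 15 + s → c ≠ 27 + s → τ c = σ c := fun c h h' => by
    rw [hτ, Store.write_of_ne h', Store.write_of_ne h]
  have hS₁ : Struct n p θ E T τ := hS.congr fun c hc => w1 c (by omega) (by omega)
  have hH₁ : Holds τ s [x] := ⟨Store.write_same _ _ _ _, fun j hj => by
    obtain rfl : j = 0 := by simpa using hj
    rw [hτ, Store.write_of_ne (by omega), Store.write_same]; rfl⟩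
  refine Tri.seq ((mark_spec hS₁.base hs (x := x) (l := l)
    (by rw [w1 _ (by omega) (by omega), hx]) hl (by rw [w1 _ (by omega) (by omega), h26]) hS₁.ok
    (fun w hw => hS₁.inList hs hl hw) hS₁.marks hS₁.blocks).mono ?_)
  rintro τ₂ k₂ ⟨hk₂, fr₂, m9, m10⟩
  have v2 : ∀ c, c ≠ 9 → c ≠ 10 → c ≠ 31 → c ≠ 34 → c ≠ 15 + s → c ≠ 27 + s → τ₂ c = σ c :=
    fun c c1 c2 c3 c4 c5 c6 => by rw [fr₂ c c1 c2 c3 c4, w1 c c5 c6]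
  have hB₂ : Base n p θ E T τ₂ := hS.base.congr
    (v2 0 (by decide) (by decide) (by decide) (by decide) (by omega) (by omega))
    (v2 1 (by decide) (by decide) (by decide) (by decide) (by omega) (by omega))
    (v2 2 (by decide) (by decide) (by decide) (by decide) (by omega) (by omega))
    (v2 3 (by decide) (by decide) (by decide) (by decide) (by omega) (by omega))
    (v2 4 (by decide) (by decide) (by decide) (by decide) (by omega) (by omega))
  have e6 := v2 6 (by decide) (by decide) (by decide) (by decide) (by omega) (by omega)
  have e7 := v2 7 (by decide) (by decide) (by decide) (by decide) (by omega) (by omega)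
  rw [w1 6 (by omega) (by omega)] at hk₂
  refine Tri.seq ((sweep_spec hB₂ hT hθ hs (x := x) (l := l)
    (by rw [v2 _ (by omega) (by omega) (by omega) (by omega) (by omega) (by omega), hx]) hl
    (by rw [v2 _ (by omega) (by omega) (by omega) (by omega) (by omega) (by omega), h26])
    (hS.ok.congr e6 e7) m9 m10
    (hH₁.congr (fr₂ _ (by omega) (by omega) (by omega) (by omega))
      (fr₂ _ (by omega) (by omega) (by omega) (by omega)))).mono ?_)
  rintro τ₃ k₃ ⟨fr₃, z9, z10, hok₃, hoth, M, hH₃, hG₃, hin, htot, hk₃⟩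
  rw [e6, listTotal_congr e6, ← hK] at htot
  have v3 : ∀ c, c ≠ 6 → c ≠ 7 → c ≠ 9 → c ≠ 10 → c ≠ 31 → c ≠ 32 → c ≠ 33 → c ≠ 34 →
      c ≠ 15 + s → c ≠ 27 + s → τ₃ c = σ c :=
    fun c c1 c2 c3 c4 c5 c6 c7 c8 c9 c10 => by
      rw [fr₃ c c1 c2 c3 c4 c9 c10 c6 c7 c8, v2 c c3 c4 c5 c8 c9 c10]
  have hB₃ : Base n p θ E T τ₃ := hB₂.congr
    (fr₃ 0 (by omega) (by omega) (by omega) (by omega) (by omega) (by omega) (by omega) (by omega)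
      (by omega))
    (fr₃ 1 (by omega) (by omega) (by omega) (by omega) (by omega) (by omega) (by omega) (by omega)
      (by omega))
    (fr₃ 2 (by omega) (by omega) (by omega) (by omega) (by omega) (by omega) (by omega) (by omega)
      (by omega))
    (fr₃ 3 (by omega) (by omega) (by omega) (by omega) (by omega) (by omega) (by omega) (by omega)
      (by omega))
    (fr₃ 4 (by omega) (by omega) (by omega) (by omega) (by omega) (by omega) (by omega) (by omega)
      (by omega))
  have hnM : ∀ w, w ∈ M ↔ w ∈ near := by
    intro w
    have h1 := hG₃.mem w
    have hnd : ([x] ++ M).Nodup := hG₃.sorted.imp fun {a b} h e => by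
      rw [e] at h; exact lt_irrefl _ h
    have hx' : x ∉ M := by
      exact fun h => (List.nodup_append.1 hnd).2.2 x (by simp) x h rfl
    have hxn : x ∉ near := fun h => by
      have := (((hnear x).1 h).1.pos hT).2
      simp [dist, Nat.dist] at this
    rw [hnear]
    simp only [List.singleton_append, List.mem_cons] at h1
    by_cases hwx : w = x
    · subst hwx
      rw [hnear] at hxn
      exact iff_of_false hx' hxn
    · simp only [hwx, false_or] at h1
      rw [h1]
      exact ⟨fun h => h.1, fun h => ⟨h, by have := h.2; omega⟩⟩
  -- The emptied bucket has lost entries, but every neighbour that is still near was put back, and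
  -- the other buckets keep theirs; so the lists remain complete.
  have hin' : ∀ κ' < K, ∀ w : Fin n, ∀ s' l', ∀ x' : Fin n, s' < 2 → κ' = key n s' l' x' →
      NearNbr θ E T s' l' x' w → InList K σ κ' w → InList K τ₃ κ' w := by
    rintro κ' hκ' w s' l' x' hs' rfl hw hI
    by_cases hkk : key n s' l' x' = key n s l x
    · obtain ⟨rfl, rfl, h3⟩ := key_inj hs' hs x'.2 x.2 hkk
      obtain rfl : x' = x := Fin.ext h3
      exact hin w ((hnM w).2 ((hnear w).2 hw))
    · exact hoth _ hκ' hkk w ((InList.congr e6 e7).2 hI)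
  have hS₃ : Struct n p θ E T τ₃ := by
    refine ⟨hB₃, hok₃, fun l' hl' a b hab hdist => ?_, z9, z10⟩
    have h1 := hS.complete l' hl' a b hab hdist
    exact ⟨hin' _ (key_lt (by decide) hl' a.2) b 0 l' a (by decide) rfl
      ⟨by simpa [Nbr] using hab, hdist⟩ h1.1,
      hin' _ (key_lt (by decide) hl' b.2) a 1 l' b (by decide) rfl
      ⟨by simpa [Nbr] using hab, by rwa [dist, Nat.dist_comm]⟩ h1.2⟩
  have hlen : τ₃ (27 + s) 0 = M.length + 1 := by
    rw [hH₃.1]; simp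
  have hθM : 15 * (θ 0 * M.length) + 7 * M.length ≤ 22 * (θ 0 * M.length) := by
    have : M.length ≤ θ 0 * M.length := Nat.le_mul_of_pos_left _ (by omega)
    omega
  have hdone : A = near → c = 0 → ∀ k', k' ≤ 4 → Struct n p θ E T τ₃ ∧
      ∃ L, Holds τ₃ s L ∧ Listed T x A L ∧
      1 + (1 + (1 + (k₂ + (k₃ + k')))) + 7 * listTotal K τ₃ ≤ 7 * listTotal K σ +
        4 * (θ l / θ 0 + 1) + 22 * (θ 0 * (L.length - 1)) + 8 * c + 12 := by
    rintro rfl rfl k' hk'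
    refine ⟨hS₃, [x] ++ M, hH₃, ⟨hG₃.sorted, fun w => ?_⟩, ?_⟩
    · rw [← hnM]; simp
    · have : ([x] ++ M).length - 1 = M.length := by simp
      rw [this]
      omega
  refine Tri.cond (fun hb => Tri.cond (fun hb' => Tri.skip ?_) (fun hb' => ?_))
    (fun hb => Tri.skip ?_)
  · rw [eval_var, v3 _ (by omega) (by omega) (by omega) (by omega) (by omega) (by omega) (by omega)
      (by omega) (by omega) (by omega), hf] at hb'
    have hft : f = true := by by_contra h; simp [h] at hb'
    rcases hA with ⟨_, h1, h2⟩ | ⟨_, h1, _⟩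
    · exact hdone h1 h2 _ (by omega)
    · rw [hft] at h1; exact absurd h1 (by decide)
  · rw [eval_var, v3 _ (by omega) (by omega) (by omega) (by omega) (by omega) (by omega) (by omega)
      (by omega) (by omega) (by omega), hf] at hb'
    have hff : f = false := by by_contra h; simp [h] at hb'
    have hM0 : M = [] := by
      rw [eval_eq, eval_var, hlen, eval_lit] at hb
      by_contra h
      have := List.length_pos_iff.2 h
      exact hb (if_neg (by omega))
    subst hM0
    have hne : near = ∅ := Finset.eq_empty_of_forall_notMem fun w hw => by
      simpa using (hnM w).2 hw
    have hA' : A = wide ∧ c = d := by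
      rcases hA with ⟨h1, _, _⟩ | ⟨_, _, h1⟩
      · rcases h1 with h1 | h1
        · exact absurd hne h1
        · rw [hff] at h1; exact absurd h1 (by decide)
      · exact h1
    obtain ⟨rfl, rfl⟩ := hA'
    refine (wide_spec hB₃ hT hs (x := x) (d := c)
      (by rw [v3 _ (by omega) (by omega) (by omega) (by omega) (by omega) (by omega) (by omega)
        (by omega) (by omega) (by omega), hx])
      (by rw [v3 _ (by omega) (by omega) (by omega) (by omega) (by omega) (by omega) (by omega)
        (by omega) (by omega) (by omega), hd]) hd0 hd1 hd2 hH₃).frame.mono ?_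
    rintro υ k ⟨⟨hk, L, hL, hG⟩, hfr⟩
    have fυ : ∀ c ≤ 10, υ c = τ₃ c := fun c hc => hfr c (by
      have : c ≠ 30 ∧ c ≠ 34 ∧ c ≠ 15 + s ∧ c ≠ 27 + s := by omega
      simp [wideCmd, forLoop, takeCmd, setVar, Cmd.touches, this])
    refine ⟨hS₃.congr fυ, L, hL, ⟨hG.sorted, fun w => by rw [hG.mem, hwide]⟩, ?_⟩
    rw [listTotal_congr (fυ 6 (by decide))]
    simp only [List.length_nil, mul_zero, add_zero] at htot hk₃
    omega
  · rw [eval_eq, eval_var, hlen, eval_lit] at hb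
    have hM0 : M ≠ [] := by
      rintro rfl
      simp at hb
    have hne : near ≠ ∅ := by
      obtain ⟨w, hw⟩ := List.exists_mem_of_ne_nil M hM0
      exact Finset.ne_empty_of_mem ((hnM w).1 hw)
    rcases hA with ⟨_, h1, h2⟩ | ⟨h1, _⟩
    · exact hdone h1 h2 _ (by omega)
    · exact absurd h1 hne

/-! ### The stack of calls -/

/-- The stack contains the calls of `r`, the last one on top. -/
structure Stack {n : ℕ} (σ : Store) (r : List (Call n)) : Prop where
  height : σ 20 0 = r.length
  u : ∀ j (h : j < r.length), σ 11 j = (r[j].u : ℕ)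
  v : ∀ j (h : j < r.length), σ 12 j = (r[j].v : ℕ)
  f₁ : ∀ j (h : j < r.length), σ 13 j = if r[j].f₁ then 1 else 0
  f₂ : ∀ j (h : j < r.length), σ 14 j = if r[j].f₂ then 1 else 0

theorem Stack.congr {n : ℕ} {σ τ : Store} {r : List (Call n)} (h : Stack σ r)
    (h20 : τ 20 = σ 20) (h11 : τ 11 = σ 11) (h12 : τ 12 = σ 12) (h13 : τ 13 = σ 13)
    (h14 : τ 14 = σ 14) : Stack τ r := by
  constructor
  · rw [h20]; exact h.height
  · rw [h11]; exact h.u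
  · rw [h12]; exact h.v
  · rw [h13]; exact h.f₁
  · rw [h14]; exact h.f₂

theorem Stack.pop {n : ℕ} {σ : Store} {r r' : List (Call n)} (h : Stack σ (r ++ r')) {x : ℕ}
    (hx : x = r.length) : Stack (σ.write 20 0 x) r := by
  have w : ∀ c, c ≠ 20 → (σ.write 20 0 x) c = σ c := fun c hc => Store.write_of_ne hc
  have hj : ∀ j, j < r.length → j < (r ++ r').length := fun j hj => by simp; omega
  refine ⟨by rw [Store.write_same, hx], fun j hj' => ?_, fun j hj' => ?_, fun j hj' => ?_,
    fun j hj' => ?_⟩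
  · rw [w 11 (by decide), h.u j (hj j hj'), List.getElem_append_left hj']
  · rw [w 12 (by decide), h.v j (hj j hj'), List.getElem_append_left hj']
  · rw [w 13 (by decide), h.f₁ j (hj j hj'), List.getElem_append_left hj']
  · rw [w 14 (by decide), h.f₂ j (hj j hj'), List.getElem_append_left hj']

theorem push_spec {n : ℕ} {σ : Store} {r : List (Call n)} (h : Stack σ r) {c : Call n}
    (hu : σ 15 (σ 31 0) = c.u) (hv : σ 16 (σ 32 0) = c.v)
    (h₁ : (if σ 31 0 + σ 27 0 = 1 then 1 else 0) = if c.f₁ then 1 else 0)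
    (h₂ : (if σ 32 0 + σ 28 0 = 1 then 1 else 0) = if c.f₂ then 1 else 0) :
    Tri pushCmd σ fun τ k => k = 5 ∧ Stack τ (r ++ [c]) := by
  refine Tri.seq (Tri.assign (Tri.seq (Tri.assign (Tri.seq (Tri.assign (Tri.seq
    (Tri.assign (Tri.setVar ⟨rfl, ?_⟩))))))))
  simp only [eval_var, eval_cell, eval_eq, eval_add, eval_lit,
    Store.write_of_ne (show (16 : ℕ) ≠ 11 by decide),
    Store.write_of_ne (show (20 : ℕ) ≠ 11 by decide), Store.write_of_ne (show (20 : ℕ) ≠ 12 by decide),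
    Store.write_of_ne (show (20 : ℕ) ≠ 13 by decide), Store.write_of_ne (show (20 : ℕ) ≠ 14 by decide),
    Store.write_of_ne (show (31 : ℕ) ≠ 11 by decide), Store.write_of_ne (show (31 : ℕ) ≠ 12 by decide),
    Store.write_of_ne (show (27 : ℕ) ≠ 11 by decide), Store.write_of_ne (show (27 : ℕ) ≠ 12 by decide),
    Store.write_of_ne (show (32 : ℕ) ≠ 11 by decide), Store.write_of_ne (show (32 : ℕ) ≠ 12 by decide),
    Store.write_of_ne (show (28 : ℕ) ≠ 11 by decide), Store.write_of_ne (show (28 : ℕ) ≠ 12 by decide),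
    Store.write_of_ne (show (32 : ℕ) ≠ 13 by decide), Store.write_of_ne (show (28 : ℕ) ≠ 13 by decide),
    hu, hv, h₁, h₂, h.height]
  constructor
  · rw [Store.write_same]; simp
  all_goals intro j hj
  · rw [Store.write_of_ne (by decide), Store.write_of_ne (by decide), Store.write_of_ne (by decide),
      Store.write_of_ne (by decide), Store.write_apply]
    split_ifs with h3
    · subst h3; simp
    · have hj' : j < r.length := by simp at hj; omega
      rw [h.u j hj', List.getElem_append_left hj']
  · rw [Store.write_of_ne (by decide), Store.write_of_ne (by decide), Store.write_of_ne (by decide),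
      Store.write_apply, Store.write_of_ne (by decide)]
    split_ifs with h3
    · subst h3; simp
    · have hj' : j < r.length := by simp at hj; omega
      rw [h.v j hj', List.getElem_append_left hj']
  · rw [Store.write_of_ne (by decide), Store.write_of_ne (by decide), Store.write_apply,
      Store.write_of_ne (by decide), Store.write_of_ne (by decide)]
    by_cases h3 : j = r.length
    · subst h3; simp
    · have hj' : j < r.length := by simp at hj; omega
      rw [if_neg h3, h.f₁ j hj', List.getElem_append_left hj']
  · rw [Store.write_of_ne (by decide), Store.write_apply, Store.write_of_ne (by decide),
      Store.write_of_ne (by decide), Store.write_of_ne (by decide)]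
    by_cases h3 : j = r.length
    · subst h3; simp
    · have hj' : j < r.length := by simp at hj; omega
      rw [if_neg h3, h.f₂ j hj', List.getElem_append_left hj']

/-- A loop that stops at the first failure computes the filter, because in a sorted list the
property passes from an element to all earlier ones. -/
theorem filter_eq_take {α : Type*} {P : α → Bool} {R : α → α → Prop} {l : List α} {j : ℕ}
    (hl : l.Pairwise R) (hR : ∀ a b, R a b → P b = true → P a = true)
    (h₁ : ∀ a ∈ l.take j, P a = true) (h₂ : ∀ h : j < l.length, P l[j] = false) :
    l.filter P = l.take j := by
  have h3 : l.filter P = (l.take j).filter P ++ (l.drop j).filter P := by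
    rw [← List.filter_append, List.take_append_drop]
  suffices h4 : (l.drop j).filter P = [] by
    rw [h3, List.filter_eq_self.2 h₁, h4, List.append_nil]
  rw [List.filter_eq_nil_iff]
  intro a ha
  by_cases hj : j < l.length
  · have h4 := h₂ hj
    have h5 : (l.drop j).Pairwise R := hl.drop
    rw [List.drop_eq_getElem_cons hj] at ha h5
    rcases List.mem_cons.1 ha with rfl | ha
    · simp [h4]
    · intro h6
      have := hR _ _ ((List.pairwise_cons.1 h5).1 a ha) h6
      rw [h4] at this
      exact absurd this (by decide)
  · rw [List.drop_eq_nil_of_le (by omega)] at ha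
    simp at ha

theorem level_spec {n p d i : ℕ} {θ : ℕ → ℕ} {E : Finset (Fin n × Fin n)}
    {T : Equiv.Perm (Fin n)} {σ : Store} (hB : Base n p θ E T σ) (hd : σ 25 0 = d) (hi : i ≤ p)
    (h₁ : ∀ j ≤ i, θ j < d) (h₂ : d ≤ θ (i + 1)) :
    Tri levelCmd σ fun τ k => k ≤ 2 * p + 2 ∧ τ 26 0 = i := by
  refine Tri.seq (Tri.setVar ?_)
  refine (Tri.loop (fun τ k => k = 2 * τ 26 0 ∧ τ 26 0 ≤ i ∧ τ 3 = σ 3 ∧ τ 25 = σ 25)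
    (fun τ => i - τ 26 0) ?_ ?_).mono ?_
  · rintro τ k ⟨hk, h3, h4, h5⟩ hb
    refine Tri.setVar ?_
    have hlt : τ 26 0 < i := by
      by_contra hc
      have h6 : τ 26 0 = i := by omega
      apply hb
      simp only [eval_lt, eval_cell, eval_add, eval_var, eval_lit, h4, h5, h6, hd]
      rw [hB.thr (i + 1) (by omega), if_neg (by omega)]
    simp only [eval_add, eval_var, eval_lit, Store.write_same]
    exact ⟨⟨by omega, by omega, by rw [Store.write_of_ne (by decide), h4],
      by rw [Store.write_of_ne (by decide), h5]⟩, by omega⟩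
  · simp only [eval_lit, Store.write_same]
    exact ⟨trivial, by omega, Store.write_of_ne (by decide), Store.write_of_ne (by decide)⟩
  · rintro τ k ⟨hb, k₀, ⟨hk, h3, h4, h5⟩, rfl⟩
    have : τ 26 0 = i := by
      by_contra hc
      simp only [eval_lt, eval_cell, eval_add, eval_var, eval_lit, h4, h5, hd] at hb
      rw [hB.thr _ (by omega), if_pos (h₁ _ (by omega))] at hb
      exact one_ne_zero hb
    exact ⟨by omega, this⟩

theorem pop_spec {n p : ℕ} {θ : ℕ → ℕ} {E : Finset (Fin n × Fin n)}
    {T : Equiv.Perm (Fin n)} {σ : Store} (hB : Base n p θ E T σ) {r : List (Call n)} {c : Call n}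
    (hr : Stack σ (r ++ [c])) :
    Tri popCmd σ fun τ k => k = 9 ∧ Stack τ r ∧ τ 21 0 = c.u ∧ τ 22 0 = c.v ∧
      (τ 23 0 = if c.f₁ then 1 else 0) ∧ (τ 24 0 = if c.f₂ then 1 else 0) ∧
      τ 36 0 = (T c.u : ℕ) ∧ τ 37 0 = (T c.v : ℕ) ∧ τ 25 0 = (T c.v : ℕ) - (T c.u : ℕ) ∧
      (τ 38 0 = if (T c.v : ℕ) - (T c.u : ℕ) ≤ θ 0 then 1 else 0) := by
  have hh : σ 20 0 = r.length + 1 := by rw [hr.height]; simp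
  have g11 : σ 11 r.length = c.u := by rw [hr.u r.length (by simp)]; simp
  have g12 : σ 12 r.length = c.v := by rw [hr.v r.length (by simp)]; simp
  have g13 : σ 13 r.length = if c.f₁ then 1 else 0 := by rw [hr.f₁ r.length (by simp)]; simp
  have g14 : σ 14 r.length = if c.f₂ then 1 else 0 := by rw [hr.f₂ r.length (by simp)]; simp
  refine Tri.seq (Tri.setVar ?_)
  have e1 : (var 20 - Expr.lit 1).eval σ = r.length := by
    simp only [eval_sub, eval_var, eval_lit, hh]; omega
  rw [e1]
  have hr₁ := hr.pop (x := r.length) rfl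
  set σ₁ := σ.write 20 0 r.length with hσ₁
  have w : ∀ c, c ≠ 20 → σ₁ c = σ c := fun c hc => Store.write_of_ne hc
  have w20 : σ₁ 20 0 = r.length := Store.write_same _ _ _ _
  refine Tri.seq (Tri.setVar (Tri.seq (Tri.setVar (Tri.seq (Tri.setVar (Tri.seq (Tri.setVar
    (Tri.seq (Tri.setVar (Tri.seq (Tri.setVar (Tri.seq (Tri.setVar (Tri.setVar ?_))))))))))))))
  have h3 := hB.thr 0 (by omega)
  have hu := hB.ord c.u
  have hv := hB.ord c.v
  refine ⟨rfl, hr₁.congr ?_ ?_ ?_ ?_ ?_, ?_⟩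
  iterate 5 simp [Store.write_of_ne]
  simp [Store.write_of_ne, Store.write_same, w, w20, g11, g12, g13, g14, hu, hv, h3]

theorem spawn_inner_spec {n p i : ℕ} {θ : ℕ → ℕ} {E : Finset (Fin n × Fin n)}
    {T : Equiv.Perm (Fin n)} {σ : Store} (hB : Base n p θ E T σ) {r : List (Call n)}
    (hr : Stack σ r) {LA LB : List (Fin n)} (hA : Holds σ 0 LA) (hB' : Holds σ 1 LB)
    (hLB : LB.Pairwise fun a b => (T b : ℕ) < (T a : ℕ)) (h31 : σ 31 0 = i) (hi : i < LA.length)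
    {mk : Fin n → Call n} (hmk : ∀ v', (mk v').u = LA[i] ∧ (mk v').v = v')
    (hf₁ : ∀ v', (if i + LA.length = 1 then 1 else 0) = if (mk v').f₁ then 1 else 0)
    (hf₂ : ∀ j (h : j < LB.length), (if j + LB.length = 1 then 1 else 0) =
      if (mk LB[j]).f₂ then 1 else 0) :
    Tri (setVar 32 (.lit 0) ;;
      .loop (.bin .lt (var 32) (var 28) *
        .bin .lt (.cell 1 (.cell 15 (var 31))) (.cell 1 (.cell 16 (var 32)))) (
      pushCmd ;; setVar 32 (var 32 + .lit 1))) σ fun τ k =>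
      (∀ c, c ≠ 11 → c ≠ 12 → c ≠ 13 → c ≠ 14 → c ≠ 20 → c ≠ 32 → τ c = σ c) ∧
      Stack τ (r ++ (LB.filter fun v' => T LA[i] < T v').map mk) ∧
      k ≤ 7 * (LB.filter fun v' => T LA[i] < T v').length + 2 := by
  refine Tri.seq (Tri.setVar ?_)
  have hbe : ∀ τ : Store, ∀ j, (∀ c, c ≠ 11 → c ≠ 12 → c ≠ 13 → c ≠ 14 → c ≠ 20 → c ≠ 32 →
      τ c = σ c) → τ 32 0 = j →
      ((Expr.bin .lt (var 32) (var 28) * Expr.bin .lt (.cell 1 (.cell 15 (var 31)))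
        (.cell 1 (.cell 16 (var 32)))).eval τ ≠ 0 ↔
      ∃ h : j < LB.length, (T LA[i] : ℕ) < (T LB[j] : ℕ)) := by
    intro τ j hfr hj
    have e28 := hfr 28 (by decide) (by decide) (by decide) (by decide) (by decide) (by decide)
    have e1 := hfr 1 (by decide) (by decide) (by decide) (by decide) (by decide) (by decide)
    have e15 := hfr 15 (by decide) (by decide) (by decide) (by decide) (by decide) (by decide)
    have e16 := hfr 16 (by decide) (by decide) (by decide) (by decide) (by decide) (by decide)
    have e31 := hfr 31 (by decide) (by decide) (by decide) (by decide) (by decide) (by decide)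
    have hl : σ 28 0 = LB.length := hB'.1
    have ha : σ 15 i = LA[i] := hA.2 i hi
    simp only [eval_mul, eval_lt, eval_var, eval_cell, e28, e1, e15, e16, e31, hj, h31, hl, ha]
    by_cases hjl : j < LB.length
    · have hb : σ 16 j = LB[j] := hB'.2 j hjl
      rw [hb, hB.ord, hB.ord, if_pos hjl, one_mul]
      simp [hjl]
    · simp [hjl]
  refine (Tri.loop (fun τ k => ∃ j ≤ LB.length, τ 32 0 = j ∧ k = 7 * j ∧
    (∀ c, c ≠ 11 → c ≠ 12 → c ≠ 13 → c ≠ 14 → c ≠ 20 → c ≠ 32 → τ c = σ c) ∧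
    Stack τ (r ++ (LB.take j).map mk) ∧ ∀ a ∈ LB.take j, (T LA[i] : ℕ) < (T a : ℕ))
    (fun τ => LB.length - τ 32 0) ?_ ?_).mono ?_
  · rintro τ k ⟨j, hj, h32, hk, hfr, hst, hall⟩ hb
    obtain ⟨hjl, hlt⟩ := (hbe τ j hfr h32).1 hb
    have e27 := hfr 27 (by decide) (by decide) (by decide) (by decide) (by decide) (by decide)
    have e28 := hfr 28 (by decide) (by decide) (by decide) (by decide) (by decide) (by decide)
    have e15 := hfr 15 (by decide) (by decide) (by decide) (by decide) (by decide) (by decide)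
    have e16 := hfr 16 (by decide) (by decide) (by decide) (by decide) (by decide) (by decide)
    have e31 := hfr 31 (by decide) (by decide) (by decide) (by decide) (by decide) (by decide)
    have hlA : σ 27 0 = LA.length := hA.1
    have hlB : σ 28 0 = LB.length := hB'.1
    have ha : σ 15 i = LA[i] := hA.2 i hi
    have hb : σ 16 j = LB[j] := hB'.2 j hjl
    refine Tri.seq ((push_spec hst (c := mk LB[j]) ?_ ?_ ?_ ?_).frame.mono ?_)
    · rw [e15, e31, h31, ha, (hmk _).1]
    · rw [e16, h32, hb, (hmk _).2]
    · rw [e31, h31, e27, hlA]; exact hf₁ _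
    · rw [h32, e28, hlB]; exact hf₂ j hjl
    rintro τ₁ k₁ ⟨⟨rfl, hst₁⟩, fr₁⟩
    have e32 : τ₁ 32 = τ 32 := fr₁ 32 (by decide)
    refine Tri.setVar ?_
    have : (var 32 + Expr.lit 1).eval τ₁ = j + 1 := by simp [e32, h32]
    rw [this]
    refine ⟨⟨j + 1, hjl, Store.write_same _ _ _ _, by omega, fun c c1 c2 c3 c4 c5 c6 => ?_, ?_, ?_⟩,
      ?_⟩
    · rw [Store.write_of_ne c6, fr₁ c (by simp [pushCmd, setVar, Cmd.touches, c1, c2, c3, c4, c5]),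
        hfr c c1 c2 c3 c4 c5 c6]
    · rw [List.take_add_one, List.getElem?_eq_getElem hjl, List.map_append, ← List.append_assoc]
      exact hst₁.congr (Store.write_of_ne (by decide)) (Store.write_of_ne (by decide))
        (Store.write_of_ne (by decide)) (Store.write_of_ne (by decide))
        (Store.write_of_ne (by decide))
    · intro a ha
      rw [List.take_add_one, List.getElem?_eq_getElem hjl, List.mem_append] at ha
      rcases ha with ha | ha
      · exact hall a ha
      · obtain rfl : a = LB[j] := by simpa using ha
        exact hlt
    · rw [Store.write_same, h32]; omega
  · exact ⟨0, by omega, Store.write_same _ _ _ _, rfl,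
      fun c _ _ _ _ _ h => Store.write_of_ne h, by
        simpa using hr.congr (Store.write_of_ne (by decide)) (Store.write_of_ne (by decide))
          (Store.write_of_ne (by decide)) (Store.write_of_ne (by decide))
          (Store.write_of_ne (by decide)), by simp⟩
  · rintro τ k ⟨hb, k₀, ⟨j, hj, h32, hk, hfr, hst, hall⟩, rfl⟩
    have h1 : (LB.filter fun v' => T LA[i] < T v') = LB.take j := by
      refine filter_eq_take hLB (fun a b hab hb => ?_) (fun a ha => ?_) fun hjl => ?_
      · rw [decide_eq_true_eq, Fin.lt_def] at hb ⊢
        omega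
      · rw [decide_eq_true_eq]
        exact hall a ha
      · rw [decide_eq_false_iff_not]
        intro h
        exact (hbe τ j hfr h32).2 ⟨hjl, h⟩ hb
    rw [h1]
    refine ⟨hfr, hst, ?_⟩
    rw [List.length_take]
    omega

theorem spawn_spec {n p : ℕ} {θ : ℕ → ℕ} {E : Finset (Fin n × Fin n)}
    {T : Equiv.Perm (Fin n)} {σ : Store} (hB : Base n p θ E T σ) {r : List (Call n)}
    (hr : Stack σ r) {LA LB : List (Fin n)} (hA : Holds σ 0 LA) (hB' : Holds σ 1 LB)
    (hLB : LB.Pairwise fun a b => (T b : ℕ) < (T a : ℕ))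
    {mk : Fin n → Fin n → Call n} (hmk : ∀ u' v', (mk u' v').u = u' ∧ (mk u' v').v = v')
    (hf₁ : ∀ i (h : i < LA.length), ∀ v',
      (if i + LA.length = 1 then 1 else 0) = if (mk LA[i] v').f₁ then 1 else 0)
    (hf₂ : ∀ u', ∀ j (h : j < LB.length), (if j + LB.length = 1 then 1 else 0) =
      if (mk u' LB[j]).f₂ then 1 else 0) :
    Tri spawnCmd σ fun τ k =>
      (∀ c ≤ 10, τ c = σ c) ∧
      Stack τ (r ++ LA.flatMap fun u' => (LB.filter fun v' => T u' < T v').map (mk u')) ∧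
      k ≤ 7 * (LA.flatMap fun u' => (LB.filter fun v' => T u' < T v').map (mk u')).length +
        4 * LA.length + 2 := by
  refine Tri.seq (Tri.setVar ?_)
  refine (Tri.forLoop (N := LA.length) (i₀ := 0) (fun i τ k => τ 31 0 = i ∧
    (∀ c, c ≠ 11 → c ≠ 12 → c ≠ 13 → c ≠ 14 → c ≠ 20 → c ≠ 32 → c ≠ 31 → τ c = σ c) ∧
    Stack τ (r ++ (LA.take i).flatMap fun u' => (LB.filter fun v' => T u' < T v').map (mk u')) ∧
    k ≤ 7 * ((LA.take i).flatMap fun u' =>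
      (LB.filter fun v' => T u' < T v').map (mk u')).length + 4 * i)
    ?_ ?_ (Nat.zero_le _) ?_).mono ?_
  · rintro i τ k ⟨h1, h2, _⟩
    refine ⟨h1, ?_⟩
    rw [eval_var, h2 27 (by decide) (by decide) (by decide) (by decide) (by decide) (by decide)
      (by decide)]
    exact hA.1
  · rintro i τ k hi ⟨h1, h2, hst, hk⟩
    have e : ∀ c, c < 11 ∨ c = 15 ∨ c = 27 ∨ c = 16 ∨ c = 28 → τ c = σ c := fun c hc =>
      h2 c (by omega) (by omega) (by omega) (by omega) (by omega) (by omega) (by omega)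
    refine (spawn_inner_spec (hB.congr (e 0 (by omega)) (e 1 (by omega)) (e 2 (by omega))
      (e 3 (by omega)) (e 4 (by omega))) hst (hA.congr (e _ (by omega)) (e _ (by omega)))
      (hB'.congr (e _ (by omega)) (e _ (by omega))) hLB h1 hi (mk := mk LA[i])
      (fun v' => hmk _ v') (hf₁ i hi) (hf₂ _)).mono ?_
    rintro τ₁ k₁ ⟨fr₁, hst₁, hk₁⟩
    have htk : (LA.take (i + 1)).flatMap (fun u' => (LB.filter fun v' => T u' < T v').map (mk u')) =
        (LA.take i).flatMap (fun u' => (LB.filter fun v' => T u' < T v').map (mk u')) ++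
        (LB.filter fun v' => T LA[i] < T v').map (mk LA[i]) := by
      rw [List.take_add_one, List.getElem?_eq_getElem hi, List.flatMap_append]
      simp
    rw [htk]
    refine ⟨?_, Store.write_same _ _ _ _, fun c c1 c2 c3 c4 c5 c6 c7 => ?_, ?_, ?_⟩
    · rw [fr₁ 31 (by decide) (by decide) (by decide) (by decide) (by decide) (by decide), h1]
    · rw [Store.write_of_ne c7, fr₁ c c1 c2 c3 c4 c5 c6, h2 c c1 c2 c3 c4 c5 c6 c7]
    · rw [← List.append_assoc]
      exact hst₁.congr (Store.write_of_ne (by decide)) (Store.write_of_ne (by decide))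
        (Store.write_of_ne (by decide)) (Store.write_of_ne (by decide))
        (Store.write_of_ne (by decide))
    · rw [List.length_append, List.length_map]
      omega
  · exact ⟨Store.write_same _ _ _ _, fun c _ _ _ _ _ _ h => Store.write_of_ne h, by
        simpa using hr.congr (Store.write_of_ne (by decide)) (Store.write_of_ne (by decide))
          (Store.write_of_ne (by decide)) (Store.write_of_ne (by decide))
          (Store.write_of_ne (by decide)), by simp⟩
  · rintro τ k ⟨k₀, ⟨_, h2, hst, hk⟩, rfl⟩
    rw [List.take_length] at hst hk
    exact ⟨fun c hc => h2 c (by omega) (by omega) (by omega) (by omega) (by omega) (by omega)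
      (by omega), hst, by omega⟩

/-! ### One call of the recursion on the machine -/

theorem mem_outNear_of_lt {n s d : ℕ} {E : Finset (Fin n × Fin n)} {T : Equiv.Perm (Fin n)}
    (hT : IsTopOrder E T) {u v w : Fin n} (huv : (T u : ℕ) < (T v : ℕ))
    (hd : d = (T v : ℕ) - (T u : ℕ)) (hs : s < d) :
    w ∈ outNear E T s u v ↔ Nbr E 0 u w ∧ dist T u w ≤ s := by
  simp only [outNear, Finset.mem_filter, Finset.mem_univ, true_and, Nbr, if_true]
  refine and_congr_right fun h => and_iff_left_of_imp fun h' => ?_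
  have h1 : (T u : ℕ) < (T w : ℕ) := hT _ h
  rw [dist_of_le h1.le] at h'
  rw [Fin.lt_def]
  omega

theorem mem_outNear_of_le {n s d : ℕ} {E : Finset (Fin n × Fin n)} {T : Equiv.Perm (Fin n)}
    (hT : IsTopOrder E T) {u v w : Fin n} (huv : (T u : ℕ) < (T v : ℕ))
    (hd : d = (T v : ℕ) - (T u : ℕ)) (hs : d ≤ s) :
    w ∈ outNear E T s u v ↔ Nbr E 0 u w ∧ dist T u w < d := by
  simp only [outNear, Finset.mem_filter, Finset.mem_univ, true_and, Nbr, if_true]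
  refine and_congr_right fun h => ?_
  have h1 : (T u : ℕ) < (T w : ℕ) := hT _ h
  rw [dist_of_le h1.le, Fin.lt_def]
  omega

theorem mem_inNear_of_lt {n s d : ℕ} {E : Finset (Fin n × Fin n)} {T : Equiv.Perm (Fin n)}
    (hT : IsTopOrder E T) {u v w : Fin n} (huv : (T u : ℕ) < (T v : ℕ))
    (hd : d = (T v : ℕ) - (T u : ℕ)) (hs : s < d) :
    w ∈ inNear E T s u v ↔ Nbr E 1 v w ∧ dist T v w ≤ s := by
  simp only [inNear, Finset.mem_filter, Finset.mem_univ, true_and, Nbr, one_ne_zero, if_false]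
  rw [show dist T v w = dist T w v from Nat.dist_comm _ _]
  refine and_congr_right fun h => and_iff_left_of_imp fun h' => ?_
  have h1 : (T w : ℕ) < (T v : ℕ) := hT _ h
  rw [dist_of_le h1.le] at h'
  rw [Fin.lt_def]
  omega

theorem mem_inNear_of_le {n s d : ℕ} {E : Finset (Fin n × Fin n)} {T : Equiv.Perm (Fin n)}
    (hT : IsTopOrder E T) {u v w : Fin n} (huv : (T u : ℕ) < (T v : ℕ))
    (hd : d = (T v : ℕ) - (T u : ℕ)) (hs : d ≤ s) :
    w ∈ inNear E T s u v ↔ Nbr E 1 v w ∧ dist T v w < d := by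
  simp only [inNear, Finset.mem_filter, Finset.mem_univ, true_and, Nbr, one_ne_zero, if_false]
  rw [show dist T v w = dist T w v from Nat.dist_comm _ _]
  refine and_congr_right fun h => ?_
  have h1 : (T w : ℕ) < (T v : ℕ) := hT _ h
  rw [dist_of_le h1.le, Fin.lt_def]
  omega

/-- The state after the two sets of a call have been computed. -/
structure Collected {n : ℕ} (p : ℕ) (θ : ℕ → ℕ) (E : Finset (Fin n × Fin n))
    (T : Equiv.Perm (Fin n)) (c : Call n) (A B : Finset (Fin n)) (r : List (Call n))
    (LA LB : List (Fin n)) (σ : Store) : Prop where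
  struct : Struct n p θ E T σ
  stack : Stack σ r
  fst : σ 21 0 = c.u
  snd : σ 22 0 = c.v
  pos₁ : σ 36 0 = (T c.u : ℕ)
  pos₂ : σ 37 0 = (T c.v : ℕ)
  gap : σ 25 0 = (T c.v : ℕ) - (T c.u : ℕ)
  holdsA : Holds σ 0 LA
  holdsB : Holds σ 1 LB
  listA : Listed T c.u A LA
  listB : Listed T c.v B LB

/-- The unit in which the costs of calls are measured. -/
def callUnit (n p : ℕ) (θ : ℕ → ℕ) : ℕ := n / θ 0 + θ 0 + p + 1

/-- Common beginning of exchanging and recursing calls, up to the branch between them. The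
continuation `Q` lets both cases finish from the state `Collected` without naming the intermediate
memory. -/
theorem collect_spec {n p : ℕ} {θ : ℕ → ℕ} {E : Finset (Fin n × Fin n)}
    {T : Equiv.Perm (Fin n)} {σ : Store} (hS : Struct n p θ E T σ) (hT : IsTopOrder E T)
    (hθ : 1 ≤ θ 0) {r : List (Call n)} {c : Call n} (hr : Stack σ (r ++ [c]))
    (huv : (T c.u : ℕ) < (T c.v : ℕ)) {A B : Finset (Fin n)} {sa sb : ℕ}
    (hP : Picks p θ E T c A B sa sb) {Q : Store → ℕ → Prop}
    (hQ : ∀ τ k LA LB, Collected p θ E T c A B r LA LB τ →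
      k + 7 * listTotal (2 * (p + 1) * n) τ ≤ 7 * listTotal (2 * (p + 1) * n) σ +
        50 * callUnit n p θ + 22 * (θ 0 * ((LA.length - 1) + (LB.length - 1))) + 8 * (sa + sb) →
      Tri (.cond (.bin .eq (var 27 * var 28) (.lit 1)) swapCmd spawnCmd) τ
        fun υ k' => Q υ (k + k')) :
    Tri callCmd σ Q := by
  set K := 2 * (p + 1) * n with hK
  set d := (T c.v : ℕ) - (T c.u : ℕ) with hd
  have hdist : dist T c.u c.v = d := dist_of_le huv.le
  have hd0 : 1 ≤ d := by omega
  have hdn : d ≤ n := by have := (T c.v).2; omega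
  have hu1 : (0 = 0 → (T c.u : ℕ) + d ≤ n) ∧ ((0 : ℕ) ≠ 0 → d ≤ (T c.u : ℕ)) :=
    ⟨fun _ => by have := (T c.v).2; omega, fun h => absurd rfl h⟩
  have hv1 : (1 = 0 → (T c.v : ℕ) + d ≤ n) ∧ ((1 : ℕ) ≠ 0 → d ≤ (T c.v : ℕ)) :=
    ⟨fun h => by omega, fun h => by omega⟩
  refine Tri.seq ((pop_spec hS.base hr).frame.mono ?_)
  rintro σ₁ k₁ ⟨⟨rfl, hst₁, h21, h22, h23, h24, h36, h37, h25, h38⟩, fr₁⟩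
  have hS₁ : Struct n p θ E T σ₁ := hS.congr fun c hc => fr₁ c (by
    interval_cases c <;> decide)
  have t₁ : listTotal K σ₁ = listTotal K σ := listTotal_congr (fr₁ 6 (by decide))
  have hcu : callUnit n p θ = n / θ 0 + θ 0 + p + 1 := rfl
  rcases hP with ⟨h1, rfl, rfl, rfl, rfl⟩ | ⟨i, hi, h1, h2, hPA, hPB⟩
  · rw [hdist] at h1
    rw [if_pos h1] at h38
    refine Tri.seq (Tri.cond (fun _ => Tri.skip ?_) (fun h => ?_))
    swap
    · rw [eval_var, h38] at h; exact absurd h one_ne_zero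
    refine Tri.seq ((near_side_spec hS₁ hT (s := 0) (by decide) h21 h25 hd0 hu1.1 hu1.2
      (by rw [h38]; decide) (fun w => mem_outNear_of_le hT huv hd h1)).frame.mono ?_)
    rintro σ₂ k₂ ⟨⟨hk₂, hS₂, t₂, LA, hHA, hLA⟩, fr₂⟩
    refine Tri.seq ((near_side_spec hS₂ hT (s := 1) (x := c.v) (d := d) (by decide)
      (by rw [fr₂ 22 (by decide), h22]) (by rw [fr₂ 25 (by decide), h25]) hd0 hv1.1 hv1.2
      (by rw [fr₂ 38 (by decide), h38]; decide)
      (fun w => mem_inNear_of_le hT huv hd h1)).frame.mono ?_)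
    rintro σ₃ k₃ ⟨⟨hk₃, hS₃, t₃, LB, hHB, hLB⟩, fr₃⟩
    refine (hQ σ₃ (9 + (1 + 1 + (k₂ + k₃))) LA LB ⟨hS₃, ?_, ?_, ?_, ?_, ?_, ?_, ?_, hHB, hLA, hLB⟩
      ?_).mono fun υ k' h => ?_
    · exact hst₁.congr (by rw [fr₃ 20 (by decide), fr₂ 20 (by decide)])
        (by rw [fr₃ 11 (by decide), fr₂ 11 (by decide)])
        (by rw [fr₃ 12 (by decide), fr₂ 12 (by decide)])
        (by rw [fr₃ 13 (by decide), fr₂ 13 (by decide)])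
        (by rw [fr₃ 14 (by decide), fr₂ 14 (by decide)])
    · rw [fr₃ 21 (by decide), fr₂ 21 (by decide), h21]
    · rw [fr₃ 22 (by decide), fr₂ 22 (by decide), h22]
    · rw [fr₃ 36 (by decide), fr₂ 36 (by decide), h36]
    · rw [fr₃ 37 (by decide), fr₂ 37 (by decide), h37]
    · rw [fr₃ 25 (by decide), fr₂ 25 (by decide), h25]
    · exact hHA.congr (fr₃ 15 (by decide)) (fr₃ 27 (by decide))
    · rw [← hK] at t₂ t₃
      rw [t₃, t₂, t₁, hcu]
      generalize n / θ 0 = q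
      omega
    · rwa [show 9 + (1 + 1 + (k₂ + (k₃ + k'))) = 9 + (1 + 1 + (k₂ + k₃)) + k' by omega]
  · rw [hdist] at h1 h2
    have h0 := h1 0 (by omega)
    have hii := h1 i le_rfl
    rw [if_neg (by omega)] at h38
    rw [hdist] at hPA hPB
    refine Tri.seq (Tri.cond (fun h => ?_) (fun _ => ?_))
    · rw [eval_var, h38] at h; exact absurd rfl h
    refine (level_spec hS₁.base h25 hi h1 h2).frame.mono ?_
    rintro σ' k' ⟨⟨hk', h26⟩, fr'⟩
    have hS' : Struct n p θ E T σ' := hS₁.congr fun c hc => fr' c (by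
      interval_cases c <;> decide)
    have t' : listTotal K σ' = listTotal K σ₁ := listTotal_congr (fr' 6 (by decide))
    refine Tri.seq ((far_side_spec hS' hT hθ (s := 0) (x := c.u) (d := d) (l := i) (f := c.f₁)
      (by decide)
      (by rw [fr' 21 (by decide), h21]) (by rw [fr' 25 (by decide), h25]) hd0 hu1.1 hu1.2
      (by rw [fr' 38 (by decide), h38]) hi h26 (by rw [fr' 23 (by decide), h23])
      (fun w => mem_outNear_of_lt hT huv hd hii)
      (fun w => mem_outNear_of_le hT huv hd h2) hPA).frame.mono ?_)
    rintro σ₂ k₂ ⟨⟨hS₂, LA, hHA, hLA, hk₂⟩, fr₂⟩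
    refine Tri.seq ((far_side_spec hS₂ hT hθ (s := 1) (x := c.v) (d := d) (l := i) (f := c.f₂)
      (by decide)
      (by rw [fr₂ 22 (by decide), fr' 22 (by decide), h22])
      (by rw [fr₂ 25 (by decide), fr' 25 (by decide), h25]) hd0 hv1.1 hv1.2
      (by rw [fr₂ 38 (by decide), fr' 38 (by decide), h38]) hi
      (by rw [fr₂ 26 (by decide), h26])
      (by rw [fr₂ 24 (by decide), fr' 24 (by decide), h24])
      (fun w => mem_inNear_of_lt hT huv hd hii)
      (fun w => mem_inNear_of_le hT huv hd h2) hPB).frame.mono ?_)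
    rintro σ₃ k₃ ⟨⟨hS₃, LB, hHB, hLB, hk₃⟩, fr₃⟩
    refine (hQ σ₃ (9 + (1 + k' + (k₂ + k₃))) LA LB
      ⟨hS₃, ?_, ?_, ?_, ?_, ?_, ?_, ?_, hHB, hLA, hLB⟩ ?_).mono fun υ k'' h => ?_
    · exact hst₁.congr (by rw [fr₃ 20 (by decide), fr₂ 20 (by decide), fr' 20 (by decide)])
        (by rw [fr₃ 11 (by decide), fr₂ 11 (by decide), fr' 11 (by decide)])
        (by rw [fr₃ 12 (by decide), fr₂ 12 (by decide), fr' 12 (by decide)])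
        (by rw [fr₃ 13 (by decide), fr₂ 13 (by decide), fr' 13 (by decide)])
        (by rw [fr₃ 14 (by decide), fr₂ 14 (by decide), fr' 14 (by decide)])
    · rw [fr₃ 21 (by decide), fr₂ 21 (by decide), fr' 21 (by decide), h21]
    · rw [fr₃ 22 (by decide), fr₂ 22 (by decide), fr' 22 (by decide), h22]
    · rw [fr₃ 36 (by decide), fr₂ 36 (by decide), fr' 36 (by decide), h36]
    · rw [fr₃ 37 (by decide), fr₂ 37 (by decide), fr' 37 (by decide), h37]
    · rw [fr₃ 25 (by decide), fr₂ 25 (by decide), fr' 25 (by decide), h25]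
    · exact hHA.congr (fr₃ 15 (by decide)) (fr₃ 27 (by decide))
    · rw [← hK] at hk₂ hk₃
      have hdiv : θ i / θ 0 ≤ n / θ 0 := Nat.div_le_div_right (by omega)
      rw [Nat.mul_add (θ 0), hcu]
      omega
    · rwa [show 9 + (1 + k' + (k₂ + (k₃ + k''))) = 9 + (1 + k' + (k₂ + k₃)) + k'' by omega]

theorem Picks.mem {n p : ℕ} {θ : ℕ → ℕ} {E : Finset (Fin n × Fin n)} {T : Equiv.Perm (Fin n)}
    (hT : IsTopOrder E T) {c : Call n} {A B : Finset (Fin n)} {sa sb : ℕ}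
    (h : Picks p θ E T c A B sa sb) :
    (∀ a ∈ A, (T c.u : ℕ) < (T a : ℕ) ∧ (T a : ℕ) < (T c.v : ℕ)) ∧
      ∀ b ∈ B, (T c.u : ℕ) < (T b : ℕ) ∧ (T b : ℕ) < (T c.v : ℕ) := by
  rcases h with ⟨_, rfl, rfl, _⟩ | ⟨i, _, _, _, hA, hB⟩
  · exact ⟨fun a ha => (outNear_mem hT a ha).2, fun b hb => (inNear_mem hT b hb).2⟩
  · constructor
    · rcases hA with ⟨_, rfl, _⟩ | ⟨_, _, rfl, _⟩
      all_goals exact fun a ha => (outNear_mem hT a ha).2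
    · rcases hB with ⟨_, rfl, _⟩ | ⟨_, _, rfl, _⟩
      all_goals exact fun b hb => (inNear_mem hT b hb).2

theorem Listed.nodup {n : ℕ} {T : Equiv.Perm (Fin n)} {x : Fin n} {A : Finset (Fin n)}
    {L : List (Fin n)} (h : Listed T x A L) : L.Nodup :=
  h.sorted.imp fun {a b} h e => by rw [e] at h; exact lt_irrefl _ h

theorem Listed.eq_inOrder {n : ℕ} {T : Equiv.Perm (Fin n)} {x : Fin n} {A : Finset (Fin n)}
    {L : List (Fin n)} (h : Listed T x A L) (hA : ∀ a ∈ A, (T x : ℕ) < (T a : ℕ)) :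
    L = inOrder T (insert x A) := by
  have hle : ∀ w ∈ L, (T x : ℕ) ≤ (T w : ℕ) := fun w hw => by
    rcases (h.mem w).1 hw with rfl | h1
    · exact le_rfl
    · exact (hA w h1).le
  refine eq_of_pairwise_of_mem_iff (T := T) ?_ (pairwise_inOrder _ _) fun w => by
    rw [h.mem, mem_inOrder, Finset.mem_insert]
  refine h.sorted.imp_of_mem fun {a b} ha hb hab => ?_
  rw [dist_of_le (hle a ha), dist_of_le (hle b hb)] at hab
  omega

theorem Listed.pairwise_gt {n : ℕ} {T : Equiv.Perm (Fin n)} {x : Fin n} {A : Finset (Fin n)}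
    {L : List (Fin n)} (h : Listed T x A L) (hA : ∀ a ∈ A, (T a : ℕ) < (T x : ℕ)) :
    L.Pairwise fun a b => (T b : ℕ) < (T a : ℕ) := by
  have hle : ∀ w ∈ L, (T w : ℕ) ≤ (T x : ℕ) := fun w hw => by
    rcases (h.mem w).1 hw with rfl | h1
    · exact le_rfl
    · exact (hA w h1).le
  refine h.sorted.imp_of_mem fun {a b} ha hb hab => ?_
  have h1 := hle a ha
  have h2 := hle b hb
  unfold dist Nat.dist at hab
  omega

theorem Listed.eq_reverse {n : ℕ} {T : Equiv.Perm (Fin n)} {x : Fin n} {A : Finset (Fin n)}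
    {L : List (Fin n)} (h : Listed T x A L) (hA : ∀ a ∈ A, (T a : ℕ) < (T x : ℕ)) :
    L = (inOrder T (insert x A)).reverse := by
  rw [← List.reverse_eq_iff]
  refine eq_of_pairwise_of_mem_iff (T := T) ?_ (pairwise_inOrder _ _) fun w => by
    rw [List.mem_reverse, h.mem, mem_inOrder, Finset.mem_insert]
  rw [List.pairwise_reverse]
  exact h.pairwise_gt hA

theorem Listed.length {n : ℕ} {T : Equiv.Perm (Fin n)} {x : Fin n} {A : Finset (Fin n)}
    {L : List (Fin n)} (h : Listed T x A L) (hx : x ∉ A) : L.length = A.card + 1 := by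
  rw [← List.toFinset_card_of_nodup h.nodup, ← Finset.card_insert_of_notMem hx]
  congr 1
  ext w
  rw [List.mem_toFinset, h.mem, Finset.mem_insert]

/-- With `x` in front, the list has length 1 if and only if `A` is empty; the only index is then 0,
and it holds `x`. -/
theorem Listed.flag {n : ℕ} {T : Equiv.Perm (Fin n)} {x : Fin n} {A : Finset (Fin n)}
    {L : List (Fin n)} (h : Listed T x A L) (hx : x ∉ A) {i : ℕ} (hi : i < L.length) :
    (if i + L.length = 1 then 1 else 0) = if decide (L[i] = x ∧ A = ∅) = true then 1 else 0 := by
  have hl := h.length hx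
  by_cases hA : A = ∅
  · subst hA
    rw [Finset.card_empty] at hl
    have h1 : L[i] = x := by
      simpa using (h.mem L[i]).1 (List.getElem_mem hi)
    rw [if_pos (by omega), if_pos (by simp [h1])]
  · have := Finset.card_pos.2 (Finset.nonempty_iff_ne_empty.2 hA)
    rw [if_neg (by omega), if_neg (by simp [hA])]

theorem one_le_callUnit (n p : ℕ) (θ : ℕ → ℕ) : 1 ≤ callUnit n p θ :=
  Nat.le_add_left 1 _

theorem length_le_length_flatMap {α β : Type*} {f : α → List β} {l : List α}
    (h : ∀ a ∈ l, f a ≠ []) : l.length ≤ (l.flatMap f).length := by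
  induction l with
  | nil => simp
  | cons a l ih =>
    have h1 := List.length_pos_iff.2 (h a (by simp))
    have h2 := ih fun b hb => h b (by simp [hb])
    rw [List.flatMap_cons, List.length_append, List.length_cons]
    omega

theorem length_le_length_flatMap_of_mem {α β : Type*} {f : α → List β} {l : List α} {a : α}
    (h : a ∈ l) : (f a).length ≤ (l.flatMap f).length := by
  induction l with
  | nil => simp at h
  | cons b l ih =>
    rw [List.flatMap_cons, List.length_append]
    rcases List.mem_cons.1 h with rfl | h
    · omega
    · have := ih h; omega

/-- The coefficient 52 is 24 + 7 * 4: the steps of the update, and the advance payment for scanning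
the new list entries later. -/
theorem call_swap_spec {n p : ℕ} {θ : ℕ → ℕ} {E : Finset (Fin n × Fin n)}
    {T : Equiv.Perm (Fin n)} {σ : Store} (hS : Struct n p θ E T σ) (hT : IsTopOrder E T)
    (hθ : 1 ≤ θ 0) {r : List (Call n)} {c : Call n} (hr : Stack σ (r ++ [c]))
    (huv : (T c.u : ℕ) < (T c.v : ℕ)) {sa sb : ℕ}
    (hP : Picks p θ E T c ∅ ∅ sa sb) (hT' : IsTopOrder E (T * Equiv.swap c.u c.v)) :
    Tri callCmd σ fun τ k => Struct n p θ E (T * Equiv.swap c.u c.v) τ ∧ Stack τ r ∧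
      k + 7 * listTotal (2 * (p + 1) * n) τ ≤ 7 * listTotal (2 * (p + 1) * n) σ +
        51 * callUnit n p θ + 8 * (sa + sb) + 52 * ((p + 1) * dist T c.u c.v) := by
  refine collect_spec hS hT hθ hr huv hP fun τ k LA LB hc hk => ?_
  have hlA := hc.listA.length (by simp)
  have hlB := hc.listB.length (by simp)
  have h27 : τ 27 0 = LA.length := hc.holdsA.1
  have h28 : τ 28 0 = LB.length := hc.holdsB.1
  simp only [Finset.card_empty, zero_add] at hlA hlB
  refine Tri.cond (fun _ => ?_) (fun h => ?_)
  swap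
  · simp [h27, h28, hlA, hlB] at h
  refine (swap_spec hc.struct.base hT hT' huv hc.fst hc.snd hc.pos₁ hc.pos₂ hc.gap
    hc.struct.complete hc.struct.ok).frame.mono ?_
  rintro υ k' ⟨⟨hk', hB, hC, hok, htot⟩, fr⟩
  refine ⟨⟨hB, hok, hC, ?_, ?_⟩, ?_, ?_⟩
  · rw [fr 9 (by decide)]; exact hc.struct.marks
  · rw [fr 10 (by decide)]; exact hc.struct.blocks
  · exact hc.stack.congr (fr 20 (by decide)) (fr 11 (by decide)) (fr 12 (by decide))
      (fr 13 (by decide)) (fr 14 (by decide))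
  · rw [dist_of_le huv.le]
    rw [hlA, hlB] at hk
    have : 1 ≤ callUnit n p θ := one_le_callUnit n p θ
    simp only [Nat.sub_self, add_zero, mul_zero] at hk
    omega

/-- Each vertex found costs O(`θ 0`). Both lists are at most as long as the list of subcalls, since
every u' has a subcall with `c.v` and `c.u` has one with every v'. So the cost is of the order of
the unit times one plus the number of subcalls, which is what `N` counts in a `Run`. -/
theorem call_recurse_spec {n p : ℕ} {θ : ℕ → ℕ} {E : Finset (Fin n × Fin n)}
    {T : Equiv.Perm (Fin n)} {σ : Store} (hS : Struct n p θ E T σ) (hT : IsTopOrder E T)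
    (hθ : 1 ≤ θ 0) {r : List (Call n)} {c : Call n} (hr : Stack σ (r ++ [c]))
    (huv : (T c.u : ℕ) < (T c.v : ℕ)) {A B : Finset (Fin n)} {sa sb : ℕ}
    (hP : Picks p θ E T c A B sa sb) (hne : ¬ (A = ∅ ∧ B = ∅)) :
    Tri callCmd σ fun τ k => Struct n p θ E T τ ∧
      Stack τ (r ++ (subcalls T c A B).reverse) ∧
      k + 7 * listTotal (2 * (p + 1) * n) τ ≤ 7 * listTotal (2 * (p + 1) * n) σ +
        60 * (callUnit n p θ * (1 + (subcalls T c A B).length)) + 8 * (sa + sb) := by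
  obtain ⟨hA, hB⟩ := hP.mem hT
  have huA : c.u ∉ A := fun h => lt_irrefl _ (hA _ h).1
  have hvB : c.v ∉ B := fun h => lt_irrefl _ (hB _ h).2
  refine collect_spec hS hT hθ hr huv hP fun τ k LA LB hc hk => ?_
  have hlA := hc.listA.length huA
  have hlB := hc.listB.length hvB
  have h27 : τ 27 0 = LA.length := hc.holdsA.1
  have h28 : τ 28 0 = LB.length := hc.holdsB.1
  -- Both lists are sorted by distance from their end point, that is, upwards from `c.u` and
  -- downwards from `c.v`: the reverse of the order of execution, as a stack requires.
  have hsub : (subcalls T c A B).reverse = LA.flatMap fun u' =>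
      (LB.filter fun v' => T u' < T v').map (subcall c A B u') := by
    rw [hc.listA.eq_inOrder fun a ha => (hA a ha).1,
      hc.listB.eq_reverse fun b hb => (hB b hb).2]
    unfold subcalls
    rw [List.reverse_flatMap, List.reverse_reverse]
    congr 1
    funext u'
    simp only [Function.comp_apply, List.filter_reverse, List.map_reverse]
    rfl
  have hlen : (subcalls T c A B).length = (LA.flatMap fun u' =>
      (LB.filter fun v' => T u' < T v').map (subcall c A B u')).length := by
    rw [← hsub, List.length_reverse]
  have hvLB : c.v ∈ LB := (hc.listB.mem _).2 (Or.inl rfl)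
  have huLA : c.u ∈ LA := (hc.listA.mem _).2 (Or.inl rfl)
  have hLA : LA.length ≤ (subcalls T c A B).length := by
    rw [hlen]
    refine length_le_length_flatMap fun u' hu' => ?_
    refine List.ne_nil_of_mem (List.mem_map_of_mem (a := c.v) (List.mem_filter.2 ⟨hvLB, ?_⟩))
    rw [decide_eq_true_eq]
    rcases (hc.listA.mem _).1 hu' with rfl | h
    · exact huv
    · exact (hA _ h).2
  have hLB : LB.length ≤ (subcalls T c A B).length := by
    rw [hlen]
    refine le_trans (le_of_eq ?_) (length_le_length_flatMap_of_mem huLA)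
    rw [List.length_map, List.filter_eq_self.2]
    intro b hb
    rw [decide_eq_true_eq]
    rcases (hc.listB.mem _).1 hb with rfl | h
    · exact huv
    · exact (hB _ h).1
  refine Tri.cond (fun h => ?_) (fun _ => ?_)
  · exfalso
    simp only [eval_eq, eval_mul, eval_var, eval_lit, h27, h28, hlA, hlB, ne_eq,
      ite_eq_right_iff, one_ne_zero, imp_false, not_not, mul_eq_one] at h
    exact hne ⟨Finset.card_eq_zero.1 (by omega), Finset.card_eq_zero.1 (by omega)⟩
  refine (spawn_spec hc.struct.base hc.stack hc.holdsA hc.holdsB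
    (hc.listB.pairwise_gt fun b hb => (hB b hb).2) (mk := subcall c A B) (fun _ _ => ⟨rfl, rfl⟩)
    (fun i hi _ => hc.listA.flag huA hi) (fun _ j hj => hc.listB.flag hvB hj)).mono ?_
  rintro υ k' ⟨fr, hst, hk'⟩
  refine ⟨hc.struct.congr fr, by rw [hsub]; exact hst, ?_⟩
  rw [← hlen] at hk'
  rw [listTotal_congr (fr 6 (by decide))]
  set R := (subcalls T c A B).length with hR
  have h1 : 1 ≤ callUnit n p θ := one_le_callUnit n p θ
  have h2 : θ 0 ≤ callUnit n p θ := by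
    unfold callUnit; generalize n / θ 0 = q; omega
  have hR1 : 1 ≤ R := by omega
  have h3 : θ 0 * ((LA.length - 1) + (LB.length - 1)) ≤ callUnit n p θ * (2 * R - 2) :=
    Nat.mul_le_mul h2 (by omega)
  have h4 : callUnit n p θ * (2 * R - 2) + 2 * callUnit n p θ = 2 * (callUnit n p θ * R) := by
    obtain ⟨m, hm⟩ : ∃ m, R = m + 1 := ⟨R - 1, by omega⟩
    rw [hm, show 2 * (m + 1) - 2 = 2 * m by omega]
    ring
  have h5 : R ≤ callUnit n p θ * R := Nat.le_mul_of_pos_left _ (by omega)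
  rw [Nat.mul_add (callUnit n p θ), mul_one]
  omega

theorem Run.top {n p : ℕ} {θ : ℕ → ℕ} {E : Finset (Fin n × Fin n)} {T T' : Equiv.Perm (Fin n)}
    {cs : List (Call n)} {N wA wB sw : ℕ} (h : Run p θ E T cs T' N wA wB sw)
    (hT' : IsTopOrder E T') : IsTopOrder E T := by
  cases h with
  | nil => exact hT'
  | swap h => exact h
  | recurse h => exact h

/-- The program executes a run of calls. -/
theorem Run.simulate {n p : ℕ} {θ : ℕ → ℕ} {E : Finset (Fin n × Fin n)}
    {T T' : Equiv.Perm (Fin n)} {cs : List (Call n)} {N wA wB sw : ℕ} (hθ : 1 ≤ θ 0)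
    (h : Run p θ E T cs T' N wA wB sw) (hT' : IsTopOrder E T') :
    ∀ {σ : Store} {r : List (Call n)}, Struct n p θ E T σ → Stack σ (r ++ cs.reverse) →
    ∃ τ k, Struct n p θ E T' τ ∧ Stack τ r ∧
      k + 7 * listTotal (2 * (p + 1) * n) τ ≤ 7 * listTotal (2 * (p + 1) * n) σ +
        61 * (callUnit n p θ * N) + 8 * (wA + wB) + 52 * ((p + 1) * sw) ∧
      ∀ υ k', Ex (.loop (var 20) callCmd) τ υ k' → Ex (.loop (var 20) callCmd) σ υ (k + k') := by
  -- The last part of the conclusion leaves the loop running on the rest of the stack, so that the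
  -- executions of consecutive lists of calls can be concatenated.
  have h1 : 1 ≤ callUnit n p θ := one_le_callUnit n p θ
  induction h with
  | nil T =>
    intro σ r hS hr
    exact ⟨σ, 0, hS, by simpa using hr, by omega, fun υ k' h => by simpa using h⟩
  | @swap T T' c cs sa sb N wA wB sw hT huv hP hrun ih =>
    intro σ r hS hr
    rw [List.reverse_cons, ← List.append_assoc] at hr
    obtain ⟨τ, k, hex, hS₁, hr₁, hk⟩ :=
      call_swap_spec hS hT hθ hr huv hP (hrun.top hT')
    obtain ⟨υ, k₂, hS₂, hr₂, hk₂, hex₂⟩ := ih hT' hS₁ hr₁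
    refine ⟨υ, 1 + k + k₂, hS₂, hr₂, ?_, fun ρ k' hρ => ?_⟩
    · rw [Nat.mul_add (callUnit n p θ), Nat.mul_add (p + 1), mul_one]
      omega
    · rw [show 1 + k + k₂ + k' = 1 + k + (k₂ + k') by omega]
      refine Ex.loopStep ?_ hex (hex₂ ρ k' hρ)
      rw [eval_var, hr.height]; simp
  | @recurse T T' T'' c cs A B sa sb N₁ wA₁ wB₁ sw₁ N₂ wA₂ wB₂ sw₂ hT huv hP hne hrun₁ hrun₂
      ih₁ ih₂ =>
    intro σ r hS hr
    rw [List.reverse_cons, ← List.append_assoc] at hr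
    obtain ⟨τ, k, hex, hS₁, hr₁, hk⟩ := call_recurse_spec hS hT hθ hr huv hP hne
    obtain ⟨υ, k₂, hS₂, hr₂, hk₂, hex₂⟩ := ih₁ (hrun₂.top hT') hS₁ hr₁
    obtain ⟨ρ, k₃, hS₃, hr₃, hk₃, hex₃⟩ := ih₂ hT' hS₂ hr₂
    refine ⟨ρ, 1 + k + k₂ + k₃, hS₃, hr₃, ?_, fun ω k' hω => ?_⟩
    · simp only [Nat.mul_add (callUnit n p θ), Nat.mul_add (p + 1), mul_one] at hk ⊢
      omega
    · rw [show 1 + k + k₂ + k₃ + k' = 1 + k + (k₂ + (k₃ + k')) by omega]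
      refine Ex.loopStep ?_ hex (hex₂ _ _ (hex₃ ω k' hω))
      rw [eval_var, hr.height]; simp

/-! ### The insertion of an edge on the machine -/

theorem pair_index_inj {n : ℕ} {a b c d : Fin n}
    (h : (a : ℕ) * n + b = (c : ℕ) * n + d) : a = c ∧ b = d := by
  have h1 : ((a : ℕ) * n + b) % n = ((c : ℕ) * n + d) % n := by rw [h]
  rw [Nat.mul_add_mod', Nat.mul_add_mod', Nat.mod_eq_of_lt b.2, Nat.mod_eq_of_lt d.2] at h1
  have h2 : (a : ℕ) = c :=
    Nat.eq_of_mul_eq_mul_right (by have := a.2; omega : 0 < n) (by omega)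
  exact ⟨Fin.ext h2, Fin.ext h1⟩

/-- Adding an edge to the adjacency matrix and to the bucket lists. -/
theorem add_edge_spec {n p : ℕ} {θ : ℕ → ℕ} {E : Finset (Fin n × Fin n)}
    {T : Equiv.Perm (Fin n)} {σ : Store} (hS : Struct n p θ E T σ) {e : Fin n × Fin n}
    (h1 : σ 0 1 = e.1) (h2 : σ 0 2 = e.2) :
    Tri (setVar 21 (.cell 0 (.lit 1)) ;; setVar 22 (.cell 0 (.lit 2)) ;;
      .assign 2 (var 21 * nE + var 22) (.lit 1) ;; enterCmd) σ fun τ k =>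
      Struct n p θ (insert e E) T τ ∧
      k + 7 * listTotal (2 * (p + 1) * n) τ ≤ 7 * listTotal (2 * (p + 1) * n) σ +
        26 * (p + 1) := by
  set K := 2 * (p + 1) * n with hK
  refine Tri.seq (Tri.setVar (Tri.seq (Tri.setVar (Tri.seq (Tri.assign ?_)))))
  simp only [eval_cell, eval_lit, eval_add, eval_mul, eval_var, nE]
  simp only [Store.write_of_ne (show (0 : ℕ) ≠ 21 by decide),
    Store.write_of_ne (show (0 : ℕ) ≠ 22 by decide),
    Store.write_of_ne (show (21 : ℕ) ≠ 22 by decide), Store.write_same, h1, h2, hS.base.size]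
  set τ := (((σ.write 21 0 (e.1 : ℕ)).write 22 0 (e.2 : ℕ)).write 2 ((e.1 : ℕ) * n + e.2) 1)
    with hτ
  have w : ∀ c, c ≠ 2 → c ≠ 21 → c ≠ 22 → τ c = σ c := fun c c1 c2 c3 => by
    rw [hτ, Store.write_of_ne c1, Store.write_of_ne c3, Store.write_of_ne c2]
  have w2 : ∀ i, τ 2 i = if i = (e.1 : ℕ) * n + e.2 then 1 else σ 2 i := fun i => by
    rw [hτ, Store.write_apply, Store.write_of_ne (by decide), Store.write_of_ne (by decide)]
  have w21 : τ 21 0 = e.1 := by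
    rw [hτ, Store.write_of_ne (by decide), Store.write_of_ne (by decide), Store.write_same]
  have w22 : τ 22 0 = e.2 := by rw [hτ, Store.write_of_ne (by decide), Store.write_same]
  have hB : Base n p θ (insert e E) T τ := by
    constructor
    · rw [w 0 (by decide) (by decide) (by decide)]; exact hS.base.size
    · rw [w 0 (by decide) (by decide) (by decide)]; exact hS.base.lev
    · rw [w 1 (by decide) (by decide) (by decide)]; exact hS.base.ord
    · intro a b
      rw [w2]
      by_cases hab : (a, b) = e
      · rw [← hab]; simp
      · have : ¬ ((a : ℕ) * n + b = (e.1 : ℕ) * n + e.2) := fun h => by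
          obtain ⟨h3, h4⟩ := pair_index_inj h
          exact hab (Prod.ext h3 h4)
        rw [if_neg this, hS.base.graph]
        simp [hab]
    · rw [w 3 (by decide) (by decide) (by decide)]; exact hS.base.thr
    · rw [w 4 (by decide) (by decide) (by decide)]; exact hS.base.inv
    · rw [w 4 (by decide) (by decide) (by decide)]; exact hS.base.inv_lt
  have hg : Grows n K 0 σ τ := Grows.congr (w 6 (by decide) (by decide) (by decide))
    (w 7 (by decide) (by decide) (by decide)) hS.ok
  refine (enter_spec hB.size hB.lev (by rw [w21]; exact e.1.2) (by rw [w22]; exact e.2.2)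
    hg.ok).frame.mono ?_
  rintro υ k ⟨⟨hk, hg', hL⟩, fr⟩
  rw [w21, w22] at hL
  have hL' := hL (hB.edge_ne_zero.2 (by simp))
  refine ⟨⟨hB.congr (fr 0 (by decide)) (fr 1 (by decide)) (fr 2 (by decide)) (fr 3 (by decide))
    (fr 4 (by decide)), hg'.ok, fun l hl a b hab hd => ?_, ?_, ?_⟩, ?_⟩
  · rcases Finset.mem_insert.1 hab with h3 | h3
    · rw [← h3] at hL'
      exact hL' l hl
    · exact (hg.trans hg').linked hl a.2 b.2 (hS.complete l hl a b h3 hd)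
  · rw [fr 9 (by decide), w 9 (by decide) (by decide) (by decide)]; exact hS.marks
  · rw [fr 10 (by decide), w 10 (by decide) (by decide) (by decide)]; exact hS.blocks
  · have := (hg.trans hg').total
    omega

theorem insert_spec {n p : ℕ} {θ : ℕ → ℕ} {E : Finset (Fin n × Fin n)}
    {T T' : Equiv.Perm (Fin n)} {σ : Store} (hθ : 1 ≤ θ 0) (hS : Struct n p θ E T σ)
    {e : Fin n × Fin n} (h1 : σ 0 1 = e.1) (h2 : σ 0 2 = e.2) (hT' : IsTopOrder (insert e E) T')
    {N wA wB sw : ℕ}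
    (h : (T e.2 < T e.1 ∧ Run p θ E T [⟨e.2, e.1, false, false⟩] T' N wA wB sw) ∨
        (T e.1 < T e.2 ∧ T' = T ∧ N = 0 ∧ wA = 0 ∧ wB = 0 ∧ sw = 0)) :
    Tri insertCmd σ fun τ k => Struct n p θ (insert e E) T' τ ∧
      k + 7 * listTotal (2 * (p + 1) * n) τ ≤ 7 * listTotal (2 * (p + 1) * n) σ +
        61 * (callUnit n p θ * N) + 8 * (wA + wB) + 52 * ((p + 1) * sw) + 33 * (p + 1) := by
  set K := 2 * (p + 1) * n with hK
  have hc : (Expr.bin .lt (.cell 1 (.cell 0 (.lit 2))) (.cell 1 (.cell 0 (.lit 1)))).eval σ =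
      if (T e.2 : ℕ) < (T e.1 : ℕ) then 1 else 0 := by
    simp only [eval_lt, eval_cell, eval_lit, h1, h2, hS.base.ord]
  refine Tri.seq (Tri.cond (fun hb => ?_) (fun hb => Tri.skip ?_))
  · rw [hc] at hb
    rcases h with ⟨_, hrun⟩ | ⟨hlt, _⟩
    swap
    · rw [Fin.lt_def] at hlt
      exact absurd (if_neg (by omega)) hb
    refine Tri.seq (Tri.assign (Tri.seq (Tri.assign (Tri.seq (Tri.assign (Tri.seq (Tri.assign
      (Tri.seq (Tri.setVar ?_)))))))))
    simp only [eval_cell, eval_lit]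
    simp only [Store.write_of_ne (show (0 : ℕ) ≠ 11 by decide), h1, h2]
    set τ := ((((σ.write 11 0 (e.2 : ℕ)).write 12 0 (e.1 : ℕ)).write 13 0 0).write 14 0 0).write
      20 0 1 with hτ
    have w : ∀ c, c ≠ 11 → c ≠ 12 → c ≠ 13 → c ≠ 14 → c ≠ 20 → τ c = σ c :=
      fun c c1 c2 c3 c4 c5 => by
        rw [hτ, Store.write_of_ne c5, Store.write_of_ne c4, Store.write_of_ne c3,
          Store.write_of_ne c2, Store.write_of_ne c1]
    have hSτ : Struct n p θ E T τ := hS.congr fun c hc =>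
      w c (by omega) (by omega) (by omega) (by omega) (by omega)
    have hst : Stack τ ([] ++ [(⟨e.2, e.1, false, false⟩ : Call n)].reverse) := by
      constructor
      · rw [hτ, Store.write_same]; rfl
      all_goals
        intro j hj
        obtain rfl : j = 0 := by simpa using hj
      · simp [hτ, Store.write_of_ne, Store.write_same]
      · simp [hτ, Store.write_of_ne, Store.write_same]
      · simp [hτ, Store.write_of_ne, Store.write_same]
      · simp [hτ, Store.write_of_ne, Store.write_same]
    obtain ⟨υ, k, hSυ, hstυ, hk, hex⟩ := hrun.simulate hθ
      (fun f hf => hT' f (Finset.mem_insert_of_mem hf)) hSτ hst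
    have hloop := hex υ 1 (Ex.loopDone (by rw [eval_var, hstυ.height]; rfl))
    refine ⟨υ, k + 1, hloop, ?_⟩
    have f0 : υ 0 = σ 0 := by
      rw [hloop.frame (by decide), w 0 (by decide) (by decide) (by decide) (by decide) (by decide)]
    refine (add_edge_spec hSυ (by rw [f0, h1]) (by rw [f0, h2])).mono ?_
    rintro ρ k' ⟨hSρ, hk'⟩
    refine ⟨hSρ, ?_⟩
    rw [← hK] at hk hk'
    rw [listTotal_congr (w 6 (by decide) (by decide) (by decide) (by decide) (by decide))] at hk
    omega
  · rw [hc] at hb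
    rcases h with ⟨hlt, _⟩ | ⟨hlt, rfl, rfl, rfl, rfl, rfl⟩
    · rw [Fin.lt_def] at hlt
      rw [if_pos hlt] at hb
      exact absurd hb one_ne_zero
    · refine (add_edge_spec hS h1 h2).mono ?_
      rintro ρ k' ⟨hSρ, hk'⟩
      refine ⟨hSρ, ?_⟩
      rw [← hK] at hk'
      omega

/-! ### Amortization -/

/-- Szpilrajn's theorem, followed by counting along the linear extension. -/
theorem exists_equiv_fin_of_partialOrder {V : Type*} [Fintype V] [PartialOrder V] {n : ℕ}
    (h : Fintype.card V = n) : ∃ f : V ≃ Fin n, ∀ a b, a < b → f a < f b := by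
  let _ : Fintype (LinearExtension V) := inferInstanceAs (Fintype V)
  let g : Fin n ≃o LinearExtension V := monoEquivOfFin (LinearExtension V) h
  refine ⟨g.symm.toEquiv, fun a b hab => ?_⟩
  have h1 : toLinearExtension a ≤ toLinearExtension b := toLinearExtension.monotone hab.le
  have h2 : toLinearExtension a ≠ toLinearExtension b := hab.ne
  exact g.symm.strictMono (lt_of_le_of_ne h1 h2)

/-- An acyclic graph has a topological order. -/
theorem exists_topOrder {n : ℕ} {E : Finset (Fin n × Fin n)} (h : IsDAG E) :
    ∃ F, IsTopOrder E F := by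
  let P : PartialOrder (Fin n) :=
    { le := Relation.ReflTransGen fun a b => (a, b) ∈ E
      lt := fun a b => Relation.ReflTransGen (fun a b => (a, b) ∈ E) a b ∧
        ¬ Relation.ReflTransGen (fun a b => (a, b) ∈ E) b a
      le_refl := fun _ => Relation.ReflTransGen.refl
      le_trans := fun _ _ _ => Relation.ReflTransGen.trans
      le_antisymm := fun a b hab hba => by
        by_contra hne
        rcases (Relation.reflTransGen_iff_eq_or_transGen.1 hab) with h1 | h1
        · exact hne h1.symm
        · exact h a (h1.trans_left hba) }
  obtain ⟨f, hf⟩ := @exists_equiv_fin_of_partialOrder (Fin n) _ P n (Fintype.card_fin n)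
  refine ⟨f, fun e he => hf e.1 e.2 ⟨Relation.ReflTransGen.single he, fun h1 => ?_⟩⟩
  exact h e.1 (Relation.TransGen.head' he h1)

/-- The potential that pays for all steps of the program. -/
noncomputable def potential {n : ℕ} (p : ℕ) (θ : ℕ → ℕ) (F : Equiv.Perm (Fin n))
    (α : Fin n × Fin n → ℝ) (β : ℝ) (E : Finset (Fin n × Fin n)) (T : Equiv.Perm (Fin n))
    (σ : Store) : ℝ :=
  7 * (listTotal (2 * (p + 1) * n) σ : ℝ) + 244 * (callUnit n p θ : ℝ) * (unsettled F E).card +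
    84 * ((p : ℝ) + 1) * (energy F α β E T + β * (n : ℝ) ^ 3) +
    33 * ((p : ℝ) + 1) * ((n : ℝ) ^ 2 - E.card)

theorem corr_nonneg {n : ℕ} (F T : Equiv.Perm (Fin n)) : 0 ≤ corr F T :=
  Finset.sum_nonneg fun _ _ => by positivity

theorem corr_le {n : ℕ} (F T : Equiv.Perm (Fin n)) : corr F T ≤ (n : ℝ) ^ 3 := by
  have h : corr F T ≤ ∑ _w : Fin n, (n : ℝ) * n := by
    refine Finset.sum_le_sum fun w _ => ?_
    have h1 : ((T w : ℕ) : ℝ) ≤ n := by exact_mod_cast (T w).2.le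
    have h2 : ((F w : ℕ) : ℝ) ≤ n := by exact_mod_cast (F w).2.le
    exact mul_le_mul h1 h2 (by positivity) (by positivity)
  refine h.trans (le_of_eq ?_)
  simp
  ring

theorem card_le_sq {n : ℕ} (S : Finset (Fin n × Fin n)) : (S.card : ℝ) ≤ (n : ℝ) ^ 2 := by
  have h : S.card ≤ n * n := by
    refine (Finset.card_le_univ S).trans (le_of_eq ?_)
    simp
  rw [sq]
  exact_mod_cast h

/-- `energy` alone may be negative; the summand `β * n ^ 3` compensates, because the correlation is
at most `n ^ 3`. -/
theorem potential_nonneg {n p : ℕ} {θ : ℕ → ℕ} {F : Equiv.Perm (Fin n)}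
    {α : Fin n × Fin n → ℝ} {β : ℝ} (hW : Weights p θ F α β) (E : Finset (Fin n × Fin n))
    (T : Equiv.Perm (Fin n)) (σ : Store) : 0 ≤ potential p θ F α β E T σ := by
  have h1 : 0 ≤ energy F α β E T + β * (n : ℝ) ^ 3 := by
    have h2 : 0 ≤ ∑ q ∈ unsettled F E, α q := Finset.sum_nonneg fun q _ => hW.nonneg q
    have h3 := mul_le_mul_of_nonneg_left (corr_le F T) hW.beta_nonneg
    unfold energy
    linarith
  have h4 : 0 ≤ (n : ℝ) ^ 2 - E.card := by linarith [card_le_sq E]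
  unfold potential
  positivity

theorem potential_le {n p : ℕ} {θ : ℕ → ℕ} {F : Equiv.Perm (Fin n)}
    {α : Fin n × Fin n → ℝ} {β : ℝ} (hW : Weights p θ F α β) (E : Finset (Fin n × Fin n))
    (T : Equiv.Perm (Fin n)) (σ : Store) : potential p θ F α β E T σ ≤
      7 * (listTotal (2 * (p + 1) * n) σ : ℝ) + 244 * (callUnit n p θ : ℝ) * (n : ℝ) ^ 2 +
      84 * ((p : ℝ) + 1) * (∑ q ∈ Finset.univ.filter (fun q : Fin n × Fin n => F q.2 < F q.1), α q +
        β * (n : ℝ) ^ 3) + 33 * ((p : ℝ) + 1) * (n : ℝ) ^ 2 := by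
  have h1 : energy F α β E T ≤
      ∑ q ∈ Finset.univ.filter (fun q : Fin n × Fin n => F q.2 < F q.1), α q := by
    have h2 : ∑ q ∈ unsettled F E, α q ≤
        ∑ q ∈ Finset.univ.filter (fun q : Fin n × Fin n => F q.2 < F q.1), α q := by
      refine Finset.sum_le_sum_of_subset_of_nonneg (fun q hq => ?_) fun q _ _ => hW.nonneg q
      simp only [unsettled, Finset.mem_filter, Finset.mem_univ, true_and] at hq ⊢
      exact hq.1
    have h3 := mul_nonneg hW.beta_nonneg (corr_nonneg F T)
    unfold energy
    linarith
  have h4 := card_le_sq (unsettled F E)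
  have h5 : (0 : ℝ) ≤ E.card := by positivity
  unfold potential
  gcongr
  linarith

/-- The insertion of an edge, with amortized costs. -/
theorem insert_step {n p : ℕ} {θ : ℕ → ℕ} {E : Finset (Fin n × Fin n)} {F : Equiv.Perm (Fin n)}
    {α : Fin n × Fin n → ℝ} {β : ℝ} (hW : Weights p θ F α β) (hθ : 1 ≤ θ 0)
    (hθn : n ≤ θ (p + 1)) {e : Fin n × Fin n} (he : e ∉ E) (hF : IsTopOrder (insert e E) F)
    {T : Equiv.Perm (Fin n)} (hT : IsTopOrder E T) {σ : Store} (hS : Struct n p θ E T σ)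
    (h1 : σ 0 1 = e.1) (h2 : σ 0 2 = e.2) :
    Tri insertCmd σ fun τ k => ∃ T', IsTopOrder (insert e E) T' ∧
      Struct n p θ (insert e E) T' τ ∧
      (∃ N wA wB sw, (T e.2 < T e.1 ∧ Run p θ E T [⟨e.2, e.1, false, false⟩] T' N wA wB sw) ∨
        (T e.1 < T e.2 ∧ T' = T)) ∧
      (k : ℝ) + potential p θ F α β (insert e E) T' τ ≤ potential p θ F α β E T σ := by
  obtain ⟨T', N, wA, wB, sw, hT', hr, hN, hA, hB, hsw⟩ := exists_insert hW hθn hF hT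
  refine (insert_spec hθ hS h1 h2 hT' hr).mono ?_
  rintro τ k ⟨hSτ, hk⟩
  refine ⟨T', hT', hSτ, ⟨N, wA, wB, sw, ?_⟩, ?_⟩
  · rcases hr with h | h
    · exact Or.inl h
    · exact Or.inr ⟨h.1, h.2.1⟩
  · have hk' : (k : ℝ) + 7 * (listTotal (2 * (p + 1) * n) τ : ℝ) ≤
        7 * (listTotal (2 * (p + 1) * n) σ : ℝ) + 61 * ((callUnit n p θ : ℝ) * N) +
        8 * ((wA : ℝ) + wB) + 52 * (((p : ℝ) + 1) * sw) + 33 * ((p : ℝ) + 1) := by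
      exact_mod_cast hk
    have hN' : (N : ℝ) + 4 * ((unsettled F (insert e E)).card : ℝ) ≤
        4 * ((unsettled F E).card : ℝ) := by exact_mod_cast hN
    have hU : (0 : ℝ) ≤ callUnit n p θ := by positivity
    have hp : (1 : ℝ) ≤ (p : ℝ) + 1 := by
      have : (0 : ℝ) ≤ p := by positivity
      linarith
    set D := energy F α β E T - energy F α β (insert e E) T' with hD
    have hD0 : 0 ≤ D := le_trans (by positivity) hsw
    have a1 := mul_le_mul_of_nonneg_left hN' hU
    have a2 := mul_le_mul_of_nonneg_left hsw (by linarith : (0 : ℝ) ≤ (p : ℝ) + 1)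
    have a3 : D ≤ ((p : ℝ) + 1) * D := le_mul_of_one_le_left hD0 hp
    have hc : ((insert e E).card : ℝ) = E.card + 1 := by
      rw [Finset.card_insert_of_notMem he]; push_cast; ring
    have a4 : ((p : ℝ) + 1) * D = ((p : ℝ) + 1) * energy F α β E T -
        ((p : ℝ) + 1) * energy F α β (insert e E) T' := by rw [hD]; ring
    -- The coefficients match: 244 = 4 * 61 for the calls, 84 = 8 * (2 + 2) + 52 for the wide
    -- searches on both sides and the exchanges, and 33 (p + 1) for the new edge, which is charged
    -- to the shrinking number of missing edges.
    unfold potential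
    rw [hc]
    linarith

/-! ### Thresholds -/

/-- Thresholds for which the total cost is small. -/
structure Balanced (n p : ℕ) (θ : ℕ → ℕ) (κ : ℝ) : Prop where
  nonneg : 0 ≤ κ
  one_le : ∀ i ≤ p, 1 ≤ θ i
  last : n ≤ θ (p + 1)
  first_le : (θ 0 : ℝ) ≤ κ * √n
  le_first : (n : ℝ) ≤ κ * √n * θ 0
  step : ∀ l ≤ p, (θ (l + 1) : ℝ) ^ 2 ≤ κ ^ 2 * n * θ l
  levels : (p : ℝ) + 1 ≤ κ * Real.log n

/-- For fixed `b` the gaps of different vertices are different positive integers. -/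
theorem card_gap_lt_le {n : ℕ} (F : Equiv.Perm (Fin n)) (b : Fin n) {k : ℝ} (hk : 0 ≤ k) :
    ((Finset.univ.filter fun a => F b < F a ∧ gap F a b < k).card : ℝ) ≤ k := by
  have h1 : (Finset.univ.filter fun a => F b < F a ∧ gap F a b < k).card ≤
      (Finset.Ioc 0 ⌊k⌋₊).card := by
    refine Finset.card_le_card_of_injOn (fun a => (F a : ℕ) - (F b : ℕ)) ?_ ?_
    · intro a ha
      simp only [Finset.coe_filter, Finset.mem_univ, true_and, Set.mem_ofPred_eq, Fin.lt_def,
        gap] at ha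
      simp only [Finset.coe_Ioc, Set.mem_Ioc]
      refine ⟨by omega, Nat.le_floor ?_⟩
      rw [Nat.cast_sub ha.1.le]
      exact ha.2.le
    · intro a ha a' ha' h
      simp only [Finset.coe_filter, Finset.mem_univ, true_and, Set.mem_ofPred_eq,
        Fin.lt_def] at ha ha' h
      exact F.injective (Fin.ext (by omega))
  rw [Nat.card_Ioc, Nat.sub_zero] at h1
  exact (Nat.cast_le.2 h1).trans (Nat.floor_le hk)

theorem sum_pairs_gap_le {n : ℕ} (F : Equiv.Perm (Fin n)) {k x : ℝ} (hk : 0 ≤ k) (hx : 0 ≤ x) :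
    ∑ q ∈ Finset.univ.filter (fun q : Fin n × Fin n => F q.2 < F q.1),
      (if gap F q.1 q.2 < k then x else 0) ≤ x * (n * k) := by
  rw [← Finset.sum_filter, Finset.filter_filter, Finset.sum_const, nsmul_eq_mul, mul_comm]
  refine mul_le_mul_of_nonneg_left ?_ hx
  have h1 : (Finset.univ.filter fun q : Fin n × Fin n => F q.2 < F q.1 ∧ gap F q.1 q.2 < k).card =
      ∑ b : Fin n, (Finset.univ.filter fun a => F b < F a ∧ gap F a b < k).card := by
    simp only [Finset.card_filter]
    rw [Fintype.sum_prod_type_right]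
  rw [h1]
  push_cast
  refine (Finset.sum_le_sum fun b _ => card_gap_lt_le F b hk).trans ?_
  simp

/-- For each level, a pair of gap less than `k l` carries the whole price `θ (l+1)` in its weight
`α`; for larger gaps the summand 2 θ (l+1) / (k l θ l) of `β` yields the price from a displacement
`θ l`. The first charge sums to at most n k_l θ (l+1), the second to 2 θ (l+1) n³ / (k l θ l). The
term without `p` in the bound comes from the base weights `θ 0`. -/
theorem Balanced.exists_weights {n p : ℕ} {θ : ℕ → ℕ} {κ : ℝ} (h : Balanced n p θ κ)
    (hn : 1 ≤ n) (F : Equiv.Perm (Fin n)) : ∃ α β, Weights p θ F α β ∧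
      ∑ q ∈ Finset.univ.filter (fun q : Fin n × Fin n => F q.2 < F q.1), α q + β * (n : ℝ) ^ 3 ≤
        κ * ((n : ℝ) ^ 2 * √n) + 3 * ((p : ℝ) + 1) * (κ * ((n : ℝ) ^ 2 * √n)) := by
  have hn' : (0 : ℝ) < n := by exact_mod_cast hn
  have hθ : ∀ l ≤ p, (0 : ℝ) < θ l := fun l hl => by exact_mod_cast h.one_le l hl
  -- This choice makes n k_l θ (l+1) and θ (l+1) n³ / (k_l θ l) equal; the step condition bounds
  -- both by κ n^2.5.
  set k : ℕ → ℝ := fun l => n / √(θ l) with hkdef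
  have hk : ∀ l ≤ p, 0 < k l := fun l hl => div_pos hn' (Real.sqrt_pos.2 (hθ l hl))
  have hstep : ∀ l ≤ p, (θ (l + 1) : ℝ) ≤ κ * √n * √(θ l) := by
    intro l hl
    refine le_of_sq_le_sq ?_ (by have := h.nonneg; positivity)
    refine (h.step l hl).trans (le_of_eq ?_)
    rw [mul_pow, mul_pow, Real.sq_sqrt hn'.le, Real.sq_sqrt (hθ l hl).le]
  have hprod : ∀ l ≤ p, (θ (l + 1) : ℝ) * (n * k l) ≤ κ * ((n : ℝ) ^ 2 * √n) := by
    intro l hl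
    have hs := Real.sqrt_pos.2 (hθ l hl)
    have h1 := mul_le_mul_of_nonneg_right (hstep l hl) (by positivity : (0 : ℝ) ≤ n * k l)
    refine h1.trans (le_of_eq ?_)
    rw [hkdef]
    field_simp
  have hb : ∀ l ≤ p, 2 * (θ (l + 1) : ℝ) / (k l * θ l) * (n : ℝ) ^ 3 =
      2 * ((θ (l + 1) : ℝ) * (n * k l)) := by
    intro l hl
    have hs := Real.sqrt_pos.2 (hθ l hl)
    have h1 := hθ l hl
    have h2 : (θ l : ℝ) = √(θ l) * √(θ l) := (Real.mul_self_sqrt h1.le).symm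
    have h3 : k l * θ l = n * √(θ l) := by
      rw [hkdef]; simp only; rw [div_mul_eq_mul_div, div_eq_iff hs.ne', mul_assoc, ← h2]
    rw [h3, hkdef]
    field_simp
  refine ⟨fun q => θ 0 + ∑ l ∈ Finset.range (p + 1),
      if gap F q.1 q.2 < k l then (θ (l + 1) : ℝ) else 0,
    ∑ l ∈ Finset.range (p + 1), 2 * (θ (l + 1) : ℝ) / (k l * θ l), ⟨?_, ?_, ?_⟩, ?_⟩
  · refine Finset.sum_nonneg fun l hl => ?_
    have hl' : l ≤ p := by have := Finset.mem_range.1 hl; omega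
    have h1 := hk l hl'
    have h2 := hθ l hl'
    positivity
  · intro q
    refine le_add_of_nonneg_right (Finset.sum_nonneg fun l _ => ?_)
    split_ifs <;> positivity
  · intro l hl a b hab
    have hmem : l ∈ Finset.range (p + 1) := Finset.mem_range.2 (by omega)
    have hg : 0 ≤ gap F a b := by
      unfold gap
      have : ((F b : ℕ) : ℝ) ≤ ((F a : ℕ) : ℝ) := by exact_mod_cast Fin.le_def.1 hab.le
      linarith
    have hβ : 2 * (θ (l + 1) : ℝ) / (k l * θ l) ≤
        ∑ l ∈ Finset.range (p + 1), 2 * (θ (l + 1) : ℝ) / (k l * θ l) := by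
      refine Finset.single_le_sum (f := fun l => 2 * (θ (l + 1) : ℝ) / (k l * θ l))
        (fun i hi => ?_) hmem
      have hi' : i ≤ p := by have := Finset.mem_range.1 hi; omega
      have h1 := hk i hi'
      have h2 := hθ i hi'
      positivity
    have hα : (if gap F a b < k l then (θ (l + 1) : ℝ) else 0) ≤
        ∑ l ∈ Finset.range (p + 1), if gap F a b < k l then (θ (l + 1) : ℝ) else 0 := by
      refine Finset.single_le_sum
        (f := fun l => if gap F a b < k l then (θ (l + 1) : ℝ) else 0) (fun i _ => ?_) hmem
      split_ifs <;> positivity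
    have h1 := hk l hl
    have h2 := hθ l hl
    set β := ∑ l ∈ Finset.range (p + 1), 2 * (θ (l + 1) : ℝ) / (k l * θ l) with hβd
    set a' := ∑ l ∈ Finset.range (p + 1), if gap F a b < k l then (θ (l + 1) : ℝ) else 0 with had
    have hβ0 : 0 ≤ β := le_trans (by positivity) hβ
    by_cases hgk : gap F a b < k l
    · rw [if_pos hgk] at hα
      have : 0 ≤ β / 2 * (gap F a b * θ l) := by positivity
      linarith
    · push Not at hgk
      have h3 : (θ (l + 1) : ℝ) ≤ β / 2 * (gap F a b * θ l) := by
        have h4 : (θ (l + 1) : ℝ) = 2 * (θ (l + 1) : ℝ) / (k l * θ l) / 2 * (k l * θ l) := by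
          field_simp
        rw [h4]
        gcongr
      have h5 : 0 ≤ a' := le_trans (by split_ifs <;> positivity) hα
      linarith
  · rw [Finset.sum_add_distrib, Finset.sum_comm, Finset.sum_mul]
    have h1 : ∑ q ∈ Finset.univ.filter (fun q : Fin n × Fin n => F q.2 < F q.1), (θ 0 : ℝ) ≤
        κ * ((n : ℝ) ^ 2 * √n) := by
      rw [Finset.sum_const, nsmul_eq_mul]
      calc _ ≤ (n : ℝ) ^ 2 * (κ * √n) :=
            mul_le_mul (card_le_sq _) h.first_le (by positivity) (by positivity)
        _ = _ := by ring
    have h2 : ∑ l ∈ Finset.range (p + 1),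
        ∑ q ∈ Finset.univ.filter (fun q : Fin n × Fin n => F q.2 < F q.1),
          (if gap F q.1 q.2 < k l then (θ (l + 1) : ℝ) else 0) ≤
        ((p : ℝ) + 1) * (κ * ((n : ℝ) ^ 2 * √n)) := by
      refine (Finset.sum_le_sum (g := fun _ => κ * ((n : ℝ) ^ 2 * √n)) fun l hl => ?_).trans ?_
      · have hl' : l ≤ p := by have := Finset.mem_range.1 hl; omega
        exact (sum_pairs_gap_le F (hk l hl').le (by positivity)).trans (hprod l hl')
      · simp
    have h3 : ∑ l ∈ Finset.range (p + 1), 2 * (θ (l + 1) : ℝ) / (k l * θ l) * (n : ℝ) ^ 3 ≤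
        ((p : ℝ) + 1) * (2 * (κ * ((n : ℝ) ^ 2 * √n))) := by
      refine (Finset.sum_le_sum (g := fun _ => 2 * (κ * ((n : ℝ) ^ 2 * √n))) fun l hl => ?_).trans ?_
      · have hl' : l ≤ p := by have := Finset.mem_range.1 hl; omega
        rw [hb l hl']
        linarith [hprod l hl']
      · simp
    linarith

theorem half_le_log {n : ℕ} (hn : 2 ≤ n) : 1 / 2 ≤ Real.log n := by
  have h1 : Real.log 2 ≤ Real.log n := Real.log_le_log (by norm_num) (by exact_mod_cast hn)
  have h2 := Real.log_two_gt_d9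
  linarith

/-- The number of steps paid by the initial potential. -/
theorem Balanced.potential_bound {n p : ℕ} {θ : ℕ → ℕ} {κ : ℝ} (h : Balanced n p θ κ)
    (hn : 2 ≤ n) {F : Equiv.Perm (Fin n)} {α : Fin n × Fin n → ℝ} {β : ℝ}
    (hW : Weights p θ F α β)
    (hsum : ∑ q ∈ Finset.univ.filter (fun q : Fin n × Fin n => F q.2 < F q.1), α q +
      β * (n : ℝ) ^ 3 ≤ κ * ((n : ℝ) ^ 2 * √n) + 3 * ((p : ℝ) + 1) * (κ * ((n : ℝ) ^ 2 * √n)))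
    (E : Finset (Fin n × Fin n)) (T : Equiv.Perm (Fin n)) {σ : Store}
    (htot : listTotal (2 * (p + 1) * n) σ ≤ 2 * (p + 1) * n ^ 2) :
    potential p θ F α β E T σ ≤
      (3000 * (κ + κ ^ 2 + κ ^ 3)) * ((n : ℝ) ^ 2 * √n * Real.log n ^ 2) := by
  have hκ := h.nonneg
  have hlog := half_le_log hn
  set Lg := Real.log n with hLg
  have hn1 : (1 : ℝ) ≤ n := by exact_mod_cast (by omega : 1 ≤ n)
  have hs1 : 1 ≤ √(n : ℝ) := Real.one_le_sqrt.2 hn1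
  have hp := h.levels
  have htot' : (listTotal (2 * (p + 1) * n) σ : ℝ) ≤ 2 * ((p : ℝ) + 1) * (n : ℝ) ^ 2 := by
    exact_mod_cast htot
  have hθ0 : (0 : ℝ) < θ 0 := by exact_mod_cast h.one_le 0 (Nat.zero_le _)
  have hcu : (callUnit n p θ : ℝ) ≤ 2 * (κ * √n) + ((p : ℝ) + 1) := by
    unfold callUnit
    push_cast
    have h1 : ((n / θ 0 : ℕ) : ℝ) ≤ κ * √n := by
      refine Nat.cast_div_le.trans ?_
      rw [div_le_iff₀ hθ0]
      exact h.le_first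
    linarith [h.first_le]
  have h0 := potential_le hW E T σ
  set X := (n : ℝ) ^ 2 * √n with hX
  have hnX : (n : ℝ) ^ 2 ≤ X := le_mul_of_one_le_right (by positivity) hs1
  have hX0 : 0 ≤ X := by positivity
  have hp0 : (0 : ℝ) ≤ (p : ℝ) + 1 := by positivity
  have a1 : ((p : ℝ) + 1) * (n : ℝ) ^ 2 ≤ κ * Lg * X :=
    mul_le_mul hp hnX (by positivity) (by positivity)
  have a2 : (callUnit n p θ : ℝ) * (n : ℝ) ^ 2 ≤ 2 * κ * X + κ * Lg * X := by
    have h1 := mul_le_mul_of_nonneg_right hcu (by positivity : (0 : ℝ) ≤ (n : ℝ) ^ 2)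
    have h2 : (2 * (κ * √n) + ((p : ℝ) + 1)) * (n : ℝ) ^ 2 =
      2 * κ * X + ((p : ℝ) + 1) * (n : ℝ) ^ 2 := by rw [hX]; ring
    linarith
  have a3 : ((p : ℝ) + 1) * (∑ q ∈ Finset.univ.filter (fun q : Fin n × Fin n => F q.2 < F q.1), α q +
      β * (n : ℝ) ^ 3) ≤ κ * Lg * (κ * X + 3 * (κ * Lg) * (κ * X)) := by
    refine (mul_le_mul_of_nonneg_left hsum hp0).trans ?_
    refine mul_le_mul hp ?_ (by positivity) (by positivity)
    gcongr
  -- Since log n ≥ 1/2, lower powers of the logarithm are absorbed by its square at the price of a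
  -- constant.
  have b1 : 1 ≤ 4 * Lg ^ 2 := by nlinarith
  have b2 : Lg ≤ 2 * Lg ^ 2 := by nlinarith
  have c1 : κ * X ≤ 4 * (κ * (X * Lg ^ 2)) := by
    have := mul_le_mul_of_nonneg_left b1 (by positivity : 0 ≤ κ * X)
    linarith
  have c2 : κ * Lg * X ≤ 2 * (κ * (X * Lg ^ 2)) := by
    have := mul_le_mul_of_nonneg_left b2 (by positivity : 0 ≤ κ * X)
    linarith
  have c3 : κ ^ 2 * Lg * X ≤ 2 * (κ ^ 2 * (X * Lg ^ 2)) := by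
    have := mul_le_mul_of_nonneg_left b2 (by positivity : 0 ≤ κ ^ 2 * X)
    linarith
  have c4 : 0 ≤ κ * (X * Lg ^ 2) := by positivity
  have c5 : 0 ≤ κ ^ 2 * (X * Lg ^ 2) := by positivity
  have c6 : 0 ≤ κ ^ 3 * (X * Lg ^ 2) := by positivity
  have c7 : κ * Lg * (κ * X + 3 * (κ * Lg) * (κ * X)) =
    κ ^ 2 * Lg * X + 3 * (κ ^ 3 * (X * Lg ^ 2)) := by ring
  rw [c7] at a3
  have c8 : (3000 * (κ + κ ^ 2 + κ ^ 3)) * (X * Lg ^ 2) =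
    3000 * (κ * (X * Lg ^ 2)) + 3000 * (κ ^ 2 * (X * Lg ^ 2)) +
    3000 * (κ ^ 3 * (X * Lg ^ 2)) := by ring
  rw [c8]
  linarith

/-- The first bound makes the error in the exponent of the first threshold harmless; the second says
that the sums over the levels cost only a logarithm. -/
theorem levels_spec {n : ℕ} (hn : 2 ≤ n) :
    (2 / 3 : ℝ) ^ (levels n + 1) * n ≤ 1 ∧ ((levels n : ℕ) : ℝ) + 1 ≤ 7 * Real.log n := by
  have hn' : (0 : ℝ) < n := by exact_mod_cast (by omega : 0 < n)
  have hlog := half_le_log hn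
  have hl32 : 1 / 3 ≤ Real.log (3 / 2) := by
    have := Real.one_sub_inv_le_log_of_pos (show (0 : ℝ) < 3 / 2 by norm_num)
    norm_num at this ⊢
    linarith
  constructor
  · have h1 : Real.logb (3 / 2) n ≤ levels n := Nat.le_ceil _
    rw [Real.logb_le_iff_le_rpow (by norm_num) hn', Real.rpow_natCast] at h1
    have h2 : (2 / 3 : ℝ) ^ (levels n + 1) ≤ (2 / 3 : ℝ) ^ (levels n) :=
      pow_le_pow_of_le_one (by norm_num) (by norm_num) (by omega)
    have h3 : (2 / 3 : ℝ) ^ (levels n) * (3 / 2 : ℝ) ^ (levels n) = 1 := by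
      rw [← mul_pow]; norm_num
    calc _ ≤ (2 / 3 : ℝ) ^ (levels n) * (3 / 2 : ℝ) ^ (levels n) := by gcongr
      _ = 1 := h3
  · have h0 : 0 ≤ Real.logb (3 / 2) n :=
      Real.logb_nonneg (by norm_num) (by exact_mod_cast (by omega : 1 ≤ n))
    have h1 : ((levels n : ℕ) : ℝ) < Real.logb (3 / 2) n + 1 := Nat.ceil_lt_add_one h0
    have h2 : Real.logb (3 / 2) n ≤ 3 * Real.log n := by
      unfold Real.logb
      rw [div_le_iff₀ (by linarith)]
      nlinarith
    linarith

/-- In this form it is visible that the exponent is the one for which the last threshold equals `n`.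
-/
theorem expo_eq (p : ℕ) : expo p = 1 / (2 - (2 / 3 : ℝ) ^ (p + 1)) := by
  unfold expo
  have h3 : (3 : ℝ) ^ (p + 1) ≠ 0 := by positivity
  have h : 2 * (3 : ℝ) ^ (p + 1) - 2 ^ (p + 1) = 3 ^ (p + 1) * (2 - (2 / 3 : ℝ) ^ (p + 1)) := by
    rw [div_pow, mul_sub, mul_div_cancel₀ _ h3, mul_comm]
  rw [h, div_mul_cancel_left₀ h3, one_div]

/-- With ε = (2/3)^(p+1) ≤ 1/n, the exponent 1 / (2 - ε) of the first threshold t lies between 1/2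
and 1/2 + ε/2, so t is √n up to the factor n^(ε/2) ≤ 2. Hence t² ≤ 4 n, and the growth condition
reduces to a comparison of powers of t. -/
theorem threshold_facts {n : ℕ} (hn : 2 ≤ n) :
    √n ≤ threshold n 0 ∧ threshold n 0 ≤ 2 * √n ∧ threshold n (levels n + 1) = n ∧
      (∀ i, 1 ≤ threshold n i) ∧ (∀ l, threshold n (l + 1) ^ 2 ≤ 4 * n * threshold n l) ∧
      ∀ i ≤ levels n + 1, threshold n i ≤ n := by
  have hn0 : (0 : ℝ) < n := by exact_mod_cast (by omega : 0 < n)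
  have hn1 : (1 : ℝ) ≤ n := by exact_mod_cast (by omega : 1 ≤ n)
  have hnn : Real.log n ≤ n := (Real.log_le_sub_one_of_pos hn0).trans (by linarith)
  have hlog := half_le_log hn
  obtain ⟨hε, _⟩ := levels_spec hn
  set ε := (2 / 3 : ℝ) ^ (levels n + 1) with hεd
  have hε0 : 0 < ε := by positivity
  have hε1 : ε ≤ 1 := pow_le_one₀ (by norm_num) (by norm_num)
  have hf : expo (levels n) = 1 / (2 - ε) := expo_eq _
  set f := expo (levels n) with hfd
  have h2ε : 0 < 2 - ε := by linarith
  have hf1 : f * (2 - ε) = 1 := by rw [hf]; field_simp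
  have hf2 : 1 / 2 ≤ f := by nlinarith
  have hf3 : f ≤ 1 / 2 + ε / 2 := by nlinarith
  set t := (n : ℝ) ^ f with ht
  have ht0 : 0 < t := Real.rpow_pos_of_pos hn0 _
  have ht1 : 1 ≤ t := Real.one_le_rpow hn1 (by linarith)
  have hthr : ∀ i, threshold n i = t ^ (2 - (2 / 3 : ℝ) ^ i) := fun i => rfl
  have hpow : ∀ i : ℕ, (2 / 3 : ℝ) ^ i ≤ 1 := fun i => pow_le_one₀ (by norm_num) (by norm_num)
  have e0 : threshold n 0 = t := by
    rw [hthr, pow_zero, show (2 : ℝ) - 1 = 1 by norm_num, Real.rpow_one]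
  have htle : t ≤ 2 * √n := by
    calc t ≤ (n : ℝ) ^ (1 / 2 + ε / 2) := Real.rpow_le_rpow_of_exponent_le hn1 hf3
      _ = (n : ℝ) ^ (ε / 2) * √n := by rw [Real.rpow_add hn0, Real.sqrt_eq_rpow, mul_comm]
      _ ≤ 2 * √n := by
        gcongr
        rw [Real.rpow_def_of_pos hn0]
        -- Uses log n ≤ n and ε n ≤ 1.
        have h1 : Real.log n * (ε / 2) ≤ 1 / 2 := by nlinarith
        have h2 : Real.exp (1 / 2) ≤ 2 := by
          rw [← Real.le_log_iff_exp_le (by norm_num)]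
          have := Real.log_two_gt_d9
          linarith
        exact (Real.exp_le_exp.2 h1).trans h2
  have hlast : threshold n (levels n + 1) = n := by
    rw [hthr, ← hεd, ht, ← Real.rpow_mul hn0.le, hf1, Real.rpow_one]
  refine ⟨?_, by rw [e0]; exact htle, hlast, fun i => ?_, fun l => ?_, fun i hi => ?_⟩
  · rw [e0, Real.sqrt_eq_rpow]
    exact Real.rpow_le_rpow_of_exponent_le hn1 hf2
  · rw [hthr]
    exact Real.one_le_rpow ht1 (by linarith [hpow i])
  · rw [hthr, hthr, ← Real.rpow_natCast, ← Real.rpow_mul ht0.le]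
    -- The left side is 4 - (4/3) (2/3)^l, the right side 4 - (2/3)^l.
    have h1 : (2 - (2 / 3 : ℝ) ^ (l + 1)) * ((2 : ℕ) : ℝ) ≤ 2 + (2 - (2 / 3 : ℝ) ^ l) := by
      rw [pow_succ]
      have : 0 ≤ (2 / 3 : ℝ) ^ l := by positivity
      push_cast
      linarith
    calc t ^ ((2 - (2 / 3 : ℝ) ^ (l + 1)) * ((2 : ℕ) : ℝ)) ≤ t ^ (2 + (2 - (2 / 3 : ℝ) ^ l)) :=
          Real.rpow_le_rpow_of_exponent_le ht1 h1
      _ = t ^ 2 * t ^ (2 - (2 / 3 : ℝ) ^ l) := by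
          rw [Real.rpow_add ht0]; norm_num
      _ ≤ 4 * n * t ^ (2 - (2 / 3 : ℝ) ^ l) := by
          gcongr
          calc t ^ 2 ≤ (2 * √n) ^ 2 := by gcongr
            _ = 4 * (n : ℝ) := by rw [mul_pow, Real.sq_sqrt hn0.le]; norm_num
  · rw [← hlast, hthr, hthr]
    refine Real.rpow_le_rpow_of_exponent_le ht1 ?_
    have : (2 / 3 : ℝ) ^ (levels n + 1) ≤ (2 / 3 : ℝ) ^ i :=
      pow_le_pow_of_le_one (by norm_num) (by norm_num) hi
    linarith

/-- Thresholds are at least 1, so rounding down at most halves them. The constant 7 is dictated by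
the number of levels; the other conditions would allow less. -/
theorem balanced_threshold {n : ℕ} (hn : 2 ≤ n) :
    Balanced n (levels n) (fun i => ⌊threshold n i⌋₊) 7 := by
  obtain ⟨h1, h2, h3, h4, h5, h6⟩ := threshold_facts hn
  have hn0 : (0 : ℝ) < n := by exact_mod_cast (by omega : 0 < n)
  have hfl : ∀ i, threshold n i ≤ 2 * (⌊threshold n i⌋₊ : ℝ) := fun i => by
    have a1 : (1 : ℝ) ≤ (⌊threshold n i⌋₊ : ℝ) := by
      exact_mod_cast Nat.le_floor (by simpa using h4 i)
    have a2 := Nat.lt_floor_add_one (threshold n i)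
    linarith
  have hfl' : ∀ i, (⌊threshold n i⌋₊ : ℝ) ≤ threshold n i := fun i =>
    Nat.floor_le (by linarith [h4 i])
  have hs : (0 : ℝ) ≤ √n := Real.sqrt_nonneg _
  have hss : √(n : ℝ) * √n = n := Real.mul_self_sqrt hn0.le
  refine ⟨by norm_num, fun i _ => Nat.le_floor (by simpa using h4 i), ?_, ?_, ?_, fun l _ => ?_,
    (levels_spec hn).2⟩
  · show n ≤ ⌊threshold n (levels n + 1)⌋₊
    rw [h3, Nat.floor_natCast]
  · have := hfl' 0
    linarith
  · have a1 := hfl 0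
    have a2 : √n / 2 ≤ (⌊threshold n 0⌋₊ : ℝ) := by linarith
    have a3 := mul_le_mul_of_nonneg_left a2 (by positivity : 0 ≤ 7 * √(n : ℝ))
    nlinarith
  · have a1 : (⌊threshold n (l + 1)⌋₊ : ℝ) ^ 2 ≤ threshold n (l + 1) ^ 2 := by
      gcongr
      exact hfl' _
    have a2 := mul_le_mul_of_nonneg_left (hfl l) (by positivity : (0 : ℝ) ≤ 4 * n)
    have a3 : (0 : ℝ) ≤ n * ⌊threshold n l⌋₊ := by positivity
    have a4 := h5 l
    linarith

/-- Thresholds `S, 2 S, 4 S, …`. -/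
def doubling (S i : ℕ) : ℕ := 2 ^ i * S

/-- Doubling satisfies the step condition because (2 θ l)² = 4 θ l · θ l ≤ 4 n θ l while `θ l ≤ n`,
and it takes only logarithmically many levels. `S` is √n rounded up. No real powers have to be
computed. -/
theorem balanced_doubling {n S p : ℕ} (hn : 2 ≤ n) (h₁ : n ≤ S * S)
    (h₂ : ∀ s < S, s * s < n) (h₃ : n ≤ doubling S (p + 1)) (h₄ : ∀ l < p, doubling S (l + 1) < n) :
    Balanced n p (doubling S) 7 := by
  have hn0 : (0 : ℝ) < n := by exact_mod_cast (by omega : 0 < n)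
  have hS1 : 1 ≤ S := by
    rcases Nat.eq_zero_or_pos S with rfl | h
    · omega
    · exact h
  have hs1 : 1 ≤ √(n : ℝ) := Real.one_le_sqrt.2 (by exact_mod_cast (by omega : 1 ≤ n))
  have hss : √(n : ℝ) * √n = n := Real.mul_self_sqrt hn0.le
  have hlow : √(n : ℝ) ≤ S := by
    rw [Real.sqrt_le_left (by positivity), sq]
    exact_mod_cast h₁
  have hup : (S : ℝ) ≤ 2 * √n := by
    have a1 := h₂ (S - 1) (by omega)
    have a2 : ((S - 1 : ℕ) : ℝ) ≤ √n := by
      refine Real.le_sqrt_of_sq_le ?_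
      rw [sq]; exact_mod_cast a1.le
    rw [Nat.cast_sub hS1] at a2
    push_cast at a2
    linarith
  have hle : ∀ l ≤ p, doubling S l ≤ n := fun l hl => by
    rcases l with _ | l
    · by_contra hc
      have a1 := h₂ (S - 1) (by omega)
      simp only [doubling, pow_zero, one_mul] at hc
      have a2 : n ≤ S - 1 := by omega
      nlinarith
    · exact (h₄ l (by omega)).le
  have hlog := half_le_log hn
  refine ⟨by norm_num, fun i _ => ?_, h₃, ?_, ?_, fun l hl => ?_, ?_⟩
  · exact Nat.mul_pos (by positivity) hS1
  · simp only [doubling, pow_zero, one_mul]; linarith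
  · simp only [doubling, pow_zero, one_mul]
    nlinarith
  · have a1 : (doubling S (l + 1) : ℝ) = 2 * doubling S l := by
      simp only [doubling]; push_cast; ring
    have a2 : (doubling S l : ℝ) ≤ n := by exact_mod_cast hle l hl
    have a3 : (0 : ℝ) ≤ doubling S l := by positivity
    rw [a1]
    nlinarith
  · have a1 : (p : ℝ) ≤ 2 * Real.log n := by
      rcases p with _ | p
      · simp; linarith
      · have a2 : 2 ^ (p + 1) ≤ n := by
          have := hle (p + 1) le_rfl
          unfold doubling at this
          exact le_trans (Nat.le_mul_of_pos_right _ hS1) this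
        have a3 : ((2 : ℝ)) ^ (p + 1) ≤ n := by exact_mod_cast a2
        have a4 := Real.log_le_log (by positivity) a3
        rw [Real.log_pow] at a4
        have a5 := Real.log_two_gt_d9
        have a6 : (0 : ℝ) ≤ ((p + 1 : ℕ) : ℝ) := by positivity
        nlinarith
    linarith

/-! ### Initialization -/

theorem inverse_spec {n : ℕ} {T : Equiv.Perm (Fin n)} {σ : Store} (hn : σ 0 0 = n)
    (hT : ∀ v : Fin n, σ 1 v = (T v : ℕ)) (h4 : ∀ q, σ 4 q < n) :
    Tri (setVar 31 (.lit 0) ;; forLoop 31 nE (.assign 4 (.cell 1 (var 31)) (var 31))) σ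
      fun τ k => k ≤ 3 * n + 2 ∧ (∀ q, τ 4 q < n) ∧ ∀ q : Fin n, τ 4 q = (T.symm q : ℕ) := by
  refine Tri.seq (Tri.setVar ?_)
  refine (Tri.forLoop (N := n) (i₀ := 0) (fun i τ k => k ≤ 3 * i ∧ τ 31 0 = i ∧ τ 0 = σ 0 ∧
    τ 1 = σ 1 ∧ (∀ q, τ 4 q < n) ∧ ∀ j : Fin n, (j : ℕ) < i → τ 4 (T j : ℕ) = j)
    ?_ ?_ (Nat.zero_le _) ?_).mono ?_
  · rintro i τ k ⟨_, h1, h2, _⟩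
    exact ⟨h1, by simp [nE, h2, hn]⟩
  · rintro i τ k hi ⟨hk, h1, h2, h3, hlt, hinv⟩
    refine Tri.assign ?_
    have e : (Expr.cell 1 (var 31)).eval τ = T ⟨i, hi⟩ := by
      rw [eval_cell, eval_var, h1, h3]; exact hT ⟨i, hi⟩
    rw [e, eval_var, h1]
    refine ⟨by rw [Store.write_of_ne (by decide), h1], by omega, Store.write_same _ _ _ _,
      by rw [Store.write_of_ne (by decide), Store.write_of_ne (by decide), h2],
      by rw [Store.write_of_ne (by decide), Store.write_of_ne (by decide), h3], ?_, ?_⟩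
    · intro q
      rw [Store.write_of_ne (by decide), Store.write_apply]
      split_ifs
      · exact hi
      · exact hlt q
    · intro j hj
      rw [Store.write_of_ne (by decide), Store.write_apply]
      split_ifs with h5
      · have : j = ⟨i, hi⟩ := T.injective (Fin.ext h5)
        rw [this]
      · refine hinv j ?_
        rcases Nat.lt_succ_iff_lt_or_eq.1 hj with h6 | h6
        · exact h6
        · exact absurd (by rw [show j = ⟨i, hi⟩ from Fin.ext h6]) h5
  · exact ⟨by omega, Store.write_same _ _ _ _, Store.write_of_ne (by decide),
      Store.write_of_ne (by decide), by rw [Store.write_of_ne (by decide)]; exact h4,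
      fun j hj => by omega⟩
  · rintro τ k ⟨k₀, ⟨hk, _, _, _, hlt, hinv⟩, rfl⟩
    refine ⟨by omega, hlt, fun q => ?_⟩
    have := hinv (T.symm q) (T.symm q).2
    rwa [Equiv.apply_symm_apply] at this

theorem enter_row_spec {n p a : ℕ} {σ : Store} (hn : σ 0 0 = n) (hp : σ 0 3 = p)
    (ha : σ 21 0 = a) (han : a < n) (hok : ListsOK n (2 * (p + 1) * n) σ) :
    Tri (setVar 22 (.lit 0) ;; forLoop 22 nE enterCmd) σ fun τ k =>
      k ≤ (9 * (p + 1) + 2) * n + 2 ∧ (∀ c, c ≠ 6 → c ≠ 7 → c ≠ 22 → c ≠ 29 → τ c = σ c) ∧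
      Grows n (2 * (p + 1) * n) (2 * (p + 1) * n) σ τ ∧
      ∀ b < n, σ 2 (a * n + b) ≠ 0 → ∀ l ≤ p, Linked n (2 * (p + 1) * n) τ l a b := by
  set K := 2 * (p + 1) * n with hK
  refine Tri.seq (Tri.setVar ?_)
  refine (Tri.forLoop (N := n) (i₀ := 0) (fun i τ k => k ≤ (9 * (p + 1) + 2) * i ∧ τ 22 0 = i ∧
    (∀ c, c ≠ 6 → c ≠ 7 → c ≠ 22 → c ≠ 29 → τ c = σ c) ∧
    Grows n K (2 * (p + 1) * i) σ τ ∧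
    ∀ b < i, σ 2 (a * n + b) ≠ 0 → ∀ l ≤ p, Linked n K τ l a b)
    ?_ ?_ (Nat.zero_le _) ?_).mono ?_
  · rintro i τ k ⟨_, h1, h2, _⟩
    exact ⟨h1, by simp [nE, h2 0, hn]⟩
  · rintro i τ k hi ⟨hk, h1, h2, hg, hL⟩
    have e0 := h2 0 (by decide) (by decide) (by decide) (by decide)
    have e2 := h2 2 (by decide) (by decide) (by decide) (by decide)
    have e21 := h2 21 (by decide) (by decide) (by decide) (by decide)
    refine (enter_spec (n := n) (p := p) (by rw [e0]; exact hn) (by rw [e0]; exact hp)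
      (by rw [e21, ha]; exact han) (by rw [h1]; exact hi) hg.ok).frame.mono ?_
    rintro υ k' ⟨⟨hk', hg', hL'⟩, fr⟩
    rw [e2, e21, ha, h1] at hL'
    have hc : Grows n K 0 υ (υ.write 22 0 (i + 1)) :=
      Grows.congr (Store.write_of_ne (by decide)) (Store.write_of_ne (by decide)) hg'.ok
    refine ⟨by rw [fr 22 (by decide), h1], ?_, Store.write_same _ _ _ _,
      fun c c1 c2 c3 c4 => ?_, ((hg.trans hg').trans hc).le ?_, fun b hb hne l hl => ?_⟩
    · rw [Nat.mul_succ]; omega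
    · rw [Store.write_of_ne c3, fr c (by
        simp [enterCmd, linkCmd, appendCmd, forLoop, setVar, Cmd.touches, c1, c2, c4]),
        h2 c c1 c2 c3 c4]
    · exact le_of_eq (by ring)
    · rcases Nat.lt_succ_iff_lt_or_eq.1 hb with h6 | h6
      · exact (hg'.trans hc).linked hl han (by omega) (hL b h6 hne l hl)
      · subst h6
        exact hc.linked hl han hi (hL' hne l hl)
  · exact ⟨by omega, Store.write_same _ _ _ _, fun c _ _ h _ => Store.write_of_ne h,
      Grows.congr (Store.write_of_ne (by decide)) (Store.write_of_ne (by decide)) hok,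
      fun b hb => by omega⟩
  · rintro τ k ⟨k₀, ⟨hk, _, h2, hg, hL⟩, rfl⟩
    exact ⟨by omega, h2, hg, hL⟩

/-- All edges are entered on all levels whatever their length, so completeness is immediate; the
surplus entries are paid for by the initial potential, being at most 2 (p + 1) n² in number. -/
theorem setup_spec {n p : ℕ} {θ : ℕ → ℕ} {E : Finset (Fin n × Fin n)} {T : Equiv.Perm (Fin n)}
    {σ : Store} (hn : σ 0 0 = n) (hn1 : 1 ≤ n) (hp : σ 0 3 = p)
    (hT : ∀ v : Fin n, σ 1 v = (T v : ℕ))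
    (hE : ∀ u w : Fin n, σ 2 ((u : ℕ) * n + w) = if (u, w) ∈ E then 1 else 0)
    (hθ : ∀ i ≤ p + 1, σ 3 i = θ i) (hz : ∀ c, 4 ≤ c → ∀ i, σ c i = 0) :
    Tri setupCmd σ fun τ k => Struct n p θ E T τ ∧
      listTotal (2 * (p + 1) * n) τ ≤ 2 * (p + 1) * n ^ 2 ∧ k ≤ 22 * ((p + 1) * n ^ 2) := by
  set K := 2 * (p + 1) * n with hK
  have hfirst := inverse_spec hn hT (fun q => by rw [hz 4 le_rfl]; omega)
  obtain ⟨τ, k, hex, ⟨hk, hlt, hinv⟩, fr⟩ := hfirst.frame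
  have hsecond : Tri (setVar 21 (.lit 0) ;;
      forLoop 21 nE (setVar 22 (.lit 0) ;; forLoop 22 nE enterCmd)) τ fun υ k' =>
      Struct n p θ E T υ ∧ listTotal K υ ≤ 2 * (p + 1) * n ^ 2 ∧
        k' ≤ ((9 * (p + 1) + 2) * n + 4) * n + 2 := by
    have f0 : τ 0 = σ 0 := fr 0 (by decide)
    have f1 : τ 1 = σ 1 := fr 1 (by decide)
    have f2 : τ 2 = σ 2 := fr 2 (by decide)
    have f3 : τ 3 = σ 3 := fr 3 (by decide)
    have f6 : ∀ i, τ 6 i = 0 := fun i => by rw [fr 6 (by decide)]; exact hz 6 (by decide) i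
    have hB : Base n p θ E T τ := ⟨by rw [f0]; exact hn, by rw [f0]; exact hp,
      by rw [f1]; exact hT, by rw [f2]; exact hE, by rw [f3]; exact hθ, hinv, hlt⟩
    have hok : ListsOK n K τ := fun κ _ j hj => by rw [f6] at hj; omega
    have htot : listTotal K τ = 0 := Finset.sum_eq_zero fun i _ => f6 i
    refine Tri.seq (Tri.setVar ?_)
    refine (Tri.forLoop (N := n) (i₀ := 0) (fun i υ k => k ≤ ((9 * (p + 1) + 2) * n + 4) * i ∧
      υ 21 0 = i ∧ (∀ c, c ≠ 6 → c ≠ 7 → c ≠ 21 → c ≠ 22 → c ≠ 29 → υ c = τ c) ∧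
      Grows n K (K * i) τ υ ∧
      ∀ a b : Fin n, (a : ℕ) < i → (a, b) ∈ E → ∀ l ≤ p, Linked n K υ l a b)
      ?_ ?_ (Nat.zero_le _) ?_).mono ?_
    · rintro i υ k ⟨_, h1, h2, _⟩
      exact ⟨h1, by simp [nE, h2 0, f0, hn]⟩
    · rintro i υ k hi ⟨hk, h1, h2, hg, hL⟩
      have e0 := h2 0 (by decide) (by decide) (by decide) (by decide) (by decide)
      have e2 := h2 2 (by decide) (by decide) (by decide) (by decide) (by decide)
      refine (enter_row_spec (n := n) (p := p) (by rw [e0]; exact hB.size)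
        (by rw [e0]; exact hB.lev) h1 hi hg.ok).mono ?_
      rintro ρ k' ⟨hk', fr', hg', hL'⟩
      have hc : Grows n K 0 ρ (ρ.write 21 0 (i + 1)) :=
        Grows.congr (Store.write_of_ne (by decide)) (Store.write_of_ne (by decide)) hg'.ok
      refine ⟨by rw [fr' 21 (by decide) (by decide) (by decide) (by decide), h1], ?_,
        Store.write_same _ _ _ _, fun c c1 c2 c3 c4 c5 => ?_, ((hg.trans hg').trans hc).le ?_,
        fun a b hai hab l hl => ?_⟩
      · rw [Nat.mul_succ]; omega
      · rw [Store.write_of_ne c3, fr' c c1 c2 c4 c5, h2 c c1 c2 c3 c4 c5]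
      · exact le_of_eq (by rw [hK]; ring)
      · rcases Nat.lt_succ_iff_lt_or_eq.1 hai with h6 | h6
        · exact (hg'.trans hc).linked hl a.2 b.2 (hL a b h6 hab l hl)
        · subst h6
          refine hc.linked hl a.2 b.2 (hL' b b.2 ?_ l hl)
          rw [e2]
          exact hB.edge_ne_zero.2 hab
    · exact ⟨by omega, Store.write_same _ _ _ _, fun c _ _ h _ _ => Store.write_of_ne h,
        Grows.congr (Store.write_of_ne (by decide)) (Store.write_of_ne (by decide)) hok,
        fun a b hb => by omega⟩
    · rintro υ k ⟨k₀, ⟨hk, _, h2, hg, hL⟩, rfl⟩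
      have h2' : ∀ c, c < 5 ∨ c = 9 ∨ c = 10 → υ c = τ c := fun c hc =>
        h2 c (by omega) (by omega) (by omega) (by omega) (by omega)
      refine ⟨⟨hB.congr (h2' 0 (by omega)) (h2' 1 (by omega)) (h2' 2 (by omega)) (h2' 3 (by omega))
        (h2' 4 (by omega)), hg.ok, fun l hl a b hab _ => hL a b a.2 hab l hl, fun e => ?_,
        fun e => ?_⟩, ?_, by omega⟩
      · rw [h2' 9 (by omega), fr 9 (by decide)]; exact hz 9 (by decide) e
      · rw [h2' 10 (by omega), fr 10 (by decide)]; exact hz 10 (by decide) e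
      · have h5 := hg.total
        rw [htot] at h5
        refine h5.trans (le_of_eq ?_)
        rw [hK]; ring
  obtain ⟨υ, k', hex', hSυ, ht, hk'⟩ := hsecond
  have h1 : n ≤ (p + 1) * n ^ 2 := by nlinarith [Nat.zero_le (p * n ^ 2)]
  refine Tri.mono (Q := fun ρ j => ρ = υ ∧ j = k + k') ?_ ?_
  · cases hex with
    | seq hx hy => exact ⟨υ, _, hx.seq (hy.seq hex'), rfl, by ring⟩
  · rintro ρ j ⟨rfl, rfl⟩
    refine ⟨hSυ, ht, ?_⟩
    have h2 : ((9 * (p + 1) + 2) * n + 4) * n = 9 * ((p + 1) * n ^ 2) + 2 * n ^ 2 + 4 * n := by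
      ring
    have h3 : n ^ 2 ≤ (p + 1) * n ^ 2 := Nat.le_mul_of_pos_left _ (by omega)
    omega

/-! ### Initialization without a given order -/

/-- The smallest number in cell `0` of array `3` whose square is at least the number of
vertices. -/
def rootCmd : Cmd :=
  .loop (.bin .lt (var 3 * var 3) nE) (.assign 3 (.lit 0) (var 3 + .lit 1))

/-- The next threshold, twice the current one. -/
def doubleCmd : Cmd :=
  -- Doubling by single increments keeps every assignment within one of the stored numbers, as
  -- `Ex.exec` requires.
  .assign 3 (pE + .lit 1) (.cell 3 pE) ;; setVar 40 (.lit 0) ;;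
  forLoop 40 (.cell 3 pE) (.assign 3 (pE + .lit 1) (.cell 3 (pE + .lit 1) + .lit 1))

/-- All thresholds. -/
def thresholdsCmd : Cmd :=
  rootCmd ;; doubleCmd ;;
  .loop (.bin .lt (.cell 3 (pE + .lit 1)) nE) (.assign 0 (.lit 3) (pE + .lit 1) ;; doubleCmd)

/-- The identical order. -/
def identityCmd : Cmd :=
  setVar 31 (.lit 0) ;;
  forLoop 31 nE (.assign 1 (var 31) (var 31) ;; .assign 4 (var 31) (var 31))

/-- Move the adjacency matrix to array `5`. -/
def moveCmd : Cmd :=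
  setVar 40 (.lit 0) ;;
  forLoop 40 (nE * nE) (.assign 5 (var 40) (.cell 2 (var 40)) ;; .assign 2 (var 40) (.lit 0))

/-- Insert the edges of the matrix in array `5` one by one. -/
def buildCmd : Cmd :=
  setVar 40 (.lit 0) ;;
  forLoop 40 (nE * nE) (.cond (.cell 5 (var 40)) (
    -- Quotient and remainder of the matrix index are the end points of the edge.
    .assign 0 (.lit 1) (var 40 / nE) ;; .assign 0 (.lit 2) (var 40 - var 40 / nE * nE) ;;
    insertCmd) .skip)

/-- Initialization for a given graph. -/
def startCmd : Cmd := thresholdsCmd ;; identityCmd ;; moveCmd ;; buildCmd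

theorem startCmd_slow : startCmd.slow = true := by decide

theorem root_spec {n : ℕ} {σ : Store} (hn : σ 0 0 = n) (h3 : σ 3 0 = 0) :
    Tri rootCmd σ fun τ k => n ≤ τ 3 0 * τ 3 0 ∧ (∀ s < τ 3 0, s * s < n) ∧ τ 3 0 ≤ n ∧
      k ≤ 2 * n + 1 := by
  refine (Tri.loop (fun τ k => τ 0 = σ 0 ∧ (∀ s < τ 3 0, s * s < n) ∧ τ 3 0 ≤ n ∧ k ≤ 2 * τ 3 0)
    (fun τ => n - τ 3 0) ?_ ⟨rfl, by rw [h3]; omega, by omega, by omega⟩).mono ?_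
  · rintro τ k ⟨h0, hs, hle, hk⟩ hb
    have hlt : τ 3 0 * τ 3 0 < n := by
      by_contra h
      exact hb (by simp [nE, h0, hn, h])
    have hlt' : τ 3 0 < n := lt_of_le_of_lt (Nat.le_mul_self _) hlt
    refine Tri.assign ?_
    simp only [eval_lit, eval_add, eval_var]
    rw [Store.write_same, Store.write_of_ne (by decide)]
    refine ⟨⟨h0, fun s hs' => ?_, by omega, by omega⟩, by omega⟩
    rcases Nat.lt_succ_iff_lt_or_eq.1 hs' with h | rfl
    · exact hs s h
    · exact hlt
  · rintro τ k ⟨hb, k₀, ⟨h0, hs, hle, hk⟩, rfl⟩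
    refine ⟨?_, hs, hle, by omega⟩
    by_contra h
    simp [nE, h0, hn, Nat.lt_of_not_le h] at hb

theorem double_spec {σ : Store} {p x : ℕ} (hp : σ 0 3 = p) (hx : σ 3 p = x) :
    Tri doubleCmd σ fun τ k => τ 3 (p + 1) = 2 * x ∧ (∀ j ≤ p, τ 3 j = σ 3 j) ∧ k = 3 * x + 3 := by
  refine Tri.seq (Tri.assign (Tri.seq (Tri.setVar ?_)))
  simp only [pE, eval_cell, eval_lit, eval_add, hp, hx]
  refine (Tri.forLoop (N := x) (i₀ := 0) (fun i τ k => k = 3 * i ∧ τ 40 0 = i ∧ τ 0 = σ 0 ∧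
    τ 3 (p + 1) = x + i ∧ ∀ j ≤ p, τ 3 j = σ 3 j) ?_ ?_ (Nat.zero_le _) ?_).mono ?_
  · rintro i τ k ⟨_, h1, h0, _, h3⟩
    exact ⟨h1, by simp [h0, hp, h3 p le_rfl, hx]⟩
  · rintro i τ k hi ⟨hk, h1, h0, h2, h3⟩
    refine Tri.assign ?_
    simp only [eval_cell, eval_lit, eval_add, h0, hp, h2]
    refine ⟨by rw [Store.write_of_ne (by decide), h1], by omega, Store.write_same _ _ _ _,
      by rw [Store.write_of_ne (by decide), Store.write_of_ne (by decide), h0],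
      by rw [Store.write_of_ne (by decide), Store.write_same]; omega, fun j hj => ?_⟩
    rw [Store.write_of_ne (by decide), Store.write_apply, if_neg (by omega), h3 j hj]
  · refine ⟨by omega, Store.write_same _ _ _ _,
      by rw [Store.write_of_ne (by decide), Store.write_of_ne (by decide)],
      by rw [Store.write_of_ne (by decide), Store.write_same]; omega, fun j hj => ?_⟩
    rw [Store.write_of_ne (by decide), Store.write_apply, if_neg (by omega)]
  · rintro τ k ⟨k₀, ⟨hk, _, _, h2, h3⟩, rfl⟩
    exact ⟨by omega, h3, by omega⟩

theorem doubling_succ (S i : ℕ) : doubling S (i + 1) = 2 * doubling S i := by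
  unfold doubling; ring

/-- Computing a threshold takes time proportional to its size. The sizes form a geometric series
ending at no more than 2 n, so the total is linear. -/
theorem thresholds_spec {n : ℕ} (hn2 : 2 ≤ n) {σ : Store} (hn : σ 0 0 = n) (hp : σ 0 3 = 0)
    (h3 : σ 3 0 = 0) :
    Tri thresholdsCmd σ fun τ k => ∃ p S, Balanced n p (doubling S) 7 ∧ τ 0 0 = n ∧ τ 0 3 = p ∧
      (∀ i ≤ p + 1, τ 3 i = doubling S i) ∧ k ≤ 32 * n := by
  refine Tri.seq ((root_spec hn h3).frame.mono ?_)
  rintro τ k ⟨⟨h1, h2, hle, hk⟩, fr⟩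
  have e0 : τ 0 = σ 0 := fr 0 (by decide)
  set S := τ 3 0 with hS
  have hS1 : 1 ≤ S := by
    rcases Nat.eq_zero_or_pos S with h | h
    · rw [h] at h1; omega
    · exact h
  have hpos : ∀ i, 1 ≤ doubling S i := fun i => Nat.mul_pos (by positivity) hS1
  have hd0 : doubling S 0 = S := by simp [doubling]
  refine Tri.seq ((double_spec (p := 0) (by rw [e0]; exact hp) rfl).frame.mono ?_)
  rintro υ k' ⟨⟨h4, h5, hk'⟩, fr'⟩
  have e0' : υ 0 = σ 0 := by rw [fr' 0 (by decide), e0]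
  refine (Tri.loop (fun ρ k => ρ 0 0 = n ∧ (∀ j ≤ ρ 0 3 + 1, ρ 3 j = doubling S j) ∧
    (∀ l < ρ 0 3, doubling S (l + 1) < n) ∧ k ≤ 12 * doubling S (ρ 0 3 + 1))
    (fun ρ => n - ρ 3 (ρ 0 3 + 1)) ?_ ?_).mono ?_
  · rintro ρ j ⟨g0, g1, g2, hj⟩ hb
    have g3 := g1 _ le_rfl
    have hlt : doubling S (ρ 0 3 + 1) < n := by
      by_contra h
      exact hb (by simp [pE, nE, g0, g3, h])
    refine Tri.seq (Tri.assign ?_)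
    simp only [pE, eval_cell, eval_lit, eval_add]
    set p := ρ 0 3 with hp
    set ρ' := ρ.write 0 3 (p + 1) with hρ'
    have a1 : ρ' 0 3 = p + 1 := Store.write_same _ _ _ _
    have a2 : ρ' 3 = ρ 3 := Store.write_of_ne (by decide)
    have a3 : ρ' 0 0 = n := by rw [hρ', Store.write_apply, if_neg (by decide), g0]
    refine (double_spec a1 (x := doubling S (p + 1)) (by rw [a2, g3])).frame.mono ?_
    rintro π j' ⟨⟨b1, b2, hj'⟩, fr''⟩
    have c0 : π 0 = ρ' 0 := fr'' 0 (by decide)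
    rw [c0, a1, b1, g3]
    have hp1 := hpos (p + 1)
    refine ⟨⟨a3, fun i hi => ?_, fun l hl => ?_, ?_⟩, by omega⟩
    · rcases Nat.lt_succ_iff_lt_or_eq.1 (Nat.lt_succ_of_le hi) with h | h
      · rw [b2 i (by omega), a2, g1 i (by omega)]
      · rw [h, b1, doubling_succ S (p + 1)]
    · rcases Nat.lt_succ_iff_lt_or_eq.1 hl with h | h
      · exact g2 l h
      · rw [h]; exact hlt
    · rw [doubling_succ S (p + 1)]; omega
  · rw [e0', hn, hp]
    refine ⟨rfl, fun j hj => ?_, fun l hl => by omega, by omega⟩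
    have : j = 0 ∨ j = 1 := by omega
    rcases this with rfl | rfl
    · rw [h5 0 le_rfl, hd0]
    · rw [doubling_succ, hd0]; exact h4
  · rintro ρ j ⟨hb, j₀, ⟨g0, g1, g2, hj⟩, rfl⟩
    have g3 := g1 _ le_rfl
    have hge : n ≤ doubling S (ρ 0 3 + 1) := by
      by_contra h
      simp [pE, nE, g0, g3, Nat.lt_of_not_le h] at hb
    refine ⟨ρ 0 3, S, balanced_doubling hn2 h1 h2 hge g2, g0, rfl, g1, ?_⟩
    have hup : doubling S (ρ 0 3 + 1) ≤ 2 * n := by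
      rw [doubling_succ]
      rcases Nat.eq_zero_or_pos (ρ 0 3) with h | h
      · rw [h, hd0]; omega
      · have := g2 (ρ 0 3 - 1) (by omega)
        rw [Nat.sub_add_cancel h] at this
        omega
    omega

theorem identity_spec {n : ℕ} {σ : Store} (hn : σ 0 0 = n) (h4 : ∀ q, σ 4 q < n) :
    Tri identityCmd σ fun τ k => k ≤ 4 * n + 2 ∧ (∀ q < n, τ 1 q = q) ∧ (∀ q < n, τ 4 q = q) ∧
      ∀ q, τ 4 q < n := by
  refine Tri.seq (Tri.setVar ?_)
  refine (Tri.forLoop (N := n) (i₀ := 0) (fun i τ k => k ≤ 4 * i ∧ τ 31 0 = i ∧ τ 0 = σ 0 ∧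
    (∀ q < i, τ 1 q = q) ∧ (∀ q < i, τ 4 q = q) ∧ ∀ q, τ 4 q < n)
    ?_ ?_ (Nat.zero_le _) ?_).mono ?_
  · rintro i τ k ⟨_, h1, h2, _⟩
    exact ⟨h1, by simp [nE, h2, hn]⟩
  · rintro i τ k hi ⟨hk, h1, h0, h2, h3, h5⟩
    refine Tri.seq (Tri.assign (Tri.assign ?_))
    simp only [eval_var, h1]
    rw [Store.write_of_ne (show (31 : ℕ) ≠ 1 by decide), h1]
    refine ⟨by rw [Store.write_of_ne (by decide), Store.write_of_ne (by decide), h1], by omega,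
      Store.write_same _ _ _ _, by rw [Store.write_of_ne (by decide), Store.write_of_ne (by decide),
      Store.write_of_ne (by decide), h0], fun q hq => ?_, fun q hq => ?_, fun q => ?_⟩
    · rw [Store.write_of_ne (by decide), Store.write_of_ne (by decide), Store.write_apply]
      split_ifs with h
      · exact h.symm
      · exact h2 q (by omega)
    · rw [Store.write_of_ne (by decide), Store.write_apply, Store.write_of_ne (by decide)]
      split_ifs with h
      · exact h.symm
      · exact h3 q (by omega)
    · rw [Store.write_of_ne (by decide), Store.write_apply, Store.write_of_ne (by decide)]
      split_ifs with h
      · exact hi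
      · exact h5 q
  · exact ⟨by omega, Store.write_same _ _ _ _, Store.write_of_ne (by decide),
      fun q hq => by omega, fun q hq => by omega,
      by rw [Store.write_of_ne (by decide)]; exact h4⟩
  · rintro τ k ⟨k₀, ⟨hk, _, _, h2, h3, h5⟩, rfl⟩
    exact ⟨by omega, h2, h3, h5⟩

theorem move_spec {n : ℕ} {σ : Store} (hn : σ 0 0 = n) :
    Tri moveCmd σ fun τ k => k ≤ 4 * (n * n) + 2 ∧ (∀ q < n * n, τ 5 q = σ 2 q) ∧
      ∀ q < n * n, τ 2 q = 0 := by
  refine Tri.seq (Tri.setVar ?_)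
  refine (Tri.forLoop (N := n * n) (i₀ := 0) (fun i τ k => k ≤ 4 * i ∧ τ 40 0 = i ∧ τ 0 = σ 0 ∧
    (∀ q < i, τ 5 q = σ 2 q) ∧ (∀ q < i, τ 2 q = 0) ∧ ∀ q, i ≤ q → τ 2 q = σ 2 q)
    ?_ ?_ (Nat.zero_le _) ?_).mono ?_
  · rintro i τ k ⟨_, h1, h2, _⟩
    exact ⟨h1, by simp [nE, h2, hn]⟩
  · rintro i τ k hi ⟨hk, h1, h0, h2, h3, h5⟩
    refine Tri.seq (Tri.assign (Tri.assign ?_))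
    simp only [eval_var, eval_cell, eval_lit, h1]
    rw [Store.write_of_ne (show (40 : ℕ) ≠ 5 by decide), h1]
    refine ⟨by rw [Store.write_of_ne (by decide), Store.write_of_ne (by decide), h1], by omega,
      Store.write_same _ _ _ _, by rw [Store.write_of_ne (by decide), Store.write_of_ne (by decide),
      Store.write_of_ne (by decide), h0], fun q hq => ?_, fun q hq => ?_, fun q hq => ?_⟩
    · rw [Store.write_of_ne (by decide), Store.write_of_ne (by decide), Store.write_apply]
      split_ifs with h
      · rw [h]; exact h5 i le_rfl
      · exact h2 q (by omega)
    · rw [Store.write_of_ne (by decide), Store.write_apply, Store.write_of_ne (by decide)]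
      split_ifs with h
      · rfl
      · exact h3 q (by omega)
    · rw [Store.write_of_ne (by decide), Store.write_apply, Store.write_of_ne (by decide),
        if_neg (by omega)]
      exact h5 q (by omega)
  · exact ⟨by omega, Store.write_same _ _ _ _, Store.write_of_ne (by decide),
      fun q hq => by omega, fun q hq => by omega, fun q _ => by rw [Store.write_of_ne (by decide)]⟩
  · rintro τ k ⟨k₀, ⟨hk, _, _, h2, h3, h5⟩, rfl⟩
    exact ⟨by omega, h2, h3⟩

/-- Cells 1 and 2 of array 0 receive the presented edge and do not belong to the data structure, so
array 0 need only agree in cells 0 and 3. -/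
theorem Struct.of_cells {n p : ℕ} {θ : ℕ → ℕ} {E : Finset (Fin n × Fin n)}
    {T : Equiv.Perm (Fin n)} {σ τ : Store} (h : Struct n p θ E T σ) (h0 : τ 0 0 = σ 0 0)
    (h3 : τ 0 3 = σ 0 3) (hc : ∀ c, 1 ≤ c → c ≤ 10 → τ c = σ c) : Struct n p θ E T τ := by
  have e6 := hc 6 (by decide) (by decide)
  have e7 := hc 7 (by decide) (by decide)
  refine ⟨⟨h0.trans h.base.size, h3.trans h.base.lev, ?_, ?_, ?_, ?_, ?_⟩, h.ok.congr e6 e7, ?_,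
    ?_, ?_⟩
  · rw [hc 1 le_rfl (by decide)]; exact h.base.ord
  · rw [hc 2 (by decide) (by decide)]; exact h.base.graph
  · rw [hc 3 (by decide) (by decide)]; exact h.base.thr
  · rw [hc 4 (by decide) (by decide)]; exact h.base.inv
  · rw [hc 4 (by decide) (by decide)]; exact h.base.inv_lt
  · intro l hl a b hab hd
    have := h.complete l hl a b hab hd
    exact ⟨(InList.congr e6 e7).2 this.1, (InList.congr e6 e7).2 this.2⟩
  · rw [hc 9 (by decide) (by decide)]; exact h.marks
  · rw [hc 10 (by decide) (by decide)]; exact h.blocks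

theorem potential_congr {n p : ℕ} {θ : ℕ → ℕ} {F : Equiv.Perm (Fin n)} {α : Fin n × Fin n → ℝ}
    {β : ℝ} {E : Finset (Fin n × Fin n)} {T : Equiv.Perm (Fin n)} {σ τ : Store}
    (h : τ 6 = σ 6) : potential p θ F α β E T τ = potential p θ F α β E T σ := by
  unfold potential
  rw [listTotal_congr h]

/-- The edges among the first `q` pairs. -/
def initialEdges {n : ℕ} (E : Finset (Fin n × Fin n)) (q : ℕ) : Finset (Fin n × Fin n) :=
  E.filter fun e => (e.1 : ℕ) * n + e.2 < q

theorem initialEdges_succ {n : ℕ} (E : Finset (Fin n × Fin n)) (u w : Fin n) :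
    initialEdges E ((u : ℕ) * n + w + 1) = if (u, w) ∈ E then
      insert (u, w) (initialEdges E ((u : ℕ) * n + w)) else initialEdges E ((u : ℕ) * n + w) := by
  have key : ∀ e : Fin n × Fin n, (e.1 : ℕ) * n + e.2 < (u : ℕ) * n + w + 1 ↔
      e = (u, w) ∨ (e.1 : ℕ) * n + e.2 < (u : ℕ) * n + w := by
    intro e
    rw [Nat.lt_succ_iff_lt_or_eq, or_comm]
    refine or_congr_left ⟨fun h => ?_, fun h => by rw [h]⟩
    obtain ⟨h1, h2⟩ := pair_index_inj h
    exact Prod.ext h1 h2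
  ext e
  split_ifs with h
  · simp only [initialEdges, Finset.mem_filter, Finset.mem_insert, key]
    refine ⟨fun ⟨h1, h2⟩ => ?_, ?_⟩
    · exact h2.imp id fun h3 => ⟨h1, h3⟩
    · rintro (rfl | h1)
      · exact ⟨h, Or.inl rfl⟩
      · exact ⟨h1.1, Or.inr h1.2⟩
  · simp only [initialEdges, Finset.mem_filter, key]
    refine and_congr_right fun h1 => or_iff_right ?_
    rintro rfl
    exact h h1

/-- The starting edges are treated as insertions into the empty graph. `F` is an order of the final
graph and thus of every intermediate one, so the potential that pays for the later insertions pays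
for these as well. -/
theorem build_spec {n p : ℕ} {θ : ℕ → ℕ} {E : Finset (Fin n × Fin n)} {F : Equiv.Perm (Fin n)}
    {α : Fin n × Fin n → ℝ} {β : ℝ} (hW : Weights p θ F α β) (hθ : 1 ≤ θ 0)
    (hθn : n ≤ θ (p + 1)) (hF : IsTopOrder E F) {T₀ : Equiv.Perm (Fin n)} {σ : Store}
    (hS : Struct n p θ ∅ T₀ σ)
    (h5 : ∀ u w : Fin n, σ 5 ((u : ℕ) * n + w) = if (u, w) ∈ E then 1 else 0) :
    Tri buildCmd σ fun τ k => ∃ T, IsTopOrder E T ∧ Struct n p θ E T τ ∧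
      (k : ℝ) + potential p θ F α β E T τ ≤
        potential p θ F α β ∅ T₀ σ + 5 * (n : ℝ) ^ 2 + 2 := by
  have hn := hS.base.size
  refine Tri.seq (Tri.setVar ?_)
  refine (Tri.forLoop (N := n * n) (i₀ := 0) (fun q τ k => τ 40 0 = q ∧ τ 5 = σ 5 ∧
    ∃ T, IsTopOrder (initialEdges E q) T ∧ Struct n p θ (initialEdges E q) T τ ∧
      (k : ℝ) + potential p θ F α β (initialEdges E q) T τ ≤
        potential p θ F α β ∅ T₀ σ + 5 * q) ?_ ?_ (Nat.zero_le _) ?_).mono ?_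
  · rintro q τ k ⟨h1, _, T, _, hSτ, _⟩
    exact ⟨h1, by simp [nE, hSτ.base.size]⟩
  · rintro q τ k hq ⟨h1, h2, T, hT, hSτ, hk⟩
    have hn0 : 0 < n := Nat.pos_of_ne_zero fun h => by simp [h] at hq
    obtain ⟨u, w, rfl⟩ : ∃ u w : Fin n, q = (u : ℕ) * n + w :=
      ⟨⟨q / n, Nat.div_lt_of_lt_mul hq⟩, ⟨q % n, Nat.mod_lt _ hn0⟩,
        by rw [mul_comm]; exact (Nat.div_add_mod q n).symm⟩
    have hdiv : ((u : ℕ) * n + w) / n = u := by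
      rw [mul_comm, Nat.mul_add_div hn0, Nat.div_eq_of_lt w.2, add_zero]
    have e5 : (Expr.cell 5 (var 40)).eval τ = if (u, w) ∈ E then 1 else 0 := by
      rw [eval_cell, eval_var, h1, h2, h5]
    refine Tri.cond (fun hb => ?_) (fun hb => Tri.skip ?_)
    · have he : (u, w) ∈ E := by
        by_contra h
        rw [e5, if_neg h] at hb
        exact hb rfl
      rw [initialEdges_succ, if_pos he]
      have hnew : (u, w) ∉ initialEdges E ((u : ℕ) * n + w) := by
        simp [initialEdges]
      refine Tri.seq (Tri.assign (Tri.seq (Tri.assign ?_)))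
      simp only [nE, eval_div, eval_sub, eval_mul, eval_var, eval_cell, eval_lit, h1]
      rw [Store.write_of_ne (show (40 : ℕ) ≠ 0 by decide), Store.write_apply,
        if_neg (by decide), h1, hSτ.base.size, hdiv, Nat.add_sub_cancel_left]
      set ρ := (τ.write 0 1 (u : ℕ)).write 0 2 (w : ℕ) with hρ
      have hρc : ∀ c, c ≠ 0 → ρ c = τ c := fun c hc => by
        rw [hρ, Store.write_of_ne hc, Store.write_of_ne hc]
      have hSρ : Struct n p θ (initialEdges E ((u : ℕ) * n + w)) T ρ :=
        hSτ.of_cells (by simp [hρ, Store.write]) (by simp [hρ, Store.write])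
          fun c hc _ => hρc c (by omega)
      have hFi : IsTopOrder (insert (u, w) (initialEdges E ((u : ℕ) * n + w))) F := by
        intro e h
        rcases Finset.mem_insert.1 h with rfl | h
        · exact hF _ he
        · exact hF _ (Finset.mem_filter.1 h).1
      refine (insert_step hW hθ hθn hnew hFi hT hSρ (by simp [hρ, Store.write])
        (by simp [hρ, Store.write])).frame.mono ?_
      rintro υ j ⟨⟨T', hT', hSυ, _, hj⟩, fr⟩
      refine ⟨by rw [fr 40 (by decide), hρc 40 (by decide), h1], Store.write_same _ _ _ _,
        by rw [Store.write_of_ne (by decide), fr 5 (by decide), hρc 5 (by decide), h2], T', hT',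
        hSυ.congr fun c hc => Store.write_of_ne (by omega), ?_⟩
      rw [potential_congr (σ := υ) (Store.write_of_ne (by decide))]
      rw [potential_congr (σ := τ) (hρc 6 (by decide))] at hj
      push_cast at hk ⊢
      linarith
    · have he : (u, w) ∉ E := fun h => by
        rw [e5, if_pos h] at hb
        omega
      rw [initialEdges_succ, if_neg he]
      refine ⟨h1, Store.write_same _ _ _ _, by rw [Store.write_of_ne (by decide), h2], T, hT,
        hSτ.congr fun c hc => Store.write_of_ne (by omega), ?_⟩
      rw [potential_congr (σ := τ) (Store.write_of_ne (by decide))]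
      push_cast at hk ⊢
      linarith
  · have hE0 : initialEdges E 0 = ∅ := by simp [initialEdges]
    rw [hE0]
    refine ⟨Store.write_same _ _ _ _, Store.write_of_ne (by decide), T₀, fun e he => by simp at he,
      hS.congr fun c hc => Store.write_of_ne (by omega), ?_⟩
    rw [potential_congr (σ := σ) (Store.write_of_ne (by decide))]
    simp
  · rintro τ k ⟨k₀, ⟨_, _, T, hT, hSτ, hk⟩, rfl⟩
    have hEn : initialEdges E (n * n) = E := by
      refine Finset.filter_true_of_mem fun e _ => ?_
      have h1 := e.1.2
      have h2 := e.2.2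
      calc (e.1 : ℕ) * n + e.2 < (e.1 : ℕ) * n + n := by omega
        _ = ((e.1 : ℕ) + 1) * n := by ring
        _ ≤ n * n := Nat.mul_le_mul_right n h1
    rw [hEn] at hT hSτ hk
    refine ⟨T, hT, hSτ, ?_⟩
    push_cast at hk ⊢
    linarith

theorem inputStore_graph {n : ℕ} (E : Finset (Fin n × Fin n)) (u w : Fin n) :
    inputStore n E 2 ((u : ℕ) * n + w) = if (u, w) ∈ E then 1 else 0 := by
  unfold inputStore
  rw [if_neg (by omega)]
  refine if_congr ⟨?_, fun h => ⟨rfl, _, h, rfl⟩⟩ rfl rfl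
  rintro ⟨_, e, he, h⟩
  obtain ⟨h1, h2⟩ := pair_index_inj h
  rwa [h1, h2]

theorem inputStore_eq_zero {n : ℕ} (E : Finset (Fin n × Fin n)) {c : ℕ} (h0 : c ≠ 0)
    (h2 : c ≠ 2) (i : ℕ) : inputStore n E c i = 0 := by
  unfold inputStore
  rw [if_neg (by tauto), if_neg (by tauto)]

/-- `F` is arbitrary here because it has to be an order of the graph after all insertions; the
potential that remains after the initialization is handed on to them. -/
theorem start_spec {n : ℕ} (hn : 2 ≤ n) {E : Finset (Fin n × Fin n)} {F : Equiv.Perm (Fin n)}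
    (hF : IsTopOrder E F) :
    Tri startCmd (inputStore n E) fun τ k => ∃ p θ α β T, 1 ≤ θ 0 ∧ n ≤ θ (p + 1) ∧
      Weights p θ F α β ∧ IsTopOrder E T ∧ Struct n p θ E T τ ∧
      (k : ℝ) + potential p θ F α β E T τ ≤
        (3000 * (7 + 7 ^ 2 + 7 ^ 3)) * ((n : ℝ) ^ 2 * √n * Real.log n ^ 2) + 34 * (n : ℝ) ^ 2 := by
  set σ := inputStore n E with hσ
  have hz : ∀ c, c ≠ 0 → c ≠ 2 → ∀ i, σ c i = 0 := fun c h0 h2 i => inputStore_eq_zero E h0 h2 i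
  refine Tri.seq ((thresholds_spec hn (σ := σ) (by simp [hσ, inputStore])
    (by simp [hσ, inputStore]) (hz 3 (by decide) (by decide) 0)).frame.mono ?_)
  rintro τ k ⟨⟨p, S, hB, h0, hp, hθ, hk⟩, fr⟩
  have hτ : ∀ c, c ≠ 0 → c ≠ 2 → c ≠ 3 → c ≠ 40 → ∀ i, τ c i = 0 := fun c h0 h2 h3 h40 i => by
    rw [fr c (by simp [thresholdsCmd, rootCmd, doubleCmd, forLoop, setVar, Cmd.touches, h0, h3,
      h40])]
    exact hz c h0 h2 i
  refine Tri.seq ((identity_spec h0 fun q => by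
    rw [hτ 4 (by decide) (by decide) (by decide) (by decide)]; omega).frame.mono ?_)
  rintro υ k' ⟨⟨hk', i1, i4, i5⟩, fr'⟩
  refine Tri.seq ((move_spec (n := n) (by rw [fr' 0 (by decide)]; exact h0)).frame.mono ?_)
  rintro ρ k'' ⟨⟨hk'', m5, m2⟩, fr''⟩
  have hidx : ∀ u w : Fin n, (u : ℕ) * n + w < n * n := fun u w => by
    have h1 := u.2
    have h2 := w.2
    calc (u : ℕ) * n + w < (u : ℕ) * n + n := by omega
      _ = ((u : ℕ) + 1) * n := by ring
      _ ≤ n * n := Nat.mul_le_mul_right n h1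
  have hρ0 : ρ 0 = τ 0 := by rw [fr'' 0 (by decide), fr' 0 (by decide)]
  have hρ6 : ∀ i, ρ 6 i = 0 := fun i => by
    rw [fr'' 6 (by decide), fr' 6 (by decide)]
    exact hτ 6 (by decide) (by decide) (by decide) (by decide) i
  have hS : Struct n p (doubling S) ∅ 1 ρ := by
    refine ⟨⟨by rw [hρ0]; exact h0, by rw [hρ0]; exact hp, fun v => ?_, fun u w => ?_,
      fun i hi => ?_, fun q => ?_, fun q => ?_⟩, fun κ _ j hj => ?_, fun l _ a b hab => ?_,
      fun e => ?_, fun e => ?_⟩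
    · rw [fr'' 1 (by decide), i1 v v.2]; rfl
    · rw [m2 _ (hidx u w)]; simp
    · rw [fr'' 3 (by decide), fr' 3 (by decide)]; exact hθ i hi
    · rw [fr'' 4 (by decide), i4 q q.2]; rfl
    · rw [fr'' 4 (by decide)]; exact i5 q
    · rw [hρ6] at hj; omega
    · simp at hab
    · rw [fr'' 9 (by decide), fr' 9 (by decide)]
      exact hτ 9 (by decide) (by decide) (by decide) (by decide) e
    · rw [fr'' 10 (by decide), fr' 10 (by decide)]
      exact hτ 10 (by decide) (by decide) (by decide) (by decide) e
  obtain ⟨α, β, hW, hsum⟩ := hB.exists_weights (by omega) F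
  have hpot := hB.potential_bound hn hW hsum ∅ 1 (σ := ρ) (by
    rw [listTotal, Finset.sum_eq_zero fun i _ => hρ6 i]; exact Nat.zero_le _)
  refine (build_spec hW (hB.one_le 0 (Nat.zero_le _)) hB.last hF hS fun u w => ?_).mono ?_
  · rw [m5 _ (hidx u w), fr' 2 (by decide), fr 2 (by decide)]
    exact inputStore_graph E u w
  · rintro π j ⟨T, hT, hSπ, hj⟩
    refine ⟨p, doubling S, α, β, T, hB.one_le 0 (Nat.zero_le _), hB.last, hW, hT, hSπ, ?_⟩
    have h1 : k + k' + k'' + 2 ≤ 29 * (n * n) := by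
      have : 2 * n ≤ n * n := Nat.mul_le_mul_right n hn
      omega
    have h1' : (k : ℝ) + k' + k'' + 2 ≤ 29 * (n : ℝ) ^ 2 := by
      rw [sq]; exact_mod_cast h1
    push_cast
    linarith

/-! ### Sequences of insertions -/

theorem graphAfter_cons {n : ℕ} (E : Finset (Fin n × Fin n)) (e : Fin n × Fin n)
    (es : List (Fin n × Fin n)) (i : ℕ) :
    graphAfter E (e :: es) (i + 1) = graphAfter (insert e E) es i := by
  simp [graphAfter, Finset.insert_union]

theorem graphAfter_zero {n : ℕ} (E : Finset (Fin n × Fin n)) (es : List (Fin n × Fin n)) :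
    graphAfter E es 0 = E := by
  simp [graphAfter]

theorem presentEdge_of_ne {n : ℕ} (σ : Store) (e : Fin n × Fin n) {c : ℕ} (h : c ≠ 0) :
    presentEdge σ e c = σ c := by
  rw [presentEdge, Store.write_of_ne h, Store.write_of_ne h]

theorem Struct.presentEdge {n p : ℕ} {θ : ℕ → ℕ} {E : Finset (Fin n × Fin n)}
    {T : Equiv.Perm (Fin n)} {σ : Store} (h : Struct n p θ E T σ) (e : Fin n × Fin n) :
    Struct n p θ E T (presentEdge σ e) :=
  h.of_cells (by simp [OnlineTopo.presentEdge, Store.write])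
    (by simp [OnlineTopo.presentEdge, Store.write]) fun _ hc _ => presentEdge_of_ne σ e (by omega)

/-- The amortized bounds telescope, and the final potential is not negative, so all steps together
are at most the initial potential, independently of the number of edges. -/
theorem exists_trace {n p : ℕ} {θ : ℕ → ℕ} {F : Equiv.Perm (Fin n)} {α : Fin n × Fin n → ℝ}
    {β : ℝ} (hW : Weights p θ F α β) (hθ : 1 ≤ θ 0) (hθn : n ≤ θ (p + 1)) :
    ∀ (es : List (Fin n × Fin n)) (E : Finset (Fin n × Fin n)) (T₀ : Equiv.Perm (Fin n))
      (σ₀ : Store), es.Nodup → (∀ e ∈ es, e ∉ E) → IsTopOrder (E ∪ es.toFinset) F →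
      IsTopOrder E T₀ → Struct n p θ E T₀ σ₀ →
      ∃ (T : ℕ → Equiv.Perm (Fin n)) (σ : ℕ → Store) (s : ℕ → ℕ), T 0 = T₀ ∧ σ 0 = σ₀ ∧
        (∀ i ≤ es.length, IsTopOrder (graphAfter E es i) (T i) ∧
          ∀ v : Fin n, σ i 1 v = (T i v : ℕ)) ∧
        (∀ (i : ℕ) (h : i < es.length),
          Ex insertCmd (OnlineTopo.presentEdge (σ i) es[i]) (σ (i + 1)) (s i) ∧
          ∃ N wA wB sw, (T i es[i].2 < T i es[i].1 ∧ Run p θ (graphAfter E es i) (T i)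
              [⟨es[i].2, es[i].1, false, false⟩] (T (i + 1)) N wA wB sw) ∨
            (T i es[i].1 < T i es[i].2 ∧ T (i + 1) = T i)) ∧
        ((∑ i ∈ Finset.range es.length, s i : ℕ) : ℝ) ≤ potential p θ F α β E T₀ σ₀ := by
  intro es
  induction es with
  | nil =>
    intro E T₀ σ₀ _ _ _ hT hS
    refine ⟨fun _ => T₀, fun _ => σ₀, fun _ => 0, rfl, rfl, fun i hi => ⟨?_, hS.base.ord⟩,
      fun i h => absurd h (Nat.not_lt_zero i), ?_⟩
    · simpa [graphAfter] using hT
    · simpa using potential_nonneg hW E T₀ σ₀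
  | cons e es ih =>
    intro E T₀ σ₀ hnd hnew hF hT hS
    rw [List.nodup_cons] at hnd
    have hsub : insert e E ∪ es.toFinset = E ∪ (e :: es).toFinset := by
      simp [Finset.insert_union]
    have he : e ∉ E := hnew e List.mem_cons_self
    have hF' : IsTopOrder (insert e E) F := fun x hx =>
      hF x (by rw [← hsub]; exact Finset.mem_union_left _ hx)
    obtain ⟨τ, k, hex, T₁, hT₁, hSτ, hrun, hk⟩ := insert_step hW hθ hθn he hF' hT
      (hS.presentEdge e) (by simp [OnlineTopo.presentEdge, Store.write])
      (by simp [OnlineTopo.presentEdge, Store.write])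
    rw [potential_congr (σ := σ₀) (presentEdge_of_ne σ₀ e (by decide))] at hk
    obtain ⟨T, σ, s, hT0, hσ0, hord, hstep, hsum⟩ := ih (insert e E) T₁ τ hnd.2 (fun x hx h => by
        rcases Finset.mem_insert.1 h with rfl | h
        · exact hnd.1 hx
        · exact hnew x (List.mem_cons_of_mem _ hx) h) (by rw [hsub]; exact hF) hT₁ hSτ
    refine ⟨fun i => i.casesOn T₀ T, fun i => i.casesOn σ₀ σ, fun i => i.casesOn k s, rfl, rfl,
      ?_, ?_, ?_⟩
    · rintro (_ | i) hi
      · exact ⟨by rw [graphAfter_zero]; exact hT, hS.base.ord⟩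
      · rw [graphAfter_cons]
        exact hord i (by simpa using hi)
    · rintro (_ | i) hi
      · rw [graphAfter_zero]
        simp only [List.getElem_cons_zero, hσ0, hT0]
        exact ⟨hex, hrun⟩
      · rw [graphAfter_cons]
        exact hstep i (by simpa using hi)
    · rw [List.length_cons, Finset.sum_range_succ', Nat.cast_add]
      have h : ((∑ i ∈ Finset.range es.length, s i : ℕ) : ℝ) + k ≤
          potential p θ F α β E T₀ σ₀ := by linarith
      exact h

/-- From step counts to costs. -/
theorem maintainsWithin_of_ex {n : ℕ} {P : OnlineProgram} (hs : P.setup.slow = true)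
    (hi : P.onInsert.slow = true) {σ₀ : Store} {M : ℕ} (hM : 1 ≤ M) (hn : n ≤ M)
    (h₀ : ∀ a i, σ₀ a i ≤ M) {es : List (Fin n × Fin n)} {T : ℕ → Equiv.Perm (Fin n)}
    {σ : ℕ → Store} {k : ℕ} {s : ℕ → ℕ} (hk : Ex P.setup σ₀ (σ 0) k)
    (hstep : ∀ (i : ℕ) (h : i < es.length),
      Ex P.onInsert (presentEdge (σ i) es[i]) (σ (i + 1)) (s i))
    (hT : ∀ i ≤ es.length, ∀ v : Fin n, σ i 1 v = (T i v : ℕ)) {S : ℕ}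
    (hS : k + ∑ i ∈ Finset.range es.length, s i = S) {B : ℝ}
    (hB : (S : ℝ) * ((P.setup.weight + P.onInsert.weight : ℕ) * len (M + S + 2)) ≤ B) :
    MaintainsWithin P σ₀ es T B := by
  set X := M + S + 2 with hX
  -- A bound for all cells after `i` insertions: the initial bound plus the number of steps so far.
  set m := fun i => M + k + ∑ j ∈ Finset.range i, s j with hm
  have hmS : ∀ i ≤ es.length, m i ≤ M + S := fun i hi => by
    have : ∑ j ∈ Finset.range i, s j ≤ ∑ j ∈ Finset.range es.length, s j :=
      Finset.sum_le_sum_of_subset (Finset.range_subset_range.2 hi)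
    simp only [hm]; omega
  obtain ⟨b₀, hc₀⟩ := hk.exec hs hM h₀
  have hpres : ∀ i (e : Fin n × Fin n), (∀ a j, σ i a j ≤ m i) →
      ∀ a j, presentEdge (σ i) e a j ≤ m i := by
    intro i e h a j
    have h1 := e.1.2
    have h2 := e.2.2
    have h3 : M ≤ m i := by simp only [hm]; omega
    unfold presentEdge Store.write
    split_ifs
    · omega
    · omega
    · exact h a j
  have hbd : ∀ i ≤ es.length, ∀ a j, σ i a j ≤ m i := by
    intro i
    induction i with
    | zero => intro _ a j; simpa [hm] using b₀ a j
    | succ i ih =>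
      intro hi a j
      have := ((hstep i hi).exec ‹_› (M := m i) (by simp only [hm]; omega)
        (hpres i _ (ih (by omega)))).1 a j
      simp only [hm, Finset.sum_range_succ] at this ⊢
      omega
  have hcost : ∀ i, ∃ c, ∀ h : i < es.length,
      Exec P.onInsert (presentEdge (σ i) es[i]) (σ (i + 1)) c ∧
        c ≤ s i * (P.onInsert.weight * len X) := by
    intro i
    by_cases h : i < es.length
    · obtain ⟨c, hc, hc'⟩ := ((hstep i h).exec hi (M := m i) (by simp only [hm]; omega)
        (hpres i _ (hbd i h.le))).2 X (by
          have := hmS (i + 1) h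
          simp only [hm, Finset.sum_range_succ] at this ⊢
          omega)
      exact ⟨c, fun _ => ⟨hc, hc'⟩⟩
    · exact ⟨0, fun h' => absurd h' h⟩
  choose c hc using hcost
  obtain ⟨c₀, hc₀, hc₀'⟩ := hc₀ X (by omega)
  refine ⟨σ, fun i => i.casesOn c₀ c, hc₀, fun i h => (hc i h).1, hT, le_trans ?_ hB⟩
  have h1 : ∑ i ∈ Finset.range es.length, c i ≤
      (∑ i ∈ Finset.range es.length, s i) * (P.onInsert.weight * len X) := by
    rw [Finset.sum_mul]
    exact Finset.sum_le_sum fun i h => (hc i (Finset.mem_range.1 h)).2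
  have h2 : c₀ + ∑ i ∈ Finset.range es.length, c i ≤
      S * ((P.setup.weight + P.onInsert.weight) * len X) := by
    rw [← hS]
    have h3 := Nat.zero_le (k * (P.onInsert.weight * len X))
    have h4 := Nat.zero_le ((∑ i ∈ Finset.range es.length, s i) * (P.setup.weight * len X))
    simp only [add_mul, mul_add] at *
    omega
  rw [Finset.sum_range_succ', add_comm]
  exact_mod_cast h2

theorem exists_len_le (A : ℝ) : ∃ D : ℝ, 0 ≤ D ∧ ∀ n : ℕ, 2 ≤ n → ∀ X : ℕ,
    (X : ℝ) ≤ A * (n : ℝ) ^ 5 → (len X : ℝ) ≤ D * Real.log n := by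
  -- If 2^k is the leading power of two in X, then k ≤ 2 (log (|A| + 1) + 5 log n), since log 2 ≥
  -- 1/2. The constant terms are absorbed by 1 ≤ 2 log n.
  refine ⟨4 * Real.log (|A| + 1) + 14, ?_, fun n hn X hX => ?_⟩
  · have := Real.log_nonneg (show (1 : ℝ) ≤ |A| + 1 by linarith [abs_nonneg A])
    linarith
  have hlog := half_le_log hn
  have hA := Real.log_nonneg (show (1 : ℝ) ≤ |A| + 1 by linarith [abs_nonneg A])
  have hn0 : (0 : ℝ) < n := by exact_mod_cast (by omega : 0 < n)
  have h2 : (1 : ℝ) / 2 ≤ Real.log 2 := half_le_log (n := 2) le_rfl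
  rcases Nat.eq_zero_or_pos X with rfl | hX0
  · simp only [len, Nat.size_zero, zero_add, Nat.cast_one]
    nlinarith
  obtain ⟨k, hk⟩ : ∃ k, Nat.size X = k + 1 :=
    ⟨Nat.size X - 1, (Nat.sub_add_cancel (Nat.size_pos.2 hX0)).symm⟩
  have h3 : 2 ^ k ≤ X := Nat.lt_size.1 (by omega)
  have h4 : (k : ℝ) * Real.log 2 ≤ Real.log X := by
    rw [← Real.log_pow]
    exact Real.log_le_log (by positivity) (by exact_mod_cast h3)
  have h5 : Real.log X ≤ Real.log (|A| + 1) + 5 * Real.log n := by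
    have h6 : (X : ℝ) ≤ (|A| + 1) * (n : ℝ) ^ 5 :=
      hX.trans (mul_le_mul_of_nonneg_right (by linarith [le_abs_self A]) (by positivity))
    refine (Real.log_le_log (by exact_mod_cast hX0) h6).trans (le_of_eq ?_)
    rw [Real.log_mul (by positivity) (by positivity), Real.log_pow]
    norm_num
  have h6 : (k : ℝ) ≤ 2 * (Real.log (|A| + 1) + 5 * Real.log n) := by
    have : (0 : ℝ) ≤ k := by positivity
    nlinarith
  have h7 : (len X : ℝ) = k + 2 := by
    simp only [len, hk]; push_cast; ring
  rw [h7]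
  nlinarith

/-- The stored numbers are bounded by the number of steps plus 8 n, hence by a constant times n^5;
their length adds one more logarithm to the two in the step count. -/
theorem exists_cost_le {A : ℝ} (hA : 0 ≤ A) (w : ℕ) : ∃ C : ℝ, ∀ n : ℕ, 2 ≤ n → ∀ S : ℕ,
    (S : ℝ) ≤ A * ((n : ℝ) ^ 2 * √n * Real.log n ^ 2) →
    (S : ℝ) * (w * len (8 * n + S + 2)) ≤ C * (n : ℝ) ^ (5 / 2 : ℝ) * Real.log n ^ 3 := by
  obtain ⟨D, hD0, hD⟩ := exists_len_le (10 + A)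
  refine ⟨A * w * D, fun n hn S hS => ?_⟩
  have hlog := half_le_log hn
  have hn1 : (1 : ℝ) ≤ n := by exact_mod_cast (by omega : 1 ≤ n)
  have hn0 : (0 : ℝ) < n := by linarith
  have hlogn : Real.log n ≤ n := (Real.log_le_sub_one_of_pos hn0).trans (by linarith)
  have hsq : √(n : ℝ) ≤ n := by
    rw [Real.sqrt_le_left (by positivity)]; nlinarith
  have h1 : (n : ℝ) ^ 2 * √n * Real.log n ^ 2 ≤ (n : ℝ) ^ 5 := by
    calc (n : ℝ) ^ 2 * √n * Real.log n ^ 2 ≤ (n : ℝ) ^ 2 * n * (n : ℝ) ^ 2 := by gcongr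
      _ = (n : ℝ) ^ 5 := by ring
  have hn5 : (n : ℝ) ≤ (n : ℝ) ^ 5 := le_self_pow₀ hn1 (by norm_num)
  have hlen : (len (8 * n + S + 2) : ℝ) ≤ D * Real.log n := by
    refine hD n hn _ ?_
    push_cast
    have := mul_le_mul_of_nonneg_left h1 hA
    linarith
  have hpow : (n : ℝ) ^ (5 / 2 : ℝ) = (n : ℝ) ^ 2 * √n := by
    rw [Real.sqrt_eq_rpow, ← Real.rpow_natCast, ← Real.rpow_add hn0]
    norm_num
  calc (S : ℝ) * (w * len (8 * n + S + 2))
      ≤ (A * ((n : ℝ) ^ 2 * √n * Real.log n ^ 2)) * (w * (D * Real.log n)) := by gcongr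
    _ = A * w * D * (n : ℝ) ^ (5 / 2 : ℝ) * Real.log n ^ 3 := by rw [hpow]; ring

theorem sq_le_main {n : ℕ} (hn : 2 ≤ n) :
    (n : ℝ) ^ 2 * Real.log n ≤ 2 * ((n : ℝ) ^ 2 * √n * Real.log n ^ 2) ∧
      (n : ℝ) ^ 2 ≤ 4 * ((n : ℝ) ^ 2 * √n * Real.log n ^ 2) := by
  have hlog := half_le_log hn
  have hn1 : (1 : ℝ) ≤ n := by exact_mod_cast (by omega : 1 ≤ n)
  have hs : 1 ≤ √(n : ℝ) := Real.one_le_sqrt.2 hn1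
  have h1 : (n : ℝ) ^ 2 * Real.log n ≤ 2 * ((n : ℝ) ^ 2 * √n * Real.log n ^ 2) := by
    have h2 : 1 ≤ 2 * (√n * Real.log n) := by nlinarith
    have h3 : 0 ≤ (n : ℝ) ^ 2 * Real.log n := by positivity
    nlinarith
  refine ⟨h1, ?_⟩
  have h3 : 0 ≤ (n : ℝ) ^ 2 := by positivity
  nlinarith

/-! ### The main results -/

theorem inputStore_le {n : ℕ} (hn : 2 ≤ n) (E : Finset (Fin n × Fin n)) (a i : ℕ) :
    inputStore n E a i ≤ n := by
  unfold inputStore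
  split_ifs <;> omega

theorem exists_program_of_graph : ∃ (P : OnlineProgram) (C : ℝ) (k : ℕ),
    ∀ (n : ℕ), 2 ≤ n → ∀ (E₀ : Finset (Fin n × Fin n)) (es : List (Fin n × Fin n)),
      IsInsertionSequence E₀ es → ∃ T : ℕ → Equiv.Perm (Fin n),
        (∀ i ≤ es.length, IsTopOrder (graphAfter E₀ es i) (T i)) ∧
        MaintainsWithin P (inputStore n E₀) es T
          (C * (n : ℝ) ^ (5 / 2 : ℝ) * Real.log n ^ k) := by
  -- The summand 136 is 34 * 4: the quadratic part of the initialization, expressed by the main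
  -- term.
  obtain ⟨C, hC⟩ := exists_cost_le (A := 3000 * (7 + 7 ^ 2 + 7 ^ 3) + 136) (by norm_num)
    (startCmd.weight + insertCmd.weight)
  refine ⟨⟨startCmd, insertCmd⟩, C, 3, fun n hn E₀ es ⟨hnd, hnew, hdag⟩ => ?_⟩
  obtain ⟨F, hF⟩ := exists_topOrder hdag
  obtain ⟨τ, k, hex, p, θ, α, β, T₀, hθ, hθn, hW, hT₀, hS, hk⟩ :=
    start_spec hn (E := E₀) (F := F) fun e he => hF e (Finset.mem_union_left _ he)
  obtain ⟨T, σ, s, -, rfl, hord, hstep, hsum⟩ :=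
    exists_trace hW hθ hθn es E₀ T₀ τ hnd hnew hF hT₀ hS
  refine ⟨T, fun i hi => (hord i hi).1, maintainsWithin_of_ex (M := 8 * n) startCmd_slow
    insertCmd_slow (by omega) (by omega) (fun a i => (inputStore_le hn E₀ a i).trans (by omega))
    hex (fun i h => (hstep i h).1) (fun i hi => (hord i hi).2) rfl (hC n hn _ ?_)⟩
  have := (sq_le_main hn).2
  push_cast at hsum ⊢
  linarith

theorem exists_program_of_order : ∃ (P : OnlineProgram) (C : ℝ) (k : ℕ),
    ∀ (n : ℕ), 2 ≤ n → ∀ (E₀ : Finset (Fin n × Fin n)) (es : List (Fin n × Fin n))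
      (T₀ : Equiv.Perm (Fin n)), IsInsertionSequence E₀ es → IsTopOrder E₀ T₀ →
      ∃ T : ℕ → Equiv.Perm (Fin n), T 0 = T₀ ∧
        (∀ (i : ℕ) (h : i < es.length), InsertStep (levels n) (threshold n)
          (graphAfter E₀ es i) (T i) es[i] (T (i + 1))) ∧
        (∀ i ≤ es.length, IsTopOrder (graphAfter E₀ es i) (T i)) ∧
        MaintainsWithin P (inputStoreWithParameters n E₀ T₀) es T
          (C * (n : ℝ) ^ (5 / 2 : ℝ) * Real.log n ^ k) := by
  -- The summand 308 is 22 * 7 * 2: the setup takes 22 (p + 1) n² steps, and p + 1 ≤ 7 log n.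
  obtain ⟨C, hC⟩ := exists_cost_le (A := 3000 * (7 + 7 ^ 2 + 7 ^ 3) + 308) (by norm_num)
    (setupCmd.weight + insertCmd.weight)
  refine ⟨⟨setupCmd, insertCmd⟩, C, 3, fun n hn E₀ es T₀ ⟨hnd, hnew, hdag⟩ hT₀ => ?_⟩
  obtain ⟨F, hF⟩ := exists_topOrder hdag
  have hB := balanced_threshold hn
  obtain ⟨-, -, -, ht1, -, htn⟩ := threshold_facts hn
  have hlev := (levels_spec hn).2
  obtain ⟨τ, k, hex, hS, htot, hk⟩ := setup_spec (n := n) (p := levels n)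
    (θ := fun i => ⌊threshold n i⌋₊) (E := E₀) (T := T₀)
    (σ := inputStoreWithParameters n E₀ T₀) (by simp [inputStoreWithParameters, inputStore])
    (by omega) (by simp [inputStoreWithParameters])
    (fun v => by simp [inputStoreWithParameters])
    (fun u w => by
      rw [← inputStore_graph E₀ u w]
      simp [inputStoreWithParameters])
    (fun i hi => by simp [inputStoreWithParameters, hi])
    (fun c hc i => by
      unfold inputStoreWithParameters
      rw [if_neg (by omega), if_neg (by omega), if_neg (by omega)]
      exact inputStore_eq_zero E₀ (by omega) (by omega) i)
  obtain ⟨α, β, hW, hw⟩ := hB.exists_weights (by omega) F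
  have hpot := hB.potential_bound hn hW hw E₀ T₀ htot
  obtain ⟨T, σ, s, hT0, rfl, hord, hstep, hsum⟩ :=
    exists_trace hW (hB.one_le 0 (Nat.zero_le _)) hB.last es E₀ T₀ τ hnd hnew hF hT₀ hS
  have hn0 : (0 : ℝ) < n := by exact_mod_cast (by omega : 0 < n)
  have hbound : ∀ a i, inputStoreWithParameters n E₀ T₀ a i ≤ 8 * n := by
    intro a i
    -- The number of levels is the only input that may exceed `n`; hence the bound 8 n for the
    -- initial memory.
    have h1 : levels n ≤ 7 * n := by
      have h2 : Real.log n ≤ n := (Real.log_le_sub_one_of_pos hn0).trans (by linarith)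
      have h3 : ((levels n : ℕ) : ℝ) ≤ 7 * n := by linarith
      exact_mod_cast h3
    unfold inputStoreWithParameters
    split_ifs with h2 h3 h4 h5 h6
    · omega
    · have := (T₀ ⟨i, h4⟩).2
      omega
    · omega
    · have : ⌊threshold n i⌋₊ ≤ n := Nat.floor_le_of_le (htn i h6)
      omega
    · omega
    · exact (inputStore_le hn E₀ a i).trans (by omega)
  refine ⟨T, hT0, fun i h => ?_, fun i hi => (hord i hi).1, maintainsWithin_of_ex (M := 8 * n)
    setupCmd_slow insertCmd_slow (by omega) (by omega) hbound hex (fun i h => (hstep i h).1)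
    (fun i hi => (hord i hi).2) rfl (hC n hn _ ?_)⟩
  · obtain ⟨N, wA, wB, sw, hr | hr⟩ := (hstep i h).2
    · exact Or.inl ⟨hr.1.le, hr.2.calls fun i => zero_le_one.trans (ht1 i)⟩
    · exact Or.inr hr
  · have hk' : (k : ℝ) ≤ 22 * (((levels n : ℕ) : ℝ) + 1) * (n : ℝ) ^ 2 := by
      rw [mul_assoc]; exact_mod_cast hk
    have h1 : 22 * (((levels n : ℕ) : ℝ) + 1) * (n : ℝ) ^ 2 ≤
        154 * ((n : ℝ) ^ 2 * Real.log n) := by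
      have := mul_le_mul_of_nonneg_right hlev (sq_nonneg (n : ℝ))
      linarith
    have h2 := (sq_le_main hn).1
    push_cast at hsum ⊢
    linarith

end OnlineTopo

theorem mainTheorem1 :
    -- a uniform online program for online topological ordering, in time `Õ(n ^ 2.5)`
    (∃ (P : OnlineTopo.OnlineProgram) (C : ℝ) (k : ℕ),
      ∀ (n : ℕ), 2 ≤ n → ∀ (E₀ : Finset (Fin n × Fin n)) (es : List (Fin n × Fin n)),
        OnlineTopo.IsInsertionSequence E₀ es →
        ∃ T : ℕ → Equiv.Perm (Fin n),
          (∀ i ≤ es.length, OnlineTopo.IsTopOrder (OnlineTopo.graphAfter E₀ es i) (T i)) ∧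
          OnlineTopo.MaintainsWithin P (OnlineTopo.inputStore n E₀) es T
            (C * (n : ℝ) ^ (5 / 2 : ℝ) * Real.log n ^ k)) ∧
    -- `Insert` / `Reorder` with the stated choice of `p` and of the thresholds is correct and has
    -- an implementation that runs in time `Õ(n ^ 2.5)`
    (∃ (P : OnlineTopo.OnlineProgram) (C : ℝ) (k : ℕ),
      ∀ (n : ℕ), 2 ≤ n → ∀ (E₀ : Finset (Fin n × Fin n)) (es : List (Fin n × Fin n))
        (T₀ : Equiv.Perm (Fin n)),
        OnlineTopo.IsInsertionSequence E₀ es → OnlineTopo.IsTopOrder E₀ T₀ →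
        ∃ T : ℕ → Equiv.Perm (Fin n),
          T 0 = T₀ ∧
          (∀ (i : ℕ) (h : i < es.length),
            OnlineTopo.InsertStep (OnlineTopo.levels n) (OnlineTopo.threshold n)
              (OnlineTopo.graphAfter E₀ es i) (T i) es[i] (T (i + 1))) ∧
          (∀ i ≤ es.length, OnlineTopo.IsTopOrder (OnlineTopo.graphAfter E₀ es i) (T i)) ∧
          OnlineTopo.MaintainsWithin P (OnlineTopo.inputStoreWithParameters n E₀ T₀) es T
            (C * (n : ℝ) ^ (5 / 2 : ℝ) * Real.log n ^ k)) := by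
  exact ⟨OnlineTopo.exists_program_of_graph, OnlineTopo.exists_program_of_order⟩
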